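/- Let $p\neq 2,3$ be a prime, $F$ a field of characteristic $p$, $m\ge 1$ and $n=2m+1$ (so $n \geq 3$). Let $A(n)=F[x_1,\dots,x_n]/(x_1^p,\dots,x_n^p)$, with partial derivatives $D_i=\partial/\partial x_i$, and put $\deg(x^a)=|a|+a_n-2$, where $|a|=a_1+\dots+a_n$. Let $K'(n)$ be the Lie algebra over $F$ with underlying vector space $A(n)$ and bracket $$[x^a,x^b]=\sum_{i=1}^{m}\bigl(D_i(x^a)D_{i+m}(x^b)-D_{i+m}(x^a)D_i(x^b)\bigr)+\bigl(a_n\deg(x^b)-b_n\deg(x^a)\bigr)x^{a+b-\epsilon_n},$$ where $\epsilon_n$ is the $n$-th unit vector (the last term is $0$ if $a_n=b_n=0$), and let $K(n)=[K'(n),K'(n)]$ be the (restricted) Contact algebra; it contains $1$ and $x_1,\dots,x_{2m}$. For an element $\gamma$ of a Lie algebra $\mathfrak g$ over $F$, let ${\rm Sq}(\gamma)\in Z^2(\mathfrak g,\mathfrak g)$ be the squaring cocycle $${\rm Sq}(\gamma)(x,y)=\sum_{i=1}^{p-1}\frac{[{\rm ad}(\gamma)^i(x),{\rm ad}(\gamma)^{p-i}(y)]}{i!\,(p-i)!}.$$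 Then the second Lie algebra cohomology group with adjoint coefficients satisfies $$H^2(K(n),K(n))=\bigoplus_{i=1}^{2m}\langle {\rm Sq}(x_i)\rangle_F\oplus\langle {\rm Sq}(1)\rangle_F ,\qquad \dim_F H^2(K(n),K(n))=n,$$ that is, the classes of the $n$ cocycles ${\rm Sq}(x_1),\dots,{\rm Sq}(x_{2m}),{\rm Sq}(1)$ form an $F$-basis of it. -/

import Mathlib

open MvPolynomial
open scoped Nat

noncomputable section

namespace LieH2

open LieModule.Cohomology

section
variable (F L M : Type*) [CommRing F] [LieRing L] [LieAlgebra F L]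
  [AddCommGroup M] [Module F M] [LieRingModule L M] [LieModule F L M]

/-- The additive group structure that the `2`-cocycles inherit from the `2`-cochains. -/
instance : AddCommGroup (twoCocycle F L M) :=
  @Submodule.addCommGroup F (twoCochain F L M) _ (Submodule.addCommGroup _) _ (twoCocycle F L M)

/-- The `2`-coboundaries, as a submodule of the `2`-cocycles. -/
def twoCoboundary : Submodule F (twoCocycle F L M) :=
  (LinearMap.range (d₁₂ F L M)).comap (twoCocycle F L M).subtype

/-- Second (Chevalley-Eilenberg) cohomology `H²(L, M)`: cocycles modulo coboundaries. -/
abbrev H2 : Type _ := twoCocycle F L M ⧸ twoCoboundary F L M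

/-- The cohomology class of a `2`-cocycle. -/
abbrev H2.mk : twoCocycle F L M →ₗ[F] H2 F L M := (twoCoboundary F L M).mkQ
end

section Squaring

variable {F L : Type*} [Field F] [LieRing L] [LieAlgebra F L]

/-- Squaring `∑_{i=1}^{p-1} [ad(γ)^i x, ad(γ)^{p-i} y] / (i! (p-i)!)` as a bilinear map. -/
def sqBilin (p : ℕ) (γ : L) : L →ₗ[F] L →ₗ[F] L :=
  LinearMap.mk₂ F
    (fun x y => ∑ i ∈ Finset.Icc 1 (p - 1), ((i ! * (p - i)! : ℕ) : F)⁻¹ •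
      ⁅(LieAlgebra.ad F L γ ^ i) x, (LieAlgebra.ad F L γ ^ (p - i)) y⁆)
    (fun x x' y => by simp only [map_add, add_lie, smul_add, Finset.sum_add_distrib])
    (fun c x y => by simp only [map_smul, smul_lie, Finset.smul_sum, smul_comm c])
    (fun x y y' => by simp only [map_add, lie_add, smul_add, Finset.sum_add_distrib])
    (fun c x y => by simp only [map_smul, lie_smul, Finset.smul_sum, smul_comm c])

theorem sqBilin_apply (p : ℕ) (γ x y : L) :
    sqBilin (F := F) p γ x y =
      ∑ i ∈ Finset.Icc 1 (p - 1), ((i ! * (p - i)! : ℕ) : F)⁻¹ •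
        ⁅(LieAlgebra.ad F L γ ^ i) x, (LieAlgebra.ad F L γ ^ (p - i)) y⁆ := rfl

theorem sqBilin_alt (p : ℕ) (γ x : L) : sqBilin (F := F) p γ x x = 0 := by
  rw [sqBilin_apply]
  refine Finset.sum_involution (fun i _ => p - i) ?_ ?_ ?_ ?_
  · intro i hi
    rw [Finset.mem_Icc] at hi
    have h : p - (p - i) = i := by omega
    rw [h, ← lie_skew, mul_comm (p - i)!, smul_neg, neg_add_cancel]
  · intro i hi h1 h2
    rw [h2, lie_self, smul_zero] at h1
    exact h1 rfl
  · intro i hi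
    rw [Finset.mem_Icc] at hi ⊢
    omega
  · intro i hi
    rw [Finset.mem_Icc] at hi
    omega

/-- Divided powers `ad(γ)^i / i!` for `i < p`, extended by zero. -/
def divAd (F : Type*) {L : Type*} [Field F] [LieRing L] [LieAlgebra F L]
    (p : ℕ) (γ : L) (i : ℕ) : L →ₗ[F] L :=
  if i < p then ((i ! : ℕ) : F)⁻¹ • (LieAlgebra.ad F L γ ^ i) else 0

theorem sqBilin_eq_antidiagonal (p : ℕ) (γ x y : L) :
    sqBilin (F := F) p γ x y =
      ∑ k ∈ Finset.HasAntidiagonal.antidiagonal p, ⁅divAd F p γ k.1 x, divAd F p γ k.2 y⁆ := by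
  rw [Finset.Nat.sum_antidiagonal_eq_sum_range_succ_mk, sqBilin_apply]
  symm
  refine (Finset.sum_subset (s₁ := Finset.Icc 1 (p - 1)) ?_ ?_).symm.trans ?_
  · intro i hi
    rw [Finset.mem_Icc] at hi
    rw [Finset.mem_range]
    omega
  · intro i hi hi'
    rw [Finset.mem_range] at hi
    rw [Finset.mem_Icc] at hi'
    have : ¬ (i < p) ∨ ¬ (p - i < p) := by omega
    rcases this with h | h <;> simp [divAd, h]
  · refine Finset.sum_congr rfl fun i hi => ?_
    rw [Finset.mem_Icc] at hi
    have h1 : i < p := by omega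
    have h2 : p - i < p := by omega
    simp only [divAd, h1, h2, if_true, LinearMap.smul_apply, smul_lie, lie_smul, smul_smul]
    rw [Nat.cast_mul, mul_inv, mul_comm]

theorem divAd_lie (p : ℕ) [Fact p.Prime] [CharP F p] (γ x y : L) {k : ℕ} (hk : k < p) :
    divAd F p γ k ⁅x, y⁆ =
      ∑ i ∈ Finset.HasAntidiagonal.antidiagonal k, ⁅divAd F p γ i.1 x, divAd F p γ i.2 y⁆ := by
  have hf (n : ℕ) (hn : n < p) : ((n ! : ℕ) : F) ≠ 0 := by
    rw [Ne, CharP.cast_eq_zero_iff F p, (Fact.out : p.Prime).dvd_factorial]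
    omega
  simp only [divAd, hk, if_true, LinearMap.smul_apply, LieAlgebra.ad_pow_lie, Finset.smul_sum]
  refine Finset.sum_congr rfl fun i hi => ?_
  rw [Finset.HasAntidiagonal.mem_antidiagonal] at hi
  have h1 : i.1 < p := by omega
  have h2 : i.2 < p := by omega
  simp only [h1, h2, if_true, LinearMap.smul_apply, smul_lie, lie_smul, smul_smul]
  rw [← Nat.cast_smul_eq_nsmul F, smul_smul]
  congr 1
  have h3 := hf _ h1
  have h4 := hf _ h2
  have h5 := hf _ hk
  have h6 := Nat.choose_mul_factorial_mul_factorial (show i.1 ≤ k by omega)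
  rw [show k - i.1 = i.2 by omega] at h6
  rw [← h6] at h5 ⊢
  push_cast at h5 ⊢
  have h7 : ((k.choose i.1 : ℕ) : F) ≠ 0 := fun h => h5 (by rw [h]; ring)
  field_simp

theorem sum_triple_swap {B : Type*} [AddCommMonoid B] (p : ℕ) (G : ℕ → ℕ → ℕ → B) :
    ∑ k ∈ Finset.HasAntidiagonal.antidiagonal p,
      ∑ i ∈ Finset.HasAntidiagonal.antidiagonal k.1, G i.1 i.2 k.2 =
      ∑ k ∈ Finset.HasAntidiagonal.antidiagonal p,
      ∑ i ∈ Finset.HasAntidiagonal.antidiagonal k.1, G i.1 k.2 i.2 := by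
  rw [Finset.sum_sigma', Finset.sum_sigma']
  refine Finset.sum_nbij' (fun t => ⟨(t.2.1 + t.1.2, t.2.2), (t.2.1, t.1.2)⟩)
    (fun t => ⟨(t.2.1 + t.1.2, t.2.2), (t.2.1, t.1.2)⟩) ?_ ?_ ?_ ?_ ?_
  · rintro ⟨⟨a, b⟩, ⟨c, d⟩⟩ h
    simp only [Finset.mem_sigma, Finset.HasAntidiagonal.mem_antidiagonal, and_true] at h ⊢
    omega
  · rintro ⟨⟨a, b⟩, ⟨c, d⟩⟩ h
    simp only [Finset.mem_sigma, Finset.HasAntidiagonal.mem_antidiagonal, and_true] at h ⊢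
    omega
  all_goals
    rintro ⟨⟨a, b⟩, ⟨c, d⟩⟩ h
    simp only [Finset.mem_sigma, Finset.HasAntidiagonal.mem_antidiagonal] at h
    obtain ⟨h1, rfl⟩ := h
    rfl

theorem sum_triple_swap' {B : Type*} [AddCommMonoid B] (p : ℕ) (G : ℕ → ℕ → ℕ → B) :
    ∑ k ∈ Finset.HasAntidiagonal.antidiagonal p,
      ∑ i ∈ Finset.HasAntidiagonal.antidiagonal k.1, G i.1 i.2 k.2 =
      ∑ k ∈ Finset.HasAntidiagonal.antidiagonal p,
      ∑ i ∈ Finset.HasAntidiagonal.antidiagonal k.1, G i.2 i.1 k.2 :=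
  Finset.sum_congr rfl fun k _ =>
    (Finset.Nat.sum_antidiagonal_swap (f := fun i => G i.1 i.2 k.2)).symm

theorem sqBilin_lie (p : ℕ) [Fact p.Prime] [CharP F p] (γ x y z : L) :
    sqBilin (F := F) p γ ⁅x, y⁆ z =
      (∑ k ∈ Finset.HasAntidiagonal.antidiagonal p,
      ∑ i ∈ Finset.HasAntidiagonal.antidiagonal k.1,
        ⁅⁅divAd F p γ i.1 x, divAd F p γ i.2 y⁆, divAd F p γ k.2 z⁆)
      - ⁅sqBilin (F := F) p γ x y, z⁆ := by
  have hp : 0 < p := (Fact.out : p.Prime).pos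
  rw [sqBilin_eq_antidiagonal p γ x y, sqBilin_eq_antidiagonal]
  have hmem : (p, 0) ∈ Finset.HasAntidiagonal.antidiagonal p := by simp
  rw [← Finset.add_sum_erase _ _ hmem, ← Finset.add_sum_erase _ (fun k : ℕ × ℕ =>
    ∑ i ∈ Finset.HasAntidiagonal.antidiagonal k.1,
      ⁅⁅divAd F p γ i.1 x, divAd F p γ i.2 y⁆, divAd F p γ k.2 z⁆) hmem]
  have h0 : divAd F p γ p = 0 := by simp [divAd]
  have h1 : divAd F p γ 0 = LinearMap.id := by
    simp only [divAd, hp, if_true, Nat.factorial_zero, Nat.cast_one, inv_one, one_smul, pow_zero]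
    rfl
  have h2 : ∑ k ∈ (Finset.HasAntidiagonal.antidiagonal p).erase (p, 0),
      ⁅divAd F p γ k.1 ⁅x, y⁆, divAd F p γ k.2 z⁆ =
      ∑ k ∈ (Finset.HasAntidiagonal.antidiagonal p).erase (p, 0),
        ∑ i ∈ Finset.HasAntidiagonal.antidiagonal k.1,
        ⁅⁅divAd F p γ i.1 x, divAd F p γ i.2 y⁆, divAd F p γ k.2 z⁆ := by
    refine Finset.sum_congr rfl fun k hk => ?_
    rw [Finset.mem_erase, Finset.HasAntidiagonal.mem_antidiagonal] at hk
    have hk1 : k.1 < p := by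
      rcases k with ⟨a, b⟩
      simp only [ne_eq, Prod.mk.injEq] at hk ⊢
      omega
    rw [divAd_lie p γ x y hk1, sum_lie]
  rw [h2]
  simp only [h0, h1, LinearMap.zero_apply, zero_lie, LinearMap.id_apply, ← sum_lie]
  abel

/-- The squaring cocycle `Sq(γ) ∈ Z²(L, L)`. -/
def sq (p : ℕ) [Fact p.Prime] [CharP F p] (γ : L) : twoCocycle F L L :=
  ⟨⟨sqBilin p γ, sqBilin_alt p γ⟩, by
    rw [mem_twoCocycle_iff]
    ext x y z
    have h (u v : L) : (⟨sqBilin (F := F) p γ, sqBilin_alt p γ⟩ : twoCochain F L L) u v =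
      sqBilin (F := F) p γ u v := rfl
    simp only [d₂₃_apply, h, sqBilin_lie, LinearMap.zero_apply]
    rw [sum_triple_swap p (fun i j l => ⁅⁅divAd F p γ i x, divAd F p γ j z⁆, divAd F p γ l y⁆),
      sum_triple_swap p (fun i j l => ⁅⁅divAd F p γ i y, divAd F p γ j z⁆, divAd F p γ l x⁆),
      sum_triple_swap' p (fun i j l => ⁅⁅divAd F p γ i y, divAd F p γ l z⁆, divAd F p γ j x⁆)]
    have hJ : (∑ k ∈ Finset.HasAntidiagonal.antidiagonal p,
      ∑ i ∈ Finset.HasAntidiagonal.antidiagonal k.1,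
        ⁅⁅divAd F p γ i.1 x, divAd F p γ i.2 y⁆, divAd F p γ k.2 z⁆)
        - (∑ k ∈ Finset.HasAntidiagonal.antidiagonal p,
      ∑ i ∈ Finset.HasAntidiagonal.antidiagonal k.1,
        ⁅⁅divAd F p γ i.1 x, divAd F p γ k.2 z⁆, divAd F p γ i.2 y⁆)
        + (∑ k ∈ Finset.HasAntidiagonal.antidiagonal p,
      ∑ i ∈ Finset.HasAntidiagonal.antidiagonal k.1,
        ⁅⁅divAd F p γ i.2 y, divAd F p γ k.2 z⁆, divAd F p γ i.1 x⁆) = 0 := by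
      simp only [← Finset.sum_sub_distrib, ← Finset.sum_add_distrib]
      refine Finset.sum_eq_zero fun k _ => Finset.sum_eq_zero fun i _ => ?_
      generalize divAd F p γ i.1 x = a
      generalize divAd F p γ i.2 y = b
      generalize divAd F p γ k.2 z = c
      have := lie_jacobi a b c
      rw [← lie_skew a ⁅b, c⁆, ← lie_skew b ⁅c, a⁆, ← lie_skew c ⁅a, b⁆, ← lie_skew c a,
        neg_lie, neg_neg] at this
      rw [← neg_eq_zero, ← this]
      abel
    rw [← lie_skew x, ← lie_skew y, ← lie_skew z]
    rw [← neg_eq_zero, ← hJ]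
    abel⟩

theorem sq_apply (p : ℕ) [Fact p.Prime] [CharP F p] (γ x y : L) :
    (sq (F := F) p γ : twoCochain F L L) x y =
      ∑ i ∈ Finset.Icc 1 (p - 1), ((i ! * (p - i)! : ℕ) : F)⁻¹ •
        ⁅(LieAlgebra.ad F L γ ^ i) x, (LieAlgebra.ad F L γ ^ (p - i)) y⁆ := rfl

/-- The second adjoint cohomology `H²(L, L)`: `L` acts on itself by the bracket. -/
abbrev AdjointH2 (F L : Type*) [CommRing F] [LieRing L] [LieAlgebra F L] : Type _ := H2 F L L

/-- The class of `Sq(γ)` in `H²(L, L)`. -/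
def sqClass (p : ℕ) [Fact p.Prime] [CharP F p] (γ : L) : AdjointH2 F L := H2.mk F L L (sq p γ)

end Squaring
end LieH2

namespace Contact

section Generic

variable {F A : Type*} [CommRing F] [CommRing A] [Algebra F A]

/-- Poisson bracket attached to two families of derivations. -/
def poisson {ι : Type*} [Fintype ι] (D E : ι → Derivation F A A) (f g : A) : A :=
  ∑ i, (D i f * E i g - E i f * D i g)

variable {ι : Type*} [Fintype ι] {D E : ι → Derivation F A A}

theorem poisson_add_left (f g h : A) :
    poisson D E (f + g) h = poisson D E f h + poisson D E g h := by
  simp only [poisson, ← Finset.sum_add_distrib, map_add]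
  exact Finset.sum_congr rfl fun i _ => by ring

theorem poisson_skew (f g : A) : poisson D E g f = - poisson D E f g := by
  simp only [poisson, ← Finset.sum_neg_distrib]
  exact Finset.sum_congr rfl fun i _ => by ring

theorem poisson_self (f : A) : poisson D E f f = 0 := by
  simp only [poisson]
  exact Finset.sum_eq_zero fun i _ => by ring

theorem poisson_add_right (f g h : A) :
    poisson D E f (g + h) = poisson D E f g + poisson D E f h := by
  rw [poisson_skew, poisson_add_left, poisson_skew g, poisson_skew h]; ring

theorem poisson_smul_right (c : F) (f g : A) :
    poisson D E f (c • g) = c • poisson D E f g := by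
  simp only [poisson, Finset.smul_sum, Derivation.map_smul, smul_sub, mul_smul_comm]

theorem poisson_mul_right (f g h : A) :
    poisson D E f (g * h) = poisson D E f g * h + g * poisson D E f h := by
  simp only [poisson, Finset.sum_mul, Finset.mul_sum, ← Finset.sum_add_distrib,
    Derivation.leibniz, smul_eq_mul]
  exact Finset.sum_congr rfl fun i _ => by ring

theorem poisson_mul_left (f g h : A) :
    poisson D E (g * h) f = poisson D E g f * h + g * poisson D E h f := by
  rw [poisson_skew, poisson_mul_right, poisson_skew g, poisson_skew h]; ring

theorem poisson_leibniz (hDD : ∀ i j f, D i (D j f) = D j (D i f))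
    (hEE : ∀ i j f, E i (E j f) = E j (E i f)) (hDE : ∀ i j f, D i (E j f) = E j (D i f))
    (f g h : A) :
    poisson D E f (poisson D E g h) =
      poisson D E (poisson D E f g) h + poisson D E g (poisson D E f h) := by
  set S : ι → ι → A := fun i j =>
    (D i f * E i (D j g) - E i f * D i (D j g)) * E j h
    - (D i f * E i (E j g) - E i f * D i (E j g)) * D j h
    + D j g * (D i f * E i (E j h) - E i f * D i (E j h))
    - E j g * (D i f * E i (D j h) - E i f * D i (D j h))
    - ((D i (D j f) * E i h - E i (D j f) * D i h) * E j g
      - (D i (E j f) * E i h - E i (E j f) * D i h) * D j g) with hS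
  rw [← sub_eq_zero]
  have hT : poisson D E f (poisson D E g h) -
      (poisson D E (poisson D E f g) h + poisson D E g (poisson D E f h)) =
      ∑ i, ∑ j, (S i j - S j i) := by
    simp only [poisson, map_sum, Finset.mul_sum, Finset.sum_mul, ← Finset.sum_sub_distrib,
      ← Finset.sum_add_distrib, Derivation.leibniz, map_sub, smul_eq_mul, hS]
    refine Finset.sum_congr rfl fun i _ => Finset.sum_congr rfl fun j _ => ?_
    simp only [hDE, hDD j i, hEE j i]
    ring
  rw [hT]
  simp only [Finset.sum_sub_distrib]
  rw [Finset.sum_comm, sub_self]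

variable (D E)

/-- Contact bracket attached to derivations `D i`, `E i`, `∂` and `e`. -/
def bracket (d e : Derivation F A A) (f g : A) : A :=
  poisson D E f g + (d f * (e g - 2 * g) - d g * (e f - 2 * f))

variable {D E}

theorem bracket_leibniz (hDD : ∀ i j f, D i (D j f) = D j (D i f))
    (hEE : ∀ i j f, E i (E j f) = E j (E i f)) (hDE : ∀ i j f, D i (E j f) = E j (D i f))
    (d e : Derivation F A A) (hdD : ∀ i f, d (D i f) = D i (d f))
    (hdE : ∀ i f, d (E i f) = E i (d f)) (hDe : ∀ i f, e (D i f) = D i (e f) - D i f)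
    (hEe : ∀ i f, e (E i f) = E i (e f) - E i f) (hde : ∀ f, d (e f) = e (d f) + 2 * d f)
    (f g h : A) :
    bracket D E d e f (bracket D E d e g h) =
      bracket D E d e (bracket D E d e f g) h + bracket D E d e g (bracket D E d e f h) := by
  have hdP (f g : A) : d (poisson D E f g) = poisson D E (d f) g + poisson D E f (d g) := by
    simp only [poisson, map_sum, ← Finset.sum_add_distrib, Derivation.leibniz, map_sub,
      smul_eq_mul, hdD, hdE]
    exact Finset.sum_congr rfl fun i _ => by ring
  have heP (f g : A) : e (poisson D E f g) =
      poisson D E (e f) g + poisson D E f (e g) - 2 * poisson D E f g := by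
    simp only [poisson, map_sum, ← Finset.sum_add_distrib, Derivation.leibniz, map_sub,
      smul_eq_mul, hDe, hEe, Finset.mul_sum, ← Finset.sum_sub_distrib]
    exact Finset.sum_congr rfl fun i _ => by ring
  have h2 (f : A) : poisson D E f 2 = 0 := by
    have : (2 : A) = ((2 : ℕ) : A) := by norm_num
    simp only [poisson, this, Derivation.map_natCast]; simp
  have hd2 (d : Derivation F A A) : d 2 = 0 := by
    have : (2 : A) = ((2 : ℕ) : A) := by norm_num
    rw [this, Derivation.map_natCast]
  have hsub (f g h : A) : poisson D E f (g - h) = poisson D E f g - poisson D E f h := by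
    simp only [poisson, map_sub, ← Finset.sum_sub_distrib]
    exact Finset.sum_congr rfl fun i _ => by ring
  have hJ := poisson_leibniz hDD hEE hDE f g h
  rw [poisson_skew h (poisson D E f g)] at hJ
  simp only [bracket]
  rw [poisson_skew h (_ + _)]
  simp only [poisson_add_right, hsub, poisson_mul_right, map_add, map_sub, Derivation.leibniz,
    hdP, heP, h2, hd2, hde, smul_eq_mul]
  have K (a b : A) : poisson D E a b + poisson D E b a = 0 := by
    rw [poisson_skew a b]; ring
  linear_combination hJ + (2 * h - e h) * K (d f) g - d g * K (e f) h + (e g - 2 * g) * K (d f) h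
    + 2 * d g * K f h - 2 * d h * K f g - 2 * d f * K g h
    + d h * K (e f) g + d f * K (e g) h + (2 * f - e f) * K (d g) h

end Generic

section Truncated

variable (F : Type*) [Field F] (p : ℕ) (ι : Type*)

/-- The ideal `(x_i^p : i ∈ ι)`. -/
def truncIdeal : Ideal (MvPolynomial ι F) :=
  Ideal.span (Set.range fun i => (X i : MvPolynomial ι F) ^ p)

/-- Truncated polynomials `F[x_i : i ∈ ι] / (x_i^p)`. -/
abbrev Trunc : Type _ := MvPolynomial ι F ⧸ truncIdeal F p ι

variable {ι}

/-- The class of the monomial `x^a`. -/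
def truncMonomial (a : ι →₀ ℕ) : Trunc F p ι :=
  Ideal.Quotient.mk (truncIdeal F p ι) (monomial a 1)

theorem pderiv_mem_truncIdeal [CharP F p] (i : ι) {f : MvPolynomial ι F}
    (hf : f ∈ truncIdeal F p ι) : pderiv i f ∈ truncIdeal F p ι := by
  refine Submodule.span_induction ?_ ?_ ?_ ?_ hf
  · rintro _ ⟨j, rfl⟩
    simp [Derivation.leibniz_pow]
  · simp
  · intro x y _ _ hx hy
    rw [map_add]
    exact add_mem hx hy
  · intro a x hx hx'
    rw [smul_eq_mul, Derivation.leibniz, smul_eq_mul, smul_eq_mul]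
    exact add_mem (Ideal.mul_mem_left _ _ hx') (Ideal.mul_mem_right _ _ hx)

/-- The partial derivative `∂/∂x_i` of `F[x] / (x_i^p)`, where `p` is the characteristic. -/
def truncDeriv [CharP F p] (i : ι) : Derivation F (Trunc F p ι) (Trunc F p ι) :=
  Derivation.mk'
    (Submodule.mapQ ((truncIdeal F p ι).restrictScalars F) ((truncIdeal F p ι).restrictScalars F)
      (pderiv i).toLinearMap (fun _ hf => pderiv_mem_truncIdeal F p i hf))
    (by
      intro a b
      obtain ⟨f, rfl⟩ := Ideal.Quotient.mk_surjective a
      obtain ⟨g, rfl⟩ := Ideal.Quotient.mk_surjective b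
      change Ideal.Quotient.mk (truncIdeal F p ι) (pderiv i (f * g)) =
        Ideal.Quotient.mk (truncIdeal F p ι) f *
          Ideal.Quotient.mk (truncIdeal F p ι) (pderiv i g) +
        Ideal.Quotient.mk (truncIdeal F p ι) g *
          Ideal.Quotient.mk (truncIdeal F p ι) (pderiv i f)
      rw [← map_mul, ← map_mul, ← map_add, Derivation.leibniz, smul_eq_mul, smul_eq_mul])

theorem truncDeriv_mk [CharP F p] (i : ι) (f : MvPolynomial ι F) :
    truncDeriv F p i (Ideal.Quotient.mk (truncIdeal F p ι) f) =
      Ideal.Quotient.mk (truncIdeal F p ι) (pderiv i f) := rfl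

theorem truncDeriv_comm [CharP F p] (i j : ι) (a : Trunc F p ι) :
    truncDeriv F p i (truncDeriv F p j a) = truncDeriv F p j (truncDeriv F p i a) := by
  obtain ⟨f, rfl⟩ := Ideal.Quotient.mk_surjective a
  simp only [truncDeriv_mk]
  congr 1
  have h : ⁅(pderiv i : Derivation F (MvPolynomial ι F) (MvPolynomial ι F)),
      (pderiv j : Derivation F (MvPolynomial ι F) (MvPolynomial ι F))⁆ = 0 := by
    classical
    refine MvPolynomial.derivation_ext fun k => ?_
    rw [Derivation.commutator_apply, pderiv_X, pderiv_X, Pi.single_apply, Pi.single_apply]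
    split_ifs <;> simp
  have := congrArg (fun D => D f) h
  simpa [Derivation.commutator_apply, sub_eq_zero] using this

/-- The class of the variable `x_i`. -/
def truncX (i : ι) : Trunc F p ι := Ideal.Quotient.mk (truncIdeal F p ι) (X i)

theorem truncDeriv_X [CharP F p] [DecidableEq ι] (i j : ι) :
    truncDeriv F p i (truncX F p j) = if i = j then 1 else 0 := by
  rw [truncX, truncDeriv_mk, pderiv_X, Pi.single_apply]
  simp only [eq_comm (a := j)]
  split <;> simp

theorem truncDeriv_monomial [CharP F p] (i : ι) (a : ι →₀ ℕ) :
    truncDeriv F p i (truncMonomial F p a) =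
      (a i : F) • truncMonomial F p (a - Finsupp.single i 1) := by
  rw [truncMonomial, truncDeriv_mk, pderiv_monomial, truncMonomial,
    ← Ideal.Quotient.mk_eq_mk, ← Ideal.Quotient.mk_eq_mk, ← Submodule.Quotient.mk_smul,
    smul_monomial]
  simp

theorem truncX_mul_truncMonomial (i : ι) (a : ι →₀ ℕ) :
    truncX F p i * truncMonomial F p a = truncMonomial F p (a + Finsupp.single i 1) := by
  rw [truncX, truncMonomial, ← map_mul, truncMonomial, X, monomial_mul, one_mul, add_comm]

theorem truncMonomial_mul (a b : ι →₀ ℕ) :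
    truncMonomial F p a * truncMonomial F p b = truncMonomial F p (a + b) := by
  rw [truncMonomial, truncMonomial, ← map_mul, truncMonomial, monomial_mul, one_mul]

end Truncated

section ContactAlgebra

/-- Labels of the variables `x_1, …, x_n`, `n = 2m+1`: for `i : Fin m` (counted from `0`),
`some (inl i)` is `x_{i+1}`, its conjugate `some (inr i)` is `x_{i+1+m}`, and `none` is `x_n`. -/
abbrev Var (m : ℕ) : Type := Option (Fin m ⊕ Fin m)

variable (F : Type*) [Field F] (p : ℕ) [CharP F p] (m : ℕ)

/-- The derivation `x_1 D_1 + ⋯ + x_{2m} D_{2m} + 2 x_n D_n`, which multiplies `x^a` by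
`|a| + a_n`. -/
def eulerDeriv : Derivation F (Trunc F p (Var m)) (Trunc F p (Var m)) :=
  ∑ i : Var m, truncX F p i • truncDeriv F p (ι := Var m) i +
    truncX F p (ι := Var m) none • truncDeriv F p (ι := Var m) none

theorem eulerDeriv_apply (f : Trunc F p (Var m)) :
    eulerDeriv F p m f = ∑ i : Var m, truncX F p i * truncDeriv F p i f +
      truncX F p none * truncDeriv F p none f := by
  have h := map_sum (Derivation.coeFnAddMonoidHom (R := F) (A := Trunc F p (Var m))
    (M := Trunc F p (Var m))) (fun i : Var m => truncX F p i • truncDeriv F p i) Finset.univ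
  have h' := congrFun h f
  rw [Finset.sum_apply] at h'
  exact congrArg (· + truncX F p none * truncDeriv F p none f) h'

/-- The underlying vector space of `K'(n)`, `n = 2m+1`: the truncated polynomials `A(n)`.
It is a type synonym, because its Lie bracket is not the commutator of the ring `A(n)`. -/
def ContactPrime : Type _ := Trunc F p (Var m)

instance : AddCommGroup (ContactPrime F p m) := inferInstanceAs (AddCommGroup (Trunc F p (Var m)))

instance : Module F (ContactPrime F p m) := inferInstanceAs (Module F (Trunc F p (Var m)))

/-- The contact bracket `D_H(f)(g) + D_n(f) deg(g) - D_n(g) deg(f)` where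
`D_H(f)(g) = ∑_{i ≤ m} (D_i(f) D_{i+m}(g) - D_{i+m}(f) D_i(g))` and `deg` is the linear map
with `deg(x^a) = (|a| + a_n - 2) x^a`. -/
def contactBracket (f g : Trunc F p (Var m)) : Trunc F p (Var m) :=
  bracket (fun i : Fin m => truncDeriv F p (some (Sum.inl i)))
    (fun i : Fin m => truncDeriv F p (some (Sum.inr i)))
    (truncDeriv F p none) (eulerDeriv F p m) f g

theorem euler_truncDeriv_some (i : Fin m ⊕ Fin m) (f : Trunc F p (Var m)) :
    eulerDeriv F p m (truncDeriv F p (some i) f) =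
      truncDeriv F p (some i) (eulerDeriv F p m f) - truncDeriv F p (some i) f := by
  classical
  simp only [eulerDeriv_apply, map_add, map_sum, smul_eq_mul, Derivation.leibniz, truncDeriv_X,
    truncDeriv_comm F p (some i), Finset.sum_add_distrib]
  simp
  ring

theorem truncDeriv_none_euler (f : Trunc F p (Var m)) :
    truncDeriv F p none (eulerDeriv F p m f) =
      eulerDeriv F p m (truncDeriv F p none f) + 2 * truncDeriv F p none f := by
  classical
  simp only [eulerDeriv_apply, map_add, map_sum, smul_eq_mul, Derivation.leibniz, truncDeriv_X,
    truncDeriv_comm F p none, Finset.sum_add_distrib]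
  simp
  ring

theorem contactBracket_add_left (f g h : Trunc F p (Var m)) :
    contactBracket F p m (f + g) h = contactBracket F p m f h + contactBracket F p m g h := by
  simp only [contactBracket, bracket, poisson_add_left, map_add]
  ring

theorem contactBracket_add_right (f g h : Trunc F p (Var m)) :
    contactBracket F p m f (g + h) = contactBracket F p m f g + contactBracket F p m f h := by
  simp only [contactBracket, bracket, poisson_add_right, map_add]
  ring

theorem contactBracket_self (f : Trunc F p (Var m)) : contactBracket F p m f f = 0 := by
  rw [contactBracket, bracket, poisson_self, sub_self, add_zero]

theorem contactBracket_smul_right (c : F) (f g : Trunc F p (Var m)) :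
    contactBracket F p m f (c • g) = c • contactBracket F p m f g := by
  simp only [contactBracket, bracket, poisson_smul_right, Derivation.map_smul, smul_add, smul_sub,
    mul_sub, mul_smul_comm, smul_mul_assoc]

theorem contactBracket_leibniz (f g h : Trunc F p (Var m)) :
    contactBracket F p m f (contactBracket F p m g h) =
      contactBracket F p m (contactBracket F p m f g) h +
        contactBracket F p m g (contactBracket F p m f h) :=
  bracket_leibniz (fun _ _ => truncDeriv_comm F p _ _) (fun _ _ => truncDeriv_comm F p _ _)
    (fun _ _ => truncDeriv_comm F p _ _) _ _ (fun _ => truncDeriv_comm F p _ _)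
    (fun _ => truncDeriv_comm F p _ _) (fun _ => euler_truncDeriv_some F p m _)
    (fun _ => euler_truncDeriv_some F p m _) (truncDeriv_none_euler F p m) f g h

instance : LieRing (ContactPrime F p m) where
  bracket := contactBracket F p m
  add_lie := contactBracket_add_left F p m
  lie_add := contactBracket_add_right F p m
  lie_self := contactBracket_self F p m
  leibniz_lie := contactBracket_leibniz F p m

instance : LieAlgebra F (ContactPrime F p m) where
  lie_smul := contactBracket_smul_right F p m

/-- The monomial `x^a` as an element of `K'(n)`. -/
def ContactPrime.mono (a : Var m →₀ ℕ) : ContactPrime F p m := truncMonomial F p a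

/-- The degree `|a| + a_n - 2` of `x^a`. -/
def deg {m : ℕ} (a : Var m →₀ ℕ) : ℤ := (∑ i, a i : ℕ) + a none - 2

theorem truncX_mul_truncDeriv (i : Var m) (a : Var m →₀ ℕ) :
    truncX F p i * truncDeriv F p i (truncMonomial F p a) = (a i : F) • truncMonomial F p a := by
  rw [truncDeriv_monomial, mul_smul_comm, truncX_mul_truncMonomial]
  rcases Nat.eq_zero_or_pos (a i) with h | h
  · simp [h]
  · rw [tsub_add_cancel_of_le]
    rwa [Finsupp.single_le_iff]

theorem euler_monomial (a : Var m →₀ ℕ) :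
    eulerDeriv F p m (truncMonomial F p a) - 2 * truncMonomial F p a =
      (deg a : F) • truncMonomial F p a := by
  have h2 : (2 : Trunc F p (Var m)) * truncMonomial F p a = (2 : F) • truncMonomial F p a := by
    rw [two_mul, two_smul]
  simp only [eulerDeriv_apply, truncX_mul_truncDeriv, h2, ← Finset.sum_smul, ← add_smul,
    ← sub_smul]
  simp [deg]

/-- The bracket of `K'(n)` on monomials:
`[x^a, x^b] = D_H(x^a)(x^b) + (a_n deg(x^b) - b_n deg(x^a)) x^{a+b-ε_n}`. -/
theorem contact_lie_monomial (a b : Var m →₀ ℕ) :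
    ⁅ContactPrime.mono F p m a, ContactPrime.mono F p m b⁆ =
      ∑ i : Fin m, ((a (some (Sum.inl i)) * b (some (Sum.inr i)) : F)
          - a (some (Sum.inr i)) * b (some (Sum.inl i))) •
        ContactPrime.mono F p m
          (a + b - Finsupp.single (some (Sum.inl i)) 1 - Finsupp.single (some (Sum.inr i)) 1)
      + ((a none : F) * deg b - b none * deg a) •
        ContactPrime.mono F p m (a + b - Finsupp.single none 1) := by
  have key (i j : Var m) : truncDeriv F p i (truncMonomial F p a) *
      truncDeriv F p j (truncMonomial F p b) = ((a i : F) * b j) •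
        truncMonomial F p (a + b - Finsupp.single i 1 - Finsupp.single j 1) := by
    rw [truncDeriv_monomial, truncDeriv_monomial, smul_mul_smul_comm, truncMonomial_mul]
    rcases Nat.eq_zero_or_pos (a i) with h | h
    · simp [h]
    rcases Nat.eq_zero_or_pos (b j) with h' | h'
    · simp [h']
    rw [tsub_add_eq_add_tsub (by rwa [Finsupp.single_le_iff]),
      ← add_tsub_assoc_of_le (by rwa [Finsupp.single_le_iff]), tsub_right_comm]
  have key' (a b : Var m →₀ ℕ) : truncDeriv F p none (truncMonomial F p a) *
      truncMonomial F p b = (a none : F) • truncMonomial F p (a + b - Finsupp.single none 1) := by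
    rw [truncDeriv_monomial, smul_mul_assoc, truncMonomial_mul]
    rcases Nat.eq_zero_or_pos (a none) with h | h
    · simp [h]
    · rw [tsub_add_eq_add_tsub (by rwa [Finsupp.single_le_iff])]
  change contactBracket F p m (truncMonomial F p a) (truncMonomial F p b) =
    ∑ i : Fin m, ((a (some (Sum.inl i)) * b (some (Sum.inr i)) : F)
          - a (some (Sum.inr i)) * b (some (Sum.inl i))) •
        truncMonomial F p
          (a + b - Finsupp.single (some (Sum.inl i)) 1 - Finsupp.single (some (Sum.inr i)) 1)
      + ((a none : F) * deg b - b none * deg a) •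
        truncMonomial F p (a + b - Finsupp.single none 1)
  rw [contactBracket, bracket, poisson, euler_monomial, euler_monomial, mul_smul_comm,
    mul_smul_comm, key', key', add_comm b a, smul_smul, smul_smul, ← sub_smul]
  congr 1
  · refine Finset.sum_congr rfl fun i _ => ?_
    rw [key, key, tsub_right_comm (b := Finsupp.single (some (Sum.inr i)) 1), ← sub_smul]
  · congr 1
    ring

/-- The Contact algebra `K(n) = [K'(n), K'(n)]`, `n = 2m+1`. -/
abbrev ContactAlgebra : Type _ := LieAlgebra.derivedSeries F (ContactPrime F p m) 1

theorem lie_mem_derived (f g : ContactPrime F p m) :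
    ⁅f, g⁆ ∈ LieAlgebra.derivedSeries F (ContactPrime F p m) 1 := by
  rw [LieAlgebra.derivedSeries_def, LieAlgebra.derivedSeriesOfIdeal_succ,
    LieAlgebra.derivedSeriesOfIdeal_zero]
  exact LieSubmodule.lie_mem_lie (LieSubmodule.mem_top _) (LieSubmodule.mem_top _)

variable {m}

theorem mono_single_mem (i : Fin m ⊕ Fin m) :
    ContactPrime.mono F p m (Finsupp.single (some i) 1) ∈
      LieAlgebra.derivedSeries F (ContactPrime F p m) 1 := by
  have h : ContactPrime.mono F p m (Finsupp.single (some i) 1) =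
      - ⁅ContactPrime.mono F p m (Finsupp.single none 1),
        ContactPrime.mono F p m (Finsupp.single (some i) 1)⁆ := by
    rw [contact_lie_monomial, add_comm (Finsupp.single none 1), add_tsub_cancel_right]
    have h1 : deg (m := m) (Finsupp.single (some i) 1) = -1 := by
      simp [deg, Finsupp.single_apply]
    simp [h1]
  rw [h]
  exact neg_mem (lie_mem_derived F p m _ _)

theorem mono_zero_mem (hm : 1 ≤ m) :
    ContactPrime.mono F p m 0 ∈ LieAlgebra.derivedSeries F (ContactPrime F p m) 1 := by
  have h : ContactPrime.mono F p m 0 =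
      ⁅ContactPrime.mono F p m (Finsupp.single (some (Sum.inl ⟨0, hm⟩)) 1),
        ContactPrime.mono F p m (Finsupp.single (some (Sum.inr ⟨0, hm⟩)) 1)⁆ := by
    rw [contact_lie_monomial, Finset.sum_eq_single ⟨0, hm⟩]
    · simp [add_tsub_cancel_left]
    · intro i _ hi
      simp [hi.symm]
    · simp
  rw [h]
  exact lie_mem_derived F p m _ _

/-- The element `x_i` (`1 ≤ i ≤ 2m`) of `K(n)`. -/
def ContactAlgebra.x (i : Fin m ⊕ Fin m) : ContactAlgebra F p m :=
  ⟨ContactPrime.mono F p m (Finsupp.single (some i) 1), mono_single_mem F p i⟩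

/-- The element `1 = x^0` of `K(n)`, where `n = 2m+1 ≥ 3`. -/
def ContactAlgebra.one (hm : 1 ≤ m) : ContactAlgebra F p m :=
  ⟨ContactPrime.mono F p m 0, mono_zero_mem F p hm⟩

end ContactAlgebra

end Contact

end

/-! Write t = x_n and give each x_i (i ≤ 2m) weight 1 and t weight 2, so that the Lie degree is the
weight minus 2. Let L be the contact algebra and L₊ (`corePos`) its subalgebra of nonnegative
degree; below it lie only 1 and the x_i. Taking constant terms, L₊ acts on F through the character
λ(f) = -2 ∂f/∂t(0) (`lam`, `act_apply_zero`). All divided power series in n variables (`DivPow`)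
form the L-module coinduced from λ. It contains A(n) as the set of elements killed by every ∂_i^p,
and ∂_i^p commutes with the action of L (`shift_prime_act`).

Coinduction gives a Shapiro argument, carried out by integrating power series (`exists_act_eq`): a
cocycle with values in `DivPow` is a coboundary as soon as its constant term is one as a λ-valued
cocycle of L₊ (`IsVecCocycle.exists_eq_vcob`). In the same way H¹ and H⁰ of L in `DivPow` vanish.

The scalar cohomology of L₊ is detected by the n numbers Φ(x_i t, x_i^(p-1)) and Φ(t², t^(p-1)).
They vanish on coboundaries, since both members of each pair are killed by λ and commute: their
bracket is a multiple of x_i^p = 0 or t^p = 0. Conversely, if all n numbers vanish, then Φ is a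
coboundary (`IsCocycle.exists_eq_cob`): coboundaries are subtracted to make Φ vanish on a torus,
then almost everywhere on t², then on all quadratics x_i x_j. What remains is invariant under the
symplectic algebra. Invariance leaves two possible values near the top monomial; a linear relation
ties them together and one last coboundary removes them. Since L₊ is generated in degrees 0 and 1
(`bi_le_of_generators`), Φ then vanishes.

To return from `DivPow` to A(n), suppose that an A(n)-valued cocycle is the coboundary of a
series-valued cochain u. Then ∂_i^p u is a 1-cocycle, hence given by the action on some v_i. As H⁰
vanishes, the v_i are compatible and integrate to a single e with ∂_i^p e = v_i, and f ↦ u(f) - f·e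
takes values in A(n); perfectness of L puts them into L (`exists_core_cochain`).

So the n functionals embed H²(L, L) into Fⁿ. On Sq(x_j) and Sq(1) they form a monomial matrix with
nonzero entries -3(±1)^p and -12·2^(p-1): Sq(x_j) is seen only by the variable conjugate to x_j, and
Sq(1) only by the pair of powers of t. Hence the n classes are a basis. -/

namespace Contact

/-! ### The contact action on modules with connection -/

section ModuleBracket

variable {F A V : Type*} [CommRing F] [CommRing A] [Algebra F A] [AddCommGroup V] [Module F V]
  [Module A V] [IsScalarTower F A V] {ι : Type*} [Fintype ι]

/-- The contact bracket of an element of `A` with an element of a module with connection. -/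
def moduleBracket (D E : ι → Derivation F A A) (D' E' : ι → V →ₗ[F] V) (d e : Derivation F A A)
    (d' e' : V →ₗ[F] V) (f : A) (v : V) : V :=
  ∑ i, (D i f • E' i v - E i f • D' i v) + (d f • (e' v - (2 : A) • v) - (e f - 2 * f) • d' v)

section
variable [Module Aᵐᵒᵖ V] [IsCentralScalar A V] [IsScalarTower F Aᵐᵒᵖ V]

/-- The derivation of the square zero extension `A ⊕ V` given by a derivation of `A` and a
compatible operator on `V`. -/
def extDerivation (D : Derivation F A A) (D' : V →ₗ[F] V)
    (h : ∀ (a : A) (v : V), D' (a • v) = D a • v + a • D' v) :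
    Derivation F (TrivSqZeroExt A V) (TrivSqZeroExt A V) :=
  Derivation.mk'
    { toFun := fun x => TrivSqZeroExt.inl (D x.fst) + TrivSqZeroExt.inr (D' x.snd)
      map_add' := fun x y => by ext <;> simp
      map_smul' := fun c x => by ext <;> simp }
    (fun x y => by
      ext
      · simp
      · simp [h]
        abel)

theorem extDerivation_apply (D : Derivation F A A) (D' : V →ₗ[F] V)
    (h : ∀ (a : A) (v : V), D' (a • v) = D a • v + a • D' v) (x : TrivSqZeroExt A V) :
    extDerivation D D' h x = TrivSqZeroExt.inl (D x.fst) + TrivSqZeroExt.inr (D' x.snd) := rfl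

/-- In the square zero extension A ⊕ V the contact bracket of an element of A with one of V is the
module bracket. The Jacobi identity `bracket_leibniz` for the extension, read in the V component, is
therefore the module axiom, with no new computation. -/
theorem moduleBracket_leibniz_aux {D E : ι → Derivation F A A} {D' E' : ι → V →ₗ[F] V}
    {d e : Derivation F A A} {d' e' : V →ₗ[F] V}
    (hD : ∀ i (a : A) (v : V), D' i (a • v) = D i a • v + a • D' i v)
    (hE : ∀ i (a : A) (v : V), E' i (a • v) = E i a • v + a • E' i v)
    (hd : ∀ (a : A) (v : V), d' (a • v) = d a • v + a • d' v)
    (he : ∀ (a : A) (v : V), e' (a • v) = e a • v + a • e' v)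
    (hDD : ∀ i j f, D i (D j f) = D j (D i f)) (hDD' : ∀ i j f, D' i (D' j f) = D' j (D' i f))
    (hEE : ∀ i j f, E i (E j f) = E j (E i f)) (hEE' : ∀ i j f, E' i (E' j f) = E' j (E' i f))
    (hDE : ∀ i j f, D i (E j f) = E j (D i f)) (hDE' : ∀ i j f, D' i (E' j f) = E' j (D' i f))
    (hdD : ∀ i f, d (D i f) = D i (d f)) (hdD' : ∀ i f, d' (D' i f) = D' i (d' f))
    (hdE : ∀ i f, d (E i f) = E i (d f)) (hdE' : ∀ i f, d' (E' i f) = E' i (d' f))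
    (heD : ∀ i f, e (D i f) = D i (e f) - D i f) (heD' : ∀ i f, e' (D' i f) = D' i (e' f) - D' i f)
    (heE : ∀ i f, e (E i f) = E i (e f) - E i f) (heE' : ∀ i f, e' (E' i f) = E' i (e' f) - E' i f)
    (hde : ∀ f, d (e f) = e (d f) + 2 * d f)
    (hde' : ∀ f, d' (e' f) = e' (d' f) + (2 : A) • d' f) (f g : A) (v : V) :
    moduleBracket D E D' E' d e d' e' f (moduleBracket D E D' E' d e d' e' g v) =
      moduleBracket D E D' E' d e d' e' (bracket D E d e f g) v +
        moduleBracket D E D' E' d e d' e' g (moduleBracket D E D' E' d e d' e' f v) := by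
  set D1 := fun i => extDerivation (D i) (D' i) (hD i) with hD1
  set E1 := fun i => extDerivation (E i) (E' i) (hE i) with hE1
  set d1 := extDerivation d d' hd with hd1
  set e1 := extDerivation e e' he with he1
  have h2 : (2 : TrivSqZeroExt A V) = TrivSqZeroExt.inl 2 := rfl
  have hf (g : ι → TrivSqZeroExt A V) : (∑ i, g i).fst = ∑ i, (g i).fst :=
    map_sum (TrivSqZeroExt.fstHom F A V) g Finset.univ
  have hs (g : ι → TrivSqZeroExt A V) : (∑ i, g i).snd = ∑ i, (g i).snd :=
    map_sum (TrivSqZeroExt.sndHom A V) g Finset.univ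
  have k1 (f : A) (v : V) : bracket D1 E1 d1 e1 (TrivSqZeroExt.inl f) (TrivSqZeroExt.inr v) =
      TrivSqZeroExt.inr (moduleBracket D E D' E' d e d' e' f v) := by
    ext
    · simp [bracket, poisson, hD1, hE1, hd1, he1, extDerivation_apply, hf]
    · have h3 : MulOpposite.op (e f) - MulOpposite.op f * 2 = MulOpposite.op (e f - 2 * f) := rfl
      simp [bracket, poisson, hD1, hE1, hd1, he1, extDerivation_apply, moduleBracket, h2, hs]
      rw [h3, op_smul_eq_smul]
  have k2 (f g : A) : bracket D1 E1 d1 e1 (TrivSqZeroExt.inl f) (TrivSqZeroExt.inl g) =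
      TrivSqZeroExt.inl (bracket D E d e f g) := by
    ext
    · simp [bracket, poisson, hD1, hE1, hd1, he1, extDerivation_apply, h2, hf]
    · simp [bracket, poisson, hD1, hE1, hd1, he1, extDerivation_apply, h2, hs]
  have key := bracket_leibniz (F := F) (D := D1) (E := E1) (d := d1) (e := e1)
    (fun i j f => by ext <;> simp [hD1, extDerivation_apply, hDD i j, hDD' i j])
    (fun i j f => by ext <;> simp [hE1, extDerivation_apply, hEE i j, hEE' i j])
    (fun i j f => by ext <;> simp [hD1, hE1, extDerivation_apply, hDE i j, hDE' i j])
    (fun i f => by ext <;> simp [hD1, hd1, extDerivation_apply, hdD i, hdD' i])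
    (fun i f => by ext <;> simp [hE1, hd1, extDerivation_apply, hdE i, hdE' i])
    (fun i f => by ext <;> simp [hD1, he1, extDerivation_apply, heD i, heD' i])
    (fun i f => by ext <;> simp [hE1, he1, extDerivation_apply, heE i, heE' i])
    (fun f => by ext <;> simp [hd1, he1, extDerivation_apply, hde, hde', h2])
    (TrivSqZeroExt.inl f) (TrivSqZeroExt.inl g) (TrivSqZeroExt.inr v)
  simp only [k1, k2] at key
  have := congrArg TrivSqZeroExt.snd key
  simpa using this

end

theorem moduleBracket_leibniz {D E : ι → Derivation F A A} {D' E' : ι → V →ₗ[F] V}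
    {d e : Derivation F A A} {d' e' : V →ₗ[F] V}
    (hD : ∀ i (a : A) (v : V), D' i (a • v) = D i a • v + a • D' i v)
    (hE : ∀ i (a : A) (v : V), E' i (a • v) = E i a • v + a • E' i v)
    (hd : ∀ (a : A) (v : V), d' (a • v) = d a • v + a • d' v)
    (he : ∀ (a : A) (v : V), e' (a • v) = e a • v + a • e' v)
    (hDD : ∀ i j f, D i (D j f) = D j (D i f)) (hDD' : ∀ i j f, D' i (D' j f) = D' j (D' i f))
    (hEE : ∀ i j f, E i (E j f) = E j (E i f)) (hEE' : ∀ i j f, E' i (E' j f) = E' j (E' i f))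
    (hDE : ∀ i j f, D i (E j f) = E j (D i f)) (hDE' : ∀ i j f, D' i (E' j f) = E' j (D' i f))
    (hdD : ∀ i f, d (D i f) = D i (d f)) (hdD' : ∀ i f, d' (D' i f) = D' i (d' f))
    (hdE : ∀ i f, d (E i f) = E i (d f)) (hdE' : ∀ i f, d' (E' i f) = E' i (d' f))
    (heD : ∀ i f, e (D i f) = D i (e f) - D i f) (heD' : ∀ i f, e' (D' i f) = D' i (e' f) - D' i f)
    (heE : ∀ i f, e (E i f) = E i (e f) - E i f) (heE' : ∀ i f, e' (E' i f) = E' i (e' f) - E' i f)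
    (hde : ∀ f, d (e f) = e (d f) + 2 * d f)
    (hde' : ∀ f, d' (e' f) = e' (d' f) + (2 : A) • d' f) (f g : A) (v : V) :
    moduleBracket D E D' E' d e d' e' f (moduleBracket D E D' E' d e d' e' g v) =
      moduleBracket D E D' E' d e d' e' (bracket D E d e f g) v +
        moduleBracket D E D' E' d e d' e' g (moduleBracket D E D' E' d e d' e' f v) := by
  -- The square zero extension needs a two-sided action; A is commutative, so the left action serves
  -- on the right as well.
  let : Module Aᵐᵒᵖ V := Module.compHom V ((RingHom.id A).fromOpposite mul_comm)
  have : IsCentralScalar A V := ⟨fun _ _ => rfl⟩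
  have : IsScalarTower F Aᵐᵒᵖ V := IsScalarTower.of_algebraMap_smul (fun r x => by
      rw [MulOpposite.algebraMap_apply, op_smul_eq_smul, algebraMap_smul])
  exact moduleBracket_leibniz_aux hD hE hd he hDD hDD' hEE hEE' hDE hDE' hdD hdD' hdE hdE' heD heD'
    heE heE' hde hde' f g v

end ModuleBracket
end Contact

namespace Contact

/-! ### Monomials span the truncated polynomials -/

section TruncSpan

variable {F : Type*} [Field F] {p : ℕ} {ι : Type*}

theorem span_truncMonomial : Submodule.span F (Set.range (truncMonomial F p (ι := ι))) = ⊤ := by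
  rw [eq_top_iff]
  rintro f -
  obtain ⟨f, rfl⟩ := Ideal.Quotient.mk_surjective f
  induction f using MvPolynomial.induction_on' with
  | monomial a c =>
    have : Ideal.Quotient.mk (truncIdeal F p ι) (monomial a c) = c • truncMonomial F p a := by
      rw [truncMonomial, ← Ideal.Quotient.mk_eq_mk, ← Ideal.Quotient.mk_eq_mk,
        ← Submodule.Quotient.mk_smul, smul_monomial, smul_eq_mul, mul_one]
    rw [this]
    exact Submodule.smul_mem _ _ (Submodule.subset_span ⟨a, rfl⟩)
  | add f g hf hg =>
    rw [map_add]
    exact add_mem hf hg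

theorem trunc_ext {W : Type*} [AddCommGroup W] [Module F W] {f g : Trunc F p ι →ₗ[F] W}
    (h : ∀ a, f (truncMonomial F p a) = g (truncMonomial F p a)) : f = g :=
  LinearMap.ext_on_range span_truncMonomial h

theorem trunc_induction {P : Trunc F p ι → Prop} (f : Trunc F p ι)
    (mono : ∀ a, P (truncMonomial F p a))
    (add : ∀ f g, P f → P g → P (f + g)) (smul : ∀ (c : F) f, P f → P (c • f)) : P f := by
  have h : f ∈ Submodule.span F (Set.range (truncMonomial F p (ι := ι))) := by
    rw [span_truncMonomial]; trivial
  refine Submodule.span_induction ?_ (by simpa using smul 0 _ (mono 0)) (fun x y _ _ => add x y) (fun c x _ => smul c x) h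
  rintro _ ⟨a, rfl⟩
  exact mono a

theorem truncMonomial_eq_zero {a : ι →₀ ℕ} {i : ι} (h : p ≤ a i) : truncMonomial F p a = 0 := by
  rw [truncMonomial, Ideal.Quotient.eq_zero_iff_mem]
  have : (monomial a (1 : F)) = X i ^ p * monomial (a - Finsupp.single i p) 1 := by
    rw [X_pow_eq_monomial, monomial_mul, mul_one, add_tsub_cancel_of_le]
    rwa [Finsupp.single_le_iff]
  rw [this]
  exact Ideal.mul_mem_right _ _ (Ideal.subset_span ⟨i, rfl⟩)

theorem truncMonomial_zero : truncMonomial F p (0 : ι →₀ ℕ) = 1 := by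
  rw [truncMonomial]
  exact map_one _

theorem truncX_eq (i : ι) : truncX F p i = truncMonomial F p (Finsupp.single i 1) := rfl

end TruncSpan

/-! ### Divided power series as a module over truncated polynomials -/

section DividedPowers

/-- Divided power series in the variables `ι`, as functions of the exponent. -/
def DivPow (F ι : Type*) : Type _ := (ι →₀ ℕ) → F

variable {F : Type*} [Field F] {p : ℕ} {ι : Type*}

noncomputable instance : AddCommGroup (DivPow F ι) := inferInstanceAs (AddCommGroup ((ι →₀ ℕ) → F))

noncomputable instance : Module F (DivPow F ι) := inferInstanceAs (Module F ((ι →₀ ℕ) → F))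

namespace DivPow

omit [Field F] in
@[ext] theorem ext {v w : DivPow F ι} (h : ∀ c, v c = w c) : v = w := funext h

@[simp] theorem add_apply (v w : DivPow F ι) (c) : (v + w) c = v c + w c := rfl
@[simp] theorem sub_apply (v w : DivPow F ι) (c) : (v - w) c = v c - w c := rfl
@[simp] theorem neg_apply (v : DivPow F ι) (c) : (-v) c = - v c := rfl
@[simp] theorem zero_apply (c) : (0 : DivPow F ι) c = 0 := rfl
@[simp] theorem smul_apply (r : F) (v : DivPow F ι) (c) : (r • v) c = r * v c := rfl

/-- Evaluation of a coefficient. -/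
def evalAt (c : ι →₀ ℕ) : DivPow F ι →ₗ[F] F where
  toFun v := v c
  map_add' _ _ := rfl
  map_smul' _ _ := rfl

theorem evalAt_apply (c : ι →₀ ℕ) (v : DivPow F ι) : evalAt c v = v c := rfl

@[simp] theorem sum_apply {κ : Type*} (s : Finset κ) (f : κ → DivPow F ι) (c) :
    (∑ k ∈ s, f k) c = ∑ k ∈ s, f k c := map_sum (evalAt (F := F) c) f s

/-- The shift of the exponent by `a`: the differential operator `∂^a`. -/
noncomputable def shift (a : ι →₀ ℕ) : DivPow F ι →ₗ[F] DivPow F ι where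
  toFun v c := v (c + a)
  map_add' _ _ := rfl
  map_smul' _ _ := rfl

@[simp] theorem shift_apply (a : ι →₀ ℕ) (v : DivPow F ι) (c) : shift a v c = v (c + a) := rfl

theorem shift_comm (a b : ι →₀ ℕ) (v : DivPow F ι) : shift a (shift b v) = shift b (shift a v) := by
  ext c
  simp [add_right_comm]

variable [Fintype ι]

/-- Product of descending factorials. -/
def descFact (c a : ι →₀ ℕ) : ℕ := ∏ i, (c i).descFactorial (a i)

theorem descFact_eq_zero {c a : ι →₀ ℕ} (h : ¬ a ≤ c) : descFact c a = 0 := by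
  rw [Finsupp.le_def] at h
  push Not at h
  obtain ⟨i, hi⟩ := h
  exact Finset.prod_eq_zero (Finset.mem_univ i) (Nat.descFactorial_eq_zero_iff_lt.mpr hi)

theorem descFact_add (c a b : ι →₀ ℕ) : descFact c (a + b) = descFact c a * descFact (c - a) b := by
  rw [descFact, descFact, descFact, ← Finset.prod_mul_distrib]
  refine Finset.prod_congr rfl fun i _ => ?_
  rw [mul_comm, Finsupp.tsub_apply, Finsupp.add_apply,
    ← Nat.descFactorial_mul_descFactorial (show a i ≤ a i + b i by omega)]
  simp

/-- The difference equation (c+1)_a = c_a + a c_(a-1) of falling factorials. It is the product rule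
for ∂_i and multiplication by x^a in divided power coordinates. -/
theorem descFact_add_single (c a : ι →₀ ℕ) (i : ι) :
    descFact (c + Finsupp.single i 1) a = descFact c a +
      a i * descFact c (a - Finsupp.single i 1) := by
  classical
  rw [descFact, descFact, descFact, ← Finset.mul_prod_erase _ _ (Finset.mem_univ i),
    ← Finset.mul_prod_erase _ _ (Finset.mem_univ i), ← Finset.mul_prod_erase _ _ (Finset.mem_univ i)]
  have h1 : ∏ x ∈ Finset.univ.erase i, ((c + Finsupp.single i 1 : ι →₀ ℕ) x).descFactorial (a x) =
      ∏ x ∈ Finset.univ.erase i, (c x).descFactorial (a x) := by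
    refine Finset.prod_congr rfl fun x hx => ?_
    rw [Finset.mem_erase] at hx
    simp [hx.1.symm]
  have h2 : ∏ x ∈ Finset.univ.erase i, (c x).descFactorial ((a - Finsupp.single i 1 : ι →₀ ℕ) x) =
      ∏ x ∈ Finset.univ.erase i, (c x).descFactorial (a x) := by
    refine Finset.prod_congr rfl fun x hx => ?_
    rw [Finset.mem_erase] at hx
    simp [hx.1.symm]
  rw [h1, h2, ← mul_assoc, ← add_mul]
  congr 1
  simp only [Finsupp.add_apply, Finsupp.single_eq_same, Finsupp.tsub_apply]
  rcases h : a i with _ | k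
  · simp
  · rw [Nat.succ_descFactorial_succ, Nat.descFactorial_succ, Nat.add_sub_cancel, ← add_mul]
    rcases lt_or_ge (c i) k with h' | h'
    · rw [Nat.descFactorial_eq_zero_iff_lt.mpr h']; simp
    · congr 1; omega

/-- Multiplication by the monomial `x^a` on divided power series. -/
noncomputable def monoAct (a : ι →₀ ℕ) : Module.End F (DivPow F ι) where
  toFun v c := (descFact c a : F) * v (c - a)
  map_add' _ _ := funext fun _ => mul_add _ _ _
  map_smul' _ _ := funext fun _ => mul_left_comm _ _ _

theorem monoAct_apply (a : ι →₀ ℕ) (v : DivPow F ι) (c) :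
    monoAct a v c = (descFact c a : F) * v (c - a) := rfl

theorem monoAct_add (a b : ι →₀ ℕ) :
    (monoAct (a + b) : Module.End F (DivPow F ι)) = monoAct a * monoAct b := by
  refine LinearMap.ext fun v => ?_
  ext c
  rw [Module.End.mul_apply, monoAct_apply, monoAct_apply, monoAct_apply, descFact_add,
    Nat.cast_mul, mul_assoc, tsub_tsub]

variable (F ι) in
/-- Polynomials act on divided power series. -/
noncomputable def polyAct : MvPolynomial ι F →ₐ[F] Module.End F (DivPow F ι) :=
  AddMonoidAlgebra.lift F (Module.End F (DivPow F ι)) (ι →₀ ℕ)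
    { toFun := fun a => monoAct a.toAdd
      map_one' := by
        refine LinearMap.ext fun v => ?_
        ext c
        simp [monoAct_apply, descFact]
      map_mul' := fun a b => monoAct_add _ _ }

theorem polyAct_monomial (a : ι →₀ ℕ) (r : F) : polyAct F ι (monomial a r) = r • monoAct a := by
  rw [polyAct, ← MvPolynomial.single_eq_monomial, AddMonoidAlgebra.lift_single]
  rfl

variable [Fact p.Prime] [CharP F p]

/-- Multiplication by x_i^p introduces the factor c_i(c_i-1)⋯(c_i-p+1), a product of p consecutive
integers, hence zero in characteristic p. This is why the truncated algebra acts on untruncated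
divided powers. -/
theorem polyAct_eq_zero {f : MvPolynomial ι F} (hf : f ∈ truncIdeal F p ι) :
    polyAct F ι f = 0 := by
  have : truncIdeal F p ι ≤ RingHom.ker (polyAct F ι) := by
    rw [truncIdeal, Ideal.span_le]
    rintro _ ⟨i, rfl⟩
    simp only [SetLike.mem_coe, RingHom.mem_ker]
    rw [X_pow_eq_monomial, polyAct_monomial, one_smul]
    refine LinearMap.ext fun v => ?_
    ext c
    rw [monoAct_apply]
    have : ((descFact c (Finsupp.single i p) : ℕ) : F) = 0 := by
      rw [CharP.cast_eq_zero_iff F p]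
      refine dvd_trans ?_ (Finset.dvd_prod_of_mem _ (Finset.mem_univ i))
      rw [Finsupp.single_eq_same]
      exact dvd_trans (Nat.dvd_factorial (Fact.out : p.Prime).pos le_rfl)
        (Nat.factorial_dvd_descFactorial _ _)
    rw [this]; simp
  exact this hf

variable (F p ι) in
/-- Truncated polynomials act on divided power series. -/
noncomputable def truncAct : Trunc F p ι →+* Module.End F (DivPow F ι) :=
  Ideal.Quotient.lift (truncIdeal F p ι) (polyAct F ι).toRingHom fun _ hf => polyAct_eq_zero hf

noncomputable instance : Module (Trunc F p ι) (DivPow F ι) :=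
  Module.compHom _ (truncAct F p ι)

theorem truncMonomial_smul (a : ι →₀ ℕ) (v : DivPow F ι) :
    truncMonomial F p a • v = monoAct a v := by
  change truncAct F p ι (truncMonomial F p a) v = _
  rw [truncAct, truncMonomial, Ideal.Quotient.lift_mk]
  change polyAct F ι (monomial a 1) v = _
  rw [polyAct_monomial, one_smul]

instance : IsScalarTower F (Trunc F p ι) (DivPow F ι) where
  smul_assoc r f v := by
    obtain ⟨f, rfl⟩ := Ideal.Quotient.mk_surjective f
    rw [← Ideal.Quotient.mk_eq_mk, ← Submodule.Quotient.mk_smul]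
    change polyAct F ι (r • f) v = r • polyAct F ι f v
    rw [map_smul, LinearMap.smul_apply]

theorem trunc_smul_smul (f : Trunc F p ι) (r : F) (v : DivPow F ι) : f • r • v = r • f • v := by
  change truncAct F p ι f (r • v) = r • truncAct F p ι f v
  exact map_smul _ _ _

theorem shift_smul (i : ι) (f : Trunc F p ι) (v : DivPow F ι) :
    shift (Finsupp.single i 1) (f • v) =
      truncDeriv F p i f • v + f • shift (Finsupp.single i 1) v := by
  induction f using trunc_induction with
  | add f g hf hg => simp only [add_smul, map_add, hf, hg]; abel
  | smul r f hf => simp only [smul_assoc, map_smul, Derivation.map_smul, hf, smul_add]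
  | mono a =>
    rw [truncMonomial_smul, truncDeriv_monomial, smul_assoc, truncMonomial_smul,
      truncMonomial_smul]
    ext c
    simp only [shift_apply, add_apply, smul_apply, monoAct_apply, descFact_add_single]
    rcases Nat.eq_zero_or_pos (a i) with h | h
    · rw [h]
      by_cases hac : a ≤ c
      · rw [show c + Finsupp.single i 1 - a = c - a + Finsupp.single i 1 from
          (tsub_add_eq_add_tsub hac).symm]
        simp
      · simp [descFact_eq_zero hac]
    · have hs : Finsupp.single i 1 ≤ a := by rwa [Finsupp.single_le_iff]
      have h1 : c + Finsupp.single i 1 - a = c - (a - Finsupp.single i 1) := by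
        ext j
        have := hs j
        simp only [Finsupp.tsub_apply, Finsupp.add_apply]
        omega
      rw [h1]
      by_cases hac : a ≤ c
      · have h2 : c - (a - Finsupp.single i 1) = c - a + Finsupp.single i 1 := by
          rw [← h1, tsub_add_eq_add_tsub hac]
        rw [h2]; push_cast; ring
      · rw [descFact_eq_zero hac]; push_cast; ring

/-- The divided power series `1`. -/
noncomputable def one (F ι : Type*) [Field F] : DivPow F ι := fun c => by classical exact if c = 0 then 1 else 0

variable (F p ι) in
/-- The embedding of truncated polynomials into divided power series. -/
noncomputable def ofTrunc : Trunc F p ι →ₗ[F] DivPow F ι where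
  toFun f := f • one F ι
  map_add' _ _ := add_smul _ _ _
  map_smul' _ _ := smul_assoc _ _ _

theorem ofTrunc_apply (f : Trunc F p ι) : ofTrunc F p ι f = f • one F ι := rfl

theorem ofTrunc_mul (f g : Trunc F p ι) : ofTrunc F p ι (f * g) = f • ofTrunc F p ι g :=
  mul_smul _ _ _

theorem ofTrunc_deriv (i : ι) (f : Trunc F p ι) :
    ofTrunc F p ι (truncDeriv F p i f) = shift (Finsupp.single i 1) (ofTrunc F p ι f) := by
  rw [ofTrunc_apply, ofTrunc_apply, shift_smul]
  have : shift (Finsupp.single i 1) (one F ι) = 0 := by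
    ext c
    have : c + Finsupp.single i 1 ≠ 0 := fun h => by simpa using DFunLike.congr_fun h i
    simp [one, this]
  rw [this, smul_zero, add_zero]

/-- The ordinary power x^a is a! times the divided power; for exponents below p this factor is
invertible, which makes the embedding injective. -/
theorem ofTrunc_monomial [DecidableEq ι] (a c : ι →₀ ℕ) :
    ofTrunc F p ι (truncMonomial F p a) c = if c = a then (descFact a a : F) else 0 := by
  rw [ofTrunc_apply, truncMonomial_smul, monoAct_apply, one]
  by_cases hac : a ≤ c
  · by_cases h : c = a
    · subst h; simp
    · have : c - a ≠ 0 := fun h' => h (le_antisymm (tsub_eq_zero_iff_le.mp h') hac)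
      simp [h, this]
  · rw [descFact_eq_zero hac, if_neg (c := c = a) (fun h => hac h.ge)]
    simp

theorem descFact_self_ne_zero {a : ι →₀ ℕ} (h : ∀ i, a i < p) : (descFact a a : F) ≠ 0 := by
  rw [Ne, CharP.cast_eq_zero_iff F p, descFact,
    (Fact.out : p.Prime).prime.dvd_finsetProd_iff]
  push Not
  intro i _
  rw [Nat.descFactorial_self, (Fact.out : p.Prime).dvd_factorial]
  have := h i
  omega

end DivPow
end DividedPowers

/-! ### The monomial basis and the image of A(n) in divided power series -/

section TruncBasis

variable {F : Type*} [Field F] {p : ℕ} {ι : Type*} [Fintype ι] [Fact p.Prime] [CharP F p]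

/-- The exponents of the nonzero monomials of `F[x] / (x^p)`. -/
noncomputable def restricted (p : ℕ) (ι : Type*) [Fintype ι] : Finset (ι →₀ ℕ) := by
  classical
  exact (Fintype.piFinset fun _ : ι => Finset.range p).map
    Finsupp.equivFunOnFinite.symm.toEmbedding

omit [Fact p.Prime] in
theorem mem_restricted {a : ι →₀ ℕ} : a ∈ restricted p ι ↔ ∀ i, a i < p := by
  classical
  rw [restricted, Finset.mem_map_equiv, Fintype.mem_piFinset]
  simp

open DivPow in
/-- The coefficient of `x^a`. -/
noncomputable def truncCoeff (a : ι →₀ ℕ) : Trunc F p ι →ₗ[F] F :=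
  (descFact a a : F)⁻¹ • (evalAt a ∘ₗ ofTrunc F p ι)

theorem truncCoeff_monomial [DecidableEq ι] {a : ι →₀ ℕ} (ha : ∀ i, a i < p) (b : ι →₀ ℕ) :
    truncCoeff a (truncMonomial F p b) = if a = b then 1 else 0 := by
  rw [truncCoeff, LinearMap.smul_apply, LinearMap.comp_apply, DivPow.evalAt_apply,
    DivPow.ofTrunc_monomial, smul_eq_mul]
  split_ifs with h
  · subst h; exact inv_mul_cancel₀ (DivPow.descFact_self_ne_zero ha)
  · exact mul_zero _

theorem sum_truncCoeff (f : Trunc F p ι) :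
    ∑ a ∈ restricted p ι, truncCoeff a f • truncMonomial F p a = f := by
  classical
  have : (∑ a ∈ restricted p ι, (truncCoeff (F := F) a).smulRight (truncMonomial F p a)) =
      LinearMap.id := by
    refine trunc_ext fun b => ?_
    rw [LinearMap.sum_apply, LinearMap.id_apply]
    simp only [LinearMap.smulRight_apply]
    by_cases hb : b ∈ restricted p ι
    · rw [Finset.sum_eq_single b]
      · rw [truncCoeff_monomial (mem_restricted.mp hb), if_pos rfl, one_smul]
      · intro a ha hab
        rw [truncCoeff_monomial (mem_restricted.mp ha), if_neg hab, zero_smul]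
      · exact fun h => absurd hb h
    · rw [Finset.sum_eq_zero]
      · rw [mem_restricted] at hb
        push Not at hb
        obtain ⟨i, hi⟩ := hb
        exact (truncMonomial_eq_zero hi).symm
      · intro a ha
        rw [truncCoeff_monomial (mem_restricted.mp ha), if_neg, zero_smul]
        rintro rfl
        exact hb ha
  have := LinearMap.congr_fun this f
  simpa using this

/-- The linear map with prescribed values on the nonzero monomials. -/
noncomputable def truncLift {W : Type*} [AddCommGroup W] [Module F W] (w : (ι →₀ ℕ) → W) :
    Trunc F p ι →ₗ[F] W :=
  ∑ a ∈ restricted p ι, (truncCoeff a).smulRight (w a)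

theorem truncLift_monomial {W : Type*} [AddCommGroup W] [Module F W] (w : (ι →₀ ℕ) → W)
    {a : ι →₀ ℕ} (ha : ∀ i, a i < p) : truncLift w (truncMonomial F p a) = w a := by
  classical
  rw [truncLift, LinearMap.sum_apply, Finset.sum_eq_single a]
  · rw [LinearMap.smulRight_apply, truncCoeff_monomial ha, if_pos rfl, one_smul]
  · intro b hb hab
    rw [LinearMap.smulRight_apply, truncCoeff_monomial (mem_restricted.mp hb), if_neg hab,
      zero_smul]
  · exact fun h => absurd (mem_restricted.mpr ha) h

theorem ofTrunc_injective : Function.Injective (DivPow.ofTrunc F p ι) := by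
  rw [← LinearMap.ker_eq_bot, LinearMap.ker_eq_bot']
  intro f hf
  rw [← sum_truncCoeff f]
  refine Finset.sum_eq_zero fun a _ => ?_
  rw [truncCoeff, LinearMap.smul_apply, LinearMap.comp_apply, hf, map_zero, smul_zero, zero_smul]

/-- The image of A(n) is the set of series supported on exponents below p, equivalently those killed
by every ∂_i^p. This is the criterion by which a series-valued cochain is later seen to take values
in A(n). -/
theorem exists_ofTrunc_eq {v : DivPow F ι} (hv : ∀ c i, p ≤ c i → v c = 0) :
    ∃ f, DivPow.ofTrunc F p ι f = v := by
  classical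
  refine ⟨∑ a ∈ restricted p ι,
    ((DivPow.descFact a a : F)⁻¹ * v a) • truncMonomial F p a, ?_⟩
  ext c
  rw [map_sum, DivPow.sum_apply]
  simp only [map_smul, DivPow.smul_apply, DivPow.ofTrunc_monomial]
  by_cases hc : c ∈ restricted p ι
  · rw [Finset.sum_eq_single c]
    · have := DivPow.descFact_self_ne_zero (F := F) (mem_restricted.mp hc)
      rw [if_pos rfl]
      field_simp
    · intro a _ h
      rw [if_neg h.symm, mul_zero]
    · exact fun h => absurd hc h
  · rw [Finset.sum_eq_zero]
    · rw [mem_restricted] at hc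
      push Not at hc
      obtain ⟨i, hi⟩ := hc
      exact (hv c i hi).symm
    · intro a ha
      rw [if_neg, mul_zero]
      rintro rfl
      exact hc ha

end TruncBasis
end Contact

namespace Contact

/-! ### Contact brackets with elements of low degree -/

section Hamiltonian

variable {F : Type*} [Field F] {p : ℕ} [CharP F p] {m : ℕ}

/-- The sign in `{x_i, f} = ± ∂f/∂x_{i'}`. -/
def sgn (F : Type*) [Field F] : Fin m ⊕ Fin m → F := Sum.elim (fun _ => 1) (fun _ => -1)

theorem sgn_ne_zero (i : Fin m ⊕ Fin m) : sgn F i ≠ 0 := by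
  rcases i with i | i <;> simp [sgn]

theorem sgn_mul_self (i : Fin m ⊕ Fin m) : sgn F i * sgn F i = 1 := by
  rcases i with i | i <;> simp [sgn]

theorem sgn_swap (i : Fin m ⊕ Fin m) : sgn F i.swap = - sgn F i := by
  rcases i with i | i <;> simp [sgn]

theorem swap_ne (i : Fin m ⊕ Fin m) : i.swap ≠ i := by
  rcases i with i | i <;> simp

variable (F p)

/-- The Hamiltonian derivation `{x_i, ·}`. -/
noncomputable def ham (i : Fin m ⊕ Fin m) : Derivation F (Trunc F p (Var m)) (Trunc F p (Var m)) :=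
  sgn F i • truncDeriv F p (some i.swap)

/-- The variable `x_i`, `i ≤ 2m`. -/
noncomputable abbrev vx (i : Fin m ⊕ Fin m) : Trunc F p (Var m) := truncX F p (some i)

/-- The variable `t = x_n`. -/
noncomputable abbrev vt (m : ℕ) : Trunc F p (Var m) := truncX F p (none : Var m)

/-- The derivation `∂/∂t`. -/
noncomputable abbrev dt (m : ℕ) : Derivation F (Trunc F p (Var m)) (Trunc F p (Var m)) :=
  truncDeriv F p (none : Var m)

variable {F p}

theorem ham_apply (i : Fin m ⊕ Fin m) (f : Trunc F p (Var m)) :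
    ham F p i f = sgn F i • truncDeriv F p (some i.swap) f := rfl

/-- The value of the symplectic form on `x_i` and `x_j`. -/
def omega (F : Type*) [Field F] (i j : Fin m ⊕ Fin m) : F := if j = i.swap then sgn F i else 0

theorem omega_swap (i j : Fin m ⊕ Fin m) : omega F j i = - omega F i j := by
  unfold omega
  by_cases h : j = i.swap
  · subst h
    simp [sgn_swap]
  · have : i ≠ j.swap := by rintro rfl; simp at h
    simp [h, this]

theorem ham_vx (i j : Fin m ⊕ Fin m) : ham F p i (vx F p j) = omega F i j • 1 := by
  rw [ham_apply, truncDeriv_X, omega]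
  simp only [Option.some.injEq, eq_comm (a := j)]
  split <;> simp

theorem ham_vt (i : Fin m ⊕ Fin m) : ham F p i (vt F p m) = 0 := by
  rw [ham_apply, truncDeriv_X]
  simp

theorem dt_vx (i : Fin m ⊕ Fin m) : dt F p m (vx F p i) = 0 := by
  rw [truncDeriv_X]; simp

theorem dt_vt : dt F p m (vt F p m) = 1 := by
  rw [truncDeriv_X]; simp

theorem euler_vx (i : Fin m ⊕ Fin m) : eulerDeriv F p m (vx F p i) = vx F p i := by
  classical
  simp only [eulerDeriv_apply, truncDeriv_X]
  simp

theorem euler_vt : eulerDeriv F p m (vt F p m) = 2 * vt F p m := by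
  classical
  simp only [eulerDeriv_apply, truncDeriv_X]
  simp
  ring

/-- Summing over all 2m variables, with the sign absorbed in `ham`, makes the Poisson part collapse
when f is a product of variables, by `sum_deriv_vx_mul`. -/
theorem contactBracket_eq (f g : Trunc F p (Var m)) :
    contactBracket F p m f g = ∑ i, truncDeriv F p (some i) f * ham F p i g +
      (dt F p m f * (eulerDeriv F p m g - 2 * g) - dt F p m g * (eulerDeriv F p m f - 2 * f)) := by
  rw [contactBracket, bracket, poisson, Fintype.sum_sum_type, ← Finset.sum_add_distrib]
  congr 1
  refine Finset.sum_congr rfl fun i _ => ?_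
  simp only [ham_apply, sgn, Sum.elim_inl, Sum.elim_inr, Sum.swap_inl, Sum.swap_inr, one_smul,
    neg_smul]
  ring

theorem contactBracket_skew (f g : Trunc F p (Var m)) :
    contactBracket F p m g f = - contactBracket F p m f g := by
  rw [contactBracket, contactBracket, bracket, bracket, poisson_skew]
  ring

theorem sum_deriv_vx_mul (j : Fin m ⊕ Fin m) (w : Fin m ⊕ Fin m → Trunc F p (Var m)) :
    ∑ i, truncDeriv F p (some i) (vx F p j) * w i = w j := by
  classical
  simp [truncDeriv_X]

theorem deriv_some_vt (i : Fin m ⊕ Fin m) : truncDeriv F p (some i) (vt F p m) = 0 := by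
  rw [truncDeriv_X]; simp

theorem bracket_one (g : Trunc F p (Var m)) : contactBracket F p m 1 g = 2 * dt F p m g := by
  rw [contactBracket_eq]
  simp only [Derivation.map_one_eq_zero]
  simp
  ring

theorem bracket_vx (i : Fin m ⊕ Fin m) (g : Trunc F p (Var m)) :
    contactBracket F p m (vx F p i) g = ham F p i g + vx F p i * dt F p m g := by
  rw [contactBracket_eq, sum_deriv_vx_mul, dt_vx, euler_vx]
  ring

theorem bracket_vt (g : Trunc F p (Var m)) :
    contactBracket F p m (vt F p m) g = eulerDeriv F p m g - 2 * g := by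
  rw [contactBracket_eq, dt_vt, euler_vt]
  simp [deriv_some_vt]

theorem bracket_vt_sq (g : Trunc F p (Var m)) :
    contactBracket F p m (vt F p m ^ 2) g =
      2 * vt F p m * (eulerDeriv F p m g - 2 * g - vt F p m * dt F p m g) := by
  rw [contactBracket_eq]
  simp only [Derivation.leibniz_pow, euler_vt, dt_vt, deriv_some_vt]
  simp
  ring

theorem bracket_vt_cube (g : Trunc F p (Var m)) :
    contactBracket F p m (vt F p m ^ 3) g =
      vt F p m ^ 2 * (3 * (eulerDeriv F p m g - 2 * g) - 4 * (vt F p m * dt F p m g)) := by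
  rw [contactBracket_eq]
  simp only [Derivation.leibniz_pow, euler_vt, dt_vt, deriv_some_vt]
  simp
  ring

theorem bracket_vx_vt (i : Fin m ⊕ Fin m) (g : Trunc F p (Var m)) :
    contactBracket F p m (vx F p i * vt F p m) g =
      vt F p m * ham F p i g + vx F p i * (eulerDeriv F p m g - 2 * g - vt F p m * dt F p m g) := by
  rw [contactBracket_eq]
  simp only [Derivation.leibniz, euler_vt, euler_vx, dt_vt, dt_vx, deriv_some_vt, smul_eq_mul,
    mul_zero, zero_add, mul_assoc, ← Finset.mul_sum, sum_deriv_vx_mul]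
  ring

theorem bracket_quadratic (i j : Fin m ⊕ Fin m) (g : Trunc F p (Var m)) :
    contactBracket F p m (vx F p i * vx F p j) g =
      vx F p i * ham F p j g + vx F p j * ham F p i g := by
  rw [contactBracket_eq]
  simp only [Derivation.leibniz, euler_vx, dt_vx, smul_eq_mul,
    mul_zero, add_mul, mul_assoc, Finset.sum_add_distrib, ← Finset.mul_sum, sum_deriv_vx_mul]
  ring

theorem bracket_cubic (i j k : Fin m ⊕ Fin m) (g : Trunc F p (Var m)) :
    contactBracket F p m (vx F p i * vx F p j * vx F p k) g =
      vx F p i * vx F p j * ham F p k g + vx F p i * vx F p k * ham F p j g +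
        vx F p j * vx F p k * ham F p i g - vx F p i * vx F p j * vx F p k * dt F p m g := by
  rw [contactBracket_eq]
  simp only [Derivation.leibniz, euler_vx, dt_vx, smul_eq_mul,
    mul_zero, add_mul, mul_add, mul_assoc, Finset.sum_add_distrib, ← Finset.mul_sum,
    sum_deriv_vx_mul]
  ring

end Hamiltonian

/-! ### The bigrading by degree in the x_i and degree in t -/

section Bigraded

variable {F : Type*} [Field F] {p : ℕ} {m : ℕ}

/-- The degree of a monomial in the variables `x_1, …, x_{2m}`. -/
def xdeg (a : Var m →₀ ℕ) : ℕ := ∑ i, a (some i)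

theorem xdeg_add (a b : Var m →₀ ℕ) : xdeg (a + b) = xdeg a + xdeg b := by
  simp [xdeg, Finset.sum_add_distrib]

@[simp] theorem xdeg_single_none (k : ℕ) : xdeg (Finsupp.single (none : Var m) k) = 0 := by
  simp [xdeg]

@[simp] theorem xdeg_single_some (i : Fin m ⊕ Fin m) (k : ℕ) :
    xdeg (Finsupp.single (some i : Var m) k) = k := by
  classical
  simp [xdeg, Finsupp.single_apply]

variable (F p m) in
/-- The span of the monomials of degree `r` in `x_1, …, x_{2m}` and degree `b` in `t`. -/
noncomputable def bi (r b : ℕ) : Submodule F (Trunc F p (Var m)) :=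
  Submodule.span F {f | ∃ a : Var m →₀ ℕ, xdeg a = r ∧ a none = b ∧ f = truncMonomial F p a}

theorem monomial_mem_bi (a : Var m →₀ ℕ) :
    truncMonomial F p a ∈ bi F p m (xdeg a) (a none) :=
  Submodule.subset_span ⟨a, rfl, rfl, rfl⟩

theorem monomial_mem_bi' {a : Var m →₀ ℕ} {r b : ℕ} (h : xdeg a = r) (h' : a none = b) :
    truncMonomial F p a ∈ bi F p m r b :=
  Submodule.subset_span ⟨a, h, h', rfl⟩

theorem mul_mem_bi {r b r' b' : ℕ} {f g : Trunc F p (Var m)} (hf : f ∈ bi F p m r b)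
    (hg : g ∈ bi F p m r' b') : f * g ∈ bi F p m (r + r') (b + b') := by
  induction hf using Submodule.span_induction with
  | zero => rw [zero_mul]; exact zero_mem _
  | add x y _ _ hx hy => rw [add_mul]; exact add_mem hx hy
  | smul c x _ hx => rw [smul_mul_assoc]; exact Submodule.smul_mem _ _ hx
  | mem x hx =>
    obtain ⟨a, rfl, rfl, rfl⟩ := hx
    induction hg using Submodule.span_induction with
    | zero => rw [mul_zero]; exact zero_mem _
    | add x y _ _ hx hy => rw [mul_add]; exact add_mem hx hy
    | smul c x _ hx => rw [mul_smul_comm]; exact Submodule.smul_mem _ _ hx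
    | mem y hy =>
      obtain ⟨a', rfl, rfl, rfl⟩ := hy
      rw [truncMonomial_mul]
      exact monomial_mem_bi' (xdeg_add _ _) rfl

theorem vx_mem_bi (i : Fin m ⊕ Fin m) : vx F p i ∈ bi F p m 1 0 :=
  monomial_mem_bi' (by simp) (by simp)

theorem vt_mem_bi : vt F p m ∈ bi F p m 0 1 := monomial_mem_bi' (by simp) (by simp)

theorem vt_pow_mem_bi (k : ℕ) : vt F p m ^ k ∈ bi F p m 0 k := by
  induction k with
  | zero =>
    rw [pow_zero, ← truncMonomial_zero]
    exact monomial_mem_bi' (by simp [xdeg]) (by simp)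
  | succ k ih =>
    have h := mul_mem_bi ih (vt_mem_bi (F := F) (p := p) (m := m))
    rwa [← pow_succ, zero_add] at h

theorem vx_mul_mem_bi (i : Fin m ⊕ Fin m) {r b : ℕ} {g : Trunc F p (Var m)}
    (hg : g ∈ bi F p m r b) : vx F p i * g ∈ bi F p m (r + 1) b := by
  have := mul_mem_bi (vx_mem_bi (F := F) (p := p) i) hg
  rwa [add_comm, zero_add] at this

theorem vt_mul_mem_bi {r b : ℕ} {g : Trunc F p (Var m)}
    (hg : g ∈ bi F p m r b) : vt F p m * g ∈ bi F p m r (b + 1) := by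
  have := mul_mem_bi (vt_mem_bi (F := F) (p := p)) hg
  rwa [zero_add, add_comm] at this

theorem bi_eq_bot_of_le {r b : ℕ} (h : p ≤ b) : bi F p m r b = ⊥ := by
  rw [bi, Submodule.span_eq_bot]
  rintro _ ⟨a, -, rfl, rfl⟩
  exact truncMonomial_eq_zero h

theorem bi_eq_bot_of_lt (hp : 0 < p) {r b : ℕ} (h : 2 * m * (p - 1) < r) : bi F p m r b = ⊥ := by
  rw [bi, Submodule.span_eq_bot]
  rintro _ ⟨a, rfl, -, rfl⟩
  by_contra h'
  have h2 (i : Fin m ⊕ Fin m) : a (some i) ≤ p - 1 := by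
    by_contra h3
    exact h' (truncMonomial_eq_zero (i := some i) (by omega))
  have : xdeg a ≤ ∑ _i : Fin m ⊕ Fin m, (p - 1) := Finset.sum_le_sum fun i _ => h2 i
  simp only [Finset.sum_const, Finset.card_univ, Fintype.card_sum, Fintype.card_fin,
    smul_eq_mul] at this
  rw [← two_mul] at this
  omega

theorem bi_ext {W : Type*} [AddCommGroup W] [Module F W] {r b : ℕ} {u w : Trunc F p (Var m) →ₗ[F] W}
    (h : ∀ a : Var m →₀ ℕ, xdeg a = r → a none = b → (∀ i, a i < p) →
      u (truncMonomial F p a) = w (truncMonomial F p a))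
    {g : Trunc F p (Var m)} (hg : g ∈ bi F p m r b) : u g = w g := by
  induction hg using Submodule.span_induction with
  | zero => rw [map_zero, map_zero]
  | add x y _ _ hx hy => rw [map_add, map_add, hx, hy]
  | smul c x _ hx => rw [map_smul, map_smul, hx]
  | mem x hx =>
    obtain ⟨a, h1, h2, rfl⟩ := hx
    by_cases ha : ∀ i, a i < p
    · exact h a h1 h2 ha
    · push Not at ha
      obtain ⟨i, hi⟩ := ha
      rw [truncMonomial_eq_zero hi, map_zero, map_zero]

variable [CharP F p]

theorem deriv_none_mem_bi {r b : ℕ} {g : Trunc F p (Var m)}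
    (hg : g ∈ bi F p m r b) : dt F p m g ∈ bi F p m r (b - 1) := by
  induction hg using Submodule.span_induction with
  | zero => rw [map_zero]; exact zero_mem _
  | add x y _ _ hx hy => rw [map_add]; exact add_mem hx hy
  | smul c x _ hx => rw [Derivation.map_smul]; exact Submodule.smul_mem _ _ hx
  | mem x hx =>
    obtain ⟨a, rfl, rfl, rfl⟩ := hx
    rw [truncDeriv_monomial]
    exact Submodule.smul_mem _ _ (monomial_mem_bi' (by simp [xdeg]) (by simp))

theorem ham_monomial (i : Fin m ⊕ Fin m) (a : Var m →₀ ℕ) :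
    ham F p i (truncMonomial F p a) = (sgn F i * a (some i.swap)) •
      truncMonomial F p (a - Finsupp.single (some i.swap) 1) := by
  rw [ham_apply, truncDeriv_monomial, smul_smul]

theorem xdeg_sub_single {a : Var m →₀ ℕ} {i : Fin m ⊕ Fin m} (h : a (some i) ≠ 0) :
    xdeg (a - Finsupp.single (some i) 1) + 1 = xdeg a := by
  have : a - Finsupp.single (some i) 1 + Finsupp.single (some i) 1 = a := by
    rw [tsub_add_cancel_of_le]
    rw [Finsupp.single_le_iff]
    omega
  conv_rhs => rw [← this, xdeg_add, xdeg_single_some]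

theorem ham_mem_bi (i : Fin m ⊕ Fin m) {r b : ℕ} {g : Trunc F p (Var m)}
    (hg : g ∈ bi F p m r b) : ham F p i g ∈ bi F p m (r - 1) b := by
  induction hg using Submodule.span_induction with
  | zero => rw [map_zero]; exact zero_mem _
  | add x y _ _ hx hy => rw [map_add]; exact add_mem hx hy
  | smul c x _ hx => rw [Derivation.map_smul]; exact Submodule.smul_mem _ _ hx
  | mem x hx =>
    obtain ⟨a, rfl, rfl, rfl⟩ := hx
    rw [ham_monomial]
    by_cases h : a (some i.swap) = 0
    · rw [h]; simp
    · have := xdeg_sub_single h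
      exact Submodule.smul_mem _ _ (monomial_mem_bi' (by omega) (by simp))

theorem ham_eq_zero (i : Fin m ⊕ Fin m) {b : ℕ} {g : Trunc F p (Var m)}
    (hg : g ∈ bi F p m 0 b) : ham F p i g = 0 := by
  induction hg using Submodule.span_induction with
  | zero => rw [map_zero]
  | add x y _ _ hx hy => rw [map_add, hx, hy, add_zero]
  | smul c x _ hx => rw [Derivation.map_smul, hx, smul_zero]
  | mem x hx =>
    obtain ⟨a, h, -, rfl⟩ := hx
    rw [ham_monomial]
    have : a (some i.swap) = 0 := by
      rw [xdeg, Finset.sum_eq_zero_iff] at h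
      exact h _ (Finset.mem_univ _)
    rw [this]
    simp

theorem vt_mul_dt {r b : ℕ} {g : Trunc F p (Var m)} (hg : g ∈ bi F p m r b) :
    vt F p m * dt F p m g = (b : F) • g := by
  induction hg using Submodule.span_induction with
  | zero => rw [map_zero, mul_zero, smul_zero]
  | add x y _ _ hx hy => rw [map_add, mul_add, hx, hy, smul_add]
  | smul c x _ hx => rw [Derivation.map_smul, mul_smul_comm, hx, smul_comm]
  | mem x hx =>
    obtain ⟨a, -, rfl, rfl⟩ := hx
    exact truncX_mul_truncDeriv F p m none a

theorem euler_bi {r b : ℕ} {g : Trunc F p (Var m)} (hg : g ∈ bi F p m r b) :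
    eulerDeriv F p m g = (r + 2 * b : F) • g := by
  induction hg using Submodule.span_induction with
  | zero => rw [map_zero, smul_zero]
  | add x y _ _ hx hy => rw [map_add, hx, hy, smul_add]
  | smul c x _ hx => rw [Derivation.map_smul, hx, smul_comm]
  | mem x hx =>
    obtain ⟨a, rfl, rfl, rfl⟩ := hx
    simp only [eulerDeriv_apply, truncX_mul_truncDeriv, ← Finset.sum_smul, ← add_smul]
    congr 1
    rw [Fintype.sum_option, xdeg]
    push_cast
    ring

omit [CharP F p] in
theorem trunc_smul_eq_mul (c : F) (f : Trunc F p (Var m)) :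
    c • f = algebraMap F (Trunc F p (Var m)) c * f := Algebra.smul_def c f

theorem bracket_vt_bi {r b : ℕ} {g : Trunc F p (Var m)} (hg : g ∈ bi F p m r b) :
    contactBracket F p m (vt F p m) g = (r + 2 * b - 2 : F) • g := by
  rw [bracket_vt, euler_bi hg, sub_smul, two_mul g, two_smul]

/-- The scalar decides whether t·g can be recovered from g by bracketing with t². The exceptional
locus r + b = 2 in F causes most of the case distinctions below; there t³ or a pair of conjugate
variables is used instead. -/
theorem bracket_vt_sq_bi {r b : ℕ} {g : Trunc F p (Var m)} (hg : g ∈ bi F p m r b) :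
    contactBracket F p m (vt F p m ^ 2) g = (2 * (r + b - 2) : F) • (vt F p m * g) := by
  rw [bracket_vt_sq, euler_bi hg, vt_mul_dt hg]
  simp only [trunc_smul_eq_mul, map_add, map_mul, map_sub, map_natCast, map_ofNat]
  ring

theorem bracket_vt_cube_bi {r b : ℕ} {g : Trunc F p (Var m)} (hg : g ∈ bi F p m r b) :
    contactBracket F p m (vt F p m ^ 3) g = (3 * r + 2 * b - 6 : F) • (vt F p m ^ 2 * g) := by
  rw [bracket_vt_cube, euler_bi hg, vt_mul_dt hg]
  simp only [trunc_smul_eq_mul, map_add, map_mul, map_sub, map_natCast, map_ofNat]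
  ring

theorem bracket_vx_vt_bi (i : Fin m ⊕ Fin m) {r b : ℕ} {g : Trunc F p (Var m)}
    (hg : g ∈ bi F p m r b) : contactBracket F p m (vx F p i * vt F p m) g =
      vt F p m * ham F p i g + (r + b - 2 : F) • (vx F p i * g) := by
  rw [bracket_vx_vt, euler_bi hg, vt_mul_dt hg]
  simp only [trunc_smul_eq_mul, map_add, map_mul, map_sub, map_natCast, map_ofNat]
  ring

end Bigraded
end Contact

namespace Contact

/-! ### Generation of the nonnegative part by degrees 0 and 1 -/

section Generation

variable {F : Type*} [Field F] {p : ℕ} [CharP F p] {m : ℕ}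

theorem natCast_ne_zero_of_lt {k : ℕ} (h0 : 0 < k) (h : k < p) : (k : F) ≠ 0 := by
  rw [Ne, CharP.cast_eq_zero_iff F p]
  exact Nat.not_dvd_of_pos_of_lt h0 h

theorem cast_pred (hp : 0 < p) : ((p - 1 : ℕ) : F) = -1 := by
  rw [Nat.cast_pred hp, CharP.cast_eq_zero, zero_sub]

theorem two_ne_zero_of_le (hp : 5 ≤ p) : (2 : F) ≠ 0 := by
  have := natCast_ne_zero_of_lt (F := F) (p := p) (k := 2) (by omega) (by omega)
  exact_mod_cast this

theorem three_ne_zero_of_le (hp : 5 ≤ p) : (3 : F) ≠ 0 := by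
  have := natCast_ne_zero_of_lt (F := F) (p := p) (k := 3) (by omega) (by omega)
  exact_mod_cast this

theorem four_ne_zero_of_le (hp : 5 ≤ p) : (4 : F) ≠ 0 := by
  have := natCast_ne_zero_of_lt (F := F) (p := p) (k := 4) (by omega) (by omega)
  exact_mod_cast this

omit [CharP F p] in
theorem bi_le_of_vx_mul {R : Submodule F (Trunc F p (Var m))} {r b : ℕ}
    (h : ∀ i, ∀ g ∈ bi F p m r b, vx F p i * g ∈ R) : bi F p m (r + 1) b ≤ R := by
  rw [bi, Submodule.span_le]
  rintro _ ⟨a, hr, rfl, rfl⟩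
  have : ∃ i, a (some i) ≠ 0 := by
    by_contra! h'
    simp [xdeg, h'] at hr
  obtain ⟨i, hi⟩ := this
  have h1 : truncMonomial F p a = vx F p i * truncMonomial F p (a - Finsupp.single (some i) 1) := by
    rw [truncX_mul_truncMonomial, tsub_add_cancel_of_le]
    rw [Finsupp.single_le_iff]
    omega
  rw [SetLike.mem_coe, h1]
  have := xdeg_sub_single hi
  exact h i _ (monomial_mem_bi' (by omega) (by simp))

omit [CharP F p] in
theorem bi_le_of_vt_mul {R : Submodule F (Trunc F p (Var m))} {r b : ℕ}
    (h : ∀ g ∈ bi F p m r b, vt F p m * g ∈ R) : bi F p m r (b + 1) ≤ R := by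
  rw [bi, Submodule.span_le]
  rintro _ ⟨a, rfl, hb, rfl⟩
  have h1 : truncMonomial F p a = vt F p m * truncMonomial F p (a - Finsupp.single none 1) := by
    rw [truncX_mul_truncMonomial, tsub_add_cancel_of_le]
    rw [Finsupp.single_le_iff]
    omega
  rw [SetLike.mem_coe, h1]
  exact h _ (monomial_mem_bi' (by simp [xdeg]) (by simp [hb]))

theorem bracket_cubic_vt_mul (i j k : Fin m ⊕ Fin m) {r b : ℕ} {w : Trunc F p (Var m)}
    (hw : w ∈ bi F p m r b) :
    contactBracket F p m (vx F p i * vx F p j * vx F p k) (vt F p m * w) =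
      vt F p m * (vx F p i * vx F p j * ham F p k w + vx F p i * vx F p k * ham F p j w +
        vx F p j * vx F p k * ham F p i w) -
      (b + 1 : F) • (vx F p i * vx F p j * vx F p k * w) := by
  have h := vt_mul_dt hw
  rw [bracket_cubic]
  simp only [Derivation.leibniz, ham_vt, dt_vt, smul_eq_mul]
  rw [h]
  simp only [trunc_smul_eq_mul, map_add, map_natCast, map_one]
  ring

/-- The cyclic sum cancels the terms in the symplectic form, by its antisymmetry. The part divisible
by t agrees with that of `bracket_cubic_vt_mul`, so the difference of the two identities is (3(r+b)
+ (b+1)) times x_i x_j x_k w. -/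
theorem sum_bracket_vx_vt (i j k : Fin m ⊕ Fin m) {r b : ℕ} {w : Trunc F p (Var m)}
    (hw : w ∈ bi F p m r b) :
    contactBracket F p m (vx F p i * vt F p m) (vx F p j * (vx F p k * w)) +
    contactBracket F p m (vx F p j * vt F p m) (vx F p i * (vx F p k * w)) +
    contactBracket F p m (vx F p k * vt F p m) (vx F p i * (vx F p j * w)) =
      vt F p m * (vx F p i * vx F p j * ham F p k w + vx F p i * vx F p k * ham F p j w +
        vx F p j * vx F p k * ham F p i w) +
      (3 * (r + b) : F) • (vx F p i * vx F p j * vx F p k * w) := by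
  have h (i j : Fin m ⊕ Fin m) := vx_mul_mem_bi i (vx_mul_mem_bi j hw)
  rw [bracket_vx_vt_bi _ (h j k), bracket_vx_vt_bi _ (h i k), bracket_vx_vt_bi _ (h i j)]
  simp only [Derivation.leibniz, ham_vx, smul_eq_mul]
  rw [omega_swap i j, omega_swap i k, omega_swap j k]
  simp only [trunc_smul_eq_mul, map_add, map_sub, map_mul, map_natCast, map_one, map_neg,
    Nat.cast_add, map_ofNat, Nat.cast_one]
  ring

/-- Produces t·x^a up to a correction of lower t-degree whenever the exponent of the chosen variable
is not p - 1. It replaces t² where the scalar of `bracket_vt_sq_bi` vanishes. -/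
theorem bracket_vx_vt_conj (i : Fin m ⊕ Fin m) (a : Var m →₀ ℕ) :
    contactBracket F p m (vx F p i * vt F p m) (vx F p i.swap * truncMonomial F p a) =
      (sgn F i * (a (some i.swap) + 1)) • (vt F p m * truncMonomial F p a) +
      (xdeg a + a none - 1 : F) • (vx F p i * (vx F p i.swap * truncMonomial F p a)) := by
  have h : ham F p i (vx F p i.swap * truncMonomial F p a) =
      (sgn F i * (a (some i.swap) + 1)) • truncMonomial F p a := by
    rw [truncX_mul_truncMonomial, ham_monomial, add_tsub_cancel_right]
    simp
  rw [bracket_vx_vt_bi _ (vx_mul_mem_bi _ (monomial_mem_bi a)), h, mul_smul_comm]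
  congr 2
  push_cast
  ring

variable [Fact p.Prime]

omit [Fact p.Prime] in
theorem exists_lt_of_xdeg_lt {a : Var m →₀ ℕ} (h : xdeg a < 2 * m * (p - 1)) :
    ∃ i, a (some i) < p - 1 := by
  by_contra! h'
  have : ∑ _i : Fin m ⊕ Fin m, (p - 1) ≤ xdeg a := Finset.sum_le_sum fun i _ => h' i
  simp only [Finset.sum_const, Finset.card_univ, Fintype.card_sum, Fintype.card_fin,
    smul_eq_mul] at this
  rw [← two_mul] at this
  omega

variable (F) in
theorem cast_top_xdeg : ((2 * m * (p - 1) : ℕ) : F) = - (2 * m) := by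
  rw [Nat.cast_mul, cast_pred (Fact.out : p.Prime).pos]
  push_cast
  ring

/-- A subspace closed under brackets that contains `t`, the quadratic and cubic polynomials in
the `x_i`, and the `x_i t`, contains all elements of positive degree. -/
theorem bi_le_of_generators (hp : 5 ≤ p) (hm : 1 ≤ m) {R : Submodule F (Trunc F p (Var m))}
    (hR : ∀ f ∈ R, ∀ g ∈ R, contactBracket F p m f g ∈ R) (ht : vt F p m ∈ R)
    (hq : ∀ i j, vx F p i * vx F p j ∈ R) (hxt : ∀ i, vx F p i * vt F p m ∈ R)
    (hc : ∀ i j k, vx F p i * vx F p j * vx F p k ∈ R) (N : ℕ) :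
    ∀ r b, r + 2 * b = N → 2 ≤ N → (r = 2 * m * (p - 1) → b = p - 1 → (2 * m + 4 : F) ≠ 0) →
      bi F p m r b ≤ R := by
  have h2 := two_ne_zero_of_le (F := F) hp
  have h3 := three_ne_zero_of_le (F := F) hp
  have h4 := four_ne_zero_of_le (F := F) hp
  have hpp : p.Prime := Fact.out
  have hbi00 : bi F p m 0 0 ≤ Submodule.span F {1} := by
    rw [bi, Submodule.span_le]
    rintro _ ⟨a, h, h', rfl⟩
    have : a = 0 := by
      ext i
      rcases i with _ | i
      · exact h'
      · rw [xdeg, Finset.sum_eq_zero_iff] at h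
        exact h i (Finset.mem_univ _)
    rw [this, truncMonomial_zero]
    exact Submodule.subset_span rfl
  have hbi10 (i : Fin m ⊕ Fin m) (g) (hg : g ∈ bi F p m 0 0) :
      ∃ c : F, vx F p i * g = c • vx F p i := by
    obtain ⟨c, rfl⟩ := Submodule.mem_span_singleton.mp (hbi00 hg)
    exact ⟨c, by rw [mul_smul_comm, mul_one]⟩
  -- For conjugate variables [x_i t, x_i' t] is ±t²: the other term carries the scalar 1 + 1 - 2 =
  -- 0.
  have hsq : vt F p m ^ 2 ∈ R := by
    set i : Fin m ⊕ Fin m := Sum.inl ⟨0, hm⟩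
    have h := hR _ (hxt i) _ (hxt i.swap)
    have hb : vx F p i.swap * vt F p m ∈ bi F p m 1 1 := vx_mul_mem_bi _ vt_mem_bi
    rw [bracket_vx_vt_bi _ hb] at h
    simp only [Derivation.leibniz, ham_vt, ham_vx, smul_eq_mul] at h
    have h0 : (((1 : ℕ) : F) + ((1 : ℕ) : F) - 2) = 0 := by push_cast; norm_num
    rw [h0, zero_smul, add_zero] at h
    simpa [omega, sgn, i, pow_two] using h
  have G1 {r b : ℕ} (h : bi F p m r b ≤ R) (h0 : (r + b - 2 : F) ≠ 0) : bi F p m r (b + 1) ≤ R := by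
    refine bi_le_of_vt_mul fun g hg => ?_
    have := hR _ hsq _ (h hg)
    rw [bracket_vt_sq_bi hg] at this
    exact (Submodule.smul_mem_iff _ (mul_ne_zero h2 h0)).mp this
  induction N using Nat.strong_induction_on with
  | _ N ih =>
  have step1 (r : ℕ) (hr : r = N) (h2N : 2 ≤ N) : bi F p m r 0 ≤ R := by
    subst hr
    obtain ⟨s, rfl⟩ := Nat.exists_eq_add_of_le h2N
    rcases Nat.lt_or_ge s 2 with hs | hs
    · interval_cases s
      · refine bi_le_of_vx_mul (r := 1) fun i g hg => ?_
        refine bi_le_of_vx_mul (r := 0) (R := R.comap (LinearMap.mulLeft F (vx F p i)))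
          (fun j g hg => ?_) hg
        obtain ⟨c, hc⟩ := hbi10 j g hg
        rw [Submodule.mem_comap, hc, map_smul]
        exact Submodule.smul_mem _ _ (hq i j)
      · refine bi_le_of_vx_mul (r := 2) fun i g hg => ?_
        refine bi_le_of_vx_mul (r := 1) (R := R.comap (LinearMap.mulLeft F (vx F p i)))
          (fun j g hg => ?_) hg
        refine bi_le_of_vx_mul (r := 0) (R := (R.comap (LinearMap.mulLeft F (vx F p i))).comap
          (LinearMap.mulLeft F (vx F p j))) (fun k g hg => ?_) hg
        obtain ⟨c, hc'⟩ := hbi10 k g hg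
        rw [Submodule.mem_comap, hc', map_smul, Submodule.mem_comap, map_smul]
        refine Submodule.smul_mem _ _ ?_
        have := hc i j k
        rwa [mul_assoc] at this
    · obtain ⟨q, rfl⟩ := Nat.exists_eq_add_of_le hs
      rcases Nat.lt_or_ge (2 * m * (p - 1)) (2 + (2 + q)) with htop | htop
      · rw [bi_eq_bot_of_lt hpp.pos htop]
        exact bot_le
      have key (i j k : Fin m ⊕ Fin m) (w) (hw : w ∈ bi F p m (q + 1) 0) :
          vx F p i * (vx F p j * (vx F p k * w)) ∈ R := by
        have htw : vt F p m * w ∈ R := by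
          refine ih (q + 1 + 2 * 1) (by omega) (q + 1) 1 rfl (by omega) ?_ (vt_mul_mem_bi hw)
          intro h _
          omega
        have A := hR _ (hc i j k) _ htw
        rw [bracket_cubic_vt_mul i j k hw] at A
        rw [show vx F p i * (vx F p j * (vx F p k * w)) = vx F p i * vx F p j * vx F p k * w by ring]
        have hq2 : bi F p m (q + 2) 0 ≤ R := ih (q + 2) (by omega) (q + 2) 0 (by omega) (by omega)
          (fun _ h => by omega)
        have hmem (i j k : Fin m ⊕ Fin m) : vx F p i * vx F p j * ham F p k w ∈ bi F p m (q + 2) 0 := by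
          have := vx_mul_mem_bi i (vx_mul_mem_bi j (ham_mem_bi k hw))
          rw [mul_assoc]
          exact this
        -- If q = 0 in F, the difference of the two cubic identities has scalar 3(q+1) + 1 = 4.
        -- Otherwise t² reaches the terms divisible by t, with scalar (q+2) - 2 = q, and
        -- `bracket_cubic_vt_mul` leaves x_i x_j x_k w with scalar 1.
        by_cases hr4 : ((q : F) = 0)
        · have B := add_mem (add_mem
            (hR _ (hxt i) _ (ih (q + 3) (by omega) (q + 3) 0 (by omega) (by omega)
              (fun _ h => by omega) (vx_mul_mem_bi j (vx_mul_mem_bi k hw))))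
            (hR _ (hxt j) _ (ih (q + 3) (by omega) (q + 3) 0 (by omega) (by omega)
              (fun _ h => by omega) (vx_mul_mem_bi i (vx_mul_mem_bi k hw)))))
            (hR _ (hxt k) _ (ih (q + 3) (by omega) (q + 3) 0 (by omega) (by omega)
              (fun _ h => by omega) (vx_mul_mem_bi i (vx_mul_mem_bi j hw))))
          rw [sum_bracket_vx_vt i j k hw] at B
          have C := sub_mem B A
          rw [add_sub_sub_cancel, ← add_smul] at C
          refine (Submodule.smul_mem_iff _ ?_).mp C
          push_cast
          rw [hr4]
          norm_num
          exact h4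
        · have hD : vt F p m * (vx F p i * vx F p j * ham F p k w +
              vx F p i * vx F p k * ham F p j w + vx F p j * vx F p k * ham F p i w) ∈ R := by
            refine G1 hq2 ?_ (vt_mul_mem_bi (add_mem (add_mem (hmem i j k) (hmem i k j))
              (hmem j k i)))
            push_cast
            ring_nf
            exact hr4
          have C := sub_mem hD A
          rw [sub_sub_cancel] at C
          refine (Submodule.smul_mem_iff _ ?_).mp C
          simp
      refine bi_le_of_vx_mul (r := q + 3) (fun i g hg => ?_) |>.trans' (by
        rw [show 2 + (2 + q) = q + 3 + 1 by ring])
      refine bi_le_of_vx_mul (r := q + 2) (R := R.comap (LinearMap.mulLeft F (vx F p i)))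
          (fun j g hg => ?_) hg
      refine bi_le_of_vx_mul (r := q + 1) (R := (R.comap (LinearMap.mulLeft F (vx F p i))).comap
          (LinearMap.mulLeft F (vx F p j))) (fun k g hg => ?_) hg
      exact key i j k g hg
  have step2 (r b : ℕ) (hr : r + 2 * (b + 1) = N) (h2N : 2 ≤ N) (hb : b + 1 < p)
      (h0 : (r + b - 2 : F) ≠ 0) : bi F p m r (b + 1) ≤ R := by
    rcases Nat.lt_or_ge (r + 2 * b) 2 with h | h
    · have hb0 : b = 0 := by omega
      subst hb0
      have hr1 : r = 0 ∨ r = 1 := by omega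
      rcases hr1 with rfl | rfl
      · refine bi_le_of_vt_mul fun g hg => ?_
        obtain ⟨c, rfl⟩ := Submodule.mem_span_singleton.mp (hbi00 hg)
        rw [mul_smul_comm, mul_one]
        exact Submodule.smul_mem _ _ ht
      · refine bi_le_of_vt_mul fun g hg => ?_
        refine bi_le_of_vx_mul (r := 0) (R := R.comap (LinearMap.mulLeft F (vt F p m)))
          (fun j g hg => ?_) hg
        obtain ⟨c, hc⟩ := hbi10 j g hg
        rw [Submodule.mem_comap, hc, map_smul]
        refine Submodule.smul_mem _ _ ?_
        have := hxt j
        rwa [mul_comm] at this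
    · exact G1 (ih (r + 2 * b) (by omega) r b rfl h (fun _ h => by omega)) h0
  rintro r b hN h2N htop
  rcases Nat.lt_or_ge b p with hbp | hbp
  swap
  · rw [bi_eq_bot_of_le hbp]; exact bot_le
  rcases b with _ | b
  · exact step1 r (by omega) h2N
  by_cases h0 : (r + b - 2 : F) = 0
  swap
  · exact step2 r b hN h2N hbp h0
  -- The scalar r + b - 2 vanishes here, so t² is useless. If some x-exponent is below p - 1, a
  -- conjugate pair does the work; otherwise the x-part is the top monomial and the cubics are used.
  rcases Nat.lt_or_ge r (2 * m * (p - 1)) with hr | hr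
  · rw [bi, Submodule.span_le]
    rintro _ ⟨a, ha, hab, rfl⟩
    obtain ⟨i, hi⟩ := exists_lt_of_xdeg_lt (p := p) (ha.trans_lt hr)
    set a' := a - Finsupp.single none 1 with ha'
    have e1 : xdeg a' = r := by rw [← ha]; simp [xdeg, ha']
    have e2 : a' none = b := by simp [ha', hab]
    have e3 : a' (some i) = a (some i) := by simp [ha']
    have e4 : truncMonomial F p a = vt F p m * truncMonomial F p a' := by
      rw [truncX_mul_truncMonomial, ha', tsub_add_cancel_of_le]
      rw [Finsupp.single_le_iff]
      omega
    rw [SetLike.mem_coe, e4]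
    have hmon := monomial_mem_bi' (F := F) (p := p) e1 e2
    have hle : 2 ≤ r + 2 * b + 1 := by
      rcases Nat.lt_or_ge (r + 2 * b) 1 with h | h
      · exfalso
        have h5 : r = 0 := by omega
        have h6 : b = 0 := by omega
        rw [h5, h6] at h0
        apply h2
        push_cast at h0
        linear_combination -h0
      · omega
    have hA := hR _ (hxt i.swap) _ (ih (r + 1 + 2 * b) (by omega) (r + 1) b rfl (by omega)
      (fun _ h => by omega) (vx_mul_mem_bi i hmon))
    have hconj := bracket_vx_vt_conj (F := F) (p := p) i.swap a'
    rw [Sum.swap_swap] at hconj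
    rw [hconj] at hA
    -- The correction has the same weight N, so the induction hypothesis does not cover it. But two
    -- more x's and one t fewer turn the vanishing scalar into 1, so `step2` applies (or `step1`
    -- when no t is left).
    have hB : vx F p i.swap * (vx F p i * truncMonomial F p a') ∈ R := by
      have hmem := vx_mul_mem_bi i.swap (vx_mul_mem_bi i hmon)
      rcases b with _ | b
      · exact step1 (r + 2) (by omega) h2N hmem
      · refine step2 (r + 2) b (by omega) h2N (by omega) ?_ hmem
        have : ((r + 2 : ℕ) : F) + b - 2 = 1 + (r + (b + 1 : ℕ) - 2) := by push_cast; ring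
        rw [this, h0, add_zero]
        exact one_ne_zero
    have hC := sub_mem hA (Submodule.smul_mem _ (xdeg a' + a' none - 1 : F) hB)
    rw [add_sub_cancel_right] at hC
    refine (Submodule.smul_mem_iff _ (mul_ne_zero (sgn_ne_zero _) ?_)).mp hC
    rw [e3]
    have := natCast_ne_zero_of_lt (F := F) (p := p) (k := a (some i) + 1) (by omega) (by omega)
    exact_mod_cast this
  · rcases Nat.lt_or_ge (2 * m * (p - 1)) r with hr' | hr'
    · rw [bi_eq_bot_of_lt hpp.pos hr']
      exact bot_le
    have hr : r = 2 * m * (p - 1) := le_antisymm hr' hr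
    -- With r = -2m and b + 1 = -1 in F the vanishing scalar would read -2m - 4 = 0, which is
    -- exactly the excluded top monomial.
    have hb1 : b + 1 < p - 1 := by
      by_contra hb
      have hb2 : b + 1 = p - 1 := by omega
      refine htop hr hb2 ?_
      have hb3 : (b : F) + 1 = -1 := by
        rw [← cast_pred (F := F) hpp.pos, ← hb2]; push_cast; ring
      rw [hr, cast_top_xdeg] at h0
      linear_combination -h0 + hb3
    have hr8 : 8 ≤ r := by
      rw [hr]
      calc 8 = 2 * 1 * 4 := rfl
        _ ≤ 2 * m * (p - 1) := Nat.mul_le_mul (by omega) (by omega)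
    obtain ⟨s, rfl⟩ := Nat.exists_eq_add_of_le (show 3 ≤ r by omega)
    have key (i j k : Fin m ⊕ Fin m) (w) (hw : w ∈ bi F p m s (b + 1)) :
          vx F p i * (vx F p j * (vx F p k * w)) ∈ R := by
      have htw : vt F p m * w ∈ R :=
        ih (s + 2 * (b + 1 + 1)) (by omega) s (b + 1 + 1) rfl (by omega) (fun h => by omega)
          (vt_mul_mem_bi hw)
      have A := hR _ (hc i j k) _ htw
      rw [bracket_cubic_vt_mul i j k hw] at A
      rw [show vx F p i * (vx F p j * (vx F p k * w)) = vx F p i * vx F p j * vx F p k * w by ring]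
      have hl : bi F p m (s + 1 + 1) (b + 1) ≤ R := ih (s + 2 + 2 * (b + 1)) (by omega) (s + 2) (b + 1)
        (by omega) (by omega) (fun _ h => by omega)
      have B := add_mem (add_mem
            (hR _ (hxt i) _ (hl (vx_mul_mem_bi j (vx_mul_mem_bi k hw))))
            (hR _ (hxt j) _ (hl (vx_mul_mem_bi i (vx_mul_mem_bi k hw)))))
            (hR _ (hxt k) _ (hl (vx_mul_mem_bi i (vx_mul_mem_bi j hw))))
      rw [sum_bracket_vx_vt i j k hw] at B
      have C := sub_mem B A
      rw [add_sub_sub_cancel, ← add_smul] at C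
      refine (Submodule.smul_mem_iff _ ?_).mp C
      have h5 := natCast_ne_zero_of_lt (F := F) (p := p) (k := b + 2) (by omega) (by omega)
      -- Since r = s + 3, this scalar is 3(r + b - 2) + (b + 2), whose first part vanishes; b + 2 is
      -- nonzero because b + 2 < p.
      have : 3 * ((s : F) + ((b + 1 : ℕ) : F)) + (((b + 1 : ℕ) : F) + 1) = (b + 2 : ℕ) := by
        push_cast at h0 ⊢
        linear_combination 3 * h0
      rw [this]
      exact h5
    refine bi_le_of_vx_mul (r := s + 2) (fun i g hg => ?_) |>.trans' (by
        rw [show 3 + s = s + 2 + 1 by ring])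
    refine bi_le_of_vx_mul (r := s + 1) (R := R.comap (LinearMap.mulLeft F (vx F p i)))
          (fun j g hg => ?_) hg
    refine bi_le_of_vx_mul (r := s) (R := (R.comap (LinearMap.mulLeft F (vx F p i))).comap
          (LinearMap.mulLeft F (vx F p j))) (fun k g hg => ?_) hg
    exact key i j k g hg

end Generation
end Contact

namespace Contact

/-! ### Monomial description of the contact algebra, and the character λ -/

section Core

variable {F : Type*} [Field F] {p : ℕ} {m : ℕ}

/-- The weighted degree of a monomial, with `t` of weight `2`. -/
def wt (a : Var m →₀ ℕ) : ℕ := xdeg a + 2 * a none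

theorem wt_add (a b : Var m →₀ ℕ) : wt (a + b) = wt a + wt b := by
  simp [wt, xdeg_add]; ring

variable (F p m) in
/-- The condition on the bidegree of a monomial under which it belongs to the contact algebra:
only the monomial of highest degree may have to be left out. -/
def IsGood (r b : ℕ) : Prop := r = 2 * m * (p - 1) → b = p - 1 → (2 * m + 4 : F) ≠ 0

theorem isGood_of_xdeg_ne {r b : ℕ} (h : r ≠ 2 * m * (p - 1)) : IsGood F p m r b :=
  fun h' => absurd h' h

theorem isGood_of_ne {r b : ℕ} (h : b ≠ p - 1) : IsGood F p m r b := fun _ h' => absurd h' h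

variable (F p m) in
/-- The span of the monomials that belong to the contact algebra. -/
noncomputable def core : Submodule F (Trunc F p (Var m)) :=
  Submodule.span F {f | ∃ a : Var m →₀ ℕ, IsGood F p m (xdeg a) (a none) ∧ f = truncMonomial F p a}

variable (F p m) in
/-- The span of the monomials of nonnegative degree that belong to the contact algebra. -/
noncomputable def corePos : Submodule F (Trunc F p (Var m)) :=
  Submodule.span F {f | ∃ a : Var m →₀ ℕ, IsGood F p m (xdeg a) (a none) ∧ 2 ≤ wt a ∧
    f = truncMonomial F p a}

theorem monomial_mem_core {a : Var m →₀ ℕ} (h : IsGood F p m (xdeg a) (a none)) :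
    truncMonomial F p a ∈ core F p m := Submodule.subset_span ⟨a, h, rfl⟩

theorem monomial_mem_corePos {a : Var m →₀ ℕ} (h : IsGood F p m (xdeg a) (a none)) (h2 : 2 ≤ wt a) :
    truncMonomial F p a ∈ corePos F p m := Submodule.subset_span ⟨a, h, h2, rfl⟩

theorem corePos_le_core : corePos F p m ≤ core F p m :=
  Submodule.span_mono fun _ ⟨a, h, _, h'⟩ => ⟨a, h, h'⟩

theorem bi_le_corePos {r b : ℕ} (h : IsGood F p m r b) (h2 : 2 ≤ r + 2 * b) :
    bi F p m r b ≤ corePos F p m := by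
  rw [bi, Submodule.span_le]
  rintro _ ⟨a, rfl, rfl, rfl⟩
  exact monomial_mem_corePos h h2

theorem corePos_induction {P : Trunc F p (Var m) → Prop} {f : Trunc F p (Var m)}
    (hf : f ∈ corePos F p m)
    (mono : ∀ a : Var m →₀ ℕ, (∀ i, a i < p) → IsGood F p m (xdeg a) (a none) → 2 ≤ wt a →
      P (truncMonomial F p a))
    (zero : P 0) (add : ∀ f g, P f → P g → P (f + g)) (smul : ∀ (c : F) f, P f → P (c • f)) :
    P f := by
  refine Submodule.span_induction ?_ zero (fun x y _ _ => add x y) (fun c x _ => smul c x) hf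
  rintro _ ⟨a, h, h2, rfl⟩
  by_cases ha : ∀ i, a i < p
  · exact mono a ha h h2
  · push Not at ha
    obtain ⟨i, hi⟩ := ha
    rw [truncMonomial_eq_zero hi]
    exact zero

theorem core_induction {P : Trunc F p (Var m) → Prop} {f : Trunc F p (Var m)}
    (hf : f ∈ core F p m)
    (mono : ∀ a : Var m →₀ ℕ, (∀ i, a i < p) → IsGood F p m (xdeg a) (a none) →
      P (truncMonomial F p a))
    (zero : P 0) (add : ∀ f g, P f → P g → P (f + g)) (smul : ∀ (c : F) f, P f → P (c • f)) :
    P f := by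
  refine Submodule.span_induction ?_ zero (fun x y _ _ => add x y) (fun c x _ => smul c x) hf
  rintro _ ⟨a, h, rfl⟩
  by_cases ha : ∀ i, a i < p
  · exact mono a ha h
  · push Not at ha
    obtain ⟨i, hi⟩ := ha
    rw [truncMonomial_eq_zero hi]
    exact zero

theorem core_ext {W : Type*} [AddCommGroup W] [Module F W]
    {u w : Trunc F p (Var m) →ₗ[F] W}
    (h : ∀ a : Var m →₀ ℕ, (∀ i, a i < p) → IsGood F p m (xdeg a) (a none) →
      u (truncMonomial F p a) = w (truncMonomial F p a)) {f : Trunc F p (Var m)}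
    (hf : f ∈ core F p m) : u f = w f :=
  core_induction (P := fun f => u f = w f) hf h (by simp)
    (fun f g hf hg => by rw [map_add, map_add, hf, hg])
    (fun c f hf => by rw [map_smul, map_smul, hf])

theorem corePos_ext {W : Type*} [AddCommGroup W] [Module F W]
    {u w : Trunc F p (Var m) →ₗ[F] W}
    (h : ∀ a : Var m →₀ ℕ, (∀ i, a i < p) → IsGood F p m (xdeg a) (a none) → 2 ≤ wt a →
      u (truncMonomial F p a) = w (truncMonomial F p a)) {f : Trunc F p (Var m)}
    (hf : f ∈ corePos F p m) : u f = w f :=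
  corePos_induction (P := fun f => u f = w f) hf h (by simp)
    (fun f g hf hg => by rw [map_add, map_add, hf, hg])
    (fun c f hf => by rw [map_smul, map_smul, hf])

theorem corePos_ext₂ {W : Type*} [AddCommGroup W] [Module F W]
    {u w : Trunc F p (Var m) →ₗ[F] Trunc F p (Var m) →ₗ[F] W}
    (h : ∀ a b : Var m →₀ ℕ, (∀ i, a i < p) → IsGood F p m (xdeg a) (a none) → 2 ≤ wt a →
      (∀ i, b i < p) → IsGood F p m (xdeg b) (b none) → 2 ≤ wt b →
      u (truncMonomial F p a) (truncMonomial F p b) = w (truncMonomial F p a) (truncMonomial F p b))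
    {f g : Trunc F p (Var m)} (hf : f ∈ corePos F p m) (hg : g ∈ corePos F p m) :
    u f g = w f g := by
  exact corePos_ext (u := u.flip g) (w := w.flip g) (fun a h1 h2 h3 =>
    corePos_ext (u := u (truncMonomial F p a)) (w := w (truncMonomial F p a))
      (fun b h4 h5 h6 => h a b h1 h2 h3 h4 h5 h6) hg) hf

theorem one_mem_core (hp : 2 ≤ p) : 1 ∈ core F p m := by
  rw [← truncMonomial_zero]
  exact monomial_mem_core (isGood_of_ne (by simp; omega))

theorem vx_mem_core (hp : 2 ≤ p) (i : Fin m ⊕ Fin m) : vx F p i ∈ core F p m :=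
  monomial_mem_core (isGood_of_ne (by simp; omega))

theorem vt_mem_corePos (hm : 1 ≤ m) (hp : 2 ≤ p) : vt F p m ∈ corePos F p m := by
  refine bi_le_corePos (isGood_of_xdeg_ne ?_) (by omega) vt_mem_bi
  have := Nat.mul_pos (show 0 < 2 * m by omega) (show 0 < p - 1 by omega)
  omega

variable [CharP F p]

variable (F p m) in
/-- The contact bracket as a bilinear map. -/
noncomputable def contactHom :
    Trunc F p (Var m) →ₗ[F] Trunc F p (Var m) →ₗ[F] Trunc F p (Var m) :=
  LinearMap.mk₂ F (contactBracket F p m) (contactBracket_add_left F p m)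
    (fun c f g => by
      rw [contactBracket_skew, contactBracket_smul_right, contactBracket_skew f, smul_neg, neg_neg])
    (contactBracket_add_right F p m) (fun c f g => contactBracket_smul_right F p m c f g)

theorem contactHom_apply (f g : Trunc F p (Var m)) :
    contactHom F p m f g = contactBracket F p m f g := rfl

theorem contactHom_skew (f g : Trunc F p (Var m)) :
    contactHom F p m g f = - contactHom F p m f g := contactBracket_skew f g

theorem contactHom_leibniz (f g h : Trunc F p (Var m)) :
    contactHom F p m f (contactHom F p m g h) =
      contactHom F p m (contactHom F p m f g) h + contactHom F p m g (contactHom F p m f h) :=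
  contactBracket_leibniz F p m f g h

theorem contactHom_monomial (a b : Var m →₀ ℕ) :
    contactHom F p m (truncMonomial F p a) (truncMonomial F p b) =
      ∑ i : Fin m, ((a (some (Sum.inl i)) * b (some (Sum.inr i)) : F)
          - a (some (Sum.inr i)) * b (some (Sum.inl i))) •
        truncMonomial F p
          (a + b - Finsupp.single (some (Sum.inl i)) 1 - Finsupp.single (some (Sum.inr i)) 1)
      + ((a none : F) * (wt b - 2) - b none * (wt a - 2)) •
        truncMonomial F p (a + b - Finsupp.single none 1) := by
  have h (a : Var m →₀ ℕ) : ((deg a : ℤ) : F) = wt a - 2 := by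
    rw [deg, wt, xdeg, Fintype.sum_option]
    push_cast
    ring
  rw [← h, ← h]
  exact contact_lie_monomial F p m a b

theorem contactHom_vt_monomial (a : Var m →₀ ℕ) :
    contactHom F p m (vt F p m) (truncMonomial F p a) = (wt a - 2 : F) • truncMonomial F p a := by
  rw [contactHom_apply, bracket_vt_bi (monomial_mem_bi a), wt]
  push_cast
  rfl

omit [CharP F p] in
theorem le_wt_sub_some (c : Var m →₀ ℕ) (i : Fin m ⊕ Fin m) :
    wt c ≤ wt (c - Finsupp.single (some i) 1) + 1 := by
  have h : (c - Finsupp.single (some i) 1 : Var m →₀ ℕ) none = c none := by simp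
  have h2 : xdeg c ≤ xdeg (c - Finsupp.single (some i) 1) + 1 := by
    by_cases h : c (some i) = 0
    · have : c - Finsupp.single (some i) 1 = c := by
        ext j
        by_cases hj : j = some i
        · subst hj; simp [h]
        · simp [Ne.symm hj]
      rw [this]; omega
    · rw [xdeg_sub_single h]
  rw [wt, wt, h]
  omega

omit [CharP F p] in
theorem le_wt_sub_none (c : Var m →₀ ℕ) :
    wt c ≤ wt (c - Finsupp.single none 1) + 2 := by
  have h : (c - Finsupp.single none 1 : Var m →₀ ℕ) none = c none - 1 := by simp
  have h2 : xdeg (c - Finsupp.single none 1) = xdeg c := by simp [xdeg]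
  rw [wt, wt, h, h2]
  omega

variable [Fact p.Prime]

omit [CharP F p] [Fact p.Prime] in
theorem eq_pred_of_xdeg_eq {a : Var m →₀ ℕ} (ha : ∀ i, a i < p) (h : xdeg a = 2 * m * (p - 1))
    (i : Fin m ⊕ Fin m) : a (some i) = p - 1 := by
  have h1 (i : Fin m ⊕ Fin m) : a (some i) ≤ p - 1 := by have := ha (some i); omega
  by_contra h2
  have : xdeg a < ∑ _i : Fin m ⊕ Fin m, (p - 1) :=
    Finset.sum_lt_sum (fun i _ => h1 i) ⟨i, Finset.mem_univ _, lt_of_le_of_ne (h1 i) h2⟩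
  simp only [Finset.sum_const, Finset.card_univ, Fintype.card_sum, Fintype.card_fin,
    smul_eq_mul] at this
  rw [← two_mul] at this
  omega

/-- The top monomial, all of whose exponents are p - 1, has coefficient zero in every bracket when
2m + 4 = 0 in F, that is, when p divides n + 3. -/
theorem contactHom_mem_core (hp : 5 ≤ p) (f g : Trunc F p (Var m)) :
    contactHom F p m f g ∈ core F p m := by
  induction f using trunc_induction with
  | add f f' hf hf' => rw [map_add]; exact add_mem hf hf'
  | smul c f hf => rw [map_smul]; exact Submodule.smul_mem _ _ hf
  | mono a =>
  induction g using trunc_induction with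
  | add f f' hf hf' => rw [map_add]; exact add_mem hf hf'
  | smul c f hf => rw [map_smul]; exact Submodule.smul_mem _ _ hf
  | mono b =>
  have hp0 : (p : F) = 0 := CharP.cast_eq_zero F p
  have hcast {x y : ℕ} (h : x + y = p) : (y : F) = - x := by
    have : (x + y : F) = p := by exact_mod_cast congrArg (Nat.cast (R := F)) h
    rw [hp0] at this
    linear_combination this
  have key (c : F) (e : Var m →₀ ℕ)
      (h : (∀ i, e (some i) = p - 1) → e none = p - 1 → (2 * m + 4 : F) = 0 → c = 0) :
      c • truncMonomial F p e ∈ core F p m := by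
    by_cases he : ∀ i, e i < p
    swap
    · push Not at he
      obtain ⟨i, hi⟩ := he
      rw [truncMonomial_eq_zero hi, smul_zero]
      exact zero_mem _
    by_cases hg : IsGood F p m (xdeg e) (e none)
    · exact Submodule.smul_mem _ _ (monomial_mem_core hg)
    · rw [IsGood] at hg
      push Not at hg
      rw [h (eq_pred_of_xdeg_eq he hg.1) hg.2.1 hg.2.2, zero_smul]
      exact zero_mem _
  rw [contactHom_monomial]
  refine add_mem (sum_mem fun i _ => key _ _ fun h1 _ _ => ?_) (key _ _ fun h1 h2 h3 => ?_)
  -- To reach exponent p - 1 after differentiating, both exponents of the i-th pair must add up to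
  -- p. So b = -a in F there, and the Poisson coefficient cancels.
  · have hl := h1 (Sum.inl i)
    have hr := h1 (Sum.inr i)
    simp only [Finsupp.tsub_apply, Finsupp.add_apply, Finsupp.single_apply, Option.some.injEq,
      reduceCtorEq, if_true, if_false] at hl hr
    rw [hcast (x := a (some (Sum.inl i))) (y := b (some (Sum.inl i))) (by omega),
      hcast (x := a (some (Sum.inr i))) (y := b (some (Sum.inr i))) (by omega)]
    ring
  -- Now the t-exponents add up to p, and the coefficient becomes a_n times the sum of the degrees
  -- of the two factors; that sum is -(2m + 4).
  · simp only [Finsupp.tsub_apply, Finsupp.add_apply, Finsupp.single_apply, 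
      reduceCtorEq, if_true, if_false, tsub_zero] at h1 h2
    have h4 : xdeg a + xdeg b = 2 * m * (p - 1) := by
      rw [xdeg, xdeg, ← Finset.sum_add_distrib, Finset.sum_congr rfl fun i _ => h1 i]
      simp [two_mul, add_mul]
    have h5 : (xdeg a + xdeg b : F) = - (2 * m) := by
      rw [← cast_top_xdeg F (p := p), ← h4]; push_cast; rfl
    have h6 := hcast (x := a none) (y := b none) (by omega)
    rw [wt, wt]
    push_cast
    rw [h6]
    linear_combination (a none : F) * (h5 - h3)

/-- The contact algebra is perfect. -/
theorem core_le_span_bracket (hp : 5 ≤ p) (hm : 1 ≤ m) :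
    core F p m ≤ Submodule.span F {h | ∃ f ∈ core F p m, ∃ g ∈ core F p m,
      h = contactHom F p m f g} := by
  set S := Submodule.span F {h | ∃ f ∈ core F p m, ∃ g ∈ core F p m, h = contactHom F p m f g}
  have hS {f g} (hf : f ∈ core F p m) (hg : g ∈ core F p m) : contactHom F p m f g ∈ S :=
    Submodule.subset_span ⟨f, hf, g, hg, rfl⟩
  have h2 := two_ne_zero_of_le (F := F) hp
  have hpp : p.Prime := Fact.out
  have hpred := cast_pred (F := F) hpp.pos
  have step1 (a : Var m →₀ ℕ) (ha : IsGood F p m (xdeg a) (a none)) (h0 : (wt a - 2 : F) ≠ 0) :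
      truncMonomial F p a ∈ S := by
    have := hS (corePos_le_core (vt_mem_corePos hm (by omega))) (monomial_mem_core ha)
    rw [contactHom_vt_monomial] at this
    exact (Submodule.smul_mem_iff _ h0).mp this
  have step2 (a : Var m →₀ ℕ) (ha : IsGood F p m (xdeg a) (a none)) (h : a none < p - 1) :
      truncMonomial F p a ∈ S := by
    by_cases h0 : (wt a - 2 : F) = 0
    swap
    · exact step1 a ha h0
    -- If raising the t-exponent led to the excluded monomial, then wt a = 2 and 2m + 4 = 0 together
    -- would give 2 = 0.
    have hg : IsGood F p m (xdeg (a + Finsupp.single none 1))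
        ((a + Finsupp.single none 1 : Var m →₀ ℕ) none) := by
      intro h3 h4 h5
      rw [wt] at h0
      rw [xdeg_add, xdeg_single_none, add_zero] at h3
      have h6 : (a none : F) + 1 = -1 := by
        rw [← hpred, ← h4]; simp
      push_cast at h0
      rw [h3, cast_top_xdeg] at h0
      apply h2
      linear_combination - h5 - h0 + 2 * h6
    have := hS (one_mem_core (by omega)) (monomial_mem_core hg)
    rw [contactHom_apply, bracket_one, truncDeriv_monomial, add_tsub_cancel_right,
      mul_smul_comm, two_mul, ← two_smul F, smul_smul] at this
    refine (Submodule.smul_mem_iff _ (mul_ne_zero ?_ h2)).mp this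
    simp only [Finsupp.add_apply, Finsupp.single_eq_same]
    exact natCast_ne_zero_of_lt (by omega) (by omega)
  intro f hf
  refine core_induction hf (fun a har ha => ?_) (zero_mem _) (fun _ _ => add_mem)
    (fun c _ => Submodule.smul_mem _ c)
  by_cases h : a none < p - 1
  · exact step2 a ha h
  by_cases h0 : (wt a - 2 : F) = 0
  swap
  · exact step1 a ha h0
  have hn : a none = p - 1 := by have := har none; omega
  -- Only the monomials of degree 0 in F with full t-exponent remain. If every x-exponent were full
  -- too, degree 0 would say 2m + 4 = 0, contradicting that the monomial is good.
  have h7 : ∃ i, a (some i) < p - 1 := by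
    by_contra! h8
    have h9 : xdeg a = 2 * m * (p - 1) := by
      have h10 (i) : a (some i) = p - 1 := by have := har (some i); have := h8 i; omega
      rw [xdeg, Finset.sum_congr rfl fun i _ => h10 i]
      simp [two_mul, add_mul]
    refine ha h9 hn ?_
    rw [wt] at h0
    push_cast at h0
    rw [h9, hn, cast_top_xdeg, hpred] at h0
    linear_combination - h0
  obtain ⟨i, hi⟩ := h7
  have hg : IsGood F p m (xdeg (a + Finsupp.single (some i) 1))
        ((a + Finsupp.single (some i) 1 : Var m →₀ ℕ) none) := by
    intro h3 h4 h5
    rw [wt] at h0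
    rw [xdeg_add, xdeg_single_some] at h3
    have h6 : (xdeg a : F) + 1 = - (2 * m) := by
      rw [← cast_top_xdeg F (p := p), ← h3]; push_cast; ring
    push_cast at h0
    rw [hn, hpred] at h0
    apply one_ne_zero (α := F)
    linear_combination - h5 - h0 + h6
  -- Bracketing with the conjugate variable lowers the x_i-exponent back; the additional term has
  -- t-exponent p - 2 and is covered by `step2`.
  have := hS (vx_mem_core (by omega) i.swap) (monomial_mem_core hg)
  rw [contactHom_apply, bracket_vx, ham_monomial, Sum.swap_swap, add_tsub_cancel_right,
    truncDeriv_monomial, mul_smul_comm, truncX_mul_truncMonomial] at this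
  refine (Submodule.smul_mem_iff _ (mul_ne_zero (sgn_ne_zero _) ?_)).mp
    ((Submodule.add_mem_iff_left _ (Submodule.smul_mem _ _ ?_)).mp this)
  · simp only [Finsupp.add_apply, Finsupp.single_eq_same]
    exact natCast_ne_zero_of_lt (by omega) (by omega)
  · refine step2 _ (isGood_of_ne ?_) ?_ <;> simp <;> omega

variable (F p m) in
/-- The identity map from `K'(n)` to the algebra of truncated polynomials. -/
def toTrunc : ContactPrime F p m ≃ₗ[F] Trunc F p (Var m) where
  toFun f := f
  map_add' _ _ := rfl
  map_smul' _ _ := rfl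
  invFun f := f
  left_inv _ := rfl
  right_inv _ := rfl

/-- Brackets land in `core`, and `core` is perfect, so `core` is the derived algebra. From here on
K(n) is handled through its monomials inside A(n). -/
theorem mem_derivedSeries_iff (hp : 5 ≤ p) (hm : 1 ≤ m) (f : ContactPrime F p m) :
    f ∈ LieAlgebra.derivedSeries F (ContactPrime F p m) 1 ↔ toTrunc F p m f ∈ core F p m := by
  constructor
  · intro h
    rw [LieAlgebra.derivedSeries_def, LieAlgebra.derivedSeriesOfIdeal_succ,
      LieAlgebra.derivedSeriesOfIdeal_zero, ← LieSubmodule.mem_toSubmodule,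
      LieSubmodule.lieIdeal_oper_eq_linear_span'] at h
    refine Submodule.span_induction (p := fun x _ => toTrunc F p m x ∈ core F p m) ?_ (zero_mem _)
      (fun x y _ _ hx hy => add_mem hx hy)
      (fun c x _ hx => Submodule.smul_mem (core F p m) c hx) h
    rintro _ ⟨f, -, g, -, rfl⟩
    exact contactHom_mem_core hp f g
  · intro h
    have h1 := core_le_span_bracket hp hm h
    have h2 : Submodule.span F {h | ∃ f ∈ core F p m, ∃ g ∈ core F p m, h = contactHom F p m f g} ≤
        (LieAlgebra.derivedSeries F (ContactPrime F p m) 1).toSubmodule.comap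
          (toTrunc F p m).symm.toLinearMap := by
      rw [Submodule.span_le]
      rintro _ ⟨f, -, g, -, rfl⟩
      exact lie_mem_derived F p m f g
    exact h2 h1

/-- The projection to nonnegative degree. -/
theorem mem_corePos_of_coeff {f : Trunc F p (Var m)} (hf : f ∈ core F p m)
    (h : ∀ a : Var m →₀ ℕ, (∀ i, a i < p) → wt a < 2 → truncCoeff a f = 0) :
    f ∈ corePos F p m := by
  classical
  rw [← sum_truncCoeff f]
  refine sum_mem fun a ha => ?_
  rw [mem_restricted] at ha
  by_cases h0 : wt a < 2
  · rw [h a ha h0, zero_smul]; exact zero_mem _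
  by_cases hg : IsGood F p m (xdeg a) (a none)
  · exact Submodule.smul_mem _ _ (monomial_mem_corePos hg (by omega))
  · have : truncCoeff a f = 0 := by
      refine core_ext (u := truncCoeff a) (w := 0) (fun b _ hb => ?_) hf
      rw [truncCoeff_monomial ha, if_neg]
      · rfl
      · rintro rfl
        exact hg hb
    rw [this, zero_smul]
    exact zero_mem _

/-- Every monomial in a bracket has weight at least the sum of the two weights minus 2, so weights
at least 2 are preserved. -/
theorem contactHom_mem_corePos (hp : 5 ≤ p) {f g : Trunc F p (Var m)} (hf : f ∈ corePos F p m)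
    (hg : g ∈ corePos F p m) : contactHom F p m f g ∈ corePos F p m := by
  classical
  refine mem_corePos_of_coeff (contactHom_mem_core hp f g) fun e he he2 => ?_
  refine corePos_ext₂ (u := (contactHom F p m).compr₂ (truncCoeff e)) (w := 0)
    (fun a b _ _ ha _ _ hb => ?_) hf hg
  rw [LinearMap.compr₂_apply, LinearMap.zero_apply, LinearMap.zero_apply]
  rw [contactHom_monomial, map_add, map_sum, map_smul, truncCoeff_monomial he, Finset.sum_eq_zero,
    if_neg, smul_zero, add_zero]
  · rintro rfl
    have := le_wt_sub_none (a + b)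
    rw [wt_add] at this
    omega
  · intro i _
    rw [map_smul, truncCoeff_monomial he, if_neg, smul_zero]
    rintro rfl
    have h1 := le_wt_sub_some (a + b) (Sum.inl i)
    have h2 := le_wt_sub_some (a + b - Finsupp.single (some (Sum.inl i)) 1) (Sum.inr i)
    rw [wt_add] at h1
    omega

variable (F p m) in
/-- The character `f ↦ -2 ∂f/∂t (0)` of the subalgebra of nonnegative degree. -/
noncomputable def lam : Trunc F p (Var m) →ₗ[F] F :=
  (-2 : F) • truncCoeff (Finsupp.single none 1)

theorem lam_monomial (hp : 5 ≤ p) (a : Var m →₀ ℕ) [Decidable (a = Finsupp.single none 1)] :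
    lam F p m (truncMonomial F p a) = if a = Finsupp.single none 1 then -2 else 0 := by
  classical
  have h : ∀ i, (Finsupp.single (none : Var m) 1) i < p := by
    intro i
    rw [Finsupp.single_apply]
    split <;> omega
  rw [lam, LinearMap.smul_apply, truncCoeff_monomial h]
  simp only [eq_comm (a := a)]
  split <;> simp

theorem lam_vt (hp : 5 ≤ p) : lam F p m (vt F p m) = -2 := by
  classical
  change lam F p m (truncMonomial F p (Finsupp.single none 1)) = -2
  rw [lam_monomial hp, if_pos rfl]

theorem lam_bi (hp : 5 ≤ p) {r b : ℕ} {g : Trunc F p (Var m)} (hg : g ∈ bi F p m r b)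
    (h : r ≠ 0 ∨ b ≠ 1) : lam F p m g = 0 := by
  classical
  have := bi_ext (u := lam F p m) (w := 0) (r := r) (b := b) (fun a h1 h2 _ => by
    rw [lam_monomial hp, if_neg]
    · rfl
    · rintro rfl
      simp at h1 h2
      omega) hg
  exact this

/-- To produce t, of weight 2, both factors must have weight exactly 2. The term from ∂_t then has
zero scalars; in a Poisson term one factor would contain t and hence no x_i, so its coefficient
vanishes. Thus λ is a character of the nonnegative part. -/
theorem lam_contactHom (hp : 5 ≤ p) {f g : Trunc F p (Var m)} (hf : f ∈ corePos F p m)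
    (hg : g ∈ corePos F p m) : lam F p m (contactHom F p m f g) = 0 := by
  classical
  refine corePos_ext₂ (u := (contactHom F p m).compr₂ (lam F p m)) (w := 0)
    (fun a b _ _ ha _ _ hb => ?_) hf hg
  rw [LinearMap.compr₂_apply, LinearMap.zero_apply, LinearMap.zero_apply]
  have hw : wt (Finsupp.single (none : Var m) 1) = 2 := by simp [wt]
  have hx {a : Var m →₀ ℕ} (h : xdeg a = 0) (i) : a (some i) = 0 := by
    rw [xdeg, Finset.sum_eq_zero_iff] at h
    exact h i (Finset.mem_univ _)
  rw [contactHom_monomial, map_add, map_sum, map_smul, lam_monomial hp, Finset.sum_eq_zero]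
  · rw [zero_add]
    split_ifs with h
    · have h1 := le_wt_sub_none (a + b)
      have h2 := DFunLike.congr_fun h none
      rw [h, hw, wt_add] at h1
      simp at h2
      rw [wt] at ha hb h1
      rw [wt] at h1
      have h3 : wt a = 2 := by rw [wt]; omega
      have h4 : wt b = 2 := by rw [wt]; omega
      rw [h3, h4]
      simp
    · exact smul_zero _
  · intro i _
    rw [map_smul, lam_monomial hp]
    split_ifs with h
    · have h1 := le_wt_sub_some (a + b) (Sum.inl i)
      have h2 := le_wt_sub_some (a + b - Finsupp.single (some (Sum.inl i)) 1) (Sum.inr i)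
      have h3 := DFunLike.congr_fun h none
      rw [h, hw] at h2
      rw [wt_add] at h1
      simp at h3
      have h4 : xdeg a = 0 ∨ xdeg b = 0 := by
        rw [wt] at ha hb
        rw [wt, wt] at h1
        omega
      rcases h4 with h4 | h4 <;> simp [hx h4]
    · exact smul_zero _

end Core
end Contact

namespace Contact

/-! ### Scalar cocycles with values in λ: normalization on a torus -/

section ScalarCocycles

variable {F : Type*} [Field F] {p : ℕ} [CharP F p] {m : ℕ} [Fact p.Prime]

/-- A bilinear form on truncated polynomials whose restriction to the subalgebra of nonnegative
degree is a `2`-cocycle with values in the character `lam`. -/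
structure IsCocycle (Φ : Trunc F p (Var m) →ₗ[F] Trunc F p (Var m) →ₗ[F] F) : Prop where
  alt : ∀ f, Φ f f = 0
  coc : ∀ f ∈ corePos F p m, ∀ g ∈ corePos F p m, ∀ h ∈ corePos F p m,
    Φ (contactHom F p m f g) h - Φ (contactHom F p m f h) g + Φ (contactHom F p m g h) f =
      lam F p m f * Φ g h - lam F p m g * Φ f h + lam F p m h * Φ f g

theorem IsCocycle.skew {Φ : Trunc F p (Var m) →ₗ[F] Trunc F p (Var m) →ₗ[F] F} (h : IsCocycle Φ)
    (f g) : Φ g f = - Φ f g := by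
  have := h.alt (f + g)
  simp only [map_add, LinearMap.add_apply, h.alt, zero_add, add_zero] at this
  exact eq_neg_of_add_eq_zero_left this

/-- The coboundary of a linear form. -/
noncomputable def cob (η : Trunc F p (Var m) →ₗ[F] F) :
    Trunc F p (Var m) →ₗ[F] Trunc F p (Var m) →ₗ[F] F :=
  LinearMap.mk₂ F
    (fun f g => lam F p m f * η g - lam F p m g * η f - η (contactHom F p m f g))
    (fun f f' g => by simp only [map_add, LinearMap.add_apply]; ring)
    (fun c f g => by simp only [map_smul, LinearMap.smul_apply, smul_eq_mul]; ring)
    (fun f g g' => by simp only [map_add]; ring)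
    (fun c f g => by simp only [map_smul, smul_eq_mul]; ring)

theorem cob_apply (η : Trunc F p (Var m) →ₗ[F] F) (f g) :
    cob η f g = lam F p m f * η g - lam F p m g * η f - η (contactHom F p m f g) := rfl

omit [Fact p.Prime] in
theorem contactHom_self (f : Trunc F p (Var m)) : contactHom F p m f f = 0 :=
  contactBracket_self F p m f

/-- A coboundary is a cocycle because λ vanishes on brackets and the Jacobi identity removes the
terms in which η meets a double bracket. -/
theorem IsCocycle.sub_cob (hp : 5 ≤ p) {Φ : Trunc F p (Var m) →ₗ[F] Trunc F p (Var m) →ₗ[F] F}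
    (h : IsCocycle Φ) (η : Trunc F p (Var m) →ₗ[F] F) : IsCocycle (Φ - cob η) where
  alt f := by
    rw [LinearMap.sub_apply, LinearMap.sub_apply, h.alt, cob_apply, contactHom_self, map_zero]
    ring
  coc f hf g hg k hk := by
    have h1 := h.coc f hf g hg k hk
    simp only [LinearMap.sub_apply, cob_apply]
    rw [lam_contactHom hp hf hg, lam_contactHom hp hf hk, lam_contactHom hp hg hk]
    have h2 : η (contactHom F p m (contactHom F p m f g) k) -
        η (contactHom F p m (contactHom F p m f k) g) +
        η (contactHom F p m (contactHom F p m g k) f) = 0 := by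
      rw [← map_sub, ← map_add, contactHom_skew f (contactHom F p m g k), contactHom_leibniz,
        contactHom_skew g (contactHom F p m f k)]
      convert map_zero η
      abel
    linear_combination h1 + h2

omit [CharP F p] [Fact p.Prime] in
theorem isGood_of_xdeg_lt (hp : 5 ≤ p) (hm : 1 ≤ m) {r b : ℕ} (h : r < 8) : IsGood F p m r b := by
  refine isGood_of_xdeg_ne ?_
  have := Nat.mul_le_mul (show 2 ≤ 2 * m by omega) (show 4 ≤ p - 1 by omega)
  omega

omit [CharP F p] [Fact p.Prime] in
theorem bi_le_corePos_of_lt (hp : 5 ≤ p) (hm : 1 ≤ m) {r b : ℕ} (h : r < 8) (h2 : 2 ≤ r + 2 * b) :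
    bi F p m r b ≤ corePos F p m :=
  bi_le_corePos (isGood_of_xdeg_lt hp hm h) h2

omit [CharP F p] [Fact p.Prime] in
theorem vx_mul_vx_mem_bi (i j : Fin m ⊕ Fin m) : vx F p i * vx F p j ∈ bi F p m 2 0 :=
  vx_mul_mem_bi i (vx_mem_bi j)

omit [CharP F p] [Fact p.Prime] in
theorem vx_mul_vt_mem_bi (i : Fin m ⊕ Fin m) : vx F p i * vt F p m ∈ bi F p m 1 1 :=
  vx_mul_mem_bi i vt_mem_bi

omit [CharP F p] [Fact p.Prime] in
theorem vx_mul_vx_mul_vx_mem_bi (i j k : Fin m ⊕ Fin m) :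
    vx F p i * vx F p j * vx F p k ∈ bi F p m 3 0 := by
  rw [mul_assoc]
  exact vx_mul_mem_bi i (vx_mul_mem_bi j (vx_mem_bi k))

omit [CharP F p] [Fact p.Prime] in
theorem vt_mem (hp : 5 ≤ p) (hm : 1 ≤ m) : vt F p m ∈ corePos F p m :=
  vt_mem_corePos hm (by omega)

omit [CharP F p] [Fact p.Prime] in
theorem quad_mem (hp : 5 ≤ p) (hm : 1 ≤ m) (i j : Fin m ⊕ Fin m) :
    vx F p i * vx F p j ∈ corePos F p m :=
  bi_le_corePos_of_lt hp hm (by omega) (by omega) (vx_mul_vx_mem_bi i j)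

omit [CharP F p] [Fact p.Prime] in
theorem vx_vt_mem (hp : 5 ≤ p) (hm : 1 ≤ m) (i : Fin m ⊕ Fin m) :
    vx F p i * vt F p m ∈ corePos F p m :=
  bi_le_corePos_of_lt hp hm (by omega) (by omega) (vx_mul_vt_mem_bi i)

omit [CharP F p] [Fact p.Prime] in
theorem cubic_mem (hp : 5 ≤ p) (hm : 1 ≤ m) (i j k : Fin m ⊕ Fin m) :
    vx F p i * vx F p j * vx F p k ∈ corePos F p m :=
  bi_le_corePos_of_lt hp hm (by omega) (by omega) (vx_mul_vx_mul_vx_mem_bi i j k)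

/-- The subalgebra of nonnegative degree is generated by elements of degree `0` and `1`. -/
theorem corePos_le_of_generators (hp : 5 ≤ p) (hm : 1 ≤ m) {R : Submodule F (Trunc F p (Var m))}
    (hR : ∀ f ∈ R, ∀ g ∈ R, contactHom F p m f g ∈ R) (ht : vt F p m ∈ R)
    (hq : ∀ i j, vx F p i * vx F p j ∈ R) (hxt : ∀ i, vx F p i * vt F p m ∈ R)
    (hc : ∀ i j k, vx F p i * vx F p j * vx F p k ∈ R) : corePos F p m ≤ R := by
  rw [corePos, Submodule.span_le]
  rintro _ ⟨a, h, h2, rfl⟩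
  exact bi_le_of_generators hp hm hR ht hq hxt hc _ (xdeg a) (a none) rfl h2 h (monomial_mem_bi a)

/-- A `1`-cocycle of the subalgebra of nonnegative degree with values in `lam` that vanishes at `t`
is zero. -/
theorem oneCocycle_eq_zero (hp : 5 ≤ p) (hm : 1 ≤ m) {τ : Trunc F p (Var m) →ₗ[F] F}
    (hτ : ∀ f ∈ corePos F p m, ∀ g ∈ corePos F p m,
      τ (contactHom F p m f g) = lam F p m f * τ g - lam F p m g * τ f)
    (ht : τ (vt F p m) = 0) {f : Trunc F p (Var m)} (hf : f ∈ corePos F p m) : τ f = 0 := by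
  have h2 := two_ne_zero_of_le (F := F) hp
  have h3 := three_ne_zero_of_le (F := F) hp
  -- The cocycle identity with t, where λ(t) = -2, multiplies τ by the weight r + 2b. The generators
  -- have weights 2 and 3, both invertible.
  have key {r b : ℕ} (hr : r < 8) (hrb : 2 ≤ r + 2 * b) (h0 : (r + 2 * b : F) ≠ 0) {g}
      (hg : g ∈ bi F p m r b) : τ g = 0 := by
    have := hτ _ (vt_mem hp hm) _ (bi_le_corePos_of_lt hp hm hr hrb hg)
    rw [contactHom_apply, bracket_vt_bi hg, map_smul, lam_vt hp, ht, smul_eq_mul] at this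
    refine (mul_eq_zero.mp (?_ : (r + 2 * b : F) * τ g = 0)).resolve_left h0
    linear_combination this
  have := corePos_le_of_generators hp hm (R := corePos F p m ⊓ LinearMap.ker τ)
    (fun f hf g hg => ⟨contactHom_mem_corePos hp hf.1 hg.1, by
      change τ _ = 0
      rw [hτ f hf.1 g hg.1, LinearMap.mem_ker.mp hf.2,
        LinearMap.mem_ker.mp hg.2]
      ring⟩) ⟨vt_mem hp hm, ht⟩
    (fun i j => ⟨quad_mem hp hm i j, key (by omega) (by omega) (by push_cast; simpa using h2)
      (vx_mul_vx_mem_bi i j)⟩)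
    (fun i => ⟨vx_vt_mem hp hm i, key (by omega) (by omega) (by
      push_cast; convert h3 using 1; norm_num) (vx_mul_vt_mem_bi i)⟩)
    (fun i j k => ⟨cubic_mem hp hm i j k, key (by omega) (by omega) (by
      push_cast; simpa using h3) (vx_mul_vx_mul_vx_mem_bi i j k)⟩)
  exact LinearMap.mem_ker.mp (this hf).2

omit [CharP F p] [Fact p.Prime] in
theorem vx_eq (i : Fin m ⊕ Fin m) : vx F p i = truncMonomial F p (Finsupp.single (some i) 1) := rfl

omit [CharP F p] [Fact p.Prime] in
theorem vt_eq : vt F p m = truncMonomial F p (Finsupp.single none 1) := rfl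

variable (F p) in
/-- Diagonalizable elements of degree `0`. -/
noncomputable def tor : Option (Fin m) → Trunc F p (Var m)
  | none => vt F p m
  | some j => vx F p (Sum.inl j) * vx F p (Sum.inr j)

variable (F) in
/-- The weight of a monomial with respect to `tor k`. -/
def tw : Option (Fin m) → (Var m →₀ ℕ) → F
  | none, a => wt a
  | some j, a => a (some (Sum.inr j)) - a (some (Sum.inl j))

omit [CharP F p] [Fact p.Prime] in
theorem tor_mem (hp : 5 ≤ p) (hm : 1 ≤ m) (k : Option (Fin m)) : tor F p k ∈ corePos F p m := by
  rcases k with _ | j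
  · exact vt_mem hp hm
  · exact quad_mem hp hm _ _

omit [Fact p.Prime] in
theorem vx_mul_ham_monomial (i j : Fin m ⊕ Fin m) (a : Var m →₀ ℕ) :
    vx F p i * ham F p j (truncMonomial F p a) = (sgn F j * a (some j.swap)) •
      truncMonomial F p (a - Finsupp.single (some j.swap) 1 + Finsupp.single (some i) 1) := by
  rw [ham_monomial, mul_smul_comm, truncX_mul_truncMonomial]

omit [Fact p.Prime] in
theorem vx_mul_ham_swap_monomial (i : Fin m ⊕ Fin m) (a : Var m →₀ ℕ) :
    vx F p i * ham F p i.swap (truncMonomial F p a) = (- sgn F i * a (some i)) •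
      truncMonomial F p a := by
  rw [vx_mul_ham_monomial, Sum.swap_swap, sgn_swap]
  by_cases h : a (some i) = 0
  · simp [h]
  · rw [tsub_add_cancel_of_le]
    rw [Finsupp.single_le_iff]
    omega

/-- `tw` is the eigenvalue shifted by λ(tor k). With this shift a coboundary satisfies `cob η` (tor
k) x^a = -`tw`·η(x^a) - λ(x^a)·η(tor k), so that linear forms of `tw`-weight zero are the ones
invisible to the torus. -/
theorem contactHom_tor_monomial (hp : 5 ≤ p) (k : Option (Fin m)) (a : Var m →₀ ℕ) :
    contactHom F p m (tor F p k) (truncMonomial F p a) =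
      (tw F k a + lam F p m (tor F p k)) • truncMonomial F p a := by
  rcases k with _ | j
  · rw [tor, contactHom_vt_monomial, lam_vt hp, tw, sub_eq_add_neg]
  · rw [tor, lam_bi hp (vx_mul_vx_mem_bi _ _) (Or.inl (by omega)), contactHom_apply,
      bracket_quadratic]
    have h1 := vx_mul_ham_swap_monomial (F := F) (p := p) (Sum.inl j) a
    have h2 := vx_mul_ham_swap_monomial (F := F) (p := p) (Sum.inr j) a
    rw [Sum.swap_inl] at h1
    rw [Sum.swap_inr] at h2
    rw [h1, h2, ← add_smul, tw]
    congr 1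
    simp [sgn]
    ring

theorem contactHom_tor (hp : 5 ≤ p) (k l : Option (Fin m)) :
    contactHom F p m (tor F p k) (tor F p l) = 0 := by
  have h (j : Fin m) : (tor F p (some j) : Trunc F p (Var m)) =
      truncMonomial F p (Finsupp.single (some (Sum.inr j)) 1 + Finsupp.single (some (Sum.inl j)) 1) := by
    rw [tor, vx_eq (Sum.inr j), truncX_mul_truncMonomial]
  rcases l with _ | j
  · rcases k with _ | j
    · exact contactHom_self _
    · rw [tor, vt_eq, contactHom_tor_monomial hp]
      rw [tor, lam_bi hp (vx_mul_vx_mem_bi _ _) (Or.inl (by omega))]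
      simp [tw]
  · rw [h, contactHom_tor_monomial hp]
    convert zero_smul F _
    rcases k with _ | k
    · rw [tor, lam_vt hp, tw, wt]
      simp [xdeg_add]
    · rw [tor, lam_bi hp (vx_mul_vx_mem_bi _ _) (Or.inl (by omega)), tw]
      simp [Finsupp.single_apply]

omit [CharP F p] [Fact p.Prime] in
theorem tor_mem_bi (k : Option (Fin m)) : tor F p k ∈ bi F p m (if k = none then 0 else 2)
    (if k = none then 1 else 0) := by
  rcases k with _ | j
  · exact vt_mem_bi
  · exact vx_mul_vx_mem_bi _ _

/-- The condition that a bilinear form vanishes on the torus spanned by the `tor k`. -/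
def TorNormal (Φ : Trunc F p (Var m) →ₗ[F] Trunc F p (Var m) →ₗ[F] F) : Prop :=
  ∀ k, ∀ g ∈ corePos F p m, Φ (tor F p k) g = 0

/-- Once Φ vanishes on the torus, the cocycle identity with tor k says that Φ is torus equivariant,
so it pairs only monomials whose weights balance λ. -/
theorem IsCocycle.weight (hp : 5 ≤ p) (hm : 1 ≤ m)
    {Φ : Trunc F p (Var m) →ₗ[F] Trunc F p (Var m) →ₗ[F] F} (h : IsCocycle Φ) (hT : TorNormal Φ)
    (k : Option (Fin m)) {a b : Var m →₀ ℕ} (ha : truncMonomial F p a ∈ corePos F p m)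
    (hb : truncMonomial F p b ∈ corePos F p m) :
    (tw F k a + tw F k b + lam F p m (tor F p k)) *
      Φ (truncMonomial F p a) (truncMonomial F p b) = 0 := by
  have h1 := h.coc _ (tor_mem hp hm k) _ ha _ hb
  rw [contactHom_tor_monomial hp, contactHom_tor_monomial hp, hT k _ ha, hT k _ hb,
    h.skew (tor F p k) (contactHom F p m _ _), hT k _ (contactHom_mem_corePos hp ha hb), map_smul,
    map_smul, LinearMap.smul_apply, LinearMap.smul_apply, smul_eq_mul, smul_eq_mul,
    h.skew (truncMonomial F p a) (truncMonomial F p b)] at h1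
  linear_combination h1

theorem IsCocycle.weight_bi (hp : 5 ≤ p) (hm : 1 ≤ m)
    {Φ : Trunc F p (Var m) →ₗ[F] Trunc F p (Var m) →ₗ[F] F} (h : IsCocycle Φ) (hT : TorNormal Φ)
    {r b r' b' : ℕ} {f g : Trunc F p (Var m)} (hf : f ∈ bi F p m r b) (hg : g ∈ bi F p m r' b')
    (hf' : f ∈ corePos F p m) (hg' : g ∈ corePos F p m)
    (h0 : (r + 2 * b + (r' + 2 * b') - 2 : F) ≠ 0) : Φ f g = 0 := by
  have ht := vt_mem (F := F) hp hm
  have h1 := h.coc _ ht _ hf' _ hg'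
  rw [h.skew (vt F p m) (contactHom F p m _ _), show Φ (vt F p m) f = 0 from hT none _ hf',
    show Φ (vt F p m) g = 0 from hT none _ hg',
    show Φ (vt F p m) (contactHom F p m f g) = 0 from hT none _ (contactHom_mem_corePos hp hf' hg'),
    contactHom_apply, contactHom_apply, bracket_vt_bi hf, bracket_vt_bi hg, map_smul,
    map_smul, LinearMap.smul_apply, LinearMap.smul_apply, smul_eq_mul, smul_eq_mul, lam_vt hp,
    h.skew f g] at h1
  refine (mul_eq_zero.mp (?_ : _ * Φ f g = 0)).resolve_left h0
  linear_combination h1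

/-- The coboundaries still available after the torus normalization are those of forms supported in
weight zero. -/
theorem cob_tor (hp : 5 ≤ p) {η : Trunc F p (Var m) →ₗ[F] F}
    (hη : ∀ k, ∀ a : Var m →₀ ℕ, (∀ i, a i < p) → tw F k a * η (truncMonomial F p a) = 0) :
    TorNormal (cob η) := by
  classical
  intro k g hg
  have h2 := two_ne_zero_of_le (F := F) hp
  have h0 : η (tor F p k) = 0 := by
    refine bi_ext (u := η) (w := 0) (fun a h1 h2' ha => ?_) (tor_mem_bi k)
    have := hη none a ha
    rw [tw, wt, h1, h2'] at this
    refine (mul_eq_zero.mp this).resolve_left ?_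
    rcases k with _ | k <;> simpa using h2
  refine corePos_ext (u := cob η (tor F p k)) (w := 0) (fun a ha _ _ => ?_) hg
  rw [cob_apply, h0, contactHom_tor_monomial hp, map_smul, LinearMap.zero_apply, smul_eq_mul]
  linear_combination - hη k a ha

/-- The torus acts diagonally, so Φ(tor k, ·) can be removed on monomials of nonzero weight by
division by the weight. On weight zero no division is possible; there Φ(tor k, ·) is handled as a
1-cocycle. -/
theorem exists_torNormal (hp : 5 ≤ p) (hm : 1 ≤ m)
    {Φ : Trunc F p (Var m) →ₗ[F] Trunc F p (Var m) →ₗ[F] F} (h : IsCocycle Φ) :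
    ∃ η, TorNormal (Φ - cob η) := by
  classical
  have h2 := two_ne_zero_of_le (F := F) hp
  -- The value solves the equation for one chosen torus element of nonzero weight; commutativity of
  -- the torus makes it right for the others.
  set w : (Var m →₀ ℕ) → F := fun a => if h : ∃ k, tw F k a ≠ 0 then
    - (tw F h.choose a)⁻¹ * Φ (tor F p h.choose) (truncMonomial F p a) else 0 with hw
  set η : Trunc F p (Var m) →ₗ[F] F := truncLift w with hη
  refine ⟨η, ?_⟩
  have hΦ' := h.sub_cob hp η
  have hmono (k) : ∃ a : Var m →₀ ℕ, tor F p k = truncMonomial F p a ∧ (∀ i, a i < p) ∧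
      wt a = 2 ∧ ∀ j, tw F (some j) a = 0 := by
    rcases k with _ | j
    · refine ⟨Finsupp.single none 1, rfl, fun i => ?_, by simp [wt], fun j => by simp [tw]⟩
      rw [Finsupp.single_apply]; split <;> omega
    · refine ⟨Finsupp.single (some (Sum.inr j)) 1 + Finsupp.single (some (Sum.inl j)) 1, ?_,
        fun i => ?_, by simp [wt, xdeg_add], fun j => by simp [tw, Finsupp.single_apply]⟩
      · rw [tor, vx_eq (Sum.inr j), truncX_mul_truncMonomial]
      · rw [Finsupp.add_apply, Finsupp.single_apply, Finsupp.single_apply]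
        split <;> split <;> omega
  have hηtor (k) : η (tor F p k) = - (2 : F)⁻¹ * Φ (vt F p m) (tor F p k) := by
    obtain ⟨a, h1, h3, h4, h5⟩ := hmono k
    have h6 : tw F none a ≠ 0 := by rw [tw, h4]; exact_mod_cast h2
    have h7 : ∃ k, tw F k a ≠ 0 := ⟨none, h6⟩
    have h8 : h7.choose = none := by
      have := h7.choose_spec
      rcases h9 : h7.choose with _ | j
      · rfl
      · rw [h9] at this
        exact absurd (h5 j) this
    rw [h1, hη, truncLift_monomial _ h3, hw]
    simp only [dif_pos h7, h8]
    rw [tw, h4, Nat.cast_ofNat]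
    rfl
  have hne (k) (a : Var m →₀ ℕ) (ha : ∀ i, a i < p) (hg : truncMonomial F p a ∈ corePos F p m)
      (hk : tw F k a ≠ 0) (l) : (Φ - cob η) (tor F p l) (truncMonomial F p a) = 0 := by
    rw [LinearMap.sub_apply, LinearMap.sub_apply, cob_apply, contactHom_tor_monomial hp]
    -- The monomial t is separate because λ does not vanish on it.
    by_cases hat : a = Finsupp.single none 1
    · have e : truncMonomial F p a = vt F p m := by rw [hat]; rfl
      have e2 : lam F p m (truncMonomial F p a) = -2 := by rw [e, lam_vt hp]
      have e3 : η (truncMonomial F p a) = 0 := by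
        rw [e]
        have := hηtor none
        rw [tor, h.alt, mul_zero] at this
        exact this
      rw [e2, map_smul, e3, hηtor, e, h.skew (vt F p m) (tor F p l)]
      rw [smul_zero]
      field_simp
      ring
    have hex : ∃ k, tw F k a ≠ 0 := ⟨k, hk⟩
    have hl : lam F p m (truncMonomial F p a) = 0 := by rw [lam_monomial hp, if_neg hat]
    have e4 : η (truncMonomial F p a) =
        - (tw F hex.choose a)⁻¹ * Φ (tor F p hex.choose) (truncMonomial F p a) := by
      rw [hη, truncLift_monomial _ ha, hw]
      simp only [dif_pos hex]
    -- The two torus elements commute, so the cocycle identity says that weight k times the value at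
    -- l equals weight l times the value at k.
    have h5 := h.coc _ (tor_mem hp hm l) _ (tor_mem hp hm hex.choose) _ hg
    rw [contactHom_tor hp, map_zero, LinearMap.zero_apply, contactHom_tor_monomial hp,
      contactHom_tor_monomial hp, hl, map_smul, map_smul, LinearMap.smul_apply,
      LinearMap.smul_apply, smul_eq_mul, smul_eq_mul, h.skew (tor F p l) (truncMonomial F p a),
      h.skew (tor F p hex.choose) (truncMonomial F p a)] at h5
    rw [hl, map_smul, e4, smul_eq_mul]
    have h6 := hex.choose_spec
    field_simp
    linear_combination -h5
  intro k g hg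
  -- The contraction with tor k is a λ-valued 1-cocycle, because it already vanishes outside weight
  -- zero; it also vanishes at t, hence everywhere.
  refine oneCocycle_eq_zero hp hm (τ := (Φ - cob η) (tor F p k)) ?_ ?_ hg
  swap
  · exact hne none (Finsupp.single none 1) (fun i => by rw [Finsupp.single_apply]; split <;> omega)
      (vt_mem hp hm) (by simpa [tw, wt] using h2) k
  generalize hΨ : Φ - cob η = Ψ at hne hΦ'
  have hopk {f} (hf : f ∈ corePos F p m) : Ψ (tor F p k) (contactHom F p m (tor F p k) f) =
      lam F p m (tor F p k) * Ψ (tor F p k) f := by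
    refine corePos_ext (u := Ψ (tor F p k) ∘ₗ contactHom F p m (tor F p k))
      (w := lam F p m (tor F p k) • Ψ (tor F p k)) (fun a h1 h3 h4 => ?_) hf
    rw [LinearMap.comp_apply, contactHom_tor_monomial hp, map_smul, LinearMap.smul_apply,
      smul_eq_mul, smul_eq_mul]
    by_cases h5 : tw F k a = 0
    · rw [h5, zero_add]
    · rw [hne k a h1 (monomial_mem_corePos h3 h4) h5, mul_zero, mul_zero]
  intro f hf g hg
  rw [← sub_eq_zero, ← sub_add]
  refine corePos_ext₂ (u := (contactHom F p m).compr₂ (Ψ (tor F p k)) -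
    (LinearMap.lsmul F F).compl₁₂ (lam F p m) (Ψ (tor F p k)) +
    (LinearMap.lsmul F F).flip.compl₁₂ (Ψ (tor F p k)) (lam F p m)) (w := 0)
    (fun a b h1 h3 h4 h5 h6 h7 => ?_) hf hg
  have hma := monomial_mem_corePos h3 h4
  have hmb := monomial_mem_corePos h6 h7
  have h8 := hΦ'.coc _ (tor_mem hp hm k) _ hma _ hmb
  have h9 := hopk (contactHom_mem_corePos hp hma hmb)
  rw [contactHom_leibniz, contactHom_tor_monomial hp, contactHom_tor_monomial hp, map_smul,
    map_smul, LinearMap.smul_apply, map_add, map_smul, map_smul, smul_eq_mul, smul_eq_mul] at h9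
  rw [contactHom_tor_monomial hp, contactHom_tor_monomial hp, map_smul, map_smul,
    LinearMap.smul_apply, LinearMap.smul_apply, smul_eq_mul, smul_eq_mul,
    hΦ'.skew (truncMonomial F p a) (truncMonomial F p b),
    hΦ'.skew (tor F p k) (contactHom F p m _ _)] at h8
  simp only [LinearMap.add_apply, LinearMap.sub_apply, LinearMap.compr₂_apply,
    LinearMap.compl₁₂_apply, LinearMap.lsmul_apply, LinearMap.flip_apply, smul_eq_mul,
    LinearMap.zero_apply]
  -- If the pair is balanced, the term Ψ(x^a, x^b) drops out of the cocycle identity and leaves the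
  -- 1-cocycle condition. If not, each term of that condition vanishes by weight.
  by_cases hz : tw F k a + tw F k b + lam F p m (tor F p k) = 0
  · linear_combination -h8 + hz * Ψ (truncMonomial F p a) (truncMonomial F p b)
  · have e1 : Ψ (tor F p k) (contactHom F p m (truncMonomial F p a) (truncMonomial F p b)) = 0 := by
      refine (mul_eq_zero.mp (?_ : (tw F k a + tw F k b + lam F p m (tor F p k)) * _ = 0)).resolve_left hz
      linear_combination h9
    have e2 (a b : Var m →₀ ℕ) (hb : ∀ i, b i < p) (hmb : truncMonomial F p b ∈ corePos F p m)
        (hz : tw F k a + tw F k b + lam F p m (tor F p k) ≠ 0) :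
        lam F p m (truncMonomial F p a) * Ψ (tor F p k) (truncMonomial F p b) = 0 := by
      rw [lam_monomial hp]
      split_ifs with h
      · rw [hne k b hb hmb ?_ k, mul_zero]
        rcases k with _ | j
        · rw [tor, lam_vt hp, h] at hz
          simpa [tw, wt] using hz
        · rw [tor, lam_bi hp (vx_mul_vx_mem_bi _ _) (Or.inl (by omega)), h] at hz
          simpa [tw] using hz
      · exact zero_mul _
    rw [e1]
    have h10 := e2 a b h5 hmb hz
    have h11 := e2 b a h1 hma (by rwa [add_comm (tw F k b)])
    linear_combination -h10 + h11

end ScalarCocycles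
end Contact

namespace Contact

/-! ### Normalization with respect to t² and t³ -/

section Normalization

variable {F : Type*} [Field F] {p : ℕ} [CharP F p] {m : ℕ} [Fact p.Prime]

omit [CharP F p] [Fact p.Prime] in
theorem vt_pow_eq (k : ℕ) : vt F p m ^ k = truncMonomial F p (Finsupp.single none k) := by
  induction k with
  | zero => rw [pow_zero, Finsupp.single_zero, truncMonomial_zero]
  | succ k ih =>
    rw [pow_succ', ih, truncX_mul_truncMonomial, ← Finsupp.single_add]

omit [Fact p.Prime] [CharP F p] in
theorem tw_add (k : Option (Fin m)) (a b : Var m →₀ ℕ) : tw F k (a + b) = tw F k a + tw F k b := by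
  rcases k with _ | j
  · simp [tw, wt_add]
  · simp [tw]; ring

theorem tw_single_none (hp : 5 ≤ p) (k : Option (Fin m)) (n : ℕ) :
    tw F k (Finsupp.single none n) = - n * lam F p m (tor F p k) := by
  rcases k with _ | j
  · rw [tor, lam_vt hp]; simp [tw, wt]; ring
  · rw [tor, lam_bi hp (vx_mul_vx_mem_bi _ _) (Or.inl (by omega))]
    simp [tw]

omit [Fact p.Prime] in
theorem quad_bracket_mem_bi (i j : Fin m ⊕ Fin m) {r b : ℕ} {g : Trunc F p (Var m)}
    (hg : g ∈ bi F p m r b) : contactHom F p m (vx F p i * vx F p j) g ∈ bi F p m r b := by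
  rw [contactHom_apply, bracket_quadratic]
  rcases r with _ | r
  · rw [ham_eq_zero _ hg, ham_eq_zero _ hg, mul_zero, mul_zero, add_zero]
    exact zero_mem _
  · have h1 := vx_mul_mem_bi i (ham_mem_bi j hg)
    have h2 := vx_mul_mem_bi j (ham_mem_bi i hg)
    rw [Nat.add_sub_cancel] at h1 h2
    exact add_mem h1 h2

omit [Fact p.Prime] in
theorem quad_bracket_vt_pow (i j : Fin m ⊕ Fin m) (k : ℕ) :
    contactHom F p m (vx F p i * vx F p j) (vt F p m ^ k) = 0 := by
  rw [contactHom_apply, bracket_quadratic, ham_eq_zero _ (vt_pow_mem_bi k),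
    ham_eq_zero _ (vt_pow_mem_bi k), mul_zero, mul_zero, add_zero]

/-- A cocycle that vanishes on the torus takes the value `0` on `(s, x_i t²)`, `s` quadratic. -/
theorem IsCocycle.quad_vx_vt_sq (hp : 5 ≤ p) (hm : 1 ≤ m)
    {Φ : Trunc F p (Var m) →ₗ[F] Trunc F p (Var m) →ₗ[F] F} (h : IsCocycle Φ) (hT : TorNormal Φ)
    (i j : Fin m ⊕ Fin m) {a : Var m →₀ ℕ} (ha : xdeg a = 1) (ha2 : 2 ≤ wt a) :
    Φ (vx F p i * vx F p j) (truncMonomial F p a) = 0 := by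
  have e : vx F p i * vx F p j = truncMonomial F p (Finsupp.single (some j) 1 +
      Finsupp.single (some i) 1) := by
    rw [vx_eq j, truncX_mul_truncMonomial]
  have hma : truncMonomial F p a ∈ corePos F p m :=
    bi_le_corePos_of_lt hp hm (by omega) ha2 (monomial_mem_bi a)
  have hw (k : Fin m) := h.weight hp hm hT (some k) (e ▸ quad_mem hp hm i j) hma
  have hl (k : Fin m) : lam F p m (tor F p (some k)) = 0 :=
    lam_bi hp (vx_mul_vx_mem_bi _ _) (Or.inl (by omega))
  rw [← e] at hw
  simp only [hl, add_zero] at hw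
  -- The sum of all symplectic torus weights is ±1 on each variable x_l. Three variables occur in
  -- total, so the sum is ±1 or ±3, which is never zero.
  have hsum : (∑ k : Fin m, (tw F (some k) (Finsupp.single (some j) 1 +
      Finsupp.single (some i) 1) + tw F (some k) a)) *
      Φ (vx F p i * vx F p j) (truncMonomial F p a) = 0 := by
    rw [Finset.sum_mul]
    exact Finset.sum_eq_zero fun k _ => hw k
  refine (mul_eq_zero.mp hsum).resolve_left ?_
  have hs (l : Fin m ⊕ Fin m) : ∑ k : Fin m, tw F (some k) (Finsupp.single (some l) 1) =
      - sgn F l := by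
    rcases l with l | l <;> simp [tw, sgn, Finsupp.single_apply]
  have ha' : ∃ l, a = Finsupp.single (some l) 1 + Finsupp.single none (a none) := by
    have : ∃ l, a (some l) ≠ 0 := by
      by_contra! h'
      simp [xdeg, h'] at ha
    obtain ⟨l, hl⟩ := this
    have h0 := xdeg_sub_single hl
    rw [ha] at h0
    have h1 : xdeg (a - Finsupp.single (some l) 1) = 0 := by omega
    rw [xdeg, Finset.sum_eq_zero_iff] at h1
    refine ⟨l, ?_⟩
    ext v
    rcases v with _ | v
    · simp
    · have h2 := h1 v (Finset.mem_univ _)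
      have h3 : a (some v) ≤ xdeg a :=
        Finset.single_le_sum (f := fun v => a (some v)) (fun _ _ => Nat.zero_le _)
          (Finset.mem_univ v)
      simp only [Finsupp.tsub_apply, Finsupp.add_apply] at h2 ⊢
      by_cases hv : l = v
      · subst hv; simp at h2 ⊢; omega
      · simp [hv] at h2 ⊢; omega
  obtain ⟨l, hl'⟩ := ha'
  rw [hl']
  simp only [tw_add, Finset.sum_add_distrib, hs, tw_single_none hp, hl, mul_zero, add_zero]
  have h1 := one_ne_zero (α := F)
  have h3 := three_ne_zero_of_le (F := F) hp
  have h1' : (-1 : F) ≠ 0 := neg_ne_zero.mpr h1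
  have h3' : (-3 : F) ≠ 0 := neg_ne_zero.mpr h3
  rcases i with i | i <;> rcases j with j | j <;> rcases l with l | l <;> simp only [sgn,
    Sum.elim_inl, Sum.elim_inr] <;> ring_nf <;> assumption

/-- The conditions reached by normalizing a cocycle with respect to `t²` and `t³`. -/
structure SqNormal (Φ : Trunc F p (Var m) →ₗ[F] Trunc F p (Var m) →ₗ[F] F) : Prop where
  tor : TorNormal Φ
  sq : ∀ r b : ℕ, 2 ≤ r + 2 * b → b < p - 1 → (b + 4 = p → (r : F) ≠ 6) → ∀ g ∈ bi F p m r b,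
    Φ (vt F p m ^ 2) g = 0

/-- Quadratics commute with powers of t, so the cocycle identity on (x_i x_j, t², g) expresses the
value at t·g through values on t². Where its scalar is zero, the weight forces t·g to have x-degree
6 in F and t-degree p - 3, and t³ replaces t². -/
theorem IsCocycle.quad_eq_zero (hp : 5 ≤ p) (hm : 1 ≤ m)
    {Φ : Trunc F p (Var m) →ₗ[F] Trunc F p (Var m) →ₗ[F] F} (h : IsCocycle Φ) (hΦ : SqNormal Φ)
    (hcube : ∀ r b : ℕ, 2 ≤ r + 2 * b → b + 5 = p → (r : F) = 6 → ∀ g ∈ bi F p m r b,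
      Φ (vt F p m ^ 3) g = 0)
    (i j : Fin m ⊕ Fin m) {r b : ℕ} (hb : 1 ≤ b) (hgood : IsGood F p m r b)
    {g : Trunc F p (Var m)} (hg : g ∈ bi F p m r b) : Φ (vx F p i * vx F p j) g = 0 := by
  have h2 := two_ne_zero_of_le (F := F) hp
  have h3 := three_ne_zero_of_le (F := F) hp
  have h4 := four_ne_zero_of_le (F := F) hp
  refine bi_ext (u := Φ (vx F p i * vx F p j)) (w := 0) (fun a ha hab har => ?_) hg
  rw [LinearMap.zero_apply]
  have hs2 := vx_mul_vx_mem_bi (F := F) (p := p) i j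
  have hs := quad_mem (F := F) hp hm i j
  have hls : lam F p m (vx F p i * vx F p j) = 0 := lam_bi hp hs2 (Or.inl (by omega))
  have hwt : wt a = r + 2 * b := by rw [wt, ha, hab]
  have hma : truncMonomial F p a ∈ corePos F p m :=
    monomial_mem_corePos (by rwa [ha, hab]) (by omega)
  have hmab : truncMonomial F p a ∈ bi F p m r b := monomial_mem_bi' ha hab
  -- Weights 2 and 3 are removed by the torus; from weight 4 on, dividing by t stays in the
  -- nonnegative part.
  by_cases hw4 : wt a < 4
  · refine h.weight_bi hp hm hΦ.tor hs2 hmab hs hma ?_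
    have : b = 1 := by omega
    subst this
    have hr : r = 0 ∨ r = 1 := by omega
    rcases hr with rfl | rfl
    · push_cast; simpa using h2
    · push_cast; convert h3 using 1; norm_num
  push Not at hw4
  obtain ⟨a', rfl⟩ : ∃ a', a = a' + Finsupp.single none 1 :=
    ⟨a - Finsupp.single none 1, by rw [tsub_add_cancel_of_le]; rw [Finsupp.single_le_iff]; omega⟩
  have hbp : b < p := hab ▸ har none
  obtain ⟨b, rfl⟩ : ∃ b', b = b' + 1 := ⟨b - 1, by omega⟩
  have ha' : xdeg a' = r := by rw [← ha, xdeg_add]; simp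
  have hab' : a' none = b := by simpa using hab
  have hwt2 : 2 ≤ r + 2 * b := by omega
  have hma' : truncMonomial F p a' ∈ corePos F p m :=
    bi_le_corePos (isGood_of_ne (by omega)) hwt2 (monomial_mem_bi' ha' hab')
  have hg' := monomial_mem_bi' (F := F) (p := p) ha' hab'
  have hsq : vt F p m ^ 2 ∈ corePos F p m :=
    bi_le_corePos_of_lt hp hm (by omega) (by omega) (vt_pow_mem_bi 2)
  have hcu : vt F p m ^ 3 ∈ corePos F p m :=
    bi_le_corePos_of_lt hp hm (by omega) (by omega) (vt_pow_mem_bi 3)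
  have hmul : vt F p m * truncMonomial F p a' =
      truncMonomial F p (a' + Finsupp.single none 1) := truncX_mul_truncMonomial F p _ _
  by_cases h0 : (r + b - 2 : F) = 0
  · by_cases hw : (r + 2 * (b + 1) : F) = 0
    swap
    · refine h.weight_bi hp hm hΦ.tor hs2 hmab hs hma ?_
      push_cast
      ring_nf at hw ⊢
      exact hw
    have hb4 : (b + 4 : F) = 0 := by linear_combination hw - h0
    have hbp4 : b + 4 = p := by
      have h5 : ((b + 4 : ℕ) : F) = 0 := by exact_mod_cast hb4
      rw [CharP.cast_eq_zero_iff F p] at h5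
      obtain ⟨c, hc⟩ := h5
      have : c < 2 := by
        by_contra! h6
        have := Nat.mul_le_mul_left p h6
        omega
      interval_cases c
      · omega
      · omega
    have hr6 : (r : F) = 6 := by linear_combination h0 - hb4
    obtain ⟨a', rfl⟩ : ∃ a'', a' = a'' + Finsupp.single none 1 :=
      ⟨a' - Finsupp.single none 1, by
        rw [tsub_add_cancel_of_le]; rw [Finsupp.single_le_iff]; omega⟩
    obtain ⟨b, rfl⟩ : ∃ b', b = b' + 1 := ⟨b - 1, by omega⟩
    have ha'' : xdeg a' = r := by rw [← ha', xdeg_add]; simp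
    have hab'' : a' none = b := by simpa using hab'
    by_cases hw3 : 2 ≤ r + 2 * b
    swap
    · have : r = 1 := by
        have hr : r = 0 ∨ r = 1 := by omega
        rcases hr with rfl | rfl
        · exfalso
          push_cast at hr6
          apply mul_ne_zero h2 h3
          linear_combination -hr6
        · rfl
      exact h.quad_vx_vt_sq hp hm hΦ.tor i j (ha.trans this) (by omega)
    have hg'' := monomial_mem_bi' (F := F) (p := p) ha'' hab''
    have hma'' : truncMonomial F p a' ∈ corePos F p m :=
      bi_le_corePos (isGood_of_ne (by omega)) hw3 hg''
    -- Here x-degree 6 and t-degree p - 5 give t³ the scalar 3·6 - 2·5 - 6 = 2.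
    have h5 := h.coc _ hs _ hcu _ hma''
    rw [quad_bracket_vt_pow, map_zero, LinearMap.zero_apply, h.skew (vt F p m ^ 3),
      hcube r b hw3 (by omega) hr6 _ (quad_bracket_mem_bi i j hg''), hls,
      lam_bi hp (vt_pow_mem_bi 3) (Or.inr (by omega)),
      lam_bi hp hg'' (Or.inl (by rintro rfl; push_cast at hr6; apply mul_ne_zero h2 h3; linear_combination -hr6)),
      contactHom_apply, bracket_vt_cube_bi hg'', pow_two, mul_assoc,
      truncX_mul_truncMonomial, truncX_mul_truncMonomial, h.skew (vx F p i * vx F p j), map_smul,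
      smul_eq_mul] at h5
    have h6 : (3 * r + 2 * b - 6 : F) = 2 := by
      push_cast at hb4
      linear_combination 3 * hr6 + 2 * hb4
    rw [h6] at h5
    refine (mul_eq_zero.mp (?_ : (2 : F) * _ = 0)).resolve_left h2
    linear_combination -h5
  · have hexc : b + 4 = p → (r : F) ≠ 6 := by
      intro h5 h6
      apply h0
      have : (b : F) + 4 = 0 := by
        rw [← CharP.cast_eq_zero F p, ← h5]; push_cast; ring
      linear_combination h6 + this
    have h5 := h.coc _ hs _ hsq _ hma'
    rw [quad_bracket_vt_pow, map_zero, LinearMap.zero_apply, h.skew (vt F p m ^ 2),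
      hΦ.sq r b hwt2 (by omega) hexc _ (quad_bracket_mem_bi i j hg'), hls,
      lam_bi hp (vt_pow_mem_bi 2) (Or.inr (by omega)),
      h.weight_bi hp hm hΦ.tor hs2 (vt_pow_mem_bi 2) hs hsq (by
        push_cast; convert h4 using 1; norm_num),
      contactHom_apply, bracket_vt_sq_bi hg', hmul, h.skew (vx F p i * vx F p j), map_smul,
      smul_eq_mul] at h5
    refine (mul_eq_zero.mp (?_ : (2 * (r + b - 2) : F) * _ = 0)).resolve_left (mul_ne_zero h2 h0)
    linear_combination -h5

theorem IsCocycle.exists_sqNormal (hp : 5 ≤ p) (hm : 1 ≤ m)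
    {Φ : Trunc F p (Var m) →ₗ[F] Trunc F p (Var m) →ₗ[F] F} (h : IsCocycle Φ) (hT : TorNormal Φ) :
    ∃ η, SqNormal (Φ - cob η) ∧ ∀ i j r b, 1 ≤ b → IsGood F p m r b → ∀ g ∈ bi F p m r b,
      (Φ - cob η) (vx F p i * vx F p j) g = 0 := by
  classical
  have h2 := two_ne_zero_of_le (F := F) hp
  have h3 := three_ne_zero_of_le (F := F) hp
  have h4 := four_ne_zero_of_le (F := F) hp
  have h6' : (6 : F) ≠ 0 := by
    have := mul_ne_zero h2 h3
    norm_num at this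
    exact this
  have hsq : vt F p m ^ 2 ∈ corePos F p m :=
    bi_le_corePos_of_lt hp hm (by omega) (by omega) (vt_pow_mem_bi 2)
  have hcu : vt F p m ^ 3 ∈ corePos F p m :=
    bi_le_corePos_of_lt hp hm (by omega) (by omega) (vt_pow_mem_bi 3)
  set e : Var m →₀ ℕ := Finsupp.single none 1 with he
  -- The first summand makes `cob η` (t², g) = -2(r+b-2) η(t g) agree with Φ(t², g). Where r + b = 2
  -- the inverse is 0 by convention, so η is still free there; on x-degree 6 and t-degree p - 3 the
  -- second summand uses this freedom to kill Φ(t³, ·).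
  set w : (Var m →₀ ℕ) → F := fun a =>
    (if 1 ≤ a none ∧ 4 ≤ wt a then - (2 * (xdeg (a - e) + (a - e : Var m →₀ ℕ) none - 2) : F)⁻¹ *
      Φ (vt F p m ^ 2) (truncMonomial F p (a - e)) else 0) +
    (if a none + 3 = p ∧ 6 ≤ wt a ∧ (xdeg a : F) = 6 then - (2 : F)⁻¹ *
      Φ (vt F p m ^ 3) (truncMonomial F p (a - e - e)) else 0) with hw
  have hwe : wt e = 2 := by simp [wt, e]
  -- Φ itself is balanced, so η is supported in weight zero and the torus normalization survives.
  have hwt (k) (a : Var m →₀ ℕ) (ha : ∀ i, a i < p) : tw F k a * w a = 0 := by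
    have hk := tw_single_none (F := F) hp k 1
    rw [← he, Nat.cast_one] at hk
    simp only [hw, mul_add]
    rw [ite_and]
    convert add_zero (0 : F) using 2
    · split_ifs with h1 h5
      · obtain ⟨a', rfl⟩ : ∃ a', a = a' + e :=
          ⟨a - e, by rw [tsub_add_cancel_of_le]; rw [Finsupp.single_le_iff]; omega⟩
        rw [add_tsub_cancel_right]
        have hn : (a' + e) none = a' none + 1 := by simp [e]
        have hmem : truncMonomial F p a' ∈ corePos F p m := by
          have := ha none
          rw [wt_add, hwe] at h5
          exact monomial_mem_corePos (isGood_of_ne (by omega)) (by omega)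
        rw [vt_pow_eq] at hsq ⊢
        have h6 := h.weight hp hm hT k hsq hmem
        rw [tw_single_none hp, Nat.cast_two] at h6
        rw [tw_add, hk]
        linear_combination (-(2 * (xdeg a' + a' none - 2) : F)⁻¹) * h6
      · exact mul_zero _
      · exact mul_zero _
    · split_ifs with h1
      · obtain ⟨h1, h5, -⟩ := h1
        obtain ⟨a', rfl⟩ : ∃ a', a = a' + e :=
          ⟨a - e, by rw [tsub_add_cancel_of_le]; rw [Finsupp.single_le_iff]; omega⟩
        have hn : (a' + e) none = a' none + 1 := by simp [e]
        obtain ⟨a', rfl⟩ : ∃ a'', a' = a'' + e :=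
          ⟨a' - e, by rw [tsub_add_cancel_of_le]; rw [Finsupp.single_le_iff]; omega⟩
        have hn' : (a' + e) none = a' none + 1 := by simp [e]
        rw [add_tsub_cancel_right, add_tsub_cancel_right]
        have hmem : truncMonomial F p a' ∈ corePos F p m := by
          rw [wt_add, wt_add, hwe] at h5
          exact monomial_mem_corePos (isGood_of_ne (by omega)) (by omega)
        rw [vt_pow_eq] at hcu ⊢
        have h6 := h.weight hp hm hT k hcu hmem
        rw [tw_single_none hp, Nat.cast_ofNat] at h6
        rw [tw_add, tw_add, hk]
        linear_combination (-(2 : F)⁻¹) * h6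
      · exact mul_zero _
  set η : Trunc F p (Var m) →ₗ[F] F := truncLift w with hη
  have hη1 (a : Var m →₀ ℕ) (ha : ∀ i, a i < p) : η (truncMonomial F p a) = w a :=
    truncLift_monomial w ha
  have hT' : TorNormal (Φ - cob η) := by
    intro k g hg
    have h1 := cob_tor hp (η := η) (fun k a ha => by rw [hη1 a ha]; exact hwt k a ha) k g hg
    rw [LinearMap.sub_apply, LinearMap.sub_apply, h1, hT k g hg, sub_zero]
  have hη2 (n : ℕ) (hn0 : 0 < n) (hn : n < p) : η (vt F p m ^ n) = 0 := by
    have hr : ∀ i, (Finsupp.single (none : Var m) n) i < p := by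
      intro i; rw [Finsupp.single_apply]; split <;> omega
    rw [vt_pow_eq, hη1 _ hr]
    have h1 := hwt none _ hr
    rw [tw_single_none hp, tor, lam_vt hp] at h1
    refine (mul_eq_zero.mp h1).resolve_left ?_
    have := natCast_ne_zero_of_lt (F := F) hn0 hn
    simp [this, h2]
  have hS : SqNormal (Φ - cob η) := by
    refine ⟨hT', fun r b hrb hb hexc g hg => ?_⟩
    refine bi_ext (u := (Φ - cob η) (vt F p m ^ 2)) (w := 0) (fun a ha hab har => ?_) hg
    have hab' := monomial_mem_bi' (F := F) (p := p) ha hab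
    have hmem : truncMonomial F p a ∈ corePos F p m :=
      bi_le_corePos (isGood_of_ne (by omega)) hrb hab'
    have hr' : ∀ i, (a + e) i < p := by
      intro i
      rw [Finsupp.add_apply, he, Finsupp.single_apply]
      split_ifs with h5
      · subst h5; omega
      · exact har i
    have hn : (a + e) none = a none + 1 := by simp [e]
    have hx : xdeg (a + e) = xdeg a := by rw [xdeg_add]; simp [e]
    rw [LinearMap.zero_apply, LinearMap.sub_apply, LinearMap.sub_apply, cob_apply,
      lam_bi hp (vt_pow_mem_bi 2) (Or.inr (by omega)), hη2 2 (by omega) (by omega),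
      contactHom_apply, bracket_vt_sq_bi hab', map_smul, truncX_mul_truncMonomial, ← he,
      hη1 _ hr', smul_eq_mul]
    simp only [hw]
    rw [if_pos ⟨by omega, by rw [wt_add, hwe, wt]; omega⟩, add_tsub_cancel_right, ha, hab]
    -- No correction is possible here, but none is needed: the weight of the pair becomes b + 4,
    -- which vanishes only in the excluded case b = p - 4, r = 6.
    by_cases h0 : (r + b - 2 : F) = 0
    · rw [h0, mul_zero, zero_mul]
      have h7 : Φ (vt F p m ^ 2) (truncMonomial F p a) = 0 := by
        refine h.weight_bi hp hm hT (vt_pow_mem_bi 2) hab' hsq hmem ?_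
        intro h8
        push_cast at h8
        have hb4 : (b + 4 : F) = 0 := by linear_combination h8 - h0
        have hbp4 : b + 4 = p := by
          have h5 : ((b + 4 : ℕ) : F) = 0 := by exact_mod_cast hb4
          rw [CharP.cast_eq_zero_iff F p] at h5
          obtain ⟨c, hc⟩ := h5
          have : c < 2 := by
            by_contra! h6
            have := Nat.mul_le_mul_left p h6
            omega
          interval_cases c
          · omega
          · omega
        exact hexc hbp4 (by linear_combination h0 - hb4)
      rw [h7]; ring
    · rw [if_neg]
      · have := mul_ne_zero h2 h0
        field_simp
        ring
      · rintro ⟨h5, -, h7⟩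
        rw [hx, ha] at h7
        exact hexc (by omega) h7
  refine ⟨η, hS, fun i j r b hb hgood g hg => ?_⟩
  refine (h.sub_cob hp η).quad_eq_zero hp hm hS (fun r b hrb hb hr6 g hg => ?_) i j hb hgood hg
  refine bi_ext (u := (Φ - cob η) (vt F p m ^ 3)) (w := 0) (fun a ha hab har => ?_) hg
  have hab' := monomial_mem_bi' (F := F) (p := p) ha hab
  have hr' : ∀ i, (a + e + e) i < p := by
    intro i
    rw [Finsupp.add_apply, Finsupp.add_apply, he, Finsupp.single_apply]
    split_ifs with h5
    · subst h5; omega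
    · exact har i
  have hb5 : (b : F) + 5 = 0 := by
    rw [← CharP.cast_eq_zero F p, ← hb]; push_cast; ring
  have hn : (a + e) none = a none + 1 := by simp [e]
  have hn' : (a + e + e) none = a none + 2 := by simp [e]
  have hx : xdeg (a + e) = xdeg a := by rw [xdeg_add]; simp [e]
  have hx' : xdeg (a + e + e) = xdeg a := by rw [xdeg_add]; simp [e, hx]
  rw [LinearMap.zero_apply, LinearMap.sub_apply, LinearMap.sub_apply, cob_apply,
    lam_bi hp (vt_pow_mem_bi 3) (Or.inr (by omega)), hη2 3 (by omega) (by omega),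
    contactHom_apply, bracket_vt_cube_bi hab', map_smul, pow_two, mul_assoc,
    truncX_mul_truncMonomial, truncX_mul_truncMonomial, ← he, hη1 _ hr', smul_eq_mul]
  simp only [hw]
  -- The first summand of η has the inverse of zero as a factor at this exponent, so only the
  -- summand for t³ remains.
  have hc0 : (2 * (xdeg (a + e) + (a + e : Var m →₀ ℕ) none - 2) : F) = 0 := by
    rw [hx, hn, ha, hab]
    push_cast
    linear_combination 2 * hr6 + 2 * hb5
  rw [if_pos ⟨by omega, by rw [wt_add, wt_add, hwe, wt]; omega⟩, add_tsub_cancel_right,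
    add_tsub_cancel_right, hc0, inv_zero,
    if_pos ⟨by omega, by rw [wt_add, wt_add, hwe, wt]; omega, by rw [hx', ha, hr6]⟩]
  have hc : (3 * r + 2 * b - 6 : F) = 2 := by linear_combination 3 * hr6 + 2 * hb5
  rw [hc]
  field_simp
  ring

end Normalization
end Contact

namespace Contact

/-! ### Symplectic invariants and normalization on quadratics -/

section Invariants

variable {F : Type*} [Field F] {p : ℕ} [CharP F p] {m : ℕ} [Fact p.Prime]

omit [Fact p.Prime] in
theorem natCast_inj_of_lt {x y : ℕ} (hx : x < p) (hy : y < p) (h : (x : F) = y) : x = y :=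
  CharP.natCast_injOn_Iio F p hx hy h

omit [Fact p.Prime] [CharP F p] in
theorem exists_eq_add_single {a : Var m →₀ ℕ} {j : Fin m ⊕ Fin m} (h : a (some j) ≠ 0) :
    ∃ c, a = c + Finsupp.single (some j) 1 :=
  ⟨a - Finsupp.single (some j) 1, by
    rw [tsub_add_cancel_of_le]
    rw [Finsupp.single_le_iff]
    omega⟩

omit [Fact p.Prime] in
theorem vx_mul_ham_monomial_add (i j : Fin m ⊕ Fin m) (c : Var m →₀ ℕ) :
    vx F p i * ham F p j (truncMonomial F p (c + Finsupp.single (some j.swap) 1)) =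
      (sgn F j * (c (some j.swap) + 1)) •
        truncMonomial F p (c + Finsupp.single (some i) 1) := by
  rw [vx_mul_ham_monomial, add_tsub_cancel_right]
  simp

/-- Linear forms on bihomogeneous polynomials that are invariant under the stabilizer of `x_i` in
the symplectic Lie algebra and have the weight dual to `x_i^k` are supported on two monomials. -/
theorem invariant_support {i : Fin m ⊕ Fin m} {k : ℕ} (hk : k + 2 ≤ p)
    {ℓ : Trunc F p (Var m) →ₗ[F] F} {r b : ℕ}
    (h1 : ∀ j l, j ≠ i.swap → l ≠ i.swap → ∀ a : Var m →₀ ℕ, xdeg a = r → a none = b →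
      ℓ (vx F p j * ham F p l (truncMonomial F p a) +
        vx F p l * ham F p j (truncMonomial F p a)) = 0)
    (h2 : ∀ a : Var m →₀ ℕ, xdeg a = r → a none = b → ∀ j : Fin m,
      (tw F (some j) a + tw F (some j) (Finsupp.single (some i) k)) * ℓ (truncMonomial F p a) = 0)
    (two : (2 : F) ≠ 0) {a : Var m →₀ ℕ} (ha : xdeg a = r) (hab : a none = b)
    (hne : ℓ (truncMonomial F p a) ≠ 0) :
    (∀ j, a (some j) = if j = i.swap then k else 0) ∨
      (∀ j, a (some j) = if j = i then p - 1 - k else p - 1) := by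
  classical
  have hpp : p.Prime := Fact.out
  have hres {a : Var m →₀ ℕ} (h : ℓ (truncMonomial F p a) ≠ 0) (v : Var m) : a v < p := by
    by_contra! hv
    exact h (by rw [truncMonomial_eq_zero hv, map_zero])
  have hwt {a : Var m →₀ ℕ} (ha : xdeg a = r) (hab : a none = b)
      (hne : ℓ (truncMonomial F p a) ≠ 0) (j : Fin m) :
      tw F (some j) a + tw F (some j) (Finsupp.single (some i) k) = 0 :=
    (mul_eq_zero.mp (h2 a ha hab j)).resolve_right hne
  have hwj {a : Var m →₀ ℕ} (ha : xdeg a = r) (hab : a none = b)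
      (hne : ℓ (truncMonomial F p a) ≠ 0) (j) (hj : j ≠ i) (hj' : j ≠ i.swap) :
      a (some j) = a (some j.swap) := by
    refine natCast_inj_of_lt (F := F) (hres hne _) (hres hne _) ?_
    have hj2 : j.swap ≠ i := fun h => hj' (by rw [← h, Sum.swap_swap])
    rcases j with j | j
    · have := hwt ha hab hne j
      simp only [tw, Finsupp.single_apply, Option.some.injEq] at this
      rw [if_neg (fun h => hj2 h.symm), if_neg (fun h => hj h.symm)] at this
      simp only [Nat.cast_zero, sub_zero, add_zero] at this
      rw [Sum.swap_inl]
      linear_combination -this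
    · have := hwt ha hab hne j
      simp only [tw, Finsupp.single_apply, Option.some.injEq] at this
      rw [if_neg (fun h => hj h.symm), if_neg (fun h => hj2 h.symm)] at this
      simp only [Nat.cast_zero, sub_zero, add_zero] at this
      rw [Sum.swap_inr]
      linear_combination this
  have hwi {a : Var m →₀ ℕ} (ha : xdeg a = r) (hab : a none = b)
      (hne : ℓ (truncMonomial F p a) ≠ 0) : (a (some i.swap) : F) = a (some i) + k := by
    rcases i with i | i
    · have := hwt ha hab hne i
      simp only [tw, Finsupp.single_apply, Option.some.injEq, reduceCtorEq, if_true, if_false] at this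
      rw [Sum.swap_inl]
      linear_combination this
    · have := hwt ha hab hne i
      simp only [tw, Finsupp.single_apply, Option.some.injEq, reduceCtorEq, if_true, if_false] at this
      rw [Sum.swap_inr]
      linear_combination -this
  have hpred {n : ℕ} (hn : n < p) (h : (n + 1 : F) = 0) : n = p - 1 := by
    refine natCast_inj_of_lt (F := F) hn (by have := hpp.pos; omega) ?_
    rw [cast_pred hpp.pos]
    linear_combination h
  -- Invariance under x_l², applied to the monomial with x_l replaced by its conjugate, gives 2(a_l'
  -- + 1)ℓ(x^a) = 0.
  have hsq {a : Var m →₀ ℕ} (ha : xdeg a = r) (hab : a none = b)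
      (hne : ℓ (truncMonomial F p a) ≠ 0) (l) (hl : l ≠ i.swap) (h0 : a (some l) ≠ 0) :
      a (some l.swap) = p - 1 := by
    refine hpred (hres hne _) ?_
    obtain ⟨c, rfl⟩ := exists_eq_add_single h0
    have := h1 l l hl hl (c + Finsupp.single (some l.swap) 1)
      (by rw [← ha, xdeg_add, xdeg_add]; simp) (by rw [← hab]; simp)
    rw [vx_mul_ham_monomial_add, ← add_smul, map_smul, smul_eq_mul] at this
    have h3 := (mul_eq_zero.mp this).resolve_right hne
    rw [← two_mul, mul_eq_zero, mul_eq_zero] at h3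
    have h4 := (h3.resolve_left two).resolve_left (sgn_ne_zero l)
    have h5 : (c + Finsupp.single (some l) 1 : Var m →₀ ℕ) (some l.swap) = c (some l.swap) := by
      simp [(swap_ne l).symm]
    rw [h5]
    exact h4
  -- Away from the pair of x_i the two exponents of a conjugate pair agree by weight; so both are 0
  -- or both are p - 1.
  have hdich {a : Var m →₀ ℕ} (ha : xdeg a = r) (hab : a none = b) (j) (hj : j ≠ i)
      (hj' : j ≠ i.swap) (h0 : a (some j) ≠ 0) (hp1 : a (some j) ≠ p - 1) :
      ℓ (truncMonomial F p a) = 0 := by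
    by_contra hne
    have h3 := hsq ha hab hne j hj' h0
    rw [hwj ha hab hne j hj hj'] at hp1
    exact hp1 h3
  have hi := hwi ha hab hne
  have hri := hres hne (some i)
  have hri' := hres hne (some i.swap)
  have hsi := (swap_ne i)
  have hpos : 3 ≤ p := by
    refine lt_of_le_of_ne hpp.two_le fun h => two ?_
    have := CharP.cast_eq_zero F p
    rw [← h] at this
    exact_mod_cast this
  by_cases h0 : a (some i) = 0
  · left
    have hk' : a (some i.swap) = k := by
      refine natCast_inj_of_lt (F := F) hri' (by omega) ?_
      rw [hi, h0, Nat.cast_zero, zero_add]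
    intro j
    by_cases hj' : j = i.swap
    · rw [if_pos hj', hj', hk']
    rw [if_neg hj']
    by_cases hj : j = i
    · rw [hj, h0]
    by_contra hj0
    have hjs : j.swap ≠ i := fun h => hj' (by rw [← h, Sum.swap_swap])
    have hjs' : j.swap ≠ i.swap := fun h => hj (by rw [← Sum.swap_swap j, h, Sum.swap_swap])
    have hjp : a (some j) = p - 1 := by
      by_contra hjp
      exact hne (hdich ha hab j hj hj' hj0 hjp)
    have hjp' : a (some j.swap) = p - 1 := by rw [← hwj ha hab hne j hj hj', hjp]
    obtain ⟨c, hc⟩ := exists_eq_add_single (j := j.swap) (a := a - Finsupp.single (some j) 1) (by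
      simp [(swap_ne j).symm, hjp']
      omega)
    have hac : a = c + Finsupp.single (some j.swap) 1 + Finsupp.single (some j) 1 := by
      rw [← hc, tsub_add_cancel_of_le]
      rw [Finsupp.single_le_iff]
      omega
    have hcj : c (some j) + 1 = p - 1 := by rw [← hjp, hac]; simp [swap_ne j]
    have hci' : c (some i.swap) = k := by rw [← hk', hac]; simp [hjs', hj']
    -- A full pair at j is compared, through x_i x_j, with a monomial whose x_j-exponent is p - 2.
    -- That one is killed by the dichotomy, which leaves (k + 1)ℓ(x^a) = 0.
    have := h1 i j hsi.symm hj' (c + Finsupp.single (some j.swap) 1 + Finsupp.single (some i.swap) 1)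
      (by rw [← ha, hac]; simp [xdeg_add]) (by rw [← hab, hac]; simp)
    rw [vx_mul_ham_monomial_add j i, ← hac, add_right_comm, vx_mul_ham_monomial_add i j,
      map_add, map_smul, map_smul, hdich (a := c + Finsupp.single (some i.swap) 1 +
        Finsupp.single (some i) 1) (j := j) (by rw [← ha, hac]; simp [xdeg_add])
        (by rw [← hab, hac]; simp) hj hj', smul_zero, zero_add, smul_eq_mul] at this
    · have h3 := (mul_eq_zero.mp ((mul_eq_zero.mp this).resolve_right hne)).resolve_left
        (sgn_ne_zero i)
      have h4 : (c + Finsupp.single (some j.swap) 1 : Var m →₀ ℕ) (some i.swap) = k := by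
        simp [hjs', hci']
      rw [h4] at h3
      exact natCast_ne_zero_of_lt (F := F) (p := p) (k := k + 1) (by omega) (by omega)
        (by exact_mod_cast h3)
    · rw [show (c + Finsupp.single (some i.swap) 1 + Finsupp.single (some i) 1 : Var m →₀ ℕ) (some j) =
        c (some j) by simp [hj, hj']]
      omega
    · rw [show (c + Finsupp.single (some i.swap) 1 + Finsupp.single (some i) 1 : Var m →₀ ℕ) (some j) =
        c (some j) by simp [hj, hj']]
      omega
  · right
    have hip : a (some i.swap) = p - 1 := hsq ha hab hne i hsi.symm h0
    have hik : a (some i) = p - 1 - k := by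
      refine natCast_inj_of_lt (F := F) hri (by omega) ?_
      rw [Nat.cast_sub (by omega), ← hip, hi]
      ring
    intro j
    by_cases hj : j = i
    · rw [if_pos hj, hj, hik]
    rw [if_neg hj]
    by_cases hj' : j = i.swap
    · rw [hj', hip]
    by_contra hjp
    have hjs : j.swap ≠ i := fun h => hj' (by rw [← h, Sum.swap_swap])
    have hjs' : j.swap ≠ i.swap := fun h => hj (by rw [← Sum.swap_swap j, h, Sum.swap_swap])
    have hj0 : a (some j) = 0 := by
      by_contra hj0
      exact hne (hdich ha hab j hj hj' hj0 hjp)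
    have hj0' : a (some j.swap) = 0 := by rw [← hwj ha hab hne j hj hj', hj0]
    obtain ⟨c, hc⟩ := exists_eq_add_single (j := i.swap) (a := a - Finsupp.single (some i) 1) (by
      simp [(swap_ne i).symm, hip]
      omega)
    have hac : a = c + Finsupp.single (some i.swap) 1 + Finsupp.single (some i) 1 := by
      rw [← hc, tsub_add_cancel_of_le]
      rw [Finsupp.single_le_iff]
      omega
    have hcj : c (some j) = 0 := by rw [← hj0, hac]; simp [Ne.symm hj, Ne.symm hj']
    have hcj' : c (some j.swap) = 0 := by rw [← hj0', hac]; simp [Ne.symm hjs, Ne.symm hjs']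
    -- An empty pair at j is compared with a monomial whose x_j-exponent is 1, again killed by the
    -- dichotomy; the coefficient of ℓ(x^a) is ±1.
    have := h1 i j hsi.symm hj' (c + Finsupp.single (some i.swap) 1 + Finsupp.single (some j.swap) 1)
      (by rw [← ha, hac]; simp [xdeg_add]) (by rw [← hab, hac]; simp)
    rw [vx_mul_ham_monomial_add i j, ← hac, add_right_comm, vx_mul_ham_monomial_add j i,
      map_add, map_smul, map_smul, hdich (a := c + Finsupp.single (some j.swap) 1 +
        Finsupp.single (some j) 1) (j := j) (by rw [← ha, hac]; simp [xdeg_add])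
        (by rw [← hab, hac]; simp) hj hj', smul_zero, add_zero, smul_eq_mul] at this
    · have h3 := (mul_eq_zero.mp ((mul_eq_zero.mp this).resolve_right hne)).resolve_left
        (sgn_ne_zero j)
      have h4 : (c + Finsupp.single (some i.swap) 1 : Var m →₀ ℕ) (some j.swap) = 0 := by
        simp [Ne.symm hjs', hcj']
      rw [h4] at h3
      simp at h3
    · rw [show (c + Finsupp.single (some j.swap) 1 + Finsupp.single (some j) 1 : Var m →₀ ℕ) (some j) = 1
        by simp [hcj, (swap_ne j).symm]]
      omega
    · rw [show (c + Finsupp.single (some j.swap) 1 + Finsupp.single (some j) 1 : Var m →₀ ℕ) (some j) = 1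
        by simp [hcj, (swap_ne j).symm]]
      omega

omit [CharP F p] [Fact p.Prime] in
theorem xdeg_of_low {i : Fin m ⊕ Fin m} {k : ℕ} {a : Var m →₀ ℕ}
    (h : ∀ j, a (some j) = if j = i.swap then k else 0) : xdeg a = k := by
  classical
  rw [xdeg, Finset.sum_congr rfl fun j _ => h j]
  simp

omit [CharP F p] [Fact p.Prime] in
theorem xdeg_of_high {i : Fin m ⊕ Fin m} {k : ℕ} (hk : k < p) {a : Var m →₀ ℕ}
    (h : ∀ j, a (some j) = if j = i then p - 1 - k else p - 1) : xdeg a + k = 2 * m * (p - 1) := by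
  classical
  rw [xdeg, Finset.sum_congr rfl fun j _ => h j, Finset.sum_ite, Finset.filter_eq',
    if_pos (Finset.mem_univ _), Finset.filter_ne', Finset.sum_const, Finset.sum_const,
    Finset.card_singleton, Finset.card_erase_of_mem (Finset.mem_univ _), Finset.card_univ,
    Fintype.card_sum, Fintype.card_fin, one_smul, smul_eq_mul]
  have hm : 1 ≤ m := by
    rcases i with i | i <;> exact Nat.one_le_iff_ne_zero.mpr (by rintro rfl; exact i.elim0)
  obtain ⟨n, hn⟩ : ∃ n, m + m = n + 1 := ⟨m + m - 1, by omega⟩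
  rw [two_mul, hn, Nat.add_sub_cancel, add_mul, one_mul]
  omega

omit [CharP F p] [Fact p.Prime] in
theorem xdeg_le {a : Var m →₀ ℕ} (ha : ∀ i, a i < p) : xdeg a ≤ 2 * m * (p - 1) := by
  have : xdeg a ≤ ∑ _i : Fin m ⊕ Fin m, (p - 1) :=
    Finset.sum_le_sum fun i _ => by have := ha (some i); omega
  simp only [Finset.sum_const, Finset.card_univ, Fintype.card_sum, Fintype.card_fin,
    smul_eq_mul] at this
  rwa [← two_mul] at this

/-- The quadratics without the variable conjugate to x_i annihilate x_i^k t^n. So, once the values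
on quadratics drop out, Φ(x^e, ·) is invariant under them, and `invariant_support` applies. -/
theorem IsCocycle.support (hp : 5 ≤ p) (hm : 1 ≤ m)
    {Φ : Trunc F p (Var m) →ₗ[F] Trunc F p (Var m) →ₗ[F] F} (h : IsCocycle Φ) (hT : TorNormal Φ)
    {i : Fin m ⊕ Fin m} {k : ℕ} (hk : k + 2 ≤ p) {e : Var m →₀ ℕ}
    (hmem : truncMonomial F p e ∈ corePos F p m) (hlam : lam F p m (truncMonomial F p e) = 0)
    (he : ∀ j, e (some j) = Finsupp.single (some i) k (some j)) {r b : ℕ} (hgood : IsGood F p m r b)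
    (hrb : 2 ≤ r + 2 * b) (hr : r ≠ 0 ∨ b ≠ 1)
    (hs : ∀ j l, ∀ g ∈ bi F p m r b,
      Φ (vx F p j * vx F p l) (contactHom F p m (truncMonomial F p e) g) = 0)
    {a : Var m →₀ ℕ} (ha : xdeg a = r) (hab : a none = b)
    (hne : Φ (truncMonomial F p e) (truncMonomial F p a) ≠ 0) :
    (∀ j, a (some j) = if j = i.swap then k else 0) ∨
      (∀ j, a (some j) = if j = i then p - 1 - k else p - 1) := by
  have hb := bi_le_corePos hgood hrb
  refine invariant_support hk (ℓ := Φ (truncMonomial F p e)) ?_ ?_ (two_ne_zero_of_le hp) ha hab hne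
  · intro j l hj hl a ha hab
    have hma := monomial_mem_bi' (F := F) (p := p) ha hab
    have h1 := h.coc _ (quad_mem hp hm j l) _ hmem _ (hb hma)
    have hz (j) (hj : j ≠ i.swap) : ham F p j (truncMonomial F p e) = 0 := by
      rw [ham_monomial]
      have : e (some j.swap) = 0 := by
        rw [he, Finsupp.single_apply, if_neg]
        rintro h
        apply hj
        rw [← Sum.swap_swap j, ← Option.some.inj h]
      rw [this]
      simp
    have h2 : contactHom F p m (vx F p j * vx F p l) (truncMonomial F p e) = 0 := by
      rw [contactHom_apply, bracket_quadratic, hz j hj, hz l hl, mul_zero, mul_zero, add_zero]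
    rw [h2, map_zero, LinearMap.zero_apply, hlam, lam_bi hp hma hr,
      lam_bi hp (vx_mul_vx_mem_bi j l) (Or.inl (by omega)),
      h.skew (vx F p j * vx F p l) (contactHom F p m _ _), hs j l _ hma,
      h.skew (truncMonomial F p e), contactHom_apply, bracket_quadratic] at h1
    linear_combination h1
  · intro a ha hab j
    have hma := monomial_mem_bi' (F := F) (p := p) ha hab
    have h1 := h.weight hp hm hT (some j) hmem (hb hma)
    rw [tor, lam_bi hp (vx_mul_vx_mem_bi _ _) (Or.inl (by omega))] at h1
    have h2 : tw F (some j) e = tw F (some j) (Finsupp.single (some i) k) := by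
      simp only [tw, he]
    rw [← h2]
    linear_combination h1

omit [CharP F p] [Fact p.Prime] in
theorem vx_mul_vt_eq (i : Fin m ⊕ Fin m) : vx F p i * vt F p m =
    truncMonomial F p (Finsupp.single none 1 + Finsupp.single (some i) 1) := by
  rw [vt_eq, truncX_mul_truncMonomial]

omit [CharP F p] [Fact p.Prime] in
theorem vx_pow_eq (i : Fin m ⊕ Fin m) (k : ℕ) :
    vx F p i ^ k = truncMonomial F p (Finsupp.single (some i) k) := by
  induction k with
  | zero => rw [pow_zero, Finsupp.single_zero, truncMonomial_zero]
  | succ k ih =>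
    rw [pow_succ', ih, truncX_mul_truncMonomial, ← Finsupp.single_add]

/-- The form takes equal values on `(x_i t, x_j w)` and `(x_j t, x_i w)`. -/
theorem IsCocycle.vx_vt_symm (hp : 5 ≤ p) (hm : 1 ≤ m)
    {Φ : Trunc F p (Var m) →ₗ[F] Trunc F p (Var m) →ₗ[F] F} (h : IsCocycle Φ) (hΦ : SqNormal Φ)
    (hs : ∀ i j r b, 1 ≤ b → IsGood F p m r b → ∀ g ∈ bi F p m r b,
      Φ (vx F p i * vx F p j) g = 0) (i j : Fin m ⊕ Fin m) {r : ℕ} (hr : (r : F) + 2 = 0)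
    {w : Trunc F p (Var m)} (hw : w ∈ bi F p m r 0) :
    Φ (vx F p i * vt F p m) (vx F p j * w) = Φ (vx F p j * vt F p m) (vx F p i * w) := by
  have h2 := two_ne_zero_of_le (F := F) hp
  have h3 := three_ne_zero_of_le (F := F) hp
  have h4 := four_ne_zero_of_le (F := F) hp
  have hpp : p.Prime := Fact.out
  rcases Nat.lt_or_ge r (2 * m * (p - 1)) with hlt | hge
  swap
  · have hz (j) : vx F p j * w = 0 := by
      have := vx_mul_mem_bi j hw
      rwa [bi_eq_bot_of_lt hpp.pos (by omega), Submodule.mem_bot] at this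
    rw [hz, hz, map_zero, map_zero]
  have hr3 : 3 ≤ r := by
    by_contra! hr3
    interval_cases r
    · apply h2; simpa using hr
    · apply h3; rw [← hr]; norm_num
    · apply h4; rw [← hr]; norm_num
  -- The support would require x-degree 1, hence r = 2 and 4 = 0 in F, or x-degree one below the
  -- top, hence r maximal; both are excluded.
  have hzero (i) (g) (hg : g ∈ bi F p m (r - 1) 1) : Φ (vx F p i * vt F p m) g = 0 := by
    refine bi_ext (u := Φ (vx F p i * vt F p m)) (w := 0) (fun a ha hab har => ?_) hg
    rw [LinearMap.zero_apply]
    by_contra hne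
    have hmem := vx_vt_mem (F := F) hp hm i
    have hl := lam_bi (F := F) hp (vx_mul_vt_mem_bi i) (Or.inl (by omega))
    have e1 := vx_mul_vt_eq (F := F) (p := p) i
    rw [e1] at hne hmem hl
    have := h.support hp hm hΦ.tor (i := i) (k := 1) (by omega) hmem hl (fun j => by simp)
      (isGood_of_ne (by omega)) (by omega) (Or.inl (by omega)) (fun j l g hg => by
        rw [← e1, contactHom_apply, bracket_vx_vt_bi _ hg, map_add, map_smul,
          hs j l _ _ (by omega) (isGood_of_ne (by omega)) _ (vt_mul_mem_bi (ham_mem_bi i hg)),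
          hs j l _ _ (by omega) (isGood_of_ne (by omega)) _ (vx_mul_mem_bi i hg)]
        simp) ha hab hne
    rcases this with h5 | h5
    · have := xdeg_of_low h5
      have hr2 : r = 2 := by omega
      rw [hr2] at hr
      apply h4; rw [← hr]; norm_num
    · have := xdeg_of_high (by omega) h5
      omega
  have hwm : w ∈ corePos F p m := bi_le_corePos (isGood_of_ne (by omega)) (by omega) hw
  -- The bracket of x_i t and x_j t is a multiple of t², on which Φ vanishes; the two remaining
  -- values appear with the same scalar r - 2 = -4.
  have h5 := h.coc _ (vx_vt_mem hp hm i) _ (vx_vt_mem hp hm j) _ hwm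
  have e1 : contactHom F p m (vx F p i * vt F p m) (vx F p j * vt F p m) =
      omega F i j • (vt F p m ^ 2) := by
    rw [contactHom_apply, bracket_vx_vt_bi _ (vx_mul_vt_mem_bi j)]
    simp only [Derivation.leibniz, ham_vt, ham_vx, smul_eq_mul, trunc_smul_eq_mul]
    have : algebraMap F (Trunc F p (Var m)) (((1 : ℕ) : F) + ((1 : ℕ) : F) - 2) = 0 := by
      rw [← map_zero (algebraMap F (Trunc F p (Var m)))]; congr 1; norm_num
    rw [this]
    ring
  have e2 : (r + (0 : ℕ) - 2 : F) = -4 := by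
    push_cast
    linear_combination hr
  rw [e1, map_smul, LinearMap.smul_apply, hΦ.sq r 0 (by omega) (by omega) (fun hp4 => by omega) _ hw,
    lam_bi hp (vx_mul_vt_mem_bi i) (Or.inl (by omega)),
    lam_bi hp (vx_mul_vt_mem_bi j) (Or.inl (by omega)), lam_bi hp hw (Or.inl (by omega)),
    h.skew (vx F p j * vt F p m) (contactHom F p m _ _),
    h.skew (vx F p i * vt F p m) (contactHom F p m _ _),
    contactHom_apply, contactHom_apply, bracket_vx_vt_bi _ hw, bracket_vx_vt_bi _ hw, e2,
    map_add, map_add, hzero _ _ (vt_mul_mem_bi (ham_mem_bi _ hw)),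
    hzero _ _ (vt_mul_mem_bi (ham_mem_bi _ hw)), map_smul, map_smul] at h5
  simp only [smul_eq_mul] at h5
  refine mul_left_cancel₀ h4 ?_
  linear_combination h5

/-- The conditions on a cocycle that vanishes on the quadratic polynomials. -/
structure QuadNormal (Φ : Trunc F p (Var m) →ₗ[F] Trunc F p (Var m) →ₗ[F] F) : Prop
    extends SqNormal Φ where
  quad : ∀ i j, ∀ g ∈ corePos F p m, Φ (vx F p i * vx F p j) g = 0

/-- A linear form with 3 η(x_i g) = Φ(x_i t, g) on t-free g of degree -1 in F removes the values on
(x_i t, g). It is consistent by `vx_vt_symm`, except that x_i g may be zero although g is not; that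
obstruction is Φ(x_i t, x_i^(p-1)). Then the values on quadratics vanish too. -/
theorem IsCocycle.exists_quadNormal (hp : 5 ≤ p) (hm : 1 ≤ m)
    {Φ : Trunc F p (Var m) →ₗ[F] Trunc F p (Var m) →ₗ[F] F} (h : IsCocycle Φ) (hΦ : SqNormal Φ)
    (hs : ∀ i j r b, 1 ≤ b → IsGood F p m r b → ∀ g ∈ bi F p m r b,
      Φ (vx F p i * vx F p j) g = 0)
    (hρ : ∀ i, Φ (vx F p i * vt F p m) (vx F p i ^ (p - 1)) = 0) :
    ∃ η, QuadNormal (Φ - cob η) := by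
  classical
  have h2 := two_ne_zero_of_le (F := F) hp
  have h3 := three_ne_zero_of_le (F := F) hp
  have h4 := four_ne_zero_of_le (F := F) hp
  have hpp : p.Prime := Fact.out
  set w : (Var m →₀ ℕ) → F := fun a => if hc : a none = 0 ∧ (xdeg a : F) = 0 ∧
      ∃ i, a (some i) ≠ 0 then 3⁻¹ * Φ (vx F p hc.2.2.choose * vt F p m)
        (truncMonomial F p (a - Finsupp.single (some hc.2.2.choose) 1)) else 0 with hw
  have hwt (k) (a : Var m →₀ ℕ) (ha : ∀ i, a i < p) : tw F k a * w a = 0 := by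
    simp only [hw]
    split_ifs with hc
    swap
    · exact mul_zero _
    set i := hc.2.2.choose
    have hi : a (some i) ≠ 0 := hc.2.2.choose_spec
    obtain ⟨c, hac⟩ := exists_eq_add_single hi
    rw [hac, add_tsub_cancel_right]
    have hx : xdeg a = xdeg c + 1 := by rw [hac, xdeg_add, xdeg_single_some]
    have hcn : c none = 0 := by rw [← hc.1, hac]; simp
    have hmem : truncMonomial F p c ∈ corePos F p m := by
      refine monomial_mem_corePos (isGood_of_ne (by omega)) ?_
      rw [wt]
      by_contra! hlt
      have h5 := hc.2.1
      have hxc : xdeg c = 0 ∨ xdeg c = 1 := by omega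
      rcases hxc with hxc | hxc <;> rw [hx, hxc] at h5 <;> push_cast at h5
      · simp at h5
      · apply h2; rw [← h5]
    have hmem' := vx_vt_mem (F := F) hp hm i
    rw [vx_mul_vt_eq] at hmem' ⊢
    have h6 := h.weight hp hm hΦ.tor k hmem' hmem
    rw [tw_add, tw_single_none hp, Nat.cast_one] at h6
    rw [tw_add]
    linear_combination 3⁻¹ * h6
  set η : Trunc F p (Var m) →ₗ[F] F := truncLift w with hη
  have hη1 (a : Var m →₀ ℕ) (ha : ∀ i, a i < p) : η (truncMonomial F p a) = w a :=
    truncLift_monomial w ha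
  have hT' : TorNormal (Φ - cob η) := by
    intro k g hg
    have h1 := cob_tor hp (η := η) (fun k a ha => by rw [hη1 a ha]; exact hwt k a ha) k g hg
    rw [LinearMap.sub_apply, LinearMap.sub_apply, h1, hΦ.tor k g hg, sub_zero]
  have hη0 {r b : ℕ} (hrb : 1 ≤ b ∨ (r : F) ≠ 0) {g} (hg : g ∈ bi F p m r b) : η g = 0 := by
    refine bi_ext (u := η) (w := 0) (fun a ha hab har => ?_) hg
    rw [hη1 a har, LinearMap.zero_apply]
    simp only [hw]
    rw [dif_neg]
    rintro ⟨h5, h6, -⟩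
    rw [ha] at h6
    rcases hrb with h7 | h7
    · omega
    · exact h7 h6
  have hη2 (i) {r : ℕ} (hr : (r : F) + 1 = 0) {g} (hg : g ∈ bi F p m r 0) :
      η (vx F p i * g) = 3⁻¹ * Φ (vx F p i * vt F p m) g := by
    refine bi_ext (u := η ∘ₗ LinearMap.mulLeft F (vx F p i)) (w := (3⁻¹ : F) •
      Φ (vx F p i * vt F p m)) (fun c hc hcn hcr => ?_) hg
    rw [LinearMap.comp_apply, LinearMap.mulLeft_apply, LinearMap.smul_apply, smul_eq_mul,
      truncX_mul_truncMonomial]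
    have hsym (j) (hj : c (some j) ≠ 0) : ∃ d, c = d + Finsupp.single (some j) 1 ∧
        Φ (vx F p i * vt F p m) (truncMonomial F p c) =
        Φ (vx F p j * vt F p m) (truncMonomial F p (d + Finsupp.single (some i) 1)) := by
      obtain ⟨d, rfl⟩ := exists_eq_add_single hj
      refine ⟨d, rfl, ?_⟩
      rw [xdeg_add, xdeg_single_some] at hc
      have h5 := h.vx_vt_symm hp hm hΦ hs i j (r := xdeg d) (by
        rw [← hc] at hr; push_cast at hr; linear_combination hr) (w := truncMonomial F p d)
        (monomial_mem_bi' rfl (by rw [← hcn]; simp))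
      rwa [truncX_mul_truncMonomial, truncX_mul_truncMonomial] at h5
    by_cases hi : c (some i) < p - 1
    · have har : ∀ v, (c + Finsupp.single (some i) 1 : Var m →₀ ℕ) v < p := by
        intro v
        have := hcr v
        rw [Finsupp.add_apply, Finsupp.single_apply]
        split_ifs with hv
        · subst hv; omega
        · omega
      rw [hη1 _ har]
      simp only [hw]
      have hex : ∃ j, (c + Finsupp.single (some i) 1 : Var m →₀ ℕ) (some j) ≠ 0 := ⟨i, by simp⟩
      rw [dif_pos ⟨by simp [hcn], by rw [xdeg_add, xdeg_single_some, hc]; exact_mod_cast hr, hex⟩]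
      have hj := hex.choose_spec
      generalize hex.choose = j at hj
      congr 1
      by_cases hij : j = i
      · rw [hij, add_tsub_cancel_right]
      · obtain ⟨d, rfl, hd⟩ := hsym j (by simpa [Ne.symm hij] using hj)
        rw [hd, add_right_comm, add_tsub_cancel_right]
    · have hci : c (some i) = p - 1 := by have := hcr (some i); omega
      rw [truncMonomial_eq_zero (i := some i) (by simp [hci]; omega), map_zero]
      symm
      -- Here x_i divides g to the power p - 1, so x_i g = 0 and Φ(x_i t, g) must be shown to
      -- vanish. If another variable divides g, the symmetry moves x_i onto g and gives zero; the
      -- pure power is the hypothesis `hρ`.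
      by_cases hex : ∃ j, j ≠ i ∧ c (some j) ≠ 0
      · obtain ⟨j, hji, hj⟩ := hex
        obtain ⟨d, hd, hd'⟩ := hsym j hj
        have hdi : d (some i) = p - 1 := by
          rw [← hci, hd]
          simp [hji]
        rw [hd', truncMonomial_eq_zero (i := some i) (by simp [hdi]; omega), map_zero, mul_zero]
      · push Not at hex
        have hcs : c = Finsupp.single (some i) (p - 1) := by
          ext v
          rcases v with _ | v
          · simp [hcn]
          · by_cases hv : v = i
            · rw [hv, hci]; simp
            · rw [hex v hv]; simp [Ne.symm hv]
        rw [hcs, ← vx_pow_eq, hρ, mul_zero]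
  have hΦ' := h.sub_cob hp η
  have hcob (i j) {r b : ℕ} (hb : 1 ≤ b) {g} (hg : g ∈ bi F p m r b) :
      cob η (vx F p i * vx F p j) g = 0 := by
    rw [cob_apply, hη0 (r := 2) (b := 0) (Or.inr (by simpa using h2)) (vx_mul_vx_mem_bi i j),
      hη0 (Or.inl hb) hg, hη0 (Or.inl hb) (quad_bracket_mem_bi i j hg)]
    ring
  have hsq (r b : ℕ) (hrb : 2 ≤ r + 2 * b) (hb : b < p - 1) (hexc : b + 4 = p → (r : F) ≠ 6) (g)
      (hg : g ∈ bi F p m r b) : (Φ - cob η) (vt F p m ^ 2) g = 0 := by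
    rw [LinearMap.sub_apply, LinearMap.sub_apply, hΦ.sq r b hrb hb hexc g hg, cob_apply,
      lam_bi hp (vt_pow_mem_bi 2) (Or.inr (by omega)),
      hη0 (r := 0) (b := 2) (Or.inl (by omega)) (vt_pow_mem_bi 2), contactHom_apply,
      bracket_vt_sq_bi hg, map_smul, hη0 (Or.inl (by omega)) (vt_mul_mem_bi hg), smul_zero]
    ring
  have hs1 (i j) {r b : ℕ} (hb : 1 ≤ b) (hgood : IsGood F p m r b) {g} (hg : g ∈ bi F p m r b) :
      (Φ - cob η) (vx F p i * vx F p j) g = 0 := by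
    rw [LinearMap.sub_apply, LinearMap.sub_apply, hcob i j hb hg, hs i j r b hb hgood g hg,
      sub_zero]
  have hxt (i) {r : ℕ} (hr2 : 2 ≤ r) {g} (hg : g ∈ bi F p m r 0) :
      (Φ - cob η) (vx F p i * vt F p m) g = 0 := by
    have hgm : g ∈ corePos F p m := bi_le_corePos (isGood_of_ne (by omega)) (by omega) hg
    by_cases hr : (r : F) + 1 = 0
    · rw [LinearMap.sub_apply, LinearMap.sub_apply, cob_apply,
        lam_bi hp (vx_mul_vt_mem_bi i) (Or.inl (by omega)), lam_bi hp hg (Or.inl (by omega)),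
        contactHom_apply, bracket_vx_vt_bi _ hg, map_add,
        hη0 (Or.inl (by omega)) (vt_mul_mem_bi (ham_mem_bi i hg)), map_smul, hη2 i hr hg,
        smul_eq_mul]
      have : (r + (0 : ℕ) - 2 : F) = -3 := by push_cast; linear_combination hr
      rw [this]
      field_simp
      ring
    · refine hΦ'.weight_bi hp hm hT' (vx_mul_vt_mem_bi i) hg (vx_vt_mem hp hm i) hgm ?_
      push_cast
      intro h5
      apply hr
      linear_combination h5
  refine ⟨η, ⟨⟨hT', hsq⟩, fun i j g hg => ?_⟩⟩
  refine corePos_ext (u := (Φ - cob η) (vx F p i * vx F p j)) (w := 0) (fun a har hgood h2a => ?_) hg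
  rw [LinearMap.zero_apply]
  rcases Nat.eq_zero_or_pos (a none) with hn | hn
  swap
  · exact hs1 i j hn hgood (monomial_mem_bi a)
  have hma := monomial_mem_corePos (F := F) (p := p) hgood h2a
  have hmab := monomial_mem_bi' (F := F) (p := p) (a := a) rfl hn
  have hqm := quad_mem (F := F) hp hm i j
  have hqb := vx_mul_vx_mem_bi (F := F) (p := p) i j
  have hx2 : 2 ≤ xdeg a := by rw [wt, hn] at h2a; omega
  by_cases hr : (xdeg a : F) = 0
  swap
  · refine hΦ'.weight_bi hp hm hT' hqb hmab hqm hma ?_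
    push_cast
    simpa using hr
  obtain ⟨k, hk⟩ : ∃ k, a (some k) ≠ 0 := by
    by_contra! h'
    simp [xdeg, h'] at hx2
  obtain ⟨c, rfl⟩ := exists_eq_add_single hk
  rw [xdeg_add, xdeg_single_some] at hr hx2
  have hcn : c none = 0 := by rw [← hn]; simp
  have hc2 : 2 ≤ xdeg c := by
    by_contra! h5
    have h6 : xdeg c = 1 := by omega
    rw [h6] at hr
    apply h2
    rw [← hr]
    norm_num
  have hcb := monomial_mem_bi' (F := F) (p := p) (a := c) rfl hcn
  have hcm : truncMonomial F p c ∈ corePos F p m :=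
    bi_le_corePos (isGood_of_ne (by omega)) (by omega) hcb
  -- All values on some x_l t vanish by `hxt`, and those divisible by t by `hs1`. What is left is
  -- the value at x_k x^c, with scalar deg - 2 = -3.
  have h5 := hΦ'.coc _ hqm _ (vx_vt_mem hp hm k) _ hcm
  have e1 : contactHom F p m (vx F p i * vx F p j) (vx F p k * vt F p m) =
      omega F j k • (vx F p i * vt F p m) + omega F i k • (vx F p j * vt F p m) := by
    rw [contactHom_apply, bracket_quadratic]
    simp only [Derivation.leibniz, ham_vt, ham_vx, smul_eq_mul, trunc_smul_eq_mul]
    ring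
  rw [e1, map_add, map_smul, map_smul, LinearMap.add_apply, LinearMap.smul_apply,
    LinearMap.smul_apply, hxt i hc2 hcb, hxt j hc2 hcb, hΦ'.skew (vx F p k * vt F p m),
    hxt k hc2 (quad_bracket_mem_bi i j hcb), hΦ'.skew (vx F p i * vx F p j) (contactHom F p m _ _),
    contactHom_apply, bracket_vx_vt_bi _ hcb, map_add,
    hs1 i j (by omega) (isGood_of_ne (by omega)) (vt_mul_mem_bi (ham_mem_bi k hcb)), map_smul,
    lam_bi hp hqb (Or.inl (by omega)), lam_bi hp (vx_mul_vt_mem_bi k) (Or.inl (by omega)),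
    lam_bi hp hcb (Or.inl (by omega)), truncX_mul_truncMonomial] at h5
  simp only [smul_eq_mul] at h5
  refine (mul_eq_zero.mp (?_ : (xdeg c + (0 : ℕ) - 2 : F) * _ = 0)).resolve_left ?_
  · linear_combination -h5
  · push_cast at hr ⊢
    intro h6
    apply h3
    linear_combination hr - h6

end Invariants
end Contact

namespace Contact

/-! ### Invariant cocycles: the values that can survive -/

section Vanishing

variable {F : Type*} [Field F] {p : ℕ} [CharP F p] {m : ℕ} [Fact p.Prime]

/-- The condition that a form vanishes on the quadratic polynomials in the `x_i`. -/
def QuadZero (Φ : Trunc F p (Var m) →ₗ[F] Trunc F p (Var m) →ₗ[F] F) : Prop :=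
  ∀ i j, ∀ g ∈ corePos F p m, Φ (vx F p i * vx F p j) g = 0

/-- The quadratics span the symplectic algebra and λ vanishes on them, so a cocycle that is zero on
quadratics is an invariant form. -/
theorem IsCocycle.quad_invariant (hp : 5 ≤ p) (hm : 1 ≤ m)
    {Φ : Trunc F p (Var m) →ₗ[F] Trunc F p (Var m) →ₗ[F] F} (h : IsCocycle Φ) (hQ : QuadZero Φ)
    (i j : Fin m ⊕ Fin m) {f g : Trunc F p (Var m)} (hf : f ∈ corePos F p m)
    (hg : g ∈ corePos F p m) :
    Φ (contactHom F p m (vx F p i * vx F p j) f) g =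
      - Φ f (contactHom F p m (vx F p i * vx F p j) g) := by
  have h1 := h.coc _ (quad_mem hp hm i j) _ hf _ hg
  rw [h.skew (vx F p i * vx F p j) (contactHom F p m f g),
    hQ i j _ (contactHom_mem_corePos hp hf hg), hQ i j _ hf, hQ i j _ hg,
    lam_bi hp (vx_mul_vx_mem_bi i j) (Or.inl (by omega)), h.skew f] at h1
  linear_combination h1

/-- The partner must have weight -1 in F. Of the two exponents of `IsCocycle.support`, the low one
is then x_i' t^(p-1), excluded by `hlow`, and the near-top one has t-exponent m in F. -/
theorem IsCocycle.vx_vt_support (hp : 5 ≤ p) (hm : 1 ≤ m)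
    {Φ : Trunc F p (Var m) →ₗ[F] Trunc F p (Var m) →ₗ[F] F} (h : IsCocycle Φ) (hT : TorNormal Φ)
    (hQ : QuadZero Φ) (i : Fin m ⊕ Fin m) {a : Var m →₀ ℕ} (hres : ∀ v, a v < p)
    (hgood : IsGood F p m (xdeg a) (a none)) (ha2 : 2 ≤ wt a)
    (hlow : Φ (vx F p i * vt F p m) (vt F p m * (vx F p i.swap * vt F p m ^ (p - 2))) = 0)
    (hne : Φ (vx F p i * vt F p m) (truncMonomial F p a) ≠ 0) :
    (∀ j, a (some j) = if j = i then p - 1 - 1 else p - 1) ∧ (a none : F) = m := by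
  have h2 := two_ne_zero_of_le (F := F) hp
  have hpp : p.Prime := Fact.out
  have hmem := vx_vt_mem (F := F) hp hm i
  have hl := lam_bi (F := F) hp (vx_mul_vt_mem_bi i) (Or.inl (by omega))
  have e1 := vx_mul_vt_eq (F := F) (p := p) i
  have hma := monomial_mem_corePos (F := F) (p := p) hgood ha2
  have hw : (wt a : F) + 1 = 0 := by
    by_contra hw
    refine hne (h.weight_bi hp hm hT (vx_mul_vt_mem_bi i) (monomial_mem_bi a) hmem hma ?_)
    rw [wt] at hw
    push_cast at hw ⊢
    intro h5
    apply hw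
    linear_combination h5
  have hr : xdeg a ≠ 0 ∨ a none ≠ 1 := by
    by_contra! h5
    rw [wt, h5.1, h5.2] at hw
    apply three_ne_zero_of_le (F := F) hp
    rw [← hw]
    norm_num
  have key := hne
  rw [e1] at hmem hl hne
  have := h.support hp hm hT (i := i) (k := 1) (by omega) hmem hl (fun j => by simp)
    hgood ha2 hr (fun j l g hg => hQ j l _ (contactHom_mem_corePos hp hmem
      (bi_le_corePos hgood ha2 hg))) rfl rfl hne
  rcases this with h5 | h5
  · exfalso
    have hx := xdeg_of_low h5
    rw [wt, hx] at hw
    have hn : a none = p - 1 := by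
      refine natCast_inj_of_lt (F := F) (hres none) (by omega) ?_
      rw [cast_pred hpp.pos]
      push_cast at hw
      refine mul_left_cancel₀ h2 ?_
      linear_combination hw
    apply key
    rw [← hlow]
    congr 1
    rw [vt_pow_eq, truncX_mul_truncMonomial, truncX_mul_truncMonomial]
    congr 1
    ext v
    rcases v with _ | v
    · simp [hn]; omega
    · rw [h5]
      simp [Finsupp.single_apply, eq_comm]
  · refine ⟨h5, ?_⟩
    have hx := xdeg_of_high (by omega) h5
    have hx' : (xdeg a : F) + 1 = - (2 * m) := by
      rw [← cast_top_xdeg F (p := p), ← hx]; push_cast; ring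
    rw [wt] at hw
    push_cast at hw
    refine mul_left_cancel₀ h2 ?_
    linear_combination hw - hx'

omit [Fact p.Prime] in
theorem quad_bracket_mul (q : Fin m ⊕ Fin m) (f : Trunc F p (Var m)) :
    contactHom F p m (vx F p q * vx F p q) f = 2 * (vx F p q * ham F p q f) := by
  rw [contactHom_apply, bracket_quadratic]
  ring

omit [Fact p.Prime] in
theorem cubic_bracket_mul (q : Fin m ⊕ Fin m) (f : Trunc F p (Var m)) :
    contactHom F p m (vx F p q ^ 3) f =
      3 * (vx F p q ^ 2 * ham F p q f) - vx F p q ^ 3 * dt F p m f := by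
  rw [show vx F p q ^ 3 = vx F p q * vx F p q * vx F p q by ring, contactHom_apply, bracket_cubic]
  ring

omit [Fact p.Prime] in
theorem ham_self (i : Fin m ⊕ Fin m) : ham F p i (vx F p i) = 0 := by
  rw [ham_vx, omega, if_neg (swap_ne i).symm, zero_smul]

omit [Fact p.Prime] in
theorem ham_swap (i : Fin m ⊕ Fin m) :
    ham F p i (vx F p i.swap) = algebraMap F (Trunc F p (Var m)) (sgn F i) := by
  rw [ham_vx, omega, if_pos rfl, trunc_smul_eq_mul, mul_one]

omit [Fact p.Prime] in
theorem swap_ham (i : Fin m ⊕ Fin m) :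
    ham F p i.swap (vx F p i) = - algebraMap F (Trunc F p (Var m)) (sgn F i) := by
  have := ham_swap (F := F) (p := p) i.swap
  rw [Sum.swap_swap, sgn_swap, map_neg] at this
  exact this

omit [CharP F p] [Fact p.Prime] in
theorem vx_pow_mem_bi (i : Fin m ⊕ Fin m) (k : ℕ) : vx F p i ^ k ∈ bi F p m k 0 := by
  rw [vx_pow_eq]
  exact monomial_mem_bi' (by simp) (by simp)

omit [CharP F p] [Fact p.Prime] in
theorem vx_pow_mul_mem_bi (i j : Fin m ⊕ Fin m) (k l : ℕ) :
    vx F p i ^ k * vx F p j ^ l ∈ bi F p m (k + l) 0 := by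
  simpa using mul_mem_bi (vx_pow_mem_bi (F := F) (p := p) i k) (vx_pow_mem_bi j l)

omit [CharP F p] [Fact p.Prime] in
theorem vx_pow_mul_vt_mem_bi (i j : Fin m ⊕ Fin m) (k l n : ℕ) :
    vx F p i ^ k * vx F p j ^ l * vt F p m ^ n ∈ bi F p m (k + l) n := by
  simpa using mul_mem_bi (vx_pow_mul_mem_bi (F := F) (p := p) i j k l) (vt_pow_mem_bi n)

/-- Write x, y for the conjugate pair and u = t^(p-2). Invariance under y² moves variables across
and gives Φ(y³, x³u) = -Φ(x³, y³u). The cocycle identity on (x³, y³, t^(p-1)) gives the same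
equation with a plus sign, because Φ(x²y², t^(p-1)) = 0 by invariance. Hence twice the value
vanishes. -/
theorem IsCocycle.cube_low (hp : 5 ≤ p) (hm : 1 ≤ m)
    {Φ : Trunc F p (Var m) →ₗ[F] Trunc F p (Var m) →ₗ[F] F} (h : IsCocycle Φ)
    (hQ : QuadZero Φ) (i : Fin m ⊕ Fin m) :
    Φ (vx F p i ^ 3) (vx F p i.swap ^ 3 * vt F p m ^ (p - 2)) = 0 := by
  have h2 := two_ne_zero_of_le (F := F) hp
  have h3 := three_ne_zero_of_le (F := F) hp
  have hpp : p.Prime := Fact.out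
  have hs := sgn_ne_zero (F := F) i
  have hmem (k l n : ℕ) (h1 : k + l < 8) (h2 : 2 ≤ k + l + 2 * n) :
      vx F p i ^ k * vx F p i.swap ^ l * vt F p m ^ n ∈ corePos F p m :=
    bi_le_corePos_of_lt hp hm h1 h2 (vx_pow_mul_vt_mem_bi i i.swap k l n)
  set x := vx F p i with hx
  set y := vx F p i.swap with hy
  set u := vt F p m ^ (p - 2) with hu
  set s := sgn F i with hs'
  have hxy (c : F) (f : Trunc F p (Var m)) : algebraMap F _ c * f = c • f :=
    (trunc_smul_eq_mul c f).symm
  have hd (q) (n) : ham F p q (vt F p m ^ n) = 0 := by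
    rw [Derivation.leibniz_pow, ham_vt]; simp
  have hY (k l n : ℕ) : contactHom F p m (y * y) (x ^ (k + 1) * y ^ l * vt F p m ^ n) =
      (-(2 * (k + 1)) * s : F) • (x ^ k * y ^ (l + 1) * vt F p m ^ n) := by
    rw [hy, quad_bracket_mul]
    simp only [Derivation.leibniz, hd, Derivation.leibniz_pow, ham_self, hx, swap_ham]
    rw [trunc_smul_eq_mul]
    simp only [smul_eq_mul, nsmul_eq_mul, map_mul, map_neg, map_add, map_natCast, map_one,
      map_ofNat, Nat.add_sub_cancel]
    push_cast
    ring
  have hinv (k l k' l' n : ℕ) (h1 : k + 1 + l < 8) (h2l : 2 ≤ k + 1 + l) (h1' : k' + 1 + l' < 8)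
      (h2' : 2 ≤ k' + 1 + l' + 2 * n) :
      (k + 1 : F) * Φ (x ^ k * y ^ (l + 1)) (x ^ (k' + 1) * y ^ l' * vt F p m ^ n) =
      - ((k' + 1) * Φ (x ^ (k + 1) * y ^ l) (x ^ k' * y ^ (l' + 1) * vt F p m ^ n)) := by
    have e1 := h.quad_invariant hp hm hQ i.swap i.swap (hmem (k + 1) l 0 h1 (by omega))
      (hmem (k' + 1) l' n h1' h2')
    rw [← hy, hY, hY, map_smul, map_smul, LinearMap.smul_apply, smul_eq_mul, smul_eq_mul, pow_zero,
      mul_one, mul_one] at e1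
    refine mul_left_cancel₀ (mul_ne_zero (neg_ne_zero.mpr h2) hs) ?_
    linear_combination e1
  have e1 := hinv 2 0 0 2 (p - 2) (by omega) (by omega) (by omega) (by omega)
  have e2 := hinv 1 1 1 1 (p - 2) (by omega) (by omega) (by omega) (by omega)
  have e3 := hinv 0 2 2 0 (p - 2) (by omega) (by omega) (by omega) (by omega)
  have hv : vt F p m ^ (p - 1) ∈ corePos F p m :=
    bi_le_corePos_of_lt hp hm (by omega) (by omega) (vt_pow_mem_bi (p - 1))
  have e4 := h.quad_invariant hp hm hQ i.swap i.swap (hmem 3 1 0 (by omega) (by omega)) hv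
  rw [quad_bracket_vt_pow, map_zero, neg_zero, ← hy, hY, map_smul, LinearMap.smul_apply,
    smul_eq_mul, Nat.cast_ofNat] at e4
  simp only [zero_add, Nat.reduceAdd, pow_zero, mul_one, one_mul, pow_one, Nat.cast_zero,
    Nat.cast_one, Nat.cast_ofNat] at e1 e2 e3
  have e5 : Φ (x ^ 2 * y ^ 2) (vt F p m ^ (p - 1)) = 0 := by
    rw [pow_zero, mul_one] at e4
    refine (mul_eq_zero.mp e4).resolve_left (mul_ne_zero ?_ hs)
    refine neg_ne_zero.mpr (mul_ne_zero h2 ?_)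
    convert h3 using 1
    norm_num
  have hdt (q : Fin m ⊕ Fin m) (n : ℕ) : dt F p m (vx F p q ^ n) = 0 := by
    rw [Derivation.leibniz_pow, dt_vx]; simp
  have hdv : dt F p m (vt F p m ^ (p - 1)) = - u := by
    rw [Derivation.leibniz_pow, dt_vt, smul_eq_mul, mul_one, ← Nat.cast_smul_eq_nsmul F,
      cast_pred hpp.pos, neg_one_smul, hu]
    congr 2
  have hb3 : contactHom F p m (x ^ 3) (y ^ 3) = (9 * s) • (x ^ 2 * y ^ 2) := by
    rw [hx, cubic_bracket_mul, hy, hdt, Derivation.leibniz_pow, ham_swap, trunc_smul_eq_mul]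
    simp only [smul_eq_mul, nsmul_eq_mul, map_mul, map_ofNat]
    push_cast
    ring
  have hbv (q : Fin m ⊕ Fin m) : contactHom F p m (vx F p q ^ 3) (vt F p m ^ (p - 1)) =
      vx F p q ^ 3 * u := by
    rw [cubic_bracket_mul, hd, hdv]
    ring
  have hx3 : x ^ 3 ∈ corePos F p m := by simpa using hmem 3 0 0 (by omega) (by omega)
  have hy3 : y ^ 3 ∈ corePos F p m := by simpa using hmem 0 3 0 (by omega) (by omega)
  have e6 := h.coc _ hx3 _ hy3 _ hv
  rw [hb3, hbv, hbv, ← hx, ← hy, map_smul, LinearMap.smul_apply, e5, h.skew (y ^ 3), h.skew (x ^ 3),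
    lam_bi hp (vx_pow_mem_bi i 3) (Or.inl (by omega)),
    lam_bi hp (vx_pow_mem_bi i.swap 3) (Or.inl (by omega)),
    lam_bi hp (vt_pow_mem_bi (p - 1)) (Or.inr (by omega))] at e6
  simp only [smul_zero] at e6
  refine (mul_eq_zero.mp (?_ : (2 : F) * _ = 0)).resolve_left h2
  have e7 : Φ (x * y ^ 2) (x ^ 2 * y * u) = - Φ (x ^ 2 * y) (x * y ^ 2 * u) := by
    refine mul_left_cancel₀ h2 ?_
    linear_combination e2
  linear_combination - e6 + e3 + e1 - 3 * e7

/-- As for x_i t: weight -1 leaves the low candidate x_i'³ t^(p-2), excluded by `cube_low`, and the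
near-top one, now with t-exponent m + 1 in F. -/
theorem IsCocycle.cube_support (hp : 5 ≤ p) (hm : 1 ≤ m)
    {Φ : Trunc F p (Var m) →ₗ[F] Trunc F p (Var m) →ₗ[F] F} (h : IsCocycle Φ) (hT : TorNormal Φ)
    (hQ : QuadZero Φ) (i : Fin m ⊕ Fin m) {a : Var m →₀ ℕ} (hres : ∀ v, a v < p)
    (hgood : IsGood F p m (xdeg a) (a none)) (ha2 : 2 ≤ wt a)
    (hne : Φ (vx F p i ^ 3) (truncMonomial F p a) ≠ 0) :
    (∀ j, a (some j) = if j = i then p - 1 - 3 else p - 1) ∧ (a none : F) = m + 1 := by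
  have h2 := two_ne_zero_of_le (F := F) hp
  have hpp : p.Prime := Fact.out
  have hmem : vx F p i ^ 3 ∈ corePos F p m :=
    bi_le_corePos_of_lt hp hm (by omega) (by omega) (vx_pow_mem_bi i 3)
  have hl := lam_bi (F := F) hp (vx_pow_mem_bi i 3) (Or.inl (by omega))
  have e1 := vx_pow_eq (F := F) (p := p) i 3
  have hma := monomial_mem_corePos (F := F) (p := p) hgood ha2
  have hw : (wt a : F) + 1 = 0 := by
    by_contra hw
    refine hne (h.weight_bi hp hm hT (vx_pow_mem_bi i 3) (monomial_mem_bi a) hmem hma ?_)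
    rw [wt] at hw
    push_cast at hw ⊢
    intro h5
    apply hw
    linear_combination h5
  have hr : xdeg a ≠ 0 ∨ a none ≠ 1 := by
    by_contra! h5
    rw [wt, h5.1, h5.2] at hw
    apply three_ne_zero_of_le (F := F) hp
    rw [← hw]
    norm_num
  have key := hne
  rw [e1] at hmem hl hne
  have := h.support hp hm hT (i := i) (k := 3) (by omega) hmem hl (fun j => rfl)
    hgood ha2 hr (fun j l g hg => hQ j l _ (contactHom_mem_corePos hp hmem
      (bi_le_corePos hgood ha2 hg))) rfl rfl hne
  rcases this with h5 | h5
  · exfalso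
    have hx := xdeg_of_low h5
    rw [wt, hx] at hw
    have hn : a none = p - 2 := by
      refine natCast_inj_of_lt (F := F) (hres none) (by omega) ?_
      rw [Nat.cast_sub (by omega), CharP.cast_eq_zero F p]
      push_cast at hw ⊢
      refine mul_left_cancel₀ h2 ?_
      linear_combination hw
    apply key
    rw [← h.cube_low hp hm hQ i]
    congr 1
    rw [vt_pow_eq, vx_pow_eq, truncMonomial_mul]
    congr 1
    ext v
    rcases v with _ | v
    · simp [hn]
    · rw [h5]
      simp [Finsupp.single_apply, eq_comm]
  · refine ⟨h5, ?_⟩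
    have hx := xdeg_of_high (by omega) h5
    have hx' : (xdeg a : F) + 3 = - (2 * m) := by
      rw [← cast_top_xdeg F (p := p), ← hx]; push_cast; ring
    rw [wt] at hw
    push_cast at hw
    refine mul_left_cancel₀ h2 ?_
    linear_combination hw - hx'

omit [CharP F p] [Fact p.Prime] in
theorem mem_corePos_of_bi {r b : ℕ} (h2 : 2 ≤ r + 2 * b) (h : r ≠ 2 * m * (p - 1))
    {g : Trunc F p (Var m)} (hg : g ∈ bi F p m r b) : g ∈ corePos F p m :=
  bi_le_corePos (isGood_of_xdeg_ne h) h2 hg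

/-- With x, y conjugate and W the monomial of c, the brackets [x³, x²y] and [xt, x³] are both
multiples of x⁴. Eliminating Φ(x⁴, yW) between the two cocycle identities relates the two values
that can still survive. -/
theorem IsCocycle.top_relation (hp : 5 ≤ p) (hm : 1 ≤ m)
    {Φ : Trunc F p (Var m) →ₗ[F] Trunc F p (Var m) →ₗ[F] F} (h : IsCocycle Φ) (hT : TorNormal Φ)
    (hQ : QuadZero Φ) (i : Fin m ⊕ Fin m)
    (hlow : Φ (vx F p i * vt F p m) (vt F p m * (vx F p i.swap * vt F p m ^ (p - 2))) = 0)
    {c : Var m →₀ ℕ} (hc : ∀ v, c v < p) (hci : c (some i) = p - 5)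
    (hci' : c (some i.swap) = p - 2) (hcx : xdeg c + 5 = 2 * m * (p - 1)) 
    (hcn : (c none : F) = m + 1) :
    (m + 3 : F) * Φ (vx F p i ^ 3) (vx F p i * vx F p i.swap * truncMonomial F p c) =
      Φ (vx F p i * vt F p m) (vx F p i ^ 3 * vx F p i.swap * dt F p m (truncMonomial F p c)) := by
  have h2 := two_ne_zero_of_le (F := F) hp
  have h3 := three_ne_zero_of_le (F := F) hp
  have hpp : p.Prime := Fact.out
  have hs := sgn_ne_zero (F := F) i
  have hss := sgn_mul_self (F := F) i
  have htop : 8 ≤ 2 * m * (p - 1) := Nat.mul_le_mul (show 2 ≤ 2 * m by omega) (show 4 ≤ p - 1 by omega)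
  have hx3 : vx F p i ^ 3 ∈ corePos F p m :=
    bi_le_corePos_of_lt hp hm (by omega) (by omega) (vx_pow_mem_bi i 3)
  have hx2y : vx F p i ^ 2 * vx F p i.swap ∈ bi F p m 3 0 := by
    simpa using vx_pow_mul_mem_bi (F := F) (p := p) i i.swap 2 1
  have hx2ym : vx F p i ^ 2 * vx F p i.swap ∈ corePos F p m :=
    bi_le_corePos_of_lt hp hm (by omega) (by omega) hx2y
  have hxt := vx_vt_mem (F := F) hp hm i
  have hWb : truncMonomial F p c ∈ bi F p m (xdeg c) (c none) := monomial_mem_bi c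
  have hyhy : vx F p i.swap * ham F p i (truncMonomial F p c) =
      algebraMap F _ (-2 * sgn F i) * truncMonomial F p c := by
    have := vx_mul_ham_swap_monomial (F := F) (p := p) i.swap c
    rw [Sum.swap_swap, hci', sgn_swap, trunc_smul_eq_mul, Nat.cast_sub (by omega),
      CharP.cast_eq_zero] at this
    rw [this]
    congr 2
    push_cast
    ring
  have hxhx : vx F p i * ham F p i.swap (truncMonomial F p c) =
      algebraMap F _ (5 * sgn F i) * truncMonomial F p c := by
    have := vx_mul_ham_swap_monomial (F := F) (p := p) i c
    rw [hci, trunc_smul_eq_mul, Nat.cast_sub (by omega), CharP.cast_eq_zero] at this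
    rw [this]
    congr 2
    push_cast
    ring
  have hyyW : vx F p i.swap ^ 2 * truncMonomial F p c = 0 := by
    rw [vx_pow_eq, truncMonomial_mul]
    refine truncMonomial_eq_zero (i := some i.swap) ?_
    simp [hci']
    omega
  set W := truncMonomial F p c with hWdef
  set x := vx F p i with hx
  set y := vx F p i.swap with hy
  set s := sgn F i with hs'
  set S := algebraMap F (Trunc F p (Var m)) s with hS
  have hSm (k : F) : algebraMap F (Trunc F p (Var m)) (k * s) = algebraMap F _ k * S := map_mul _ _ _
  have hyyD : y ^ 2 * dt F p m W = 0 := by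
    have := congrArg (dt F p m) hyyW
    rw [map_zero, Derivation.leibniz, Derivation.leibniz_pow, hy, dt_vx, smul_zero, smul_zero,
      smul_zero, add_zero, smul_eq_mul] at this
    exact this
  have hxi : ham F p i x = 0 := ham_self i
  have hyi : ham F p i y = S := ham_swap i
  have hxs : ham F p i.swap x = - S := swap_ham i
  have hys : ham F p i.swap y = 0 := ham_self i.swap
  have hdx : dt F p m x = 0 := dt_vx i
  have hdy : dt F p m y = 0 := dt_vx i.swap
  have hz : y * W ∈ bi F p m (xdeg c + 1) (c none) := vx_mul_mem_bi i.swap hWb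
  have hzm : y * W ∈ corePos F p m := mem_corePos_of_bi (by omega) (by omega) hz
  have b1 : contactHom F p m (x ^ 3) (y * W) =
      - (algebraMap F _ (3 * s) * (x ^ 2 * W)) - x ^ 3 * y * dt F p m W := by
    rw [hx, cubic_bracket_mul, ← hx]
    simp only [Derivation.leibniz, smul_eq_mul, hyi, hdy, hSm, map_ofNat]
    rw [hSm] at hyhy
    simp only [map_neg, map_ofNat] at hyhy
    linear_combination 3 * x ^ 2 * hyhy
  have b2 : contactHom F p m (x ^ 2 * y) (y * W) = algebraMap F _ (3 * s) * (x * y * W) := by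
    rw [hx, hy, show vx F p i ^ 2 * vx F p i.swap = vx F p i * vx F p i * vx F p i.swap by ring,
      contactHom_apply, bracket_cubic, ← hx, ← hy]
    simp only [Derivation.leibniz, smul_eq_mul, hyi, hys, hdy, hSm, map_ofNat]
    rw [hSm] at hyhy hxhx
    simp only [map_neg, map_ofNat] at hyhy hxhx
    linear_combination 2 * x * y * hyhy + x * y * hxhx - x ^ 2 * hyyD
  have b3 : contactHom F p m (x * vt F p m) (y * W) =
      - (S * (vt F p m * W)) + algebraMap F _ (-(m + 5) : F) * (x * y * W) := by
    rw [contactHom_apply, hx, bracket_vx_vt_bi _ hz, ← hx, trunc_smul_eq_mul]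
    have e : (((xdeg c + 1 : ℕ) : F) + c none - 2) = -(m + 5) := by
      have := congrArg (Nat.cast (R := F)) hcx
      rw [cast_top_xdeg] at this
      push_cast at this ⊢
      linear_combination this + hcn
    rw [e]
    simp only [Derivation.leibniz, smul_eq_mul, hyi]
    rw [hSm] at hyhy
    simp only [map_neg, map_ofNat] at hyhy
    linear_combination vt F p m * hyhy
  have b4 : contactHom F p m (x ^ 3) (x ^ 2 * y) = algebraMap F _ (3 * s) * x ^ 4 := by
    rw [hx, cubic_bracket_mul, ← hx]
    simp only [Derivation.leibniz, Derivation.leibniz_pow, smul_eq_mul, hyi, hdy, hdx, hxi, hSm,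
      map_ofNat]
    ring
  have b5 : contactHom F p m (x * vt F p m) (x ^ 3) = x ^ 4 := by
    rw [contactHom_apply, hx, bracket_vx_vt_bi _ (vx_pow_mem_bi i 3), ← hx, trunc_smul_eq_mul]
    simp only [Derivation.leibniz_pow, hxi, smul_zero]
    have e : ((3 : ℕ) : F) + (0 : ℕ) - 2 = 1 := by push_cast; norm_num
    rw [e, map_one]
    ring
  have b6 : contactHom F p m (y * y) (x ^ 3) = algebraMap F _ (-6 * s) * (x ^ 2 * y) := by
    rw [hy, quad_bracket_mul, ← hy]
    simp only [Derivation.leibniz_pow, hxs, hSm, map_neg, map_ofNat, smul_eq_mul, nsmul_eq_mul]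
    push_cast
    ring
  have b7 : contactHom F p m (y * y) (x ^ 3 * y * dt F p m W) = 0 := by
    have e := congrArg (ham F p i.swap) hyyD
    simp only [Derivation.leibniz, Derivation.leibniz_pow, hys, smul_zero, add_zero, map_zero,
      smul_eq_mul, mul_zero] at e
    rw [hy, quad_bracket_mul, ← hy]
    simp only [Derivation.leibniz, Derivation.leibniz_pow, hys, hxs, smul_eq_mul, nsmul_eq_mul]
    push_cast
    linear_combination 2 * x ^ 3 * e - 6 * x ^ 2 * S * hyyD
  have b8 : contactHom F p m (y * y) (x ^ 2 * W) = algebraMap F _ (6 * s) * (x * y * W) := by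
    rw [hy, quad_bracket_mul, ← hy]
    simp only [Derivation.leibniz, Derivation.leibniz_pow, hxs, hSm, map_ofNat, smul_eq_mul,
      nsmul_eq_mul]
    rw [hSm] at hxhx
    simp only [map_ofNat] at hxhx
    push_cast
    linear_combination 2 * x * y * hxhx
  have hx2W : x ^ 2 * W ∈ bi F p m (xdeg c + 2) (c none) := by
    have := mul_mem_bi (vx_pow_mem_bi (F := F) (p := p) i 2) hWb
    rwa [zero_add, add_comm] at this
  have hx2Wm : x ^ 2 * W ∈ corePos F p m := mem_corePos_of_bi (by omega) (by omega) hx2W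
  have hx3yW : x ^ 3 * y * dt F p m W ∈ corePos F p m := by
    have h4 := mul_mem_bi (vx_pow_mul_mem_bi (F := F) (p := p) i i.swap 3 1)
      (deriv_none_mem_bi hWb)
    rw [pow_one] at h4
    exact mem_corePos_of_bi (by omega) (by omega) h4
  have hsm (k : F) (f : Trunc F p (Var m)) : algebraMap F _ k * f = k • f :=
    (trunc_smul_eq_mul k f).symm
  -- The exponent of y is p - 2 here, while the support lemma demands p - 1.
  have z1 : Φ (x ^ 3) (vt F p m * W) = 0 := by
    rw [hWdef, truncX_mul_truncMonomial]
    by_contra hne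
    by_cases hres : c none + 1 < p
    · have := h.cube_support hp hm hT hQ i (a := c + Finsupp.single none 1) (fun v => by
        rw [Finsupp.add_apply, Finsupp.single_apply]
        split_ifs with hv
        · subst hv; exact hres
        · exact hc v) (isGood_of_xdeg_ne (by rw [xdeg_add, xdeg_single_none]; omega))
        (by rw [wt_add]; simp [wt]) hne
      have h5 := this.1 i.swap
      rw [if_neg (swap_ne i)] at h5
      simp [hci'] at h5
      omega
    · apply hne
      rw [truncMonomial_eq_zero (i := none), map_zero]
      simp
      omega
  have z2 : Φ (x * vt F p m) (x ^ 2 * W) = 0 := by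
    rw [hWdef, hx, vx_pow_eq, truncMonomial_mul, ← hx]
    by_contra hne
    have := h.vx_vt_support hp hm hT hQ i (a := Finsupp.single (some i) 2 + c) (fun v => by
        rw [Finsupp.add_apply, Finsupp.single_apply]
        split_ifs with hv
        · subst hv; omega
        · simpa using hc v) (isGood_of_xdeg_ne (by rw [xdeg_add, xdeg_single_some]; omega))
        (by rw [wt_add]; simp [wt]) hlow hne
    have h5 := this.1 i.swap
    rw [if_neg (swap_ne i)] at h5
    simp [hci', (swap_ne i).symm] at h5
    omega
  -- x²y arises from x³ under y², whereas y² kills the second argument because y²·∂_t W = 0.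
  have z3 : Φ (x ^ 2 * y) (x ^ 3 * y * dt F p m W) = 0 := by
    have e := h.quad_invariant hp hm hQ i.swap i.swap hx3 hx3yW
    rw [b6, b7, map_zero, neg_zero, hsm, map_smul, LinearMap.smul_apply,
      smul_eq_mul] at e
    refine (mul_eq_zero.mp e).resolve_left (mul_ne_zero (neg_ne_zero.mpr ?_) hs)
    have := mul_ne_zero h2 h3
    norm_num at this
    exact this
  have z4 : Φ (x ^ 2 * y) (x ^ 2 * W) = Φ (x ^ 3) (x * y * W) := by
    have e := h.quad_invariant hp hm hQ i.swap i.swap hx3 hx2Wm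
    rw [b6, b8, hsm, hsm, map_smul, map_smul, LinearMap.smul_apply,
      smul_eq_mul, smul_eq_mul] at e
    have h6 : (6 : F) ≠ 0 := by
      have := mul_ne_zero h2 h3
      norm_num at this
      exact this
    refine mul_left_cancel₀ (mul_ne_zero (neg_ne_zero.mpr h6) hs) ?_
    linear_combination e
  have c1 := h.coc _ hx3 _ hx2ym _ hzm
  have c2 := h.coc _ hxt _ hx3 _ hzm
  have l1 : lam F p m (x ^ 3) = 0 := lam_bi hp (vx_pow_mem_bi i 3) (Or.inl (by omega))
  have l2 : lam F p m (x ^ 2 * y) = 0 := lam_bi hp hx2y (Or.inl (by omega))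
  have l3 : lam F p m (x * vt F p m) = 0 := lam_bi hp (vx_mul_vt_mem_bi i) (Or.inl (by omega))
  have l4 : lam F p m (y * W) = 0 := lam_bi hp hz (Or.inl (by omega))
  rw [b4, l1, l2, l4, h.skew (x ^ 2 * y), h.skew (x ^ 3) (contactHom F p m _ _), b1, b2,
    map_sub, map_neg, hsm, hsm, hsm, map_smul, map_smul, map_smul, LinearMap.smul_apply, z3, z4] at c1
  rw [hS, hsm, hsm] at b3
  rw [b5, l1, l3, l4, h.skew (x ^ 3) (contactHom F p m _ _),
    h.skew (x * vt F p m) (contactHom F p m _ _), b1, b3, map_sub, map_neg, map_add, map_neg, hsm,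
    map_smul, map_smul, map_smul, z1, z2] at c2
  simp only [smul_eq_mul] at c1 c2
  refine mul_left_cancel₀ (mul_ne_zero h3 hs) ?_
  linear_combination c1 - 3 * s * c2

end Vanishing
end Contact

namespace Contact

/-! ### The coboundary of the top coefficient, and reduction to generators -/

section Vanishing

variable {F : Type*} [Field F] {p : ℕ} [CharP F p] {m : ℕ} [Fact p.Prime]

/-- In the cocycle identity on (x_i t, t², x_i' t^(p-2)) the bracket [x_i t, t²] is zero and the
values on t² vanish by normalization and `hσ`. The bracket of t² with the third element is -6 x_i'
t^(p-1). -/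
theorem IsCocycle.vx_vt_low (hp : 5 ≤ p) (hm : 1 ≤ m)
    {Φ : Trunc F p (Var m) →ₗ[F] Trunc F p (Var m) →ₗ[F] F} (h : IsCocycle Φ) (hΦ : SqNormal Φ)
    (hσ : Φ (vt F p m ^ 2) (vt F p m ^ (p - 1)) = 0) (i : Fin m ⊕ Fin m) :
    Φ (vx F p i * vt F p m) (vt F p m * (vx F p i.swap * vt F p m ^ (p - 2))) = 0 := by
  have h2 := two_ne_zero_of_le (F := F) hp
  have h3 := three_ne_zero_of_le (F := F) hp
  have hy : vx F p i.swap * vt F p m ^ (p - 2) ∈ bi F p m 1 (p - 2) :=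
    vx_mul_mem_bi i.swap (vt_pow_mem_bi (p - 2))
  have hym := bi_le_corePos_of_lt hp hm (by omega) (by omega) hy
  have ht : vt F p m ^ 2 ∈ bi F p m 0 2 := vt_pow_mem_bi 2
  have htm := bi_le_corePos_of_lt hp hm (by omega) (by omega) ht
  have hc : ((p - 2 : ℕ) : F) = -2 := by
    rw [Nat.cast_sub (by omega), CharP.cast_eq_zero F p]
    norm_num
  have e1 : contactHom F p m (vx F p i * vt F p m) (vt F p m ^ 2) = 0 := by
    rw [contactHom_apply, bracket_vx_vt_bi i ht, ham_eq_zero i ht]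
    simp
  have e2 : ham F p i (vx F p i.swap * vt F p m ^ (p - 2)) = sgn F i • vt F p m ^ (p - 2) := by
    rw [Derivation.leibniz, ham_swap, ham_eq_zero i (vt_pow_mem_bi (p - 2)), trunc_smul_eq_mul,
      smul_eq_mul, smul_eq_mul]
    ring
  have e3 : vt F p m * vt F p m ^ (p - 2) = vt F p m ^ (p - 1) := by
    rw [← pow_succ']
    congr 1
    omega
  have h5 := h.coc _ (vx_vt_mem hp hm i) _ htm _ hym
  rw [e1, contactHom_apply (vx F p i * vt F p m), bracket_vx_vt_bi i hy, e2, contactHom_apply,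
    bracket_vt_sq_bi hy, h.skew (vt F p m ^ 2) (_ + _), map_add, mul_smul_comm, e3, map_smul,
    map_smul, hσ, hΦ.sq (1 + 1) (p - 2) (by omega) (by omega) (by omega) _ (vx_mul_mem_bi i hy),
    h.skew (vx F p i * vt F p m) (_ • _), map_smul, lam_bi hp ht (Or.inr (by omega)),
    lam_bi hp hy (Or.inl (by omega)), lam_bi hp (vx_mul_vt_mem_bi i) (Or.inl (by omega)), hc] at h5
  simp only [smul_eq_mul, map_zero, LinearMap.zero_apply] at h5
  refine (mul_eq_zero.mp (?_ : (2 * 3 : F) * _ = 0)).resolve_left (mul_ne_zero h2 h3)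
  push_cast at h5
  linear_combination h5

/-- A full exponent p - 1 cannot be the outcome of differentiating a truncated polynomial: total
derivatives integrate to zero. -/
theorem truncCoeff_ham {T : Var m →₀ ℕ} (hT : ∀ v, T v < p) {i : Fin m ⊕ Fin m}
    (hi : T (some i.swap) = p - 1) (f : Trunc F p (Var m)) : truncCoeff T (ham F p i f) = 0 := by
  classical
  refine LinearMap.congr_fun (f := truncCoeff T ∘ₗ (ham F p i).toLinearMap) (g := 0) ?_ f
  refine trunc_ext fun a => ?_
  change truncCoeff T (ham F p i (truncMonomial F p a)) = 0
  by_cases ha : a (some i.swap) < p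
  swap
  · rw [truncMonomial_eq_zero (not_lt.mp ha), map_zero, map_zero]
  rw [ham_monomial, map_smul, truncCoeff_monomial hT, smul_eq_mul]
  split_ifs with h
  · have h2 := congrArg (fun f : Var m →₀ ℕ => f (some i.swap)) h
    simp only [Finsupp.tsub_apply, Finsupp.single_eq_same, hi] at h2
    rw [show a (some i.swap) = 0 by omega]
    simp
  · rw [mul_zero]

theorem truncCoeff_bi {T : Var m →₀ ℕ} (hT : ∀ v, T v < p) {r b : ℕ} (hr : r ≠ xdeg T)
    {g : Trunc F p (Var m)} (hg : g ∈ bi F p m r b) : truncCoeff T g = 0 := by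
  classical
  refine bi_ext (u := truncCoeff T) (w := 0) (fun a ha _ _ => ?_) hg
  rw [truncCoeff_monomial hT, if_neg, LinearMap.zero_apply]
  rintro rfl
  exact hr ha.symm

variable (p m) in
/-- The exponent of top degree in the `x_i` whose weight vanishes in `F`. -/
noncomputable def topExp : Var m →₀ ℕ :=
  Finsupp.equivFunOnFinite.symm fun v => Option.elim v (m % p) (fun _ => p - 1)

omit [Fact p.Prime] in
theorem topExp_some (i : Fin m ⊕ Fin m) : topExp p m (some i) = p - 1 := rfl

omit [Fact p.Prime] in
theorem topExp_none : topExp p m none = m % p := rfl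

theorem topExp_lt (v : Var m) : topExp p m v < p := by
  have hpp : p.Prime := Fact.out
  rcases v with _ | i
  · exact Nat.mod_lt _ hpp.pos
  · rw [topExp_some]; have := hpp.pos; omega

omit [Fact p.Prime] in
theorem xdeg_topExp : xdeg (topExp p m) = 2 * m * (p - 1) := by
  rw [xdeg, Finset.sum_congr rfl fun i _ => topExp_some i]
  rw [Finset.sum_const, Finset.card_univ, Fintype.card_sum, Fintype.card_fin, smul_eq_mul]
  ring

omit [Fact p.Prime] in
theorem cast_topExp_none : ((topExp p m none : ℕ) : F) = m :=
  (CharP.cast_eq_mod F p m).symm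

/-- The exponent `topExp` has weight -2m + 2m = 0 in F and equal exponents within each conjugate
pair, so its coefficient is a form of torus weight zero. -/
theorem cob_topExp_torNormal (hp : 5 ≤ p) (c : F) :
    TorNormal (cob (c • truncCoeff (F := F) (topExp p m))) := by
  classical
  refine cob_tor hp fun k a _ => ?_
  rw [LinearMap.smul_apply, truncCoeff_monomial topExp_lt]
  split_ifs with h
  · subst h
    rw [mul_eq_zero]
    left
    rcases k with _ | j
    · rw [tw, wt, xdeg_topExp]
      push_cast
      have := cast_top_xdeg F (p := p) (m := m)
      push_cast at this
      rw [this, cast_topExp_none]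
      ring
    · rw [tw, topExp_some, topExp_some, sub_self]
  · simp

/-- Quadratics act by total derivatives, which the coefficient of `topExp` does not see. So this
one-parameter family of coboundaries keeps every normalization made so far. -/
theorem cob_topExp_quadZero (hp : 5 ≤ p) (hm : 1 ≤ m) (c : F) :
    QuadZero (cob (c • truncCoeff (F := F) (topExp p m))) := by
  intro i j g hg
  have htop : 8 ≤ 2 * m * (p - 1) :=
    Nat.mul_le_mul (show 2 ≤ 2 * m by omega) (show 4 ≤ p - 1 by omega)
  have e1 : contactHom F p m (vx F p i * vx F p j) g =
      ham F p j (vx F p i * g) + ham F p i (vx F p j * g) := by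
    rw [contactHom_apply, bracket_quadratic, Derivation.leibniz, Derivation.leibniz, ham_vx, ham_vx,
      omega_swap i j]
    simp only [smul_eq_mul, trunc_smul_eq_mul, map_neg]
    ring
  rw [cob_apply, lam_bi hp (vx_mul_vx_mem_bi i j) (Or.inl (by omega)), LinearMap.smul_apply,
    LinearMap.smul_apply, LinearMap.smul_apply, e1, map_add, truncCoeff_ham topExp_lt rfl,
    truncCoeff_ham topExp_lt rfl, truncCoeff_bi topExp_lt (by rw [xdeg_topExp]; omega)
      (vx_mul_vx_mem_bi i j)]
  simp

theorem cob_topExp_vx_vt (hp : 5 ≤ p) (hm : 1 ≤ m) (c : F) (i : Fin m ⊕ Fin m) {r b : ℕ}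
    (hrb : r ≠ 0 ∨ b ≠ 1) {g : Trunc F p (Var m)} (hg : g ∈ bi F p m r b) :
    cob (c • truncCoeff (F := F) (topExp p m)) (vx F p i * vt F p m) g =
      - (r + b - 2) * c * truncCoeff (topExp p m) (vx F p i * g) := by
  have htop : 8 ≤ 2 * m * (p - 1) :=
    Nat.mul_le_mul (show 2 ≤ 2 * m by omega) (show 4 ≤ p - 1 by omega)
  have e1 : vt F p m * ham F p i g = ham F p i (vt F p m * g) := by
    rw [Derivation.leibniz, ham_vt]
    simp
  rw [cob_apply, lam_bi hp (vx_mul_vt_mem_bi i) (Or.inl (by omega)), lam_bi hp hg hrb,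
    contactHom_apply, bracket_vx_vt_bi i hg, e1, LinearMap.smul_apply, LinearMap.smul_apply,
    LinearMap.smul_apply, map_add, truncCoeff_ham topExp_lt rfl, map_smul]
  simp only [smul_eq_mul]
  ring

theorem cob_topExp_cube (hp : 5 ≤ p) (hm : 1 ≤ m) (c : F) (i : Fin m ⊕ Fin m) {r b : ℕ}
    (hrb : r ≠ 0 ∨ b ≠ 1) {g : Trunc F p (Var m)} (hg : g ∈ bi F p m r b) :
    cob (c • truncCoeff (F := F) (topExp p m)) (vx F p i ^ 3) g =
      c * truncCoeff (topExp p m) (vx F p i ^ 3 * dt F p m g) := by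
  have htop : 8 ≤ 2 * m * (p - 1) :=
    Nat.mul_le_mul (show 2 ≤ 2 * m by omega) (show 4 ≤ p - 1 by omega)
  have e1 : 3 * (vx F p i ^ 2 * ham F p i g) = ham F p i ((3 : F) • (vx F p i ^ 2 * g)) := by
    rw [Derivation.map_smul, trunc_smul_eq_mul, Derivation.leibniz, Derivation.leibniz_pow, ham_self,
      map_ofNat]
    simp
  rw [cob_apply, lam_bi hp (vx_pow_mem_bi i 3) (Or.inl (by omega)), lam_bi hp hg hrb,
    cubic_bracket_mul, e1, LinearMap.smul_apply, LinearMap.smul_apply,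
    LinearMap.smul_apply, map_sub, truncCoeff_ham topExp_lt rfl]
  simp only [smul_eq_mul]
  ring

/-- The elements on which Φ vanishes identically form a subalgebra. It contains t and the
quadratics, and brackets with quadratics carry the single x_i t and x_i³ to all the generators of
degree 1. -/
theorem IsCocycle.eq_zero_of_generators (hp : 5 ≤ p) (hm : 1 ≤ m)
    {Φ : Trunc F p (Var m) →ₗ[F] Trunc F p (Var m) →ₗ[F] F} (h : IsCocycle Φ) (hT : TorNormal Φ)
    (hQ : QuadZero Φ) (i : Fin m ⊕ Fin m)
    (hxt : ∀ g ∈ corePos F p m, Φ (vx F p i * vt F p m) g = 0)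
    (hx : ∀ g ∈ corePos F p m, Φ (vx F p i ^ 3) g = 0)
    {f g : Trunc F p (Var m)} (hf : f ∈ corePos F p m) (hg : g ∈ corePos F p m) : Φ f g = 0 := by
  have h2 := two_ne_zero_of_le (F := F) hp
  have h3 := three_ne_zero_of_le (F := F) hp
  let R : Submodule F (Trunc F p (Var m)) :=
    { carrier := {f | f ∈ corePos F p m ∧ ∀ g ∈ corePos F p m, Φ f g = 0}
      zero_mem' := ⟨zero_mem _, fun g _ => by simp⟩
      add_mem' := fun {a b} ha hb => ⟨add_mem ha.1 hb.1, fun g hg => by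
        rw [map_add, LinearMap.add_apply, ha.2 g hg, hb.2 g hg, add_zero]⟩
      smul_mem' := fun c a ha => ⟨Submodule.smul_mem _ c ha.1, fun g hg => by
        rw [map_smul, LinearMap.smul_apply, ha.2 g hg, smul_zero]⟩ }
  have hR : ∀ f ∈ R, ∀ g ∈ R, contactHom F p m f g ∈ R := by
    rintro f ⟨hf, hf'⟩ g ⟨hg, hg'⟩
    refine ⟨contactHom_mem_corePos hp hf hg, fun k hk => ?_⟩
    have h5 := h.coc f hf g hg k hk
    rw [h.skew g (contactHom F p m f k), h.skew f (contactHom F p m g k),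
      hg' _ (contactHom_mem_corePos hp hf hk), hf' _ (contactHom_mem_corePos hp hg hk), hg' k hk,
      hf' k hk, hf' g hg] at h5
    linear_combination h5
  have hq (j k) : vx F p j * vx F p k ∈ R := ⟨quad_mem hp hm j k, hQ j k⟩
  set y := i.swap with hy
  -- The coefficient is nonzero only for x_j = y. So bracketing with x_j y substitutes x_j for x_i,
  -- up to a scalar that is doubled when x_j = y.
  have hω (j : Fin m ⊕ Fin m) : algebraMap F (Trunc F p (Var m)) (omega F j i) * vx F p y =
      algebraMap F _ (omega F j i) * vx F p j := by
    rw [omega]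
    split_ifs with h5
    · rw [hy, h5, Sum.swap_swap]
    · rw [map_zero, zero_mul, zero_mul]
  have hκ (j : Fin m ⊕ Fin m) (k : F) (hk : k ≠ 0) : k * (omega F y i + omega F j i) ≠ 0 := by
    refine mul_ne_zero hk ?_
    have hs := sgn_ne_zero (F := F) i
    rw [omega, omega, if_pos (by rw [hy, Sum.swap_swap])]
    split_ifs with h5
    · rw [show j = y by rw [hy, h5, Sum.swap_swap], hy, sgn_swap, ← two_mul]
      exact mul_ne_zero h2 (neg_ne_zero.mpr hs)
    · rw [hy, sgn_swap, add_zero]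
      exact neg_ne_zero.mpr hs
  have hRxt (j) : vx F p j * vt F p m ∈ R := by
    have h5 := hR _ (hq j y) _ (show vx F p i * vt F p m ∈ R from ⟨vx_vt_mem hp hm i, hxt⟩)
    refine (Submodule.smul_mem_iff R (hκ j 1 one_ne_zero)).mp ?_
    convert h5 using 1
    rw [contactHom_apply, bracket_quadratic]
    simp only [Derivation.leibniz, ham_vt, ham_vx, smul_eq_mul, trunc_smul_eq_mul, map_add, one_mul]
    linear_combination -vt F p m * hω j
  have hc1 (j) : vx F p j * vx F p i * vx F p i ∈ R := by
    have h5 := hR _ (hq j y) _ (show vx F p i ^ 3 ∈ R from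
      ⟨bi_le_corePos_of_lt hp hm (by omega) (by omega) (vx_pow_mem_bi i 3), hx⟩)
    refine (Submodule.smul_mem_iff R (hκ j 3 h3)).mp ?_
    convert h5 using 1
    rw [contactHom_apply, bracket_quadratic]
    simp only [Derivation.leibniz_pow, ham_vx, smul_eq_mul, trunc_smul_eq_mul, map_add, map_mul,
      map_ofNat, nsmul_eq_mul]
    push_cast
    linear_combination -3 * vx F p i ^ 2 * hω j
  -- The bracket also acts on the factor x_k; the surplus terms contain x_i² and are already known.
  have hc2 (j k) : vx F p j * vx F p k * vx F p i ∈ R := by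
    have h5 := hR _ (hq j y) _ (hc1 k)
    refine (Submodule.smul_mem_iff R (hκ j 2 h2)).mp ?_
    have h6 : (omega F y k • (vx F p j * vx F p i * vx F p i) +
      omega F j k • (vx F p y * vx F p i * vx F p i)) ∈ R :=
      add_mem (R.smul_mem _ (hc1 j)) (R.smul_mem _ (hc1 y))
    convert sub_mem h5 h6 using 1
    rw [contactHom_apply, bracket_quadratic]
    simp only [Derivation.leibniz, ham_vx, smul_eq_mul, trunc_smul_eq_mul, map_add, map_mul,
      map_ofNat]
    linear_combination -2 * vx F p i * vx F p k * hω j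
  have hc3 (j k l) : vx F p j * vx F p k * vx F p l ∈ R := by
    have h5 := hR _ (hq j y) _ (hc2 k l)
    refine (Submodule.smul_mem_iff R (hκ j 1 one_ne_zero)).mp ?_
    have h6 : (omega F y k • (vx F p j * vx F p l * vx F p i) +
      omega F y l • (vx F p j * vx F p k * vx F p i)) +
      (omega F j k • (vx F p y * vx F p l * vx F p i) +
      omega F j l • (vx F p y * vx F p k * vx F p i)) ∈ R :=
      add_mem (add_mem (R.smul_mem _ (hc2 _ _)) (R.smul_mem _ (hc2 _ _)))
        (add_mem (R.smul_mem _ (hc2 _ _)) (R.smul_mem _ (hc2 _ _)))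
    convert sub_mem h5 h6 using 1
    rw [contactHom_apply, bracket_quadratic]
    simp only [Derivation.leibniz, ham_vx, smul_eq_mul, trunc_smul_eq_mul, map_add, one_mul]
    linear_combination -vx F p k * vx F p l * hω j
  exact (corePos_le_of_generators hp hm hR ⟨vt_mem hp hm, hT none⟩ hq hRxt hc3 hf).2 g hg

end Vanishing
end Contact

namespace Contact

/-! ### Elimination of the near-top values, and triviality of scalar cocycles -/

section Vanishing

variable {F : Type*} [Field F] {p : ℕ} [CharP F p] {m : ℕ} [Fact p.Prime]

variable (p) in
/-- The exponent which is `p - 1` at all `x_j`, except for `p - 1 - k` at `x_i`, and `n` at `t`. -/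
noncomputable def nearTop (i : Fin m ⊕ Fin m) (k n : ℕ) : Var m →₀ ℕ :=
  Finsupp.equivFunOnFinite.symm fun v => Option.elim v n (fun j => if j = i then p - 1 - k else p - 1)

omit [Fact p.Prime] in
theorem nearTop_some (i : Fin m ⊕ Fin m) (k n : ℕ) (j : Fin m ⊕ Fin m) :
    nearTop p i k n (some j) = if j = i then p - 1 - k else p - 1 := rfl

omit [Fact p.Prime] in
theorem nearTop_none (i : Fin m ⊕ Fin m) (k n : ℕ) : nearTop p i k n none = n := rfl

omit [Fact p.Prime] in
theorem xdeg_nearTop (i : Fin m ⊕ Fin m) {k : ℕ} (n : ℕ) (hk : k < p) :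
    xdeg (nearTop p i k n) + k = 2 * m * (p - 1) :=
  xdeg_of_high hk (nearTop_some i k n)

theorem nearTop_lt (i : Fin m ⊕ Fin m) (k : ℕ) {n : ℕ} (hn : n < p) (v : Var m) :
    nearTop p i k n v < p := by
  have hpp := (Fact.out : p.Prime).pos
  rcases v with _ | j
  · exact hn
  · rw [nearTop_some]
    split_ifs <;> omega

omit [Fact p.Prime] in
theorem eq_nearTop {i : Fin m ⊕ Fin m} {k n : ℕ} {a : Var m →₀ ℕ}
    (h : ∀ j, a (some j) = if j = i then p - 1 - k else p - 1) (hn : a none = n) :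
    a = nearTop p i k n := by
  ext v
  rcases v with _ | j
  · exact hn
  · exact h j

omit [Fact p.Prime] in
theorem nearTop_add_single (i : Fin m ⊕ Fin m) {k : ℕ} (hk : k < p) :
    nearTop p i k (m % p) + Finsupp.single (some i) k = topExp p m := by
  ext v
  rcases v with _ | j
  · simp [nearTop_none, topExp_none]
  · rw [Finsupp.add_apply, nearTop_some, topExp_some, Finsupp.single_apply]
    by_cases h : i = j
    · subst h
      simp
      omega
    · simp [h, Ne.symm h]

omit [CharP F p] [Fact p.Prime] in
theorem nearTop_mem (hp : 5 ≤ p) (hm : 1 ≤ m) (i : Fin m ⊕ Fin m) {k : ℕ} (hk0 : 0 < k)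
    (hk : k < 5) (n : ℕ) : truncMonomial F p (nearTop p i k n) ∈ corePos F p m := by
  have htop : 8 ≤ 2 * m * (p - 1) :=
    Nat.mul_le_mul (show 2 ≤ 2 * m by omega) (show 4 ≤ p - 1 by omega)
  have := xdeg_nearTop i n (show k < p by omega)
  refine monomial_mem_corePos (isGood_of_xdeg_ne (by omega)) ?_
  rw [wt]
  omega

/-- This is `top_relation` for the exponent obtained from `nearTop p i 3 n` by removing one x_i and
its conjugate; ∂_t contributes the factor n = m + 1. -/
theorem IsCocycle.nearTop_relation (hp : 5 ≤ p) (hm : 1 ≤ m)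
    {Φ : Trunc F p (Var m) →ₗ[F] Trunc F p (Var m) →ₗ[F] F} (h : IsCocycle Φ) (hT : TorNormal Φ)
    (hQ : QuadZero Φ) (i : Fin m ⊕ Fin m)
    (hlow : Φ (vx F p i * vt F p m) (vt F p m * (vx F p i.swap * vt F p m ^ (p - 2))) = 0)
    {n : ℕ} (hn : n < p) (hnm : (n : F) = m + 1) :
    (m + 3 : F) * Φ (vx F p i ^ 3) (truncMonomial F p (nearTop p i 3 n)) =
      (m + 1) * Φ (vx F p i * vt F p m) (truncMonomial F p (nearTop p i 1 (n - 1))) := by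
  set c := nearTop p i 3 n - Finsupp.single (some i) 1 - Finsupp.single (some i.swap) 1 with hc
  have hsw := swap_ne i
  have hci : c (some i) = p - 5 := by
    simp [hc, nearTop_some, hsw]
    omega
  have hci' : c (some i.swap) = p - 2 := by
    simp [hc, nearTop_some, hsw]
    omega
  have hcn : c none = n := by simp [hc, nearTop_none]
  have hcj (j) (h1 : j ≠ i) (h2 : j ≠ i.swap) : c (some j) = p - 1 := by
    simp [hc, nearTop_some, h1, h2]
  have e1 : c + Finsupp.single (some i.swap) 1 + Finsupp.single (some i) 1 = nearTop p i 3 n := by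
    ext v
    rcases v with _ | j
    · simp [hcn, nearTop_none]
    · rw [Finsupp.add_apply, Finsupp.add_apply, nearTop_some]
      by_cases h1 : j = i
      · subst h1
        simp [hci, hsw]
        omega
      · by_cases h2 : j = i.swap
        · subst h2
          simp [hci', hsw]
          omega
        · simp [hcj j h1 h2, Ne.symm h2, h1]
  have e2 : c - Finsupp.single none 1 + Finsupp.single (some i.swap) 1 +
      Finsupp.single (some i) 3 = nearTop p i 1 (n - 1) := by
    ext v
    rcases v with _ | j
    · simp [hcn, nearTop_none]
    · rw [Finsupp.add_apply, Finsupp.add_apply, nearTop_some]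
      by_cases h1 : j = i
      · subst h1
        simp [hci, hsw]
        omega
      · by_cases h2 : j = i.swap
        · subst h2
          simp [hci', hsw]
          omega
        · simp [hcj j h1 h2, Ne.symm h2, h1]
  have hx := congrArg xdeg e1
  rw [xdeg_add, xdeg_add, xdeg_single_some, xdeg_single_some] at hx
  have hx' := xdeg_nearTop (p := p) i n (k := 3) (by omega)
  have := h.top_relation hp hm hT hQ i hlow (c := c)
    (fun v => by
      have := nearTop_lt (p := p) i 3 hn v
      rw [hc, Finsupp.tsub_apply, Finsupp.tsub_apply]
      omega) hci hci' (by omega) (by rw [hcn, hnm])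
  rw [mul_assoc, truncX_mul_truncMonomial, truncX_mul_truncMonomial, e1, truncDeriv_monomial, hcn,
    hnm, mul_smul_comm, mul_assoc, truncX_mul_truncMonomial, vx_pow_eq, truncMonomial_mul,
    add_comm (Finsupp.single _ 3), e2, map_smul, smul_eq_mul] at this
  rw [vx_pow_eq, this]

/-- Only one value for x_i t and one for x_i³ can survive. The coboundary with parameter c shifts
them by multiples m + 3 and m + 1 of c, so one of them can be made zero, and `nearTop_relation` then
kills the other. -/
theorem IsCocycle.exists_generators_zero (hp : 5 ≤ p) (hm : 1 ≤ m)
    {Φ : Trunc F p (Var m) →ₗ[F] Trunc F p (Var m) →ₗ[F] F} (h : IsCocycle Φ) (hT : TorNormal Φ)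
    (hQ : QuadZero Φ) (i : Fin m ⊕ Fin m)
    (hlow : Φ (vx F p i * vt F p m) (vt F p m * (vx F p i.swap * vt F p m ^ (p - 2))) = 0) :
    ∃ c : F, (∀ g ∈ corePos F p m,
        (Φ - cob (c • truncCoeff (F := F) (topExp p m))) (vx F p i * vt F p m) g = 0) ∧
      ∀ g ∈ corePos F p m, (Φ - cob (c • truncCoeff (F := F) (topExp p m))) (vx F p i ^ 3) g = 0 := by
  classical
  have h2 := two_ne_zero_of_le (F := F) hp
  have hpp : p.Prime := Fact.out
  have htop : 8 ≤ 2 * m * (p - 1) :=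
    Nat.mul_le_mul (show 2 ≤ 2 * m by omega) (show 4 ≤ p - 1 by omega)
  have hmp : m % p < p := Nat.mod_lt _ hpp.pos
  have hmc : ((m % p : ℕ) : F) = m := (CharP.cast_eq_mod F p m).symm
  have hsub (c : F) : IsCocycle (Φ - cob (c • truncCoeff (F := F) (topExp p m))) := h.sub_cob hp _
  have hTc (c : F) : TorNormal (Φ - cob (c • truncCoeff (F := F) (topExp p m))) := fun k g hg => by
    rw [LinearMap.sub_apply, LinearMap.sub_apply, hT k g hg, cob_topExp_torNormal hp c k g hg,
      sub_zero]
  have hQc (c : F) : QuadZero (Φ - cob (c • truncCoeff (F := F) (topExp p m))) := fun j k g hg => by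
    rw [LinearMap.sub_apply, LinearMap.sub_apply, hQ j k g hg, cob_topExp_quadZero hp hm c j k g hg,
      sub_zero]
  have hlc (c : F) : (Φ - cob (c • truncCoeff (F := F) (topExp p m))) (vx F p i * vt F p m)
      (vt F p m * (vx F p i.swap * vt F p m ^ (p - 2))) = 0 := by
    have h5 : vt F p m * (vx F p i.swap * vt F p m ^ (p - 2)) ∈ bi F p m 1 (p - 2 + 1) :=
      vt_mul_mem_bi (vx_mul_mem_bi i.swap (vt_pow_mem_bi (p - 2)))
    rw [LinearMap.sub_apply, LinearMap.sub_apply, hlow,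
      cob_topExp_vx_vt hp hm c i (Or.inl (by omega)) h5, truncCoeff_bi topExp_lt
      (by rw [xdeg_topExp]; omega) (vx_mul_mem_bi i h5)]
    simp
  have hxt (c : F) (h0 : (Φ - cob (c • truncCoeff (F := F) (topExp p m))) (vx F p i * vt F p m)
      (truncMonomial F p (nearTop p i 1 (m % p))) = 0) (g) (hg : g ∈ corePos F p m) :
      (Φ - cob (c • truncCoeff (F := F) (topExp p m))) (vx F p i * vt F p m) g = 0 := by
    refine corePos_ext (u := (Φ - cob (c • truncCoeff (F := F) (topExp p m))) (vx F p i * vt F p m)) (w := 0)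
      (fun a ha hgood ha2 => ?_) hg
    by_contra hne
    obtain ⟨h5, h6⟩ := (hsub c).vx_vt_support hp hm (hTc c) (hQc c) i ha hgood ha2 (hlc c) hne
    rw [eq_nearTop h5 (natCast_inj_of_lt (F := F) (ha none) hmp (by rw [h6, hmc])), h0] at hne
    exact hne rfl
  have hx3 (c : F) (h0 : ∀ n < p, (n : F) = m + 1 → (Φ - cob (c • truncCoeff (F := F) (topExp p m)))
      (vx F p i ^ 3) (truncMonomial F p (nearTop p i 3 n)) = 0) (g) (hg : g ∈ corePos F p m) :
      (Φ - cob (c • truncCoeff (F := F) (topExp p m))) (vx F p i ^ 3) g = 0 := by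
    refine corePos_ext (u := (Φ - cob (c • truncCoeff (F := F) (topExp p m))) (vx F p i ^ 3)) (w := 0)
      (fun a ha hgood ha2 => ?_) hg
    by_contra hne
    obtain ⟨h5, h6⟩ := (hsub c).cube_support hp hm (hTc c) (hQc c) i ha hgood ha2 hne
    rw [eq_nearTop h5 rfl, h0 _ (ha none) h6] at hne
    exact hne rfl
  have hd1 := xdeg_nearTop (p := p) i (m % p) (k := 1) (by omega)
  have hc1 := cast_top_xdeg F (p := p) (m := m)
  -- If m + 3 = 0, then m + 1 = -2 is invertible and the cubic value is removed; otherwise the value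
  -- for x_i t is removed.
  by_cases h3 : (m + 3 : F) = 0
  · have h1 : (m + 1 : F) ≠ 0 := by
      intro h5
      apply h2
      linear_combination h3 - h5
    have hn : m % p + 1 < p := by
      by_contra! h5
      apply h1
      rw [← hmc]
      have : m % p + 1 = p := by omega
      exact_mod_cast (congrArg (Nat.cast : ℕ → F) this).trans (CharP.cast_eq_zero F p)
    have hnm : ((m % p + 1 : ℕ) : F) = m + 1 := by rw [Nat.cast_add, hmc, Nat.cast_one]
    have hd3 := xdeg_nearTop (p := p) i (m % p + 1) (k := 3) (by omega)
    set c := (m + 1 : F)⁻¹ * Φ (vx F p i ^ 3) (truncMonomial F p (nearTop p i 3 (m % p + 1)))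
      with hcdef
    have e1 : nearTop p i 3 (m % p + 1) - Finsupp.single none 1 = nearTop p i 3 (m % p) := by
      ext v
      rcases v with _ | j
      · simp [nearTop_none]
      · simp [nearTop_some]
    have h0 : ∀ n < p, (n : F) = m + 1 → (Φ - cob (c • truncCoeff (F := F) (topExp p m)))
        (vx F p i ^ 3) (truncMonomial F p (nearTop p i 3 n)) = 0 := by
      intro n hnp hnm'
      rw [natCast_inj_of_lt (F := F) hnp hn (hnm'.trans hnm.symm), LinearMap.sub_apply,
        LinearMap.sub_apply, cob_topExp_cube hp hm c i (Or.inl (by omega)) (monomial_mem_bi _),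
        truncDeriv_monomial, nearTop_none, hnm, e1, mul_smul_comm, vx_pow_eq, truncMonomial_mul,
        add_comm (Finsupp.single _ 3), nearTop_add_single i (by omega), map_smul,
        truncCoeff_monomial topExp_lt, if_pos rfl, ← vx_pow_eq, hcdef, smul_eq_mul]
      field_simp
      ring
    refine ⟨c, hxt c ?_, hx3 c h0⟩
    have h5 := (hsub c).nearTop_relation hp hm (hTc c) (hQc c) i (hlc c) hn hnm
    rw [h3, zero_mul, Nat.add_sub_cancel] at h5
    exact (mul_eq_zero.mp h5.symm).resolve_left h1
  · set c := (m + 3 : F)⁻¹ * Φ (vx F p i * vt F p m) (truncMonomial F p (nearTop p i 1 (m % p)))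
      with hcdef
    have h0 := hxt c (by
      rw [LinearMap.sub_apply, LinearMap.sub_apply,
        cob_topExp_vx_vt hp hm c i (Or.inl (by omega)) (monomial_mem_bi _),
        truncX_mul_truncMonomial, nearTop_add_single i (by omega), truncCoeff_monomial topExp_lt,
        if_pos rfl, nearTop_none, hmc, hcdef]
      have : (xdeg (nearTop p i 1 (m % p)) : F) = - (2 * m) - 1 := by
        rw [← hc1, ← hd1]
        push_cast
        ring
      rw [this]
      field_simp
      ring)
    refine ⟨c, h0, hx3 c fun n hn hnm => ?_⟩
    have h5 := (hsub c).nearTop_relation hp hm (hTc c) (hQc c) i (hlc c) hn hnm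
    rw [h0 _ (nearTop_mem hp hm i (by omega) (by omega) _), mul_zero] at h5
    exact (mul_eq_zero.mp h5).resolve_left h3

theorem cob_add (η η' : Trunc F p (Var m) →ₗ[F] F) : cob (η + η') = cob η + cob η' := by
  refine LinearMap.ext₂ fun f g => ?_
  simp only [cob_apply, LinearMap.add_apply]
  ring

/-- The pair commutes, since x_i·x_i^(p-1) = 0, and λ vanishes on both members. So this value is a
cohomological invariant and is unchanged by every normalization. -/
theorem cob_vx_vt_pow (hp : 5 ≤ p) (η : Trunc F p (Var m) →ₗ[F] F) (i : Fin m ⊕ Fin m) :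
    cob η (vx F p i * vt F p m) (vx F p i ^ (p - 1)) = 0 := by
  rw [cob_apply, lam_bi hp (vx_mul_vt_mem_bi i) (Or.inl (by omega)),
    lam_bi hp (vx_pow_mem_bi i (p - 1)) (Or.inl (by omega)), contactHom_apply,
    bracket_vx_vt_bi i (vx_pow_mem_bi i (p - 1)), Derivation.leibniz_pow, ham_self, ← pow_succ',
    vx_pow_eq i (p - 1 + 1), truncMonomial_eq_zero (i := some i) (by simp; omega)]
  simp

theorem cob_vt_sq_pow (hp : 5 ≤ p) (η : Trunc F p (Var m) →ₗ[F] F) :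
    cob η (vt F p m ^ 2) (vt F p m ^ (p - 1)) = 0 := by
  rw [cob_apply, lam_bi hp (vt_pow_mem_bi 2) (Or.inr (by omega)),
    lam_bi hp (vt_pow_mem_bi (p - 1)) (Or.inr (by omega)), contactHom_apply,
    bracket_vt_sq_bi (vt_pow_mem_bi (p - 1)), ← pow_succ', vt_pow_eq (p - 1 + 1),
    truncMonomial_eq_zero (i := none) (by simp; omega)]
  simp

/-- A scalar `2`-cocycle of the subalgebra of nonnegative degree on which the functionals
`Φ (x_i t) (x_i ^ (p - 1))` and `Φ (t ^ 2) (t ^ (p - 1))` vanish is a coboundary. -/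
theorem IsCocycle.exists_eq_cob (hp : 5 ≤ p) (hm : 1 ≤ m)
    {Φ : Trunc F p (Var m) →ₗ[F] Trunc F p (Var m) →ₗ[F] F} (h : IsCocycle Φ)
    (hρ : ∀ i, Φ (vx F p i * vt F p m) (vx F p i ^ (p - 1)) = 0)
    (hσ : Φ (vt F p m ^ 2) (vt F p m ^ (p - 1)) = 0) :
    ∃ η, ∀ f ∈ corePos F p m, ∀ g ∈ corePos F p m, Φ f g = cob η f g := by
  -- Each correction preserves the conditions still needed from the previous ones, and none changes
  -- the values in `hρ` and `hσ`; those are consumed at the quadratic stage and at `vx_vt_low`.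
  obtain ⟨η₁, h1⟩ := exists_torNormal hp hm h
  have k1 := h.sub_cob hp η₁
  obtain ⟨η₂, h2, h2'⟩ := k1.exists_sqNormal hp hm h1
  have k2 := k1.sub_cob hp η₂
  obtain ⟨η₃, h3⟩ := k2.exists_quadNormal hp hm h2 h2' (fun i => by
    simp only [LinearMap.sub_apply, cob_vx_vt_pow hp, hρ, sub_zero])
  have k3 := k2.sub_cob hp η₃
  set i : Fin m ⊕ Fin m := Sum.inl ⟨0, hm⟩
  obtain ⟨c, h4, h4'⟩ := k3.exists_generators_zero hp hm h3.tor h3.quad i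
    (k3.vx_vt_low hp hm h3.toSqNormal (by
      simp only [LinearMap.sub_apply, cob_vt_sq_pow hp, hσ, sub_zero]) i)
  have k4 := k3.sub_cob hp (c • truncCoeff (F := F) (topExp p m))
  refine ⟨η₁ + η₂ + η₃ + c • truncCoeff (topExp p m), fun f hf g hg => ?_⟩
  have h5 := k4.eq_zero_of_generators hp hm (fun k g hg => by
    rw [LinearMap.sub_apply, LinearMap.sub_apply, h3.tor k g hg, cob_topExp_torNormal hp c k g hg,
      sub_zero]) (fun j k g hg => by
    rw [LinearMap.sub_apply, LinearMap.sub_apply, h3.quad j k g hg,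
      cob_topExp_quadZero hp hm c j k g hg, sub_zero]) i h4 h4' hf hg
  simp only [LinearMap.sub_apply] at h5
  simp only [cob_add, LinearMap.add_apply]
  linear_combination h5

end Vanishing
end Contact

namespace Contact

/-! ### Divided power series as a module over the contact algebra -/

section DivPowModule

open DivPow

variable {F : Type*} [Field F] {p : ℕ} [CharP F p] {m : ℕ} [Fact p.Prime]

variable (F m) in
/-- The operator `∂ / ∂ x_i` on divided power series. -/
noncomputable abbrev dpd (i : Var m) : DivPow F (Var m) →ₗ[F] DivPow F (Var m) :=
  shift (Finsupp.single i 1)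

theorem trunc_zero_smul (v : DivPow F (Var m)) : (0 : Trunc F p (Var m)) • v = 0 :=
  zero_smul (Trunc F p (Var m)) v

variable (F p) in
/-- Multiplication by a truncated polynomial on divided power series. -/
noncomputable def mulDP : Trunc F p (Var m) →ₗ[F] DivPow F (Var m) →ₗ[F] DivPow F (Var m) :=
  LinearMap.mk₂ F (fun f v => f • v) add_smul smul_assoc smul_add
    (fun c f v => trunc_smul_smul f c v)

variable (F p m) in
/-- The Euler operator on divided power series. -/
noncomputable def dpEuler : DivPow F (Var m) →ₗ[F] DivPow F (Var m) :=
  ∑ i : Var m, mulDP F p (truncX F p i) ∘ₗ dpd F m i +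
    mulDP F p (truncX F p none) ∘ₗ dpd F m none

theorem dpEuler_apply (v : DivPow F (Var m)) : dpEuler F p m v =
    ∑ i : Var m, (truncX F p i : Trunc F p (Var m)) • dpd F m i v +
      (truncX F p none : Trunc F p (Var m)) • dpd F m none v := by
  rw [dpEuler, LinearMap.add_apply, LinearMap.sum_apply]
  rfl

theorem dpEuler_smul (f : Trunc F p (Var m)) (v : DivPow F (Var m)) :
    dpEuler F p m (f • v) = eulerDeriv F p m f • v + f • dpEuler F p m v := by
  simp only [dpEuler_apply, eulerDeriv_apply, shift_smul, smul_add, Finset.sum_add_distrib,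
    add_smul, Finset.sum_smul, Finset.smul_sum, mul_smul, smul_comm f]
  abel

theorem dpEuler_dpd (i : Var m) (v : DivPow F (Var m)) :
    dpd F m i (dpEuler F p m v) = dpEuler F p m (dpd F m i v) + dpd F m i v +
      if i = none then dpd F m i v else 0 := by
  classical
  simp only [dpEuler_apply, map_add, map_sum, shift_smul, truncDeriv_X, Finset.sum_add_distrib,
    ite_smul, one_smul, trunc_zero_smul, shift_comm (Finsupp.single i 1)]
  rw [Finset.sum_ite_eq]
  simp only [Finset.mem_univ, if_true]
  split_ifs with h
  · subst h; abel
  · abel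

variable (F p m) in
/-- The contact action on divided power series. -/
noncomputable def act : Trunc F p (Var m) →ₗ[F] DivPow F (Var m) →ₗ[F] DivPow F (Var m) :=
  LinearMap.mk₂ F
    (fun f v => moduleBracket (fun i : Fin m => truncDeriv F p (some (Sum.inl i)))
      (fun i : Fin m => truncDeriv F p (some (Sum.inr i)))
      (fun i : Fin m => dpd F m (some (Sum.inl i))) (fun i : Fin m => dpd F m (some (Sum.inr i)))
      (truncDeriv F p none) (eulerDeriv F p m) (dpd F m none) (dpEuler F p m) f v)
    (fun f f' v => by
      simp only [moduleBracket, map_add, add_smul, mul_add, sub_smul, Finset.sum_add_distrib,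
        Finset.sum_sub_distrib]
      abel)
    (fun c f v => by
      simp only [moduleBracket, Derivation.map_smul, mul_smul_comm, ← smul_sub, smul_assoc,
        ← Finset.smul_sum, ← smul_add])
    (fun f v v' => by
      simp only [moduleBracket, map_add, smul_add, smul_sub, Finset.sum_add_distrib,
        Finset.sum_sub_distrib]
      abel)
    (fun c f v => by
      simp only [moduleBracket, map_smul, trunc_smul_smul, ← smul_sub, ← Finset.smul_sum,
        ← smul_add])

theorem act_apply (f : Trunc F p (Var m)) (v : DivPow F (Var m)) : act F p m f v =
    ∑ i : Fin m, (truncDeriv F p (some (Sum.inl i)) f • dpd F m (some (Sum.inr i)) v -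
      truncDeriv F p (some (Sum.inr i)) f • dpd F m (some (Sum.inl i)) v) +
      (truncDeriv F p none f • (dpEuler F p m v - (2 : Trunc F p (Var m)) • v) -
        (eulerDeriv F p m f - 2 * f) • dpd F m none v) := rfl

/-- The partial derivatives and the Euler operator on series satisfy the product rules and
commutation relations of those on A(n), so `moduleBracket_leibniz` applies. -/
theorem act_contactHom (f g : Trunc F p (Var m)) (v : DivPow F (Var m)) :
    act F p m (contactHom F p m f g) v =
      act F p m f (act F p m g v) - act F p m g (act F p m f v) := by
  rw [eq_sub_iff_add_eq]
  refine (moduleBracket_leibniz (fun i => shift_smul _) (fun i => shift_smul _) (shift_smul _)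
    dpEuler_smul (fun _ _ => truncDeriv_comm F p _ _) (fun _ _ => shift_comm _ _)
    (fun _ _ => truncDeriv_comm F p _ _) (fun _ _ => shift_comm _ _)
    (fun _ _ => truncDeriv_comm F p _ _) (fun _ _ => shift_comm _ _)
    (fun _ => truncDeriv_comm F p _ _) (fun _ => shift_comm _ _)
    (fun _ => truncDeriv_comm F p _ _) (fun _ => shift_comm _ _)
    (fun _ => euler_truncDeriv_some F p m _) (fun i v => ?_)
    (fun _ => euler_truncDeriv_some F p m _) (fun i v => ?_) (truncDeriv_none_euler F p m)
    (fun v => ?_) f g v).symm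
  · rw [dpEuler_dpd]; simp
  · rw [dpEuler_dpd]; simp
  · rw [dpEuler_dpd, if_pos rfl, two_smul]; abel

theorem ofTrunc_euler (f : Trunc F p (Var m)) : ofTrunc F p (Var m) (eulerDeriv F p m f) =
    dpEuler F p m (ofTrunc F p (Var m) f) := by
  rw [eulerDeriv_apply, dpEuler_apply, map_add, map_sum]
  simp only [ofTrunc_mul, ofTrunc_deriv]

theorem ofTrunc_contactHom (f g : Trunc F p (Var m)) :
    ofTrunc F p (Var m) (contactHom F p m f g) = act F p m f (ofTrunc F p (Var m) g) := by
  rw [contactHom_apply, contactBracket, bracket, poisson, act_apply,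
    mul_comm (truncDeriv F p none g)]
  simp only [map_add, map_sub, map_sum, ofTrunc_mul, ofTrunc_deriv, ofTrunc_euler]

theorem act_one (v : DivPow F (Var m)) : act F p m 1 v = (2 : F) • dpd F m none v := by
  rw [act_apply]
  simp only [Derivation.map_one_eq_zero, trunc_zero_smul, sub_zero, Finset.sum_const_zero]
  rw [zero_add, zero_sub, zero_sub, mul_one, neg_smul, neg_neg, two_smul, two_smul]

theorem act_vx (i : Fin m ⊕ Fin m) (v : DivPow F (Var m)) : act F p m (vx F p i) v =
    sgn F i • dpd F m (some i.swap) v + vx F p i • dpd F m none v := by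
  classical
  rw [act_apply, dt_vx, euler_vx]
  simp only [truncDeriv_X, trunc_zero_smul, zero_sub, Option.some.injEq]
  congr 1
  · rcases i with i | i
    · simp [sgn, ite_smul, trunc_zero_smul]
    · simp [sgn, ite_smul, trunc_zero_smul]
  · rw [← neg_smul]
    congr 1
    ring

theorem smul_apply_zero (f : Trunc F p (Var m)) (v : DivPow F (Var m)) :
    (f • v) 0 = ofTrunc F p (Var m) f 0 * v 0 := by
  classical
  induction f using trunc_induction with
  | add f g hf hg => rw [add_smul, map_add, DivPow.add_apply, hf, hg, DivPow.add_apply, add_mul]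
  | smul c f hf => rw [smul_assoc, map_smul, DivPow.smul_apply, hf, DivPow.smul_apply, mul_assoc]
  | mono a =>
    rw [truncMonomial_smul, ofTrunc_monomial, monoAct_apply]
    by_cases h : a = 0
    · subst h; simp
    · rw [if_neg (Ne.symm h), descFact_eq_zero (fun h' => h (le_antisymm h' zero_le))]
      simp

/-- In nonnegative degree every coefficient of the action vanishes at the origin, except the
multiple -2 from ∂f/∂t(0). So the constant term is an equivariant map to λ, which makes this the
coinduced module. -/
theorem act_apply_zero (hp : 5 ≤ p) {f : Trunc F p (Var m)} (hf : f ∈ corePos F p m)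
    (v : DivPow F (Var m)) : act F p m f v 0 = lam F p m f * v 0 := by
  classical
  have hwz : wt (0 : Var m →₀ ℕ) = 0 := by simp [wt, xdeg]
  have hws (i : Fin m ⊕ Fin m) : wt (Finsupp.single (some i : Var m) 1) = 1 := by
    simp [wt]
  refine corePos_induction (P := fun f => act F p m f v 0 = lam F p m f * v 0) hf
    (fun a ha hgood h2 => ?_) (by simp) (fun f g hf hg => ?_) (fun c f hf => ?_)
  rotate_left
  · rw [map_add, LinearMap.add_apply, DivPow.add_apply, hf, hg, map_add, add_mul]
  · rw [map_smul, LinearMap.smul_apply, DivPow.smul_apply, hf, map_smul, smul_eq_mul, mul_assoc]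
  · have h1 (i : Fin m ⊕ Fin m) : ofTrunc F p (Var m) (truncDeriv F p (some i)
        (truncMonomial F p a)) 0 = 0 := by
      rw [ofTrunc_deriv, shift_apply, zero_add, ofTrunc_monomial, if_neg]
      rintro rfl
      rw [hws] at h2
      omega
    have h0 : ofTrunc F p (Var m) (truncMonomial F p a) 0 = 0 := by
      rw [ofTrunc_monomial, if_neg]
      rintro rfl
      rw [hwz] at h2
      omega
    have h3 : eulerDeriv F p m (truncMonomial F p a) - 2 * truncMonomial F p a =
        (wt a - 2 : F) • truncMonomial F p a := by
      rw [← bracket_vt, ← contactHom_apply, contactHom_vt_monomial]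
    have h4 : (dpEuler F p m v) 0 = 0 := by
      rw [dpEuler_apply, DivPow.add_apply, DivPow.sum_apply]
      have (i : Var m) (w : DivPow F (Var m)) : (truncX F p i • w) 0 = 0 := by
        rw [smul_apply_zero, truncX_eq, ofTrunc_monomial, if_neg, zero_mul]
        intro h
        have := DFunLike.congr_fun h i
        simp at this
      simp [this]
    have h5 : ((2 : Trunc F p (Var m)) • v) 0 = 2 * v 0 := by
      rw [two_smul, DivPow.add_apply, two_mul]
    have h6 : ofTrunc F p (Var m) (truncDeriv F p none (truncMonomial F p a)) 0 =
        if a = Finsupp.single none 1 then 1 else 0 := by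
      rw [ofTrunc_deriv, shift_apply, zero_add, ofTrunc_monomial]
      simp only [eq_comm (a := a)]
      split_ifs with h
      · rw [← h]
        have : descFact (Finsupp.single (none : Var m) 1) (Finsupp.single none 1) = 1 := by
          rw [descFact]
          refine Finset.prod_eq_one fun i _ => ?_
          rw [Finsupp.single_apply]
          split_ifs <;> simp
        rw [this, Nat.cast_one]
      · rfl
    rw [act_apply, DivPow.add_apply, DivPow.sum_apply]
    simp only [DivPow.sub_apply, smul_apply_zero, h1, h3, map_smul, DivPow.smul_apply, h0, h6, h4, h5]
    rw [lam_monomial hp]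
    split_ifs <;> simp

-- A falling factorial is a polynomial in its argument, so in F it is unchanged when the argument is
-- shifted by p.
omit [CharP F p] [Fact p.Prime] in
theorem cast_descFact_add [CharP F p] (c a : Var m →₀ ℕ) (i : Var m) :
    (descFact (c + Finsupp.single i p) a : F) = descFact c a := by
  rw [descFact, descFact, Nat.cast_prod, Nat.cast_prod]
  refine Finset.prod_congr rfl fun j _ => ?_
  rw [← descPochhammer_eval_eq_descFactorial, ← descPochhammer_eval_eq_descFactorial,
    Finsupp.add_apply, Nat.cast_add, Finsupp.single_apply]
  congr 1
  split_ifs <;> simp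

/-- ∂_i^p is linear over truncated polynomials: it is the p-th power of a derivation and kills the
coefficients. It therefore commutes with the contact action. -/
theorem shift_prime_smul (i : Var m) (f : Trunc F p (Var m)) (v : DivPow F (Var m)) :
    shift (Finsupp.single i p) (f • v) = f • shift (Finsupp.single i p) v := by
  induction f using trunc_induction with
  | add f g hf hg => rw [add_smul, map_add, hf, hg, add_smul]
  | smul c f hf => rw [smul_assoc, map_smul, hf, smul_assoc]
  | mono a =>
    rw [truncMonomial_smul, truncMonomial_smul]
    ext c
    rw [shift_apply, monoAct_apply, monoAct_apply, cast_descFact_add, shift_apply]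
    by_cases h : a ≤ c
    · rw [tsub_add_eq_add_tsub h]
    · rw [descFact_eq_zero h]; simp

theorem shift_prime_act (i : Var m) (f : Trunc F p (Var m)) (v : DivPow F (Var m)) :
    shift (Finsupp.single i p) (act F p m f v) = act F p m f (shift (Finsupp.single i p) v) := by
  simp only [act_apply, dpEuler_apply, map_add, map_sub, map_sum, shift_prime_smul,
    shift_comm (Finsupp.single i p)]

omit [CharP F p] [Fact p.Prime] in
/-- Integration of divided power series: a compatible family of prescribed derivatives `∂_i ^ q`,
`i ∈ S`, and a constant term determine a series. -/
theorem exists_shift_eq {ι : Type*} (S : Set ι) {q : ℕ} (hq : 0 < q) (g : ι → DivPow F ι)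
    (hg : ∀ i ∈ S, ∀ j ∈ S, shift (Finsupp.single i q) (g j) = shift (Finsupp.single j q) (g i))
    (e : F) : ∃ v : DivPow F ι, (∀ i ∈ S, shift (Finsupp.single i q) v = g i) ∧ v 0 = e := by
  classical
  -- A coefficient with c_i ≥ q is read off from g_i; the compatibility condition makes the choice
  -- of i immaterial. Coefficients below every threshold are free, and only the constant one is
  -- prescribed.
  refine ⟨fun c => if h : ∃ i ∈ S, q ≤ c i then g h.choose (c - Finsupp.single h.choose q)
    else if c = 0 then e else 0, fun i hi => ?_, ?_⟩
  · ext c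
    have h : ∃ j ∈ S, q ≤ (c + Finsupp.single i q) j := ⟨i, hi, by simp⟩
    change (if h : ∃ j ∈ S, q ≤ (c + Finsupp.single i q) j then _ else _ : F) = _
    rw [dif_pos h]
    obtain ⟨h1, h2⟩ := h.choose_spec
    set j := h.choose
    by_cases hij : i = j
    · rw [← hij, add_tsub_cancel_right]
    · have h3 : q ≤ c j := by simpa [Finsupp.single_apply, hij] using h2
      have h4 : c = c - Finsupp.single j q + Finsupp.single j q :=
        (tsub_add_cancel_of_le (Finsupp.single_le_iff.mpr h3)).symm
      have h5 := congrArg (fun w : DivPow F ι => w (c - Finsupp.single j q)) (hg i hi j h1)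
      simp only [shift_apply] at h5
      rw [← h4] at h5
      rw [← h5, tsub_add_eq_add_tsub (Finsupp.single_le_iff.mpr h3)]
  · change (if h : ∃ j ∈ S, q ≤ (0 : ι →₀ ℕ) j then _ else _ : F) = _
    rw [dif_neg, if_pos rfl]
    rintro ⟨i, -, h⟩
    simp at h
    omega

end DivPowModule
end Contact

namespace Contact

/-! ### Integration of the action of 1 and the x_i -/

section VectorCocycles

open DivPow

variable {F : Type*} [Field F] {p : ℕ} [CharP F p] {m : ℕ} [Fact p.Prime]

omit [CharP F p] [Fact p.Prime] in
theorem contactHom_one_vx [CharP F p] (i : Fin m ⊕ Fin m) : contactHom F p m 1 (vx F p i) = 0 := by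
  rw [contactHom_apply, bracket_one, dt_vx, mul_zero]

omit [Fact p.Prime] in
theorem contactHom_vx_vx (i j : Fin m ⊕ Fin m) :
    contactHom F p m (vx F p i) (vx F p j) = omega F i j • 1 := by
  rw [contactHom_apply, bracket_vx, dt_vx, mul_zero, add_zero, ham_vx]

omit [CharP F p] [Fact p.Prime] in
theorem wt_sub_none_add {a : Var m →₀ ℕ} (h : a none ≠ 0) :
    wt (a - Finsupp.single none 1) + 2 = wt a := by
  have h1 : a - Finsupp.single none 1 + Finsupp.single none 1 = a :=
    tsub_add_cancel_of_le (by rw [Finsupp.single_le_iff]; omega)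
  conv_rhs => rw [← h1, wt_add]
  simp [wt]

omit [CharP F p] [Fact p.Prime] in
theorem wt_sub_some_add {a : Var m →₀ ℕ} {i : Fin m ⊕ Fin m} (h : a (some i) ≠ 0) :
    wt (a - Finsupp.single (some i) 1) + 1 = wt a := by
  have h1 : a - Finsupp.single (some i) 1 + Finsupp.single (some i) 1 = a :=
    tsub_add_cancel_of_le (by rw [Finsupp.single_le_iff]; omega)
  conv_rhs => rw [← h1, wt_add]
  simp [wt]

omit [CharP F p] [Fact p.Prime] in
theorem eq_of_wt_lt_two {a : Var m →₀ ℕ} (h : wt a < 2) :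
    a = 0 ∨ ∃ i, a = Finsupp.single (some i) 1 := by
  have hn : a none = 0 := by rw [wt] at h; omega
  by_cases h0 : ∃ i, a (some i) ≠ 0
  · obtain ⟨i, hi⟩ := h0
    right
    refine ⟨i, ?_⟩
    have h1 : a - Finsupp.single (some i) 1 + Finsupp.single (some i) 1 = a :=
      tsub_add_cancel_of_le (by rw [Finsupp.single_le_iff]; omega)
    have h2 := wt_sub_some_add hi
    have h3 : wt (a - Finsupp.single (some i) 1) = 0 := by omega
    rw [wt, xdeg] at h3
    have h4 : a - Finsupp.single (some i) 1 = 0 := by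
      ext v
      rcases v with _ | j
      · simp [hn]
      · have h5 : ∑ i_1, (a - Finsupp.single (some i) 1 : Var m →₀ ℕ) (some i_1) = 0 := by omega
        rw [Finset.sum_eq_zero_iff] at h5
        exact h5 j (Finset.mem_univ j)
    rw [h4, zero_add] at h1
    exact h1.symm
  · left
    push Not at h0
    ext v
    rcases v with _ | j
    · exact hn
    · exact h0 j

omit [CharP F p] [Fact p.Prime] in
theorem core_le_of {R : Submodule F (Trunc F p (Var m))} (h1 : 1 ∈ R) (hx : ∀ i, vx F p i ∈ R)
    (hpos : corePos F p m ≤ R) : core F p m ≤ R := by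
  rw [core, Submodule.span_le]
  rintro _ ⟨a, ha, rfl⟩
  by_cases h : 2 ≤ wt a
  · exact hpos (monomial_mem_corePos ha h)
  · rcases eq_of_wt_lt_two (not_le.mp h) with rfl | ⟨i, rfl⟩
    · rw [truncMonomial_zero]; exact h1
    · exact hx i

theorem dpd_none_eq (hp : 5 ≤ p) (v : DivPow F (Var m)) :
    dpd F m none v = (2 : F)⁻¹ • act F p m 1 v := by
  rw [act_one, smul_smul, inv_mul_cancel₀ (two_ne_zero_of_le hp), one_smul]

/-- A set of divided power series without constant terms that is stable under `1` and the `x_i`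
is zero. -/
theorem eq_zero_of_stable (hp : 5 ≤ p) {S : Set (DivPow F (Var m))}
    (h1 : ∀ w ∈ S, act F p m 1 w ∈ Submodule.span F S)
    (hx : ∀ i, ∀ w ∈ S, act F p m (vx F p i) w ∈ Submodule.span F S) (h0 : ∀ w ∈ S, w 0 = 0)
    {w : DivPow F (Var m)} (hw : w ∈ S) : w = 0 := by
  set W := Submodule.span F S with hW
  have h1' : W ≤ W.comap (act F p m 1) := Submodule.span_le.mpr h1
  have hx' (i) : W ≤ W.comap (act F p m (vx F p i)) := Submodule.span_le.mpr (hx i)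
  have h0' : W ≤ LinearMap.ker (evalAt 0) := Submodule.span_le.mpr h0
  have hd (u) (hu : u ∈ W) : dpd F m none u ∈ W := by
    rw [dpd_none_eq (p := p) hp]
    exact W.smul_mem _ (h1' hu)
  -- Induction on the weight of the exponent. The action of 1 is 2∂_t, and that of the conjugate of
  -- x_i is ±∂_i plus a term in ∂_t; each reduces a coefficient to coefficients of lower weight of
  -- other members of the span.
  have key (k : ℕ) : ∀ c : Var m →₀ ℕ, wt c = k → ∀ u ∈ W, u c = 0 := by
    induction k using Nat.strong_induction_on with
    | _ k ih =>
      intro c hc u hu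
      by_cases hn : c none = 0
      · by_cases h5 : ∃ i, c (some i) ≠ 0
        · obtain ⟨i, hi⟩ := h5
          have h6 := wt_sub_some_add hi
          have h7 : u c = dpd F m (some i) u (c - Finsupp.single (some i) 1) := by
            rw [shift_apply, tsub_add_cancel_of_le (by rw [Finsupp.single_le_iff]; omega)]
          have h8 := ih _ (by omega) (c - Finsupp.single (some i) 1) rfl _ (hx' i.swap hu)
          rw [act_vx, Sum.swap_swap, DivPow.add_apply, DivPow.smul_apply, ← h7, vx_eq,
            truncMonomial_smul, monoAct_apply] at h8
          by_cases h9 : (c - Finsupp.single (some i) 1 : Var m →₀ ℕ) (some i.swap) = 0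
          · rw [descFact_eq_zero (by rw [Finsupp.single_le_iff]; omega)] at h8
            simpa [sgn_ne_zero] using h8
          · have h10 := wt_sub_some_add h9
            rw [ih _ (by omega) _ rfl _ (hd u hu), mul_zero, add_zero] at h8
            exact (mul_eq_zero.mp h8).resolve_left (sgn_ne_zero _)
        · have : c = 0 := by
            push Not at h5
            ext v
            rcases v with _ | j
            · exact hn
            · exact h5 j
          rw [this]
          exact h0' hu
      · have h6 := wt_sub_none_add hn
        have h7 := ih _ (by omega) (c - Finsupp.single none 1) rfl _ (hd u hu)
        rwa [shift_apply, tsub_add_cancel_of_le (by rw [Finsupp.single_le_iff]; omega)] at h7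
  ext c
  exact key _ c rfl w (Submodule.subset_span hw)

/-- Integration with respect to the action of `1` and the `x_i`, `i ∈ S`. -/
theorem exists_act_eq (hp : 5 ≤ p) (S : Set (Fin m ⊕ Fin m)) (g₁ : DivPow F (Var m))
    (g : Fin m ⊕ Fin m → DivPow F (Var m))
    (h1 : ∀ i ∈ S, act F p m 1 (g i) = act F p m (vx F p i) g₁)
    (h2 : ∀ i ∈ S, ∀ j ∈ S, act F p m (vx F p i) (g j) - act F p m (vx F p j) (g i) =
      omega F i j • g₁) (e : F) :
    ∃ v, act F p m 1 v = g₁ ∧ (∀ i ∈ S, act F p m (vx F p i) v = g i) ∧ v 0 = e := by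
  classical
  have two := two_ne_zero_of_le (F := F) hp
  set ht := (2 : F)⁻¹ • g₁ with hht
  have hg1 : g₁ = (2 : F) • ht := by rw [hht, smul_smul, mul_inv_cancel₀ two, one_smul]
  have hDg (i) (hi : i ∈ S) :
      dpd F m none (g i) = sgn F i • dpd F m (some i.swap) ht + vx F p i • dpd F m none ht := by
    have := h1 i hi
    rw [act_one, act_vx, hg1] at this
    simp only [map_smul, trunc_smul_smul, smul_comm (sgn F i)] at this
    rw [← smul_add] at this
    exact smul_right_injective _ two this
  have hxD (i j : Fin m ⊕ Fin m) (w : DivPow F (Var m)) : dpd F m (some j) (vx F p i • w) =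
      (if j = i then (1 : F) else 0) • w + vx F p i • dpd F m (some j) w := by
    rw [shift_smul, truncDeriv_X]
    congr 1
    by_cases h : j = i
    · simp [h]
    · simp [h, trunc_zero_smul]
  have hxT (i : Fin m ⊕ Fin m) (w : DivPow F (Var m)) : dpd F m none (vx F p i • w) =
      vx F p i • dpd F m none w := by
    rw [shift_smul, dt_vx, trunc_zero_smul, zero_add]
  -- The equations are solved for the partial derivatives: ∂_t v = g₁/2, and then ∂_i' v = ±(g_i -
  -- x_i ∂_t v). The hypotheses become the equality of mixed partial derivatives.
  set G : Var m → DivPow F (Var m) := fun v => Option.elim v ht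
    (fun j => sgn F j.swap • (g j.swap - vx F p j.swap • ht)) with hG
  have hGs (i : Fin m ⊕ Fin m) : G (some i.swap) = sgn F i • (g i - vx F p i • ht) := by
    simp [hG]
  have hts (i) (hi : i ∈ S) : dpd F m none (G (some i.swap)) = dpd F m (some i.swap) ht := by
    rw [hGs, map_smul, map_sub, hDg i hi, hxT, add_sub_cancel_right, smul_smul, sgn_mul_self,
      one_smul]
  have hss (i) (hi : i ∈ S) (j) (hj : j ∈ S) : dpd F m (some i.swap) (G (some j.swap)) =
      dpd F m (some j.swap) (G (some i.swap)) := by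
    have h5 := h2 i hi j hj
    rw [act_vx, act_vx, hDg j hj, hDg i hi, smul_add, smul_add, trunc_smul_smul, trunc_smul_smul,
      smul_comm (vx F p j) (vx F p i), hg1] at h5
    rw [hGs, hGs, map_smul, map_smul, map_sub, map_sub, hxD, hxD]
    have h6 : (2 * omega F i j : F) = sgn F i * (if i.swap = j then 1 else 0) -
        sgn F j * (if j.swap = i then 1 else 0) := by
      rw [omega]
      by_cases h : j = i.swap
      · subst h
        simp [sgn_swap]
        ring
      · have h7 : ¬ j.swap = i := fun h8 => h (by rw [← h8, Sum.swap_swap])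
        simp [h, h7, Ne.symm h]
    have h7 : (sgn F i * sgn F j) ≠ 0 := mul_ne_zero (sgn_ne_zero i) (sgn_ne_zero j)
    refine smul_right_injective _ h7 ?_
    have hi2 := sgn_mul_self (F := F) i
    have hj2 := sgn_mul_self (F := F) j
    simp only [smul_sub, smul_add, smul_smul] at h5 ⊢
    have e1 : sgn F i * sgn F j * sgn F j = sgn F i := by rw [mul_assoc, hj2, mul_one]
    have e2 : sgn F i * sgn F j * sgn F i = sgn F j := by
      rw [mul_comm (sgn F i), mul_assoc, hi2, mul_one]
    rw [mul_comm (omega F i j), h6, sub_smul] at h5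
    simp only [← mul_assoc, e1, e2]
    linear_combination (norm := abel) h5
  obtain ⟨v, hv, hv0⟩ := exists_shift_eq ({none} ∪ (fun i => some i.swap) '' S) one_pos G (by
    rintro _ (rfl | ⟨i, hi, rfl⟩) _ (rfl | ⟨j, hj, rfl⟩)
    · rfl
    · exact hts j hj
    · exact (hts i hi).symm
    · exact hss i hi j hj) e
  have hvt : dpd F m none v = ht := hv none (Or.inl rfl)
  refine ⟨v, ?_, fun i hi => ?_, hv0⟩
  · rw [act_one, hvt, hg1]
  · have h5 : dpd F m (some i.swap) v = G (some i.swap) := hv _ (Or.inr ⟨i, hi, rfl⟩)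
    rw [act_vx, hvt, h5, hGs, smul_smul, sgn_mul_self, one_smul, sub_add_cancel]

end VectorCocycles
end Contact

namespace Contact

/-! ### Cocycles with values in divided power series -/

section VectorCocycles

open DivPow

variable {F : Type*} [Field F] {p : ℕ} [CharP F p] {m : ℕ} [Fact p.Prime]

/-- A bilinear map from truncated polynomials to divided power series whose restriction to the
contact algebra is a `2`-cocycle. -/
structure IsVecCocycle (Ψ : Trunc F p (Var m) →ₗ[F] Trunc F p (Var m) →ₗ[F] DivPow F (Var m)) :
    Prop where
  alt : ∀ f, Ψ f f = 0
  coc : ∀ f ∈ core F p m, ∀ g ∈ core F p m, ∀ h ∈ core F p m,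
    Ψ (contactHom F p m f g) h - Ψ (contactHom F p m f h) g + Ψ (contactHom F p m g h) f =
      act F p m f (Ψ g h) - act F p m g (Ψ f h) + act F p m h (Ψ f g)

theorem IsVecCocycle.skew
    {Ψ : Trunc F p (Var m) →ₗ[F] Trunc F p (Var m) →ₗ[F] DivPow F (Var m)} (h : IsVecCocycle Ψ)
    (f g) : Ψ g f = - Ψ f g := by
  have := h.alt (f + g)
  simp only [map_add, LinearMap.add_apply, h.alt, zero_add, add_zero] at this
  exact eq_neg_of_add_eq_zero_left this

/-- The coboundary of a `1`-cochain with values in divided power series. -/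
noncomputable def vcob (u : Trunc F p (Var m) →ₗ[F] DivPow F (Var m)) :
    Trunc F p (Var m) →ₗ[F] Trunc F p (Var m) →ₗ[F] DivPow F (Var m) :=
  LinearMap.mk₂ F
    (fun f g => act F p m f (u g) - act F p m g (u f) - u (contactHom F p m f g))
    (fun f f' g => by simp only [map_add, LinearMap.add_apply]; abel)
    (fun c f g => by simp only [map_smul, LinearMap.smul_apply, smul_sub])
    (fun f g g' => by simp only [map_add, LinearMap.add_apply]; abel)
    (fun c f g => by simp only [map_smul, LinearMap.smul_apply, smul_sub])

theorem vcob_apply (u : Trunc F p (Var m) →ₗ[F] DivPow F (Var m)) (f g) :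
    vcob u f g = act F p m f (u g) - act F p m g (u f) - u (contactHom F p m f g) := rfl

theorem vcob_add (u w : Trunc F p (Var m) →ₗ[F] DivPow F (Var m)) :
    vcob (u + w) = vcob u + vcob w := by
  refine LinearMap.ext₂ fun f g => ?_
  simp only [vcob_apply, LinearMap.add_apply, map_add]
  abel

theorem IsVecCocycle.sub_vcob
    {Ψ : Trunc F p (Var m) →ₗ[F] Trunc F p (Var m) →ₗ[F] DivPow F (Var m)} (h : IsVecCocycle Ψ)
    (u : Trunc F p (Var m) →ₗ[F] DivPow F (Var m)) : IsVecCocycle (Ψ - vcob u) where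
  alt f := by
    rw [LinearMap.sub_apply, LinearMap.sub_apply, h.alt, vcob_apply, contactHom_self, map_zero]
    abel
  coc f hf g hg k hk := by
    have h1 := h.coc f hf g hg k hk
    have h2 : u (contactHom F p m (contactHom F p m f g) k) -
        u (contactHom F p m (contactHom F p m f k) g) +
        u (contactHom F p m (contactHom F p m g k) f) = 0 := by
      rw [← map_sub, ← map_add, contactHom_skew f (contactHom F p m g k), contactHom_leibniz,
        contactHom_skew g (contactHom F p m f k)]
      convert map_zero u
      abel
    simp only [LinearMap.sub_apply, vcob_apply, map_sub, act_contactHom]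
    linear_combination (norm := abel) h1 + h2

/-- The composition of a bilinear map with the constant term. -/
noncomputable def constTerm (Ψ : Trunc F p (Var m) →ₗ[F] Trunc F p (Var m) →ₗ[F] DivPow F (Var m)) :
    Trunc F p (Var m) →ₗ[F] Trunc F p (Var m) →ₗ[F] F :=
  Ψ.compr₂ (evalAt 0)

omit [CharP F p] [Fact p.Prime] in
theorem constTerm_apply (Ψ : Trunc F p (Var m) →ₗ[F] Trunc F p (Var m) →ₗ[F] DivPow F (Var m))
    (f g) : constTerm Ψ f g = Ψ f g 0 := rfl

/-- The constant term is equivariant for the nonnegative part, with values in λ; this is the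
restriction map of Shapiro's lemma. -/
theorem IsVecCocycle.isCocycle_constTerm (hp : 5 ≤ p)
    {Ψ : Trunc F p (Var m) →ₗ[F] Trunc F p (Var m) →ₗ[F] DivPow F (Var m)} (h : IsVecCocycle Ψ) :
    IsCocycle (constTerm Ψ) where
  alt f := by rw [constTerm_apply, h.alt]; rfl
  coc f hf g hg k hk := by
    have h1 := congrArg (fun v : DivPow F (Var m) => v 0)
      (h.coc f (corePos_le_core hf) g (corePos_le_core hg) k (corePos_le_core hk))
    simp only [DivPow.add_apply, DivPow.sub_apply, act_apply_zero hp hf, act_apply_zero hp hg,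
      act_apply_zero hp hk] at h1
    exact h1

theorem constTerm_vcob (hp : 5 ≤ p) (u : Trunc F p (Var m) →ₗ[F] DivPow F (Var m))
    {f g : Trunc F p (Var m)} (hf : f ∈ corePos F p m) (hg : g ∈ corePos F p m) :
    vcob u f g 0 = cob (evalAt 0 ∘ₗ u) f g := by
  rw [vcob_apply, DivPow.sub_apply, DivPow.sub_apply, act_apply_zero hp hf, act_apply_zero hp hg]
  rfl

/-- A `2`-cocycle that vanishes on `1` and the `x_i`, and has no constant terms, is zero. -/
theorem IsVecCocycle.eq_zero (hp : 5 ≤ p)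
    {Ψ : Trunc F p (Var m) →ₗ[F] Trunc F p (Var m) →ₗ[F] DivPow F (Var m)} (h : IsVecCocycle Ψ)
    (h1 : ∀ g ∈ core F p m, Ψ 1 g = 0) (hx : ∀ i, ∀ g ∈ core F p m, Ψ (vx F p i) g = 0)
    (h0 : ∀ f ∈ corePos F p m, ∀ g ∈ corePos F p m, Ψ f g 0 = 0) {f g : Trunc F p (Var m)}
    (hf : f ∈ core F p m) (hg : g ∈ core F p m) : Ψ f g = 0 := by
  have hone := one_mem_core (F := F) (p := p) (m := m) (by omega)
  have hvx := vx_mem_core (F := F) (p := p) (m := m) (by omega)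
  -- If n is in the radical of Ψ, the cocycle identity expresses n·Ψ(f, g) through values of Ψ. So
  -- the span of the values is stable under 1 and the x_i, and `eq_zero_of_stable` applies.
  have hstab (n) (hn : n ∈ core F p m) (hn0 : ∀ g ∈ core F p m, Ψ n g = 0) (f)
      (hf : f ∈ core F p m) (g) (hg : g ∈ core F p m) : act F p m n (Ψ f g) =
      Ψ (contactHom F p m n f) g - Ψ (contactHom F p m n g) f := by
    have h5 := h.coc n hn f hf g hg
    rw [hn0 f hf, hn0 g hg, h.skew n (contactHom F p m f g),
      hn0 _ (contactHom_mem_core hp f g), map_zero, map_zero, neg_zero, add_zero, add_zero,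
      sub_zero] at h5
    exact h5.symm
  set S : Set (DivPow F (Var m)) := {w | ∃ f ∈ core F p m, ∃ g ∈ core F p m, w = Ψ f g} with hS
  have hspan (n) (hn : n ∈ core F p m) (hn0 : ∀ g ∈ core F p m, Ψ n g = 0) :
      ∀ w ∈ S, act F p m n w ∈ Submodule.span F S := by
    rintro _ ⟨f, hf, g, hg, rfl⟩
    rw [hstab n hn hn0 f hf g hg]
    exact sub_mem (Submodule.subset_span ⟨_, contactHom_mem_core hp n f, _, hg, rfl⟩)
      (Submodule.subset_span ⟨_, contactHom_mem_core hp n g, _, hf, rfl⟩)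
  refine eq_zero_of_stable hp (S := S) (hspan 1 hone h1) (fun i => hspan _ (hvx i) (hx i)) ?_
    ⟨f, hf, g, hg, rfl⟩
  rintro _ ⟨f, hf, g, hg, rfl⟩
  -- Constant terms are assumed zero only on the nonnegative part; pairs involving 1 or some x_i
  -- vanish by hypothesis.
  have h3 : corePos F p m ≤ (LinearMap.ker ((constTerm Ψ).flip g)) := by
    intro f hf
    have h4 : core F p m ≤ LinearMap.ker (constTerm Ψ f) := by
      refine core_le_of ?_ (fun i => ?_) (fun g hg => h0 f hf g hg)
      · rw [LinearMap.mem_ker, constTerm_apply, h.skew 1 f, h1 f (corePos_le_core hf)]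
        simp
      · rw [LinearMap.mem_ker, constTerm_apply, h.skew _ f, hx i f (corePos_le_core hf)]
        simp
    exact h4 hg
  refine core_le_of (R := LinearMap.ker ((constTerm Ψ).flip g)) ?_ (fun i => ?_) h3 hf
  · rw [LinearMap.mem_ker, LinearMap.flip_apply, constTerm_apply, h1 g hg]; rfl
  · rw [LinearMap.mem_ker, LinearMap.flip_apply, constTerm_apply, hx i g hg]; rfl

/-- The values u(x_i) are found one variable at a time, with u(1) = 0. Each new u(x_k) has to
satisfy a system of first order equations, whose integrability is the cocycle identity on triples
from 1 and the x_i. -/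
theorem IsVecCocycle.exists_normal_degree_one (hp : 5 ≤ p)
    {Ψ : Trunc F p (Var m) →ₗ[F] Trunc F p (Var m) →ₗ[F] DivPow F (Var m)} (h : IsVecCocycle Ψ) :
    ∃ u : Trunc F p (Var m) →ₗ[F] DivPow F (Var m), (∀ i, (Ψ - vcob u) 1 (vx F p i) = 0) ∧
      ∀ i j, (Ψ - vcob u) (vx F p i) (vx F p j) = 0 := by
  classical
  have hone := one_mem_core (F := F) (p := p) (m := m) (by omega)
  have hvx := vx_mem_core (F := F) (p := p) (m := m) (by omega)
  have key (S : Finset (Fin m ⊕ Fin m)) : ∃ u : Fin m ⊕ Fin m → DivPow F (Var m),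
      (∀ i ∈ S, act F p m 1 (u i) = Ψ 1 (vx F p i)) ∧ ∀ i ∈ S, ∀ j ∈ S,
        act F p m (vx F p i) (u j) - act F p m (vx F p j) (u i) = Ψ (vx F p i) (vx F p j) := by
    induction S using Finset.induction_on with
    | empty => exact ⟨0, by simp, by simp⟩
    | insert k S hk ih =>
      obtain ⟨u, hu1, hu2⟩ := ih
      obtain ⟨v, hv1, hv2, -⟩ := exists_act_eq hp (S : Set (Fin m ⊕ Fin m)) (Ψ 1 (vx F p k))
        (fun i => Ψ (vx F p i) (vx F p k) + act F p m (vx F p k) (u i))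
        (fun i hi => by
          have h1 := h.coc 1 hone _ (hvx i) _ (hvx k)
          have h2 := act_contactHom 1 (vx F p k) (u i)
          rw [contactHom_one_vx, map_zero, LinearMap.zero_apply, hu1 i hi] at h2
          rw [contactHom_one_vx, contactHom_one_vx, contactHom_vx_vx, map_zero, map_smul,
            LinearMap.smul_apply, LinearMap.zero_apply, h.alt, smul_zero, LinearMap.zero_apply] at h1
          rw [map_add]
          linear_combination (norm := abel) -h1 - h2)
        (fun i hi j hj => by
          have h1 := h.coc _ (hvx i) _ (hvx j) _ (hvx k)
          have h2 := act_contactHom (vx F p i) (vx F p k) (u j)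
          have h3 := act_contactHom (vx F p j) (vx F p k) (u i)
          have h4 := congrArg (act F p m (vx F p k)) (hu2 i hi j hj)
          simp only [contactHom_vx_vx, map_smul, LinearMap.smul_apply, hu1 i hi, hu1 j hj,
            map_sub] at h1 h2 h3 h4
          simp only [map_add]
          linear_combination (norm := abel) -h1 - h2 + h3 + h4) 0
      have hup (i) (hi : i ∈ S) : Function.update u k v i = u i := by
        rw [Function.update_of_ne]
        rintro rfl
        exact hk hi
      refine ⟨Function.update u k v, fun i hi => ?_, fun i hi j hj => ?_⟩
      · rcases Finset.mem_insert.mp hi with rfl | hi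
        · rw [Function.update_self, hv1]
        · rw [hup i hi, hu1 i hi]
      · rcases Finset.mem_insert.mp hi with rfl | hi' <;>
          rcases Finset.mem_insert.mp hj with rfl | hj'
        · rw [sub_self, h.alt]
        · rw [hup j hj', Function.update_self, hv2 j hj', h.skew (vx F p j)]
          abel
        · rw [hup i hi', Function.update_self, hv2 i hi']
          abel
        · rw [hup i hi', hup j hj', hu2 i hi' j hj']
  obtain ⟨u, hu1, hu2⟩ := key Finset.univ
  set w : (Var m →₀ ℕ) → DivPow F (Var m) := fun a =>
    if h : ∃ i, a = Finsupp.single (some i) 1 then u h.choose else 0 with hw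
  have hx (i) : truncLift w (vx F p i) = u i := by
    rw [vx_eq, truncLift_monomial w (fun v => by
      rw [Finsupp.single_apply]; split_ifs <;> omega)]
    have h5 : ∃ j, (Finsupp.single (some i) 1 : Var m →₀ ℕ) = Finsupp.single (some j) 1 := ⟨i, rfl⟩
    simp only [hw]
    rw [dif_pos h5]
    have h6 := h5.choose_spec
    rw [Finsupp.single_left_inj one_ne_zero, Option.some.injEq] at h6
    rw [← h6]
  have h1 : truncLift w (1 : Trunc F p (Var m)) = 0 := by
    rw [← truncMonomial_zero, truncLift_monomial w (fun v => by simp; omega)]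
    simp only [hw]
    rw [dif_neg]
    rintro ⟨i, hi⟩
    have := DFunLike.congr_fun hi (some i)
    simp at this
  refine ⟨truncLift w, fun i => ?_, fun i j => ?_⟩
  · rw [LinearMap.sub_apply, LinearMap.sub_apply, vcob_apply, hx, h1, contactHom_one_vx,
      hu1 i (Finset.mem_univ i)]
    simp
  · rw [LinearMap.sub_apply, LinearMap.sub_apply, vcob_apply, hx, hx, contactHom_vx_vx, map_smul,
      h1, hu2 i (Finset.mem_univ i) j (Finset.mem_univ j)]
    simp

variable (F p m) in
/-- The span of the monomials of the contact algebra of weighted degree less than `k`. -/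
noncomputable def coreBelow (k : ℕ) : Submodule F (Trunc F p (Var m)) :=
  Submodule.span F {f | ∃ a : Var m →₀ ℕ, (∀ i, a i < p) ∧ IsGood F p m (xdeg a) (a none) ∧
    wt a < k ∧ f = truncMonomial F p a}

-- The monomial that may be missing from the contact algebra has the largest weight of all, so
-- anything of strictly smaller weight than a nonzero monomial belongs to the algebra.
omit [CharP F p] [Fact p.Prime] in
theorem monomial_mem_coreBelow {a b : Var m →₀ ℕ} (ha : ∀ i, a i < p) {k : ℕ} (hk : wt a ≤ k)
    (hb : wt b < wt a) : truncMonomial F p b ∈ coreBelow F p m k := by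
  by_cases hres : ∀ i, b i < p
  · refine Submodule.subset_span ⟨b, hres, fun h1 h2 => ?_, by omega, rfl⟩
    have h3 := xdeg_le ha
    have h4 := ha none
    rw [wt, wt] at hb
    omega
  · push Not at hres
    obtain ⟨i, hi⟩ := hres
    rw [truncMonomial_eq_zero hi]
    exact zero_mem _

omit [Fact p.Prime] in
theorem one_bracket_mem_coreBelow {a : Var m →₀ ℕ} (ha : ∀ i, a i < p) {k : ℕ} (hk : wt a ≤ k) :
    contactHom F p m 1 (truncMonomial F p a) ∈ coreBelow F p m k := by
  rw [contactHom_apply, bracket_one, truncDeriv_monomial, two_mul]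
  by_cases h : a none = 0
  · rw [h]; simp
  · have := wt_sub_none_add h
    have h2 := Submodule.smul_mem _ (a none : F)
      (monomial_mem_coreBelow (F := F) ha hk (b := a - Finsupp.single none 1) (by omega))
    exact add_mem h2 h2

omit [Fact p.Prime] in
theorem vx_bracket_mem_coreBelow (i : Fin m ⊕ Fin m) {a : Var m →₀ ℕ} (ha : ∀ i, a i < p) {k : ℕ}
    (hk : wt a ≤ k) : contactHom F p m (vx F p i) (truncMonomial F p a) ∈ coreBelow F p m k := by
  rw [contactHom_apply, bracket_vx, truncDeriv_monomial, ham_monomial, mul_smul_comm,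
    truncX_mul_truncMonomial]
  refine add_mem ?_ ?_
  · by_cases h : a (some i.swap) = 0
    · rw [h]; simp
    · have := wt_sub_some_add h
      exact Submodule.smul_mem _ _ (monomial_mem_coreBelow ha hk (by omega))
  · by_cases h : a none = 0
    · rw [h]; simp
    · have := wt_sub_none_add h
      refine Submodule.smul_mem _ _ (monomial_mem_coreBelow ha hk ?_)
      rw [wt_add]
      simp [wt] at this ⊢
      omega

omit [CharP F p] [Fact p.Prime] in
theorem coreBelow_ext {W : Type*} [AddCommGroup W] [Module F W] {k : ℕ}
    {u w : Trunc F p (Var m) →ₗ[F] W}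
    (h : ∀ a : Var m →₀ ℕ, (∀ i, a i < p) → IsGood F p m (xdeg a) (a none) → wt a < k →
      u (truncMonomial F p a) = w (truncMonomial F p a)) {f : Trunc F p (Var m)}
    (hf : f ∈ coreBelow F p m k) : u f = w f := by
  refine LinearMap.eqOn_span (f := u) (g := w) ?_ hf
  rintro _ ⟨a, h1, h2, h3, rfl⟩
  exact h a h1 h2 h3

end VectorCocycles
end Contact

namespace Contact

/-! ### Shapiro's lemma and the descent to truncated polynomials -/

section Shapiro

open DivPow

variable {F : Type*} [Field F] {p : ℕ} [CharP F p] {m : ℕ} [Fact p.Prime]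

/-- Brackets with 1 and the x_i lower the weight, so u is built by induction on the weight. On a
monomial of weight k the requirement is a first order system whose right side is already known; the
constant term of the solution is free and is set to η. -/
theorem IsVecCocycle.exists_normal_aux (hp : 5 ≤ p)
    {Ψ : Trunc F p (Var m) →ₗ[F] Trunc F p (Var m) →ₗ[F] DivPow F (Var m)} (h : IsVecCocycle Ψ)
    (h1 : ∀ i, Ψ 1 (vx F p i) = 0) (hx : ∀ i j, Ψ (vx F p i) (vx F p j) = 0)
    (η : Trunc F p (Var m) →ₗ[F] F) (k : ℕ) (hk : 2 ≤ k) :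
    ∃ u : Trunc F p (Var m) →ₗ[F] DivPow F (Var m),
      (∀ a : Var m →₀ ℕ, (∀ i, a i < p) → wt a < 2 → u (truncMonomial F p a) = 0) ∧
      (∀ a : Var m →₀ ℕ, (∀ i, a i < p) → IsGood F p m (xdeg a) (a none) → 2 ≤ wt a → wt a < k →
        u (truncMonomial F p a) 0 = η (truncMonomial F p a)) ∧
      ∀ f ∈ coreBelow F p m k, act F p m 1 (u f) = Ψ 1 f + u (contactHom F p m 1 f) ∧
        ∀ i, act F p m (vx F p i) (u f) = Ψ (vx F p i) f + u (contactHom F p m (vx F p i) f) := by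
  classical
  have hone := one_mem_core (F := F) (p := p) (m := m) (by omega)
  have hvx := vx_mem_core (F := F) (p := p) (m := m) (by omega)
  induction k, hk using Nat.le_induction with
  | base =>
    refine ⟨0, by simp, by omega, fun f hf => ⟨?_, fun i => ?_⟩⟩
    · have : Ψ 1 f = (0 : Trunc F p (Var m) →ₗ[F] DivPow F (Var m)) f := by
        refine coreBelow_ext (fun a _ _ ha => ?_) hf
        rcases eq_of_wt_lt_two ha with rfl | ⟨j, rfl⟩
        · rw [truncMonomial_zero, h.alt, LinearMap.zero_apply]
        · exact h1 j
      rw [this]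
      simp
    · have : Ψ (vx F p i) f = (0 : Trunc F p (Var m) →ₗ[F] DivPow F (Var m)) f := by
        refine coreBelow_ext (fun a _ _ ha => ?_) hf
        rcases eq_of_wt_lt_two ha with rfl | ⟨j, rfl⟩
        · rw [truncMonomial_zero, h.skew 1, h1, neg_zero, LinearMap.zero_apply]
        · exact hx i j
      rw [this]
      simp
  | succ k hk ih =>
    obtain ⟨u, hu0, hu1, hu2⟩ := ih
    have hex (a : Var m →₀ ℕ) : ∃ v : DivPow F (Var m), (∀ i, a i < p) →
        IsGood F p m (xdeg a) (a none) → wt a = k →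
        act F p m 1 v = Ψ 1 (truncMonomial F p a) + u (contactHom F p m 1 (truncMonomial F p a)) ∧
        (∀ i, act F p m (vx F p i) v = Ψ (vx F p i) (truncMonomial F p a) +
          u (contactHom F p m (vx F p i) (truncMonomial F p a))) ∧
        v 0 = η (truncMonomial F p a) := by
      by_cases hc : (∀ i, a i < p) ∧ IsGood F p m (xdeg a) (a none) ∧ wt a = k
      swap
      · exact ⟨0, fun h1 h2 h3 => absurd ⟨h1, h2, h3⟩ hc⟩
      obtain ⟨ha, hgood, hwt⟩ := hc
      set f := truncMonomial F p a with hf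
      have hfm : f ∈ core F p m := monomial_mem_core hgood
      have hb1 := one_bracket_mem_coreBelow (F := F) ha hwt.le
      have hbx (i) := vx_bracket_mem_coreBelow (F := F) i ha hwt.le
      rw [← hf] at hb1
      simp only [← hf] at hbx
      -- Integrability combines the cocycle identity with the equations already valid in lower
      -- weight and the Jacobi identity.
      obtain ⟨v, hv1, hv2, hv3⟩ := exists_act_eq hp Set.univ (Ψ 1 f + u (contactHom F p m 1 f))
        (fun i => Ψ (vx F p i) f + u (contactHom F p m (vx F p i) f))
        (fun i _ => by
          have e1 := h.coc 1 hone _ (hvx i) f hfm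
          have e2 := (hu2 _ (hbx i)).1
          have e3 := (hu2 _ hb1).2 i
          have e4 := contactHom_leibniz 1 (vx F p i) f
          rw [contactHom_one_vx, map_zero, LinearMap.zero_apply, zero_add] at e4
          rw [contactHom_one_vx, h1, map_zero, map_zero, LinearMap.zero_apply,
            h.skew (vx F p i) (contactHom F p m 1 f), h.skew 1 (contactHom F p m _ f)] at e1
          rw [map_add, map_add, e2, e3, e4]
          linear_combination (norm := abel) -e1)
        (fun i _ j _ => by
          have e1 := h.coc _ (hvx i) _ (hvx j) f hfm
          have e2 := (hu2 _ (hbx i)).2 j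
          have e3 := (hu2 _ (hbx j)).2 i
          have e4 := congrArg u (contactHom_leibniz (vx F p i) (vx F p j) f)
          rw [contactHom_vx_vx] at e4 e1
          simp only [map_add, map_smul, LinearMap.smul_apply] at e1 e4
          rw [hx, map_zero, h.skew (vx F p j) (contactHom F p m _ f),
            h.skew (vx F p i) (contactHom F p m _ f)] at e1
          rw [map_add, map_add, e2, e3, e4, smul_add]
          linear_combination (norm := abel) -e1) (η f)
      exact ⟨v, fun _ _ _ => ⟨hv1, fun i => hv2 i (Set.mem_univ i), hv3⟩⟩
    choose v hv using hex
    set w : (Var m →₀ ℕ) → DivPow F (Var m) := fun a =>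
      if wt a = k then v a else u (truncMonomial F p a) with hw
    have hwm (a : Var m →₀ ℕ) (ha : ∀ i, a i < p) : truncLift w (truncMonomial F p a) = w a :=
      truncLift_monomial w ha
    have hwb {f} (hf : f ∈ coreBelow F p m k) : truncLift w f = u f := by
      refine coreBelow_ext (fun a ha _ hlt => ?_) hf
      rw [hwm a ha]
      simp only [hw]
      rw [if_neg hlt.ne]
    refine ⟨truncLift w, fun a ha h2 => ?_, fun a ha hgood h2 hlt => ?_, fun f hf => ?_⟩
    · rw [hwm a ha]
      simp only [hw]
      rw [if_neg (by omega), hu0 a ha h2]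
    · rw [hwm a ha]
      simp only [hw]
      split_ifs with h5
      · exact (hv a ha hgood h5).2.2
      · exact hu1 a ha hgood h2 (by omega)
    · have hm (n : Trunc F p (Var m)) (hn : ∀ a : Var m →₀ ℕ, (∀ i, a i < p) → wt a ≤ k →
          contactHom F p m n (truncMonomial F p a) ∈ coreBelow F p m k)
          (hnu : ∀ a : Var m →₀ ℕ, (∀ i, a i < p) → IsGood F p m (xdeg a) (a none) → wt a < k →
            act F p m n (u (truncMonomial F p a)) = Ψ n (truncMonomial F p a) +
              u (contactHom F p m n (truncMonomial F p a)))
          (hnv : ∀ a : Var m →₀ ℕ, (∀ i, a i < p) → IsGood F p m (xdeg a) (a none) → wt a = k →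
            act F p m n (v a) = Ψ n (truncMonomial F p a) +
              u (contactHom F p m n (truncMonomial F p a))) :
          (act F p m n ∘ₗ truncLift w) f = (Ψ n + truncLift w ∘ₗ contactHom F p m n) f := by
        refine coreBelow_ext (fun a ha hgood hlt => ?_) hf
        rw [LinearMap.comp_apply, LinearMap.add_apply, LinearMap.comp_apply,
          hwb (hn a ha (by omega)), hwm a ha]
        simp only [hw]
        split_ifs with h5
        · exact hnv a ha hgood h5
        · exact hnu a ha hgood (by omega)
      refine ⟨hm 1 (fun a ha hak => one_bracket_mem_coreBelow ha hak)
        (fun a ha hgood hlt => (hu2 _ (Submodule.subset_span ⟨a, ha, hgood, hlt, rfl⟩)).1)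
        (fun a ha hgood hak => (hv a ha hgood hak).1), fun i => hm (vx F p i)
        (fun a ha hak => vx_bracket_mem_coreBelow i ha hak)
        (fun a ha hgood hlt => (hu2 _ (Submodule.subset_span ⟨a, ha, hgood, hlt, rfl⟩)).2 i)
        (fun a ha hgood hak => (hv a ha hgood hak).2.1 i)⟩

/-- Weights of nonzero monomials are bounded, so the induction covers the whole algebra. Prescribing
η as the constant term of u makes the coboundary of u restrict to the scalar coboundary of η. -/
theorem IsVecCocycle.exists_normal (hp : 5 ≤ p)
    {Ψ : Trunc F p (Var m) →ₗ[F] Trunc F p (Var m) →ₗ[F] DivPow F (Var m)} (h : IsVecCocycle Ψ)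
    (h1 : ∀ i, Ψ 1 (vx F p i) = 0) (hx : ∀ i j, Ψ (vx F p i) (vx F p j) = 0)
    (η : Trunc F p (Var m) →ₗ[F] F) :
    ∃ u : Trunc F p (Var m) →ₗ[F] DivPow F (Var m),
      (∀ f ∈ corePos F p m, u f 0 = η f) ∧
      ∀ f ∈ core F p m, (Ψ - vcob u) 1 f = 0 ∧ ∀ i, (Ψ - vcob u) (vx F p i) f = 0 := by
  have hwt {a : Var m →₀ ℕ} (ha : ∀ i, a i < p) : wt a < 2 * m * (p - 1) + 2 * p + 2 := by
    have h3 := xdeg_le ha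
    have h4 := ha none
    rw [wt]
    omega
  obtain ⟨u, hu0, hu1, hu2⟩ := h.exists_normal_aux hp h1 hx η (2 * m * (p - 1) + 2 * p + 2)
    (by omega)
  have hle : core F p m ≤ coreBelow F p m (2 * m * (p - 1) + 2 * p + 2) := fun f hf =>
    core_induction (P := fun f => f ∈ coreBelow F p m (2 * m * (p - 1) + 2 * p + 2)) hf
      (fun a ha hgood => Submodule.subset_span ⟨a, ha, hgood, hwt ha, rfl⟩) (zero_mem _)
      (fun _ _ => add_mem) (fun c _ => Submodule.smul_mem _ c)
  have hu1' : u 1 = 0 := by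
    rw [← truncMonomial_zero]
    exact hu0 0 (fun v => by simp; omega) (by simp [wt, xdeg])
  have hux (i) : u (vx F p i) = 0 :=
    hu0 _ (fun v => by rw [Finsupp.single_apply]; split_ifs <;> omega) (by simp [wt])
  refine ⟨u, fun f hf => ?_, fun f hf => ⟨?_, fun i => ?_⟩⟩
  · exact corePos_ext (u := evalAt 0 ∘ₗ u) (w := η)
      (fun a ha hgood h2 => hu1 a ha hgood h2 (hwt ha)) hf
  · rw [LinearMap.sub_apply, LinearMap.sub_apply, vcob_apply, (hu2 f (hle hf)).1, hu1', map_zero]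
    abel
  · rw [LinearMap.sub_apply, LinearMap.sub_apply, vcob_apply, (hu2 f (hle hf)).2 i, hux, map_zero]
    abel

/-- A `2`-cocycle with values in divided power series whose constant terms vanish at the pairs
`(x_i t, x_i ^ (p - 1))` and `(t ^ 2, t ^ (p - 1))` is a coboundary. -/
theorem IsVecCocycle.exists_eq_vcob (hp : 5 ≤ p) (hm : 1 ≤ m)
    {Ψ : Trunc F p (Var m) →ₗ[F] Trunc F p (Var m) →ₗ[F] DivPow F (Var m)} (h : IsVecCocycle Ψ)
    (hρ : ∀ i, Ψ (vx F p i * vt F p m) (vx F p i ^ (p - 1)) 0 = 0)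
    (hσ : Ψ (vt F p m ^ 2) (vt F p m ^ (p - 1)) 0 = 0) :
    ∃ u, ∀ f ∈ core F p m, ∀ g ∈ core F p m, Ψ f g = vcob u f g := by
  obtain ⟨u, hu1, hux⟩ := h.exists_normal_degree_one hp
  have h' := h.sub_vcob u
  obtain ⟨η, hη⟩ := (h'.isCocycle_constTerm hp).exists_eq_cob hp hm
    (fun i => by
      rw [constTerm_apply, LinearMap.sub_apply, LinearMap.sub_apply, DivPow.sub_apply, hρ,
        constTerm_vcob hp u (vx_vt_mem hp hm i) (bi_le_corePos (isGood_of_ne (by omega))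
          (by omega) (vx_pow_mem_bi i (p - 1))), cob_vx_vt_pow hp, sub_zero])
    (by
      rw [constTerm_apply, LinearMap.sub_apply, LinearMap.sub_apply, DivPow.sub_apply, hσ,
        constTerm_vcob hp u (bi_le_corePos_of_lt hp hm (by omega) (by omega) (vt_pow_mem_bi 2))
          (bi_le_corePos_of_lt hp hm (by omega) (by omega) (vt_pow_mem_bi (p - 1))),
        cob_vt_sq_pow hp, sub_zero])
  obtain ⟨w, hw1, hw2⟩ := h'.exists_normal hp hu1 hux η
  have h'' := h'.sub_vcob w
  refine ⟨u + w, fun f hf g hg => ?_⟩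
  -- Both corrections together leave a cocycle that vanishes on 1 and the x_i and has no constant
  -- terms in nonnegative degree, hence zero.
  have h5 := h''.eq_zero hp (fun g hg => (hw2 g hg).1) (fun i g hg => (hw2 g hg).2 i)
    (fun f hf g hg => by
      rw [LinearMap.sub_apply, LinearMap.sub_apply, DivPow.sub_apply, constTerm_vcob hp w hf hg,
        ← constTerm_apply, hη f hf g hg, cob_apply, cob_apply, LinearMap.comp_apply,
        LinearMap.comp_apply, LinearMap.comp_apply, evalAt_apply, evalAt_apply, evalAt_apply,
        hw1 f hf, hw1 g hg, hw1 _ (contactHom_mem_corePos hp hf hg), sub_self]) hf hg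
  rw [vcob_add]
  simp only [LinearMap.sub_apply, LinearMap.add_apply] at h5 ⊢
  linear_combination (norm := abel) h5

/-- A `1`-cocycle of the contact algebra with values in divided power series is a coboundary. -/
theorem exists_eq_act (hp : 5 ≤ p) (hm : 1 ≤ m)
    {τ : Trunc F p (Var m) →ₗ[F] DivPow F (Var m)}
    (hτ : ∀ f ∈ core F p m, ∀ g ∈ core F p m, τ (contactHom F p m f g) =
      act F p m f (τ g) - act F p m g (τ f)) :
    ∃ u, ∀ f ∈ core F p m, τ f = act F p m f u := by
  have hone := one_mem_core (F := F) (p := p) (m := m) (by omega)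
  have hvx := vx_mem_core (F := F) (p := p) (m := m) (by omega)
  have h2 := two_ne_zero_of_le (F := F) hp
  -- Since λ(t) = -2, the constant term -τ(t)(0)/2 makes the corrected cocycle have zero constant
  -- term at t; `oneCocycle_eq_zero` extends this to the nonnegative part.
  obtain ⟨u, hu1, hux, hu0⟩ := exists_act_eq hp Set.univ (τ 1) (fun i => τ (vx F p i))
    (fun i _ => by
      have := hτ 1 hone _ (hvx i)
      rw [contactHom_one_vx, map_zero] at this
      exact sub_eq_zero.mp this.symm)
    (fun i _ j _ => by
      have := hτ _ (hvx i) _ (hvx j)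
      rw [contactHom_vx_vx, map_smul] at this
      exact this.symm) (-(2 : F)⁻¹ * τ (vt F p m) 0)
  set τ' := τ - (act F p m).flip u with hτ'
  have hτa (f) : τ' f = τ f - act F p m f u := rfl
  have hc (f) (hf : f ∈ core F p m) (g) (hg : g ∈ core F p m) : τ' (contactHom F p m f g) =
      act F p m f (τ' g) - act F p m g (τ' f) := by
    rw [hτa, hτa, hτa, hτ f hf g hg, act_contactHom, map_sub, map_sub]
    abel
  have h1 : τ' 1 = 0 := by rw [hτa, hu1, sub_self]
  have hx (i) : τ' (vx F p i) = 0 := by rw [hτa, hux i (Set.mem_univ i), sub_self]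
  have hpos : corePos F p m ≤ LinearMap.ker (evalAt 0 ∘ₗ τ') := fun f hf =>
    oneCocycle_eq_zero hp hm (τ := evalAt 0 ∘ₗ τ') (fun f hf g hg => by
      rw [LinearMap.comp_apply, hc f (corePos_le_core hf) g (corePos_le_core hg), evalAt_apply,
        DivPow.sub_apply, act_apply_zero hp hf, act_apply_zero hp hg]
      rfl) (by
      rw [LinearMap.comp_apply, evalAt_apply, hτa, DivPow.sub_apply,
        act_apply_zero hp (vt_mem hp hm), lam_vt hp, hu0]
      field_simp
      ring) hf
  refine ⟨u, fun f hf => sub_eq_zero.mp ?_⟩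
  refine eq_zero_of_stable hp (S := {w | ∃ f ∈ core F p m, w = τ' f}) ?_ ?_ ?_ ⟨f, hf, rfl⟩
  · rintro _ ⟨f, hf, rfl⟩
    refine Submodule.subset_span ⟨_, contactHom_mem_core hp 1 f, ?_⟩
    rw [hc 1 hone f hf, h1, map_zero, sub_zero]
  · rintro i _ ⟨f, hf, rfl⟩
    refine Submodule.subset_span ⟨_, contactHom_mem_core hp (vx F p i) f, ?_⟩
    rw [hc _ (hvx i) f hf, hx, map_zero, sub_zero]
  · rintro _ ⟨f, hf, rfl⟩
    refine core_le_of (R := LinearMap.ker (evalAt 0 ∘ₗ τ')) ?_ (fun i => ?_) hpos hf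
    · rw [LinearMap.mem_ker, LinearMap.comp_apply, h1, map_zero]
    · rw [LinearMap.mem_ker, LinearMap.comp_apply, hx, map_zero]

/-- An invariant series has no constant term, because t multiplies it by λ(t) = -2; stability under
1 and the x_i then forces it to be zero. -/
theorem eq_zero_of_act_eq_zero (hp : 5 ≤ p) (hm : 1 ≤ m) {w : DivPow F (Var m)}
    (h : ∀ f ∈ core F p m, act F p m f w = 0) : w = 0 := by
  have hone := one_mem_core (F := F) (p := p) (m := m) (by omega)
  have hvx := vx_mem_core (F := F) (p := p) (m := m) (by omega)
  refine eq_zero_of_stable hp (S := {w}) ?_ ?_ ?_ rfl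
  · rintro _ rfl
    rw [h 1 hone]
    exact zero_mem _
  · rintro i _ rfl
    rw [h _ (hvx i)]
    exact zero_mem _
  · intro v hv
    rw [Set.mem_singleton_iff.mp hv]
    have h1 := act_apply_zero hp (vt_mem (F := F) hp hm) w
    rw [h _ (corePos_le_core (vt_mem hp hm)), lam_vt hp] at h1
    exact (mul_eq_zero.mp h1.symm).resolve_left (neg_ne_zero.mpr (two_ne_zero_of_le hp))

theorem shift_prime_ofTrunc (i : Var m) (f : Trunc F p (Var m)) :
    shift (Finsupp.single i p) (ofTrunc F p (Var m) f) = 0 := by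
  rw [ofTrunc_apply, shift_prime_smul]
  have hpp := (Fact.out : p.Prime).pos
  have : shift (Finsupp.single i p) (one F (Var m)) = 0 := by
    ext c
    have : c + Finsupp.single i p ≠ 0 := fun h => by
      have := DFunLike.congr_fun h i
      simp at this
      omega
    simp [one, this]
  rw [this, smul_zero]

/-- If the coboundary of a cochain with values in divided power series takes values in the contact
algebra, then it is the coboundary of a cochain with values in the contact algebra. -/
theorem exists_core_cochain (hp : 5 ≤ p) (hm : 1 ≤ m)
    {ψ : Trunc F p (Var m) →ₗ[F] Trunc F p (Var m) →ₗ[F] Trunc F p (Var m)}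
    (hψ : ∀ f g, ψ f g ∈ core F p m) {u : Trunc F p (Var m) →ₗ[F] DivPow F (Var m)}
    (hu : ∀ f ∈ core F p m, ∀ g ∈ core F p m, ofTrunc F p (Var m) (ψ f g) = vcob u f g) :
    ∃ w : Trunc F p (Var m) →ₗ[F] Trunc F p (Var m), (∀ f ∈ core F p m, w f ∈ core F p m) ∧
      ∀ f ∈ core F p m, ∀ g ∈ core F p m, ψ f g =
        contactHom F p m f (w g) - contactHom F p m g (w f) - w (contactHom F p m f g) := by
  have hpp := (Fact.out : p.Prime).pos
  -- ∂_i^p commutes with the action and kills the A(n)-valued left side, so ∂_i^p u is a 1-cocycle.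
  have hz (i : Var m) : ∃ v, ∀ f ∈ core F p m, shift (Finsupp.single i p) (u f) = act F p m f v :=
    exists_eq_act hp hm (τ := shift (Finsupp.single i p) ∘ₗ u) fun f hf g hg => by
      have h1 := congrArg (shift (Finsupp.single i p)) (hu f hf g hg)
      rw [shift_prime_ofTrunc, vcob_apply, map_sub, map_sub, shift_prime_act,
        shift_prime_act] at h1
      exact (sub_eq_zero.mp h1.symm).symm
  choose v hv using hz
  -- The differences ∂_i^p v_j - ∂_j^p v_i are invariant series, hence zero, so the v_i integrate to
  -- one series e.
  obtain ⟨e, he, -⟩ := exists_shift_eq Set.univ hpp v (fun i _ j _ => by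
    rw [← sub_eq_zero]
    refine eq_zero_of_act_eq_zero hp hm fun f hf => ?_
    rw [map_sub, ← shift_prime_act, ← shift_prime_act, ← hv j f hf, ← hv i f hf, shift_comm,
      sub_self]) 0
  have hu' (f) (hf : f ∈ core F p m) : ∃ g, ofTrunc F p (Var m) g = u f - act F p m f e := by
    refine exists_ofTrunc_eq fun c i hc => ?_
    have h1 : shift (Finsupp.single i p) (u f) (c - Finsupp.single i p) =
        act F p m f (v i) (c - Finsupp.single i p) := by rw [hv i f hf]
    rw [← he i (Set.mem_univ i), ← shift_prime_act, shift_apply, shift_apply,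
      tsub_add_cancel_of_le (Finsupp.single_le_iff.mpr hc)] at h1
    rw [DivPow.sub_apply, h1, sub_self]
  obtain ⟨r, hr⟩ := (ofTrunc F p (Var m)).exists_leftInverse_of_injective
    (LinearMap.ker_eq_bot.mpr ofTrunc_injective)
  have hr' (f) : r (ofTrunc F p (Var m) f) = f := LinearMap.congr_fun hr f
  set w := r ∘ₗ (u - (act F p m).flip e) with hw
  have hw' (f) (hf : f ∈ core F p m) : ofTrunc F p (Var m) (w f) = u f - act F p m f e := by
    obtain ⟨g, hg⟩ := hu' f hf
    rw [← hg, hw, LinearMap.comp_apply, LinearMap.sub_apply, LinearMap.flip_apply, ← hg, hr']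
  have key (f) (hf : f ∈ core F p m) (g) (hg : g ∈ core F p m) : ψ f g =
      contactHom F p m f (w g) - contactHom F p m g (w f) - w (contactHom F p m f g) := by
    apply ofTrunc_injective
    rw [hu f hf g hg, map_sub, map_sub, ofTrunc_contactHom, ofTrunc_contactHom, hw' f hf, hw' g hg,
      hw' _ (contactHom_mem_core hp f g), vcob_apply, act_contactHom, map_sub, map_sub]
    abel
  refine ⟨w, fun f hf => ?_, key⟩
  -- So far w takes values in A(n). On a bracket it is given by brackets and values of ψ, which lie
  -- in the contact algebra, and brackets span that algebra.
  have hle : core F p m ≤ (core F p m).comap w := by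
    refine (core_le_span_bracket hp hm).trans (Submodule.span_le.mpr ?_)
    rintro _ ⟨f, hf, g, hg, rfl⟩
    change w (contactHom F p m f g) ∈ core F p m
    have h1 : w (contactHom F p m f g) =
        contactHom F p m f (w g) - contactHom F p m g (w f) - ψ f g := by
      rw [key f hf g hg]
      abel
    rw [h1]
    exact sub_mem (sub_mem (contactHom_mem_core hp _ _) (contactHom_mem_core hp _ _)) (hψ f g)
  exact hle hf

/-- A `2`-cocycle of the contact algebra whose values at the pairs `(x_i t, x_i ^ (p - 1))` and
`(t ^ 2, t ^ (p - 1))` have no constant terms is a coboundary. -/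
theorem exists_core_coboundary (hp : 5 ≤ p) (hm : 1 ≤ m)
    {ψ : Trunc F p (Var m) →ₗ[F] Trunc F p (Var m) →ₗ[F] Trunc F p (Var m)}
    (hψ : ∀ f g, ψ f g ∈ core F p m) (halt : ∀ f, ψ f f = 0)
    (hcoc : ∀ f ∈ core F p m, ∀ g ∈ core F p m, ∀ h ∈ core F p m,
      ψ (contactHom F p m f g) h - ψ (contactHom F p m f h) g + ψ (contactHom F p m g h) f =
        contactHom F p m f (ψ g h) - contactHom F p m g (ψ f h) + contactHom F p m h (ψ f g))
    (hρ : ∀ i, ofTrunc F p (Var m) (ψ (vx F p i * vt F p m) (vx F p i ^ (p - 1))) 0 = 0)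
    (hσ : ofTrunc F p (Var m) (ψ (vt F p m ^ 2) (vt F p m ^ (p - 1))) 0 = 0) :
    ∃ w : Trunc F p (Var m) →ₗ[F] Trunc F p (Var m), (∀ f ∈ core F p m, w f ∈ core F p m) ∧
      ∀ f ∈ core F p m, ∀ g ∈ core F p m, ψ f g =
        contactHom F p m f (w g) - contactHom F p m g (w f) - w (contactHom F p m f g) := by
  have h : IsVecCocycle (ψ.compr₂ (ofTrunc F p (Var m))) :=
    { alt := fun f => by rw [LinearMap.compr₂_apply, halt, map_zero]
      coc := fun f hf g hg k hk => by
        simp only [LinearMap.compr₂_apply, ← ofTrunc_contactHom]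
        rw [← map_sub, ← map_add, hcoc f hf g hg k hk, map_add, map_sub] }
  obtain ⟨u, hu⟩ := h.exists_eq_vcob hp hm hρ hσ
  exact exists_core_cochain hp hm hψ hu

end Shapiro
end Contact

/-! ### Closed forms for the squaring operation -/

namespace LieH2

/-- A closed form for squaring on elements that are annihilated by `ad(γ)^3`. -/
theorem sqBilin_of_ad_cube {F L : Type*} [Field F] [LieRing L] [LieAlgebra F L] {p : ℕ}
    (hp : 5 ≤ p) (γ : L) {x : L} (hx : (LieAlgebra.ad F L γ ^ 3) x = 0) (y : L) :
    sqBilin (F := F) p γ x y =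
      (((p - 1)! : ℕ) : F)⁻¹ • ⁅(LieAlgebra.ad F L γ) x, (LieAlgebra.ad F L γ ^ (p - 1)) y⁆ +
      ((2 * (p - 2)! : ℕ) : F)⁻¹ •
        ⁅(LieAlgebra.ad F L γ ^ 2) x, (LieAlgebra.ad F L γ ^ (p - 2)) y⁆ := by
  rw [sqBilin_apply]
  have hsub : ({1, 2} : Finset ℕ) ⊆ Finset.Icc 1 (p - 1) := by
    intro i hi
    rw [Finset.mem_insert, Finset.mem_singleton] at hi
    rw [Finset.mem_Icc]
    omega
  rw [← Finset.sum_subset hsub]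
  · rw [Finset.sum_pair (by omega)]
    simp
  · intro i hi hi'
    rw [Finset.mem_Icc] at hi
    rw [Finset.mem_insert, Finset.mem_singleton] at hi'
    have : (LieAlgebra.ad F L γ ^ i) x = 0 := by
      rw [show i = (i - 3) + 3 by omega, pow_add, Module.End.mul_apply, hx, map_zero]
    rw [this, zero_lie, smul_zero]

/-- Squaring vanishes on elements that commute with `γ`. -/
theorem sqBilin_of_lie_eq_zero {F L : Type*} [Field F] [LieRing L] [LieAlgebra F L] {p : ℕ}
    (γ x : L) {y : L} (hy : ⁅γ, y⁆ = 0) : sqBilin (F := F) p γ x y = 0 := by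
  rw [sqBilin_apply]
  refine Finset.sum_eq_zero fun i hi => ?_
  rw [Finset.mem_Icc] at hi
  have : (LieAlgebra.ad F L γ ^ (p - i)) y = 0 := by
    rw [show p - i = (p - i - 1) + 1 by omega, pow_succ, Module.End.mul_apply,
      LieAlgebra.ad_apply, hy, map_zero]
  rw [this, lie_zero, smul_zero]

end LieH2

namespace Contact

/-! ### Translation to cocycles of the contact algebra -/

section ContactCohomology

open DivPow LieModule.Cohomology

variable {F : Type*} [Field F] {p : ℕ} [CharP F p] {m : ℕ}

variable (F p m) in
/-- The inclusion of the contact algebra into truncated polynomials. -/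
noncomputable def incl : ContactAlgebra F p m →ₗ[F] Trunc F p (Var m) :=
  (toTrunc F p m).toLinearMap ∘ₗ
    (LieAlgebra.derivedSeries F (ContactPrime F p m) 1).toSubmodule.subtype

theorem incl_lie (x y : ContactAlgebra F p m) :
    incl F p m ⁅x, y⁆ = contactHom F p m (incl F p m x) (incl F p m y) := rfl

theorem incl_injective : Function.Injective (incl F p m) := fun _ _ h => Subtype.ext h

theorem incl_x (i : Fin m ⊕ Fin m) : incl F p m (ContactAlgebra.x F p i) = vx F p i := rfl

theorem incl_one (hm : 1 ≤ m) : incl F p m (ContactAlgebra.one F p hm) = 1 :=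
  truncMonomial_zero

theorem incl_ad_pow (γ x : ContactAlgebra F p m) (n : ℕ) :
    incl F p m ((LieAlgebra.ad F (ContactAlgebra F p m) γ ^ n) x) =
      (contactHom F p m (incl F p m γ) ^ n) (incl F p m x) := by
  induction n with
  | zero => rfl
  | succ n ih =>
    rw [pow_succ', Module.End.mul_apply, LieAlgebra.ad_apply, incl_lie, ih, pow_succ',
      Module.End.mul_apply]

variable [Fact p.Prime]

theorem incl_mem (hp : 5 ≤ p) (hm : 1 ≤ m) (x : ContactAlgebra F p m) :
    incl F p m x ∈ core F p m := (mem_derivedSeries_iff hp hm x.1).mp x.2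

theorem exists_incl_eq (hp : 5 ≤ p) (hm : 1 ≤ m) {f : Trunc F p (Var m)} (hf : f ∈ core F p m) :
    ∃ x, incl F p m x = f :=
  ⟨⟨(toTrunc F p m).symm f, (mem_derivedSeries_iff hp hm _).mpr hf⟩, rfl⟩

variable (F p m) in
/-- The constant term of an element of the contact algebra. -/
noncomputable def counit : ContactAlgebra F p m →ₗ[F] F :=
  evalAt 0 ∘ₗ ofTrunc F p (Var m) ∘ₗ incl F p m

theorem counit_apply (x : ContactAlgebra F p m) :
    counit F p m x = ofTrunc F p (Var m) (incl F p m x) 0 := rfl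

theorem ofTrunc_one_zero : ofTrunc F p (Var m) 1 0 = 1 := by
  rw [ofTrunc_apply, one_smul]
  exact if_pos rfl

theorem counit_lie (hp : 5 ≤ p) {x : ContactAlgebra F p m} (hx : incl F p m x ∈ corePos F p m)
    (y : ContactAlgebra F p m) :
    counit F p m ⁅x, y⁆ = lam F p m (incl F p m x) * counit F p m y := by
  rw [counit_apply, incl_lie, ofTrunc_contactHom, act_apply_zero hp hx, counit_apply]

/-- For a commuting pair in nonnegative degree on which λ vanishes, every term of the coboundary has
zero constant term. The detecting functionals therefore descend to cohomology. -/
theorem counit_coboundary (hp : 5 ≤ p) {x y : ContactAlgebra F p m}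
    (hx : incl F p m x ∈ corePos F p m) (hy : incl F p m y ∈ corePos F p m)
    (hlx : lam F p m (incl F p m x) = 0) (hly : lam F p m (incl F p m y) = 0)
    (hxy : contactHom F p m (incl F p m x) (incl F p m y) = 0)
    (w : ContactAlgebra F p m →ₗ[F] ContactAlgebra F p m) :
    counit F p m (d₁₂ F (ContactAlgebra F p m) (ContactAlgebra F p m) w x y) = 0 := by
  have h0 : ⁅x, y⁆ = 0 := incl_injective (by rw [incl_lie, hxy, map_zero])
  rw [d₁₂_apply_apply, h0, map_zero, sub_zero, map_sub, counit_lie hp hx, counit_lie hp hy, hlx, hly]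
  ring

omit [Fact p.Prime] in
theorem contactHom_vx_vt_pow (hp : 5 ≤ p) (i : Fin m ⊕ Fin m) :
    contactHom F p m (vx F p i * vt F p m) (vx F p i ^ (p - 1)) = 0 := by
  rw [contactHom_apply, bracket_vx_vt_bi i (vx_pow_mem_bi i (p - 1)), Derivation.leibniz_pow,
    ham_self, ← pow_succ', vx_pow_eq i (p - 1 + 1),
    truncMonomial_eq_zero (i := some i) (by simp; omega)]
  simp

omit [Fact p.Prime] in
theorem contactHom_vt_sq_pow (hp : 5 ≤ p) :
    contactHom F p m (vt F p m ^ 2) (vt F p m ^ (p - 1)) = 0 := by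
  rw [contactHom_apply, bracket_vt_sq_bi (vt_pow_mem_bi (p - 1)), ← pow_succ',
    vt_pow_eq (p - 1 + 1), truncMonomial_eq_zero (i := none) (by simp; omega)]
  simp

/-- A linear retraction of the inclusion extends the cocycle to all truncated polynomials, where
`exists_core_coboundary` applies; the retraction is immaterial, as only values on the contact
algebra are used. -/
theorem exists_coboundary (hp : 5 ≤ p) (hm : 1 ≤ m)
    (ψ : twoCocycle F (ContactAlgebra F p m) (ContactAlgebra F p m))
    (hρ : ∀ i x y, incl F p m x = vx F p i * vt F p m → incl F p m y = vx F p i ^ (p - 1) →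
      counit F p m (ψ.1 x y) = 0)
    (hσ : ∀ x y, incl F p m x = vt F p m ^ 2 → incl F p m y = vt F p m ^ (p - 1) →
      counit F p m (ψ.1 x y) = 0) :
    ∃ w, d₁₂ F (ContactAlgebra F p m) (ContactAlgebra F p m) w = ψ.1 := by
  obtain ⟨r, hr⟩ := (incl F p m).exists_leftInverse_of_injective
    (LinearMap.ker_eq_bot.mpr incl_injective)
  have hr' (x) : r (incl F p m x) = x := LinearMap.congr_fun hr x
  have hcr {f} (hf : f ∈ core F p m) : incl F p m (r f) = f := by
    obtain ⟨x, rfl⟩ := exists_incl_eq hp hm hf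
    rw [hr']
  set ψ' : Trunc F p (Var m) →ₗ[F] Trunc F p (Var m) →ₗ[F] Trunc F p (Var m) :=
    (ψ.1.1.compl₁₂ r r).compr₂ (incl F p m) with hψ'
  have hψa (f g) : ψ' f g = incl F p m (ψ.1 (r f) (r g)) := rfl
  have hψi (x y) : ψ' (incl F p m x) (incl F p m y) = incl F p m (ψ.1 x y) := by
    rw [hψa, hr', hr']
  have hpos {f} (hf : f ∈ corePos F p m) := hcr (corePos_le_core hf)
  obtain ⟨w, hw, hψw⟩ := exists_core_coboundary hp hm (ψ := ψ')
    (fun f g => incl_mem hp hm _) (fun f => by rw [hψa, twoCochain_alt, map_zero])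
    (fun f hf g hg k hk => by
      obtain ⟨x, rfl⟩ := exists_incl_eq hp hm hf
      obtain ⟨y, rfl⟩ := exists_incl_eq hp hm hg
      obtain ⟨z, rfl⟩ := exists_incl_eq hp hm hk
      have h1 : d₂₃ F (ContactAlgebra F p m) (ContactAlgebra F p m) ψ.1 x y z = 0 := by
        rw [(mem_twoCocycle_iff F _ _ ψ.1).mp ψ.2]
        rfl
      rw [d₂₃_apply] at h1
      simp only [← incl_lie, hψi]
      rw [← map_sub, ← map_add, ← map_sub, ← map_add]
      congr 1
      linear_combination (norm := abel) -h1)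
    (fun i => hρ i _ _ (hpos (vx_vt_mem hp hm i)) (hpos (bi_le_corePos (isGood_of_ne (by omega))
      (by omega) (vx_pow_mem_bi i (p - 1)))))
    (hσ _ _ (hpos (bi_le_corePos_of_lt hp hm (by omega) (by omega) (vt_pow_mem_bi 2)))
      (hpos (bi_le_corePos_of_lt hp hm (by omega) (by omega) (vt_pow_mem_bi (p - 1)))))
  refine ⟨r ∘ₗ w ∘ₗ incl F p m, ?_⟩
  refine DFunLike.ext _ _ fun x => LinearMap.ext fun y => ?_
  apply incl_injective
  have h1 := hψw _ (incl_mem hp hm x) _ (incl_mem hp hm y)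
  rw [hψi] at h1
  rw [d₁₂_apply_apply, h1, map_sub, map_sub, incl_lie, incl_lie]
  simp only [LinearMap.comp_apply]
  rw [hcr (hw _ (incl_mem hp hm x)), hcr (hw _ (incl_mem hp hm y)), hcr (hw _ (incl_mem hp hm _)),
    incl_lie]

/-- On powers of w the operator ad γ acts as c·d/dw with c constant for ad γ. So its powers p - 1
and p - 2 on w^(p-1) are (p-1)! c^(p-1) and (p-1)! c^(p-2) w, and (p-1)!/(2(p-2)!) = -1/2. -/
theorem incl_sqBilin (hp : 5 ≤ p) {γ X Y : ContactAlgebra F p m} {c w : Trunc F p (Var m)}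
    (hX : (LieAlgebra.ad F (ContactAlgebra F p m) γ ^ 3) X = 0) (hY : incl F p m Y = w ^ (p - 1))
    (hc : ∀ g, contactHom F p m (incl F p m γ) (c * g) = c * contactHom F p m (incl F p m γ) g)
    (hw : ∀ k : ℕ, contactHom F p m (incl F p m γ) (w ^ k) = (k : F) • (c * w ^ (k - 1))) :
    incl F p m (LieH2.sqBilin (F := F) p γ X Y) =
      contactHom F p m (incl F p m ⁅γ, X⁆) (c ^ (p - 1)) -
        (2 : F)⁻¹ • contactHom F p m (incl F p m ⁅γ, ⁅γ, X⁆⁆) (c ^ (p - 2) * w) := by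
  have hcn (n : ℕ) (g) : contactHom F p m (incl F p m γ) (c ^ n * g) =
      c ^ n * contactHom F p m (incl F p m γ) g := by
    induction n generalizing g with
    | zero => simp
    | succ n ih => rw [pow_succ, mul_assoc, ih, hc, mul_assoc]
  have hpow (n k : ℕ) : (contactHom F p m (incl F p m γ) ^ n) (w ^ k) =
      (k.descFactorial n : F) • (c ^ n * w ^ (k - n)) := by
    induction n with
    | zero => simp
    | succ n ih =>
      rw [pow_succ', Module.End.mul_apply, ih, map_smul, hcn, hw, mul_smul_comm, smul_smul,
        Nat.descFactorial_succ, Nat.sub_sub, ← mul_assoc, ← pow_succ]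
      congr 1
      push_cast
      ring
  have hf : ((p - 2)! : F) ≠ 0 := by
    rw [Ne, CharP.cast_eq_zero_iff F p, (Fact.out : p.Prime).dvd_factorial]
    omega
  have hf1 : ((p - 1)! : F) = -((p - 2)! : F) := by
    rw [show p - 1 = (p - 2) + 1 by omega, Nat.factorial_succ, show p - 2 + 1 = p - 1 by omega,
      Nat.cast_mul, Nat.cast_sub (by omega), CharP.cast_eq_zero]
    ring
  have hd : (p - 1).descFactorial (p - 2) = (p - 1)! := by
    have := Nat.factorial_mul_descFactorial (show p - 2 ≤ p - 1 by omega)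
    rwa [show p - 1 - (p - 2) = 1 by omega, Nat.factorial_one, one_mul] at this
  have h2 : (2 : F) ≠ 0 := two_ne_zero_of_le hp
  rw [LieH2.sqBilin_of_ad_cube hp γ hX, map_add, map_smul, map_smul, incl_lie, incl_lie,
    incl_ad_pow, incl_ad_pow γ Y, hY, hpow, hpow, Nat.descFactorial_self, hd, Nat.sub_self,
    pow_zero, mul_one, show p - 1 - (p - 2) = 1 by omega, pow_one, map_smul, map_smul, smul_smul,
    smul_smul, pow_two, Module.End.mul_apply, LieAlgebra.ad_apply, LieAlgebra.ad_apply,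
    sub_eq_add_neg, ← neg_smul]
  congr 1
  · rw [hf1, inv_mul_cancel₀ (neg_ne_zero.mpr hf), one_smul]
  · congr 1
    rw [hf1]
    push_cast
    field_simp

theorem incl_sqBilin_of_scalar (hp : 5 ≤ p) {γ X Y : ContactAlgebra F p m}
    {w : Trunc F p (Var m)} {r : F}
    (hX : (LieAlgebra.ad F (ContactAlgebra F p m) γ ^ 3) X = 0) (hY : incl F p m Y = w ^ (p - 1))
    (hw : ∀ k : ℕ, contactHom F p m (incl F p m γ) (w ^ k) = (k : F) • r • w ^ (k - 1)) :
    incl F p m (LieH2.sqBilin (F := F) p γ X Y) =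
      r ^ (p - 1) • contactHom F p m (incl F p m ⁅γ, X⁆) 1 -
        ((2 : F)⁻¹ * r ^ (p - 2)) • contactHom F p m (incl F p m ⁅γ, ⁅γ, X⁆⁆) w := by
  rw [incl_sqBilin hp (c := algebraMap F _ r) hX hY]
  · rw [← map_pow, ← map_pow, ← Algebra.smul_def, Algebra.algebraMap_eq_smul_one, map_smul,
      map_smul, smul_smul]
  · intro g
    rw [← Algebra.smul_def, map_smul, ← Algebra.smul_def]
  · intro k
    rw [hw, ← Algebra.smul_def]

omit [Fact p.Prime] in
theorem ad_cube_eq_zero {γ X : ContactAlgebra F p m} (h : contactHom F p m (incl F p m γ)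
    (contactHom F p m (incl F p m γ) (contactHom F p m (incl F p m γ) (incl F p m X))) = 0) :
    (LieAlgebra.ad F (ContactAlgebra F p m) γ ^ 3) X = 0 := by
  apply incl_injective
  rw [incl_ad_pow, map_zero]
  exact h

end ContactCohomology
end Contact

namespace Contact

/-! ### Values of the detecting functionals on the squaring cocycles -/

section SquaringValues

open DivPow LieModule.Cohomology

variable {F : Type*} [Field F] {p : ℕ} [CharP F p] {m : ℕ} [Fact p.Prime]

/-- With ω the value of the form on x_j, x_i, the two surviving terms contribute -2ω·ω^(p-1) and
-ω²·ω^(p-2). Hence Sq(x_j) is seen only by the variable conjugate to x_j. -/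
theorem counit_sq_x_vx (hp : 5 ≤ p) (i j : Fin m ⊕ Fin m) {X Y : ContactAlgebra F p m}
    (hX : incl F p m X = vx F p i * vt F p m) (hY : incl F p m Y = vx F p i ^ (p - 1)) :
    counit F p m (LieH2.sqBilin (F := F) p (ContactAlgebra.x F p j) X Y) =
      -3 * omega F j i ^ p := by
  have h1 : contactHom F p m (vx F p j) (vx F p i * vt F p m) =
      omega F j i • vt F p m + vx F p j * vx F p i := by
    rw [contactHom_apply, bracket_vx, Derivation.leibniz, Derivation.leibniz, ham_vx, ham_vt,
      dt_vx, dt_vt]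
    simp
  have h2 : contactHom F p m (vx F p j) (omega F j i • vt F p m + vx F p j * vx F p i) =
      (2 * omega F j i) • vx F p j := by
    rw [contactHom_apply, bracket_vx, map_add, map_add, Derivation.map_smul, Derivation.map_smul,
      Derivation.leibniz, Derivation.leibniz, ham_vx, ham_vt, dt_vx, dt_vx, dt_vt, ham_self]
    simp only [smul_zero, smul_eq_mul, mul_zero, add_zero, zero_add, mul_smul_comm, mul_one]
    rw [← add_smul, two_mul]
  have h3 : contactHom F p m (vx F p j) (vx F p j) = 0 := by
    rw [contactHom_apply, bracket_vx, dt_vx, ham_self]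
    simp
  rw [counit_apply, incl_sqBilin_of_scalar hp (r := omega F j i) _ hY]
  · rw [incl_lie, incl_lie, incl_lie, incl_x, hX, h1, h2, map_smul, LinearMap.smul_apply,
      contactHom_skew 1, contactHom_apply, bracket_one, contactHom_apply, bracket_vx, ham_vx, dt_vx, map_add,
      Derivation.map_smul, Derivation.leibniz, dt_vt, dt_vx, dt_vx]
    have h4 : omega F j i ^ p = omega F j i ^ (p - 2) * omega F j i * omega F j i := by
      rw [← pow_succ, ← pow_succ]
      congr 1
      omega
    have h5 : omega F j i ^ (p - 1) = omega F j i ^ (p - 2) * omega F j i := by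
      rw [← pow_succ]
      congr 1
      omega
    have h6 : -(2 * (omega F j i • (1 : Trunc F p (Var m)) +
        (vx F p j • (0 : Trunc F p (Var m)) + vx F p i • (0 : Trunc F p (Var m))))) =
        (-2 * omega F j i) • 1 := by
      rw [trunc_smul_eq_mul, trunc_smul_eq_mul, map_mul, map_neg, map_ofNat]
      simp only [smul_zero, add_zero]
      ring
    have h7 : (2 : F) ≠ 0 := two_ne_zero_of_le hp
    rw [h6, mul_zero, add_zero, smul_smul, smul_smul, smul_smul, ← sub_smul, map_smul,
      DivPow.smul_apply, ofTrunc_one_zero, h4, h5]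
    field_simp
    ring
  · intro k
    rw [incl_x, contactHom_apply, bracket_vx, Derivation.leibniz_pow, Derivation.leibniz_pow,
      ham_vx, dt_vx, smul_zero, nsmul_zero, mul_zero, add_zero, Nat.cast_smul_eq_nsmul, smul_eq_mul,
      mul_smul_comm, mul_one]
  · exact ad_cube_eq_zero (by rw [incl_x, hX, h1, h2, map_smul, h3, smul_zero])

/-- On powers of t, ad x_j acts as x_j·d/dt. The two surviving brackets are multiples of [x_j t,
x_j^(p-1)] and [x_j², x_j^(p-2) t], both zero. -/
theorem counit_sq_x_vt (hp : 5 ≤ p) (j : Fin m ⊕ Fin m) {X Y : ContactAlgebra F p m}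
    (hX : incl F p m X = vt F p m ^ 2) (hY : incl F p m Y = vt F p m ^ (p - 1)) :
    counit F p m (LieH2.sqBilin (F := F) p (ContactAlgebra.x F p j) X Y) = 0 := by
  have h1 : contactHom F p m (vx F p j) (vt F p m ^ 2) = (2 : F) • (vx F p j * vt F p m) := by
    rw [contactHom_apply, bracket_vx, pow_two, Derivation.leibniz, Derivation.leibniz, ham_vt, dt_vt,
      two_smul]
    simp only [smul_eq_mul, mul_one]
    ring
  have h2 : contactHom F p m (vx F p j) ((2 : F) • (vx F p j * vt F p m)) =
      (2 : F) • (vx F p j * vx F p j) := by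
    rw [map_smul, contactHom_apply, bracket_vx, Derivation.leibniz, Derivation.leibniz, ham_vt, dt_vt, ham_self,
      dt_vx]
    simp
  have h3 : contactHom F p m (vx F p j) (vx F p j * vx F p j) = 0 := by
    rw [contactHom_apply, bracket_vx, Derivation.leibniz, Derivation.leibniz, dt_vx, ham_self]
    simp
  rw [counit_apply, incl_sqBilin hp (c := vx F p j) _ hY]
  · rw [incl_lie, incl_lie, incl_lie, incl_x, hX, h1, h2, map_smul, map_smul,
      LinearMap.smul_apply, LinearMap.smul_apply, contactHom_vx_vt_pow hp, contactHom_apply,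
      bracket_quadratic, Derivation.leibniz, Derivation.leibniz_pow, ham_self, ham_vt]
    simp
  · intro g
    rw [incl_x, contactHom_apply, contactHom_apply, bracket_vx, bracket_vx, Derivation.leibniz,
      Derivation.leibniz, ham_self, dt_vx]
    simp only [smul_eq_mul]
    ring
  · intro k
    rw [incl_x, contactHom_apply, bracket_vx, Derivation.leibniz_pow, Derivation.leibniz_pow,
      ham_vt, dt_vt, smul_zero, nsmul_zero, zero_add, Nat.cast_smul_eq_nsmul, smul_eq_mul, mul_one,
      mul_smul_comm]
  · exact ad_cube_eq_zero (by rw [incl_x, hX, h1, h2, map_smul, h3, smul_zero])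

theorem counit_sq_one_vx (hm : 1 ≤ m) (i : Fin m ⊕ Fin m) (X : ContactAlgebra F p m)
    {Y : ContactAlgebra F p m} (hY : incl F p m Y = vx F p i ^ (p - 1)) :
    counit F p m (LieH2.sqBilin (F := F) p (ContactAlgebra.one F p hm) X Y) = 0 := by
  rw [LieH2.sqBilin_of_lie_eq_zero, map_zero]
  apply incl_injective
  rw [incl_lie, incl_one, hY, contactHom_apply, bracket_one, Derivation.leibniz_pow, dt_vx]
  simp

/-- Here ad 1 = 2∂_t, and the two terms contribute -8·2^(p-1) and -8·2^(p-2), that is, -4·2^(p-1).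
-/
theorem counit_sq_one_vt (hp : 5 ≤ p) (hm : 1 ≤ m) {X Y : ContactAlgebra F p m}
    (hX : incl F p m X = vt F p m ^ 2) (hY : incl F p m Y = vt F p m ^ (p - 1)) :
    counit F p m (LieH2.sqBilin (F := F) p (ContactAlgebra.one F p hm) X Y) = -12 * 2 ^ (p - 1) := by
  have h1 : contactHom F p m 1 (vt F p m ^ 2) = (4 : F) • vt F p m := by
    rw [contactHom_apply, bracket_one, pow_two, Derivation.leibniz, dt_vt, trunc_smul_eq_mul,
      map_ofNat, smul_eq_mul]
    ring
  have h2 : contactHom F p m 1 (vt F p m) = (2 : F) • 1 := by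
    rw [contactHom_apply, bracket_one, dt_vt, trunc_smul_eq_mul, map_ofNat]
  have h2' : contactHom F p m 1 ((4 : F) • vt F p m) = (8 : F) • 1 := by
    rw [map_smul, h2, smul_smul]
    norm_num
  have h3 : contactHom F p m 1 (1 : Trunc F p (Var m)) = 0 := by
    rw [contactHom_apply, bracket_one, Derivation.map_one_eq_zero, mul_zero]
  rw [counit_apply, incl_sqBilin_of_scalar hp (r := 2) _ hY]
  · rw [incl_lie, incl_lie, incl_lie, incl_one, hX, h1, h2', map_smul, map_smul,
      LinearMap.smul_apply, LinearMap.smul_apply, contactHom_skew 1, h2]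
    have h4 : (2 : F) ≠ 0 := two_ne_zero_of_le hp
    rw [← neg_smul, smul_smul, smul_smul, smul_smul, smul_smul, ← sub_smul, map_smul,
      DivPow.smul_apply, ofTrunc_one_zero, show p - 1 = (p - 2) + 1 by omega, pow_succ]
    field_simp
    ring
  · intro k
    rw [incl_one, contactHom_apply, bracket_one, Derivation.leibniz_pow, dt_vt, smul_eq_mul, mul_one,
      Nat.cast_smul_eq_nsmul, mul_smul_comm, trunc_smul_eq_mul 2, map_ofNat]
  · exact ad_cube_eq_zero (by rw [incl_one, hX, h1, h2', map_smul, h3, smul_zero])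

end SquaringValues
end Contact

/-! ### The basis of the second cohomology -/

/-- A linear injection into `J → F` that maps a family to nonzero multiples of the standard basis,
in some order, shows that the family is a basis. -/
theorem exists_basis_of_injective {F V J : Type*} [Field F] [AddCommGroup V] [Module F V]
    [Finite J] [DecidableEq J] {Θ : V →ₗ[F] J → F} (hΘ : Function.Injective Θ) (v : J → V)
    (σ : Equiv.Perm J) (c : J → F) (hc : ∀ j, c j ≠ 0)
    (hv : ∀ j, Θ (v j) = c j • Pi.single (σ j) 1) :
    ∃ b : Module.Basis J F V, ∀ j, b j = v j := by
  set b := ((Pi.basisFun F J).reindex σ.symm).isUnitSMul (w := c) fun j => (hc j).isUnit with hb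
  have hbv (j) : b j = Θ (v j) := by
    rw [hb, Module.Basis.isUnitSMul_apply, hv]
    simp
  have hsurj : Function.Surjective Θ := by
    rw [← LinearMap.range_eq_top, eq_top_iff, ← b.span_eq, Submodule.span_le]
    rintro _ ⟨j, rfl⟩
    exact ⟨v j, (hbv j).symm⟩
  let e := LinearEquiv.ofBijective Θ ⟨hΘ, hsurj⟩
  refine ⟨b.map e.symm, fun j => ?_⟩
  rw [Module.Basis.map_apply, LinearEquiv.symm_apply_eq, hbv]
  rfl

namespace Contact

open LieModule.Cohomology

theorem omega_pow_ne_zero {F : Type*} [Field F] {m : ℕ} (i : Fin m ⊕ Fin m) (n : ℕ) :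
    omega F i i.swap ^ n ≠ 0 :=
  pow_ne_zero _ (by rw [omega, if_pos rfl]; exact sgn_ne_zero i)

/-- Evaluation of a `2`-cocycle at a pair of elements, followed by a linear functional. -/
def evalCocycle {F L : Type*} [CommRing F] [LieRing L] [LieAlgebra F L] (u : L →ₗ[F] F) (x y : L) :
    twoCocycle F L L →ₗ[F] F where
  toFun ψ := u (ψ.1 x y)
  map_add' ψ χ := map_add u (ψ.1 x y) (χ.1 x y)
  map_smul' c ψ := map_smul u c (ψ.1 x y)

end Contact

theorem mainTheorem1 (p : ℕ) [Fact p.Prime] (hp2 : p ≠ 2) (hp3 : p ≠ 3)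
    (F : Type*) [Field F] [CharP F p] (m : ℕ) (hm : 1 ≤ m) :
    Module.finrank F (LieH2.AdjointH2 F (Contact.ContactAlgebra F p m)) = 2 * m + 1 ∧
    ∃ b : Module.Basis ((Fin m ⊕ Fin m) ⊕ Unit) F
        (LieH2.AdjointH2 F (Contact.ContactAlgebra F p m)),
      (∀ i : Fin m ⊕ Fin m,
        b (Sum.inl i) = LieH2.sqClass p (Contact.ContactAlgebra.x F p i)) ∧
      b (Sum.inr ()) = LieH2.sqClass p (Contact.ContactAlgebra.one F p hm) := by
  classical
  have hp : 5 ≤ p := by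
    have hprime : p.Prime := Fact.out
    have := hprime.two_le
    have h4 : p ≠ 4 := by
      rintro rfl
      exact absurd hprime (by norm_num)
    omega
  have hρX (i : Fin m ⊕ Fin m) := Contact.vx_vt_mem (F := F) hp hm i
  have hρY (i : Fin m ⊕ Fin m) := Contact.bi_le_corePos (Contact.isGood_of_ne (by omega)) (by omega)
    (Contact.vx_pow_mem_bi (F := F) (p := p) i (p - 1))
  have hσX := Contact.bi_le_corePos_of_lt hp hm (by omega) (by omega)
    (Contact.vt_pow_mem_bi (F := F) (p := p) (m := m) 2)
  have hσY := Contact.bi_le_corePos_of_lt hp hm (by omega) (by omega)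
    (Contact.vt_pow_mem_bi (F := F) (p := p) (m := m) (p - 1))
  choose X hX using fun i => Contact.exists_incl_eq hp hm (Contact.corePos_le_core (hρX i))
  choose Y hY using fun i => Contact.exists_incl_eq hp hm (Contact.corePos_le_core (hρY i))
  obtain ⟨X', hX'⟩ := Contact.exists_incl_eq hp hm (Contact.corePos_le_core hσX)
  obtain ⟨Y', hY'⟩ := Contact.exists_incl_eq hp hm (Contact.corePos_le_core hσY)
  let u := Contact.counit F p m
  -- The constant terms at the n distinguished pairs; the kernel of θ turns out to be exactly the
  -- coboundaries.
  let θ := LinearMap.pi (Sum.elim (fun i => Contact.evalCocycle u (X i) (Y i))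
    fun _ : Unit => Contact.evalCocycle u X' Y')
  have hker : LinearMap.ker θ =
      LieH2.twoCoboundary F (Contact.ContactAlgebra F p m) (Contact.ContactAlgebra F p m) := by
    refine le_antisymm (fun ψ hψ => ?_) fun ψ hψ => ?_
    · obtain ⟨w, hw⟩ := Contact.exists_coboundary hp hm ψ
        (fun i x y hx hy => by
          rw [Contact.incl_injective (hx.trans (hX i).symm),
            Contact.incl_injective (hy.trans (hY i).symm)]
          exact congrFun hψ (Sum.inl i))
        (fun x y hx hy => by
          rw [Contact.incl_injective (hx.trans hX'.symm), Contact.incl_injective (hy.trans hY'.symm)]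
          exact congrFun hψ (Sum.inr ()))
      exact ⟨w, hw⟩
    · obtain ⟨w, hw : LieModule.Cohomology.d₁₂ F _ _ w = ψ.1⟩ := hψ
      refine funext fun j => ?_
      rcases j with i | j
      · change u (ψ.1 (X i) (Y i)) = 0
        rw [← hw]
        refine Contact.counit_coboundary hp ?_ ?_ ?_ ?_ ?_ w <;> simp only [hX, hY]
        · exact hρX i
        · exact hρY i
        · exact Contact.lam_bi hp (Contact.vx_mul_mem_bi i Contact.vt_mem_bi) (by simp)
        · exact Contact.lam_bi hp (Contact.vx_pow_mem_bi i (p - 1)) (by simp)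
        · exact Contact.contactHom_vx_vt_pow hp i
      · change u (ψ.1 X' Y') = 0
        rw [← hw]
        refine Contact.counit_coboundary hp ?_ ?_ ?_ ?_ ?_ w <;> simp only [hX', hY']
        · exact hσX
        · exact hσY
        · exact Contact.lam_bi hp (Contact.vt_pow_mem_bi 2) (by simp)
        · exact Contact.lam_bi hp (Contact.vt_pow_mem_bi (p - 1)) (Or.inr (by omega))
        · exact Contact.contactHom_vt_sq_pow hp
  let Θ := (LieH2.twoCoboundary F _ _).liftQ θ hker.ge
  have hΘ : Function.Injective Θ := by
    rw [← LinearMap.ker_eq_bot]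
    exact Submodule.ker_liftQ_eq_bot _ _ _ hker.le
  obtain ⟨b, hb⟩ := exists_basis_of_injective hΘ
    (Sum.elim (fun i => LieH2.sqClass p (Contact.ContactAlgebra.x F p i))
      fun _ => LieH2.sqClass p (Contact.ContactAlgebra.one F p hm))
    -- The permutation exchanges conjugate variables, because Sq(x_j) is detected by the pair
    -- belonging to the conjugate of x_j.
    (Equiv.sumCongr (Equiv.sumComm _ _) (Equiv.refl _))
    (Sum.elim (fun i => -3 * Contact.omega F i i.swap ^ p) fun _ => -12 * 2 ^ (p - 1))
    (by
      have h2 : (2 : F) ≠ 0 := Contact.two_ne_zero_of_le hp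
      have h3 : (3 : F) ≠ 0 := Contact.three_ne_zero_of_le hp
      rintro (i | i)
      · exact mul_ne_zero (neg_ne_zero.mpr h3) (Contact.omega_pow_ne_zero i p)
      · refine mul_ne_zero (neg_ne_zero.mpr ?_) (pow_ne_zero _ h2)
        rw [show (12 : F) = 2 * 2 * 3 by norm_num]
        exact mul_ne_zero (mul_ne_zero h2 h2) h3)
    (by
      rintro (j | j) <;> refine funext fun k => ?_ <;> rcases k with i | k
      · change u (LieH2.sqBilin p _ (X i) (Y i)) = _
        rw [Contact.counit_sq_x_vx hp i j (hX i) (hY i)]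
        by_cases h : i = j.swap
        · subst h
          simp
        · rw [Contact.omega, if_neg h, zero_pow (by omega)]
          simp [h]
      · change u (LieH2.sqBilin p _ X' Y') = _
        rw [Contact.counit_sq_x_vt hp j hX' hY']
        simp
      · change u (LieH2.sqBilin p _ (X i) (Y i)) = _
        rw [Contact.counit_sq_one_vx hm i (X i) (hY i)]
        simp
      · change u (LieH2.sqBilin p _ X' Y') = _
        rw [Contact.counit_sq_one_vt hp hm hX' hY']
        simp)
  refine ⟨?_, b, fun i => hb (Sum.inl i), hb (Sum.inr ())⟩
  rw [Module.finrank_eq_card_basis b]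
  simp
  omega
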